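/- **Conventions.** All vector spaces and algebras are over $\mathbb C$, algebras are unital and associative. Coproducts, counits and antipodes are denoted $\phi,\epsilon,\kappa$, and $\phi(a)=a^{(1)}\otimes a^{(2)}$. A Hopf $*$-algebra is a Hopf algebra with an antilinear antimultiplicative involution $*$ such that $\phi *=(*\otimes *)\phi$; $\mathrm{ad}(a)=a^{(2)}\otimes\kappa(a^{(1)})a^{(3)}$. Let $\mathcal A$ be a Hopf $*$-algebra (representing a quantum group $G$). A *covariant $*$-module over $\mathcal A$* is a vector space $M$ with an antilinear involution $*$, a right $\mathcal A$-module structure $\circ$ and a right $\mathcal A$-comodule structure $\Delta\colon M\to M\otimes\mathcal A$ such that $$\Delta(m\circ a)=\sum_k (m_k\circ a^{(2)})\otimes\kappa(a^{(1)})c_ka^{(3)},\qquad \Delta *=(*\otimes *)\Delta,\qquad (m\circ a)^*=m^*\circ\kappa(a)^*,$$ where $\Delta(m)=\sum_k m_k\otimes c_k$. A *covariant $*$-algebra over $\mathcal A$* is a $*$-algebra that is a covariant $*$-module such that $(xy)\circ a=(x\circ a^{(1)})(y\circ a^{(2)})$, $1\circ a=\epsilon(a)1$, and $\Delta$ is a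 unital homomorphism. **The space $\mathbb V$ and the affine quantum group.** Let $\mathbb V$ be a covariant $*$-module over $\mathcal A$ (equivalently, the left-invariant part of a bicovariant $*$-bimodule $\Psi=\mathcal A\otimes\mathbb V$), with coaction $\varkappa$. Let $\tau(\eta\otimes\theta)=\sum_k\theta_k\otimes(\eta\circ c_k)$ for $\varkappa(\theta)=\sum_k\theta_k\otimes c_k$ be its braiding. For a permutation $\pi$ let $\tau_\pi$ be the product of the operators $\tau$ along a minimal decomposition of $\pi$. Put $Y_n=\sum_{\pi\in S_n}\tau_\pi$ on $\mathbb V^{\otimes n}$, $Y=\bigoplus_n Y_n$ and $S(\mathbb V)=\mathbb V^{\otimes}/\ker Y$. Let $M_{kl}\colon\mathbb V^{\otimes(k+l)}\to\mathbb V^{\otimes k}\otimes\mathbb V^{\otimes l}$ be $\sum\tau_{\pi^{-1}}$, the sum over the permutations $\pi$ preserving the orders of the first $k$ and of the last $l$ factors. Let $\mathrm I\colon\mathbb V^\otimes\to\mathbb V^\otimes$ be the braided inversion: $\mathrm I(1)=1$ and $\mathrm I(\theta x)=\sum_k y_k(\theta\circ c_k)$, where $\varkappa(\mathrm I(x))=\sum_k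 y_k\otimes c_k$ and $\varkappa$ is extended multiplicatively to $\mathbb V^\otimes$. For $\vartheta\in\mathbb V^{\otimes n}$ and $0\le i\le n$ write $M_{i,n-i}(\vartheta)=\sum_\alpha t_{\alpha i}\otimes\vartheta_{\alpha i}$ and $\varkappa(t_{\alpha i})=\sum_\beta t_{\beta i}\otimes c^i_{\beta\alpha}$. $\widetilde{\mathcal A}$ (representing $\widetilde G$) denotes the Hopf $*$-algebra that contains $\mathcal A$ as a Hopf $*$-subalgebra and is generated by $\mathcal A$ and $\mathbb V$, with the involution extending that of $\mathbb V$, with $\theta a=a^{(1)}(\theta\circ a^{(2)})$ and $\phi(\theta)=1\otimes\theta+\varkappa(\theta)$ for $\theta\in\mathbb V$, and such that $a\otimes\vartheta\mapsto a\vartheta$ is a well-defined linear isomorphism $\mathcal A\otimes S(\mathbb V)\to\widetilde{\mathcal A}$. **The algebras $\mathcal H$ and $\widetilde{\mathcal H}$.** Let $\mathcal H$ be a covariant $*$-algebra over $\mathcal A$ with coaction $\Delta$. $\widetilde{\mathcal H}=\mathcal H\otimes S(\mathbb V)$ denotes the covariant $*$-algebra over $\widetilde{\mathcal A}$, with coaction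 $\widehat\Delta\colon\widetilde{\mathcal H}\to\widetilde{\mathcal H}\otimes\widetilde{\mathcal A}$, that is generated by its $*$-subalgebra $\mathcal H$ and by the $*$-invariant subspace $\mathbb V$, such that $h\otimes\vartheta\mapsto h\vartheta$ is a well-defined linear isomorphism $\mathcal H\otimes S(\mathbb V)\to\widetilde{\mathcal H}$; the cross-product rule $\theta h=\sum_k h_k(\theta\circ c_k)$ holds for $\Delta(h)=\sum_kh_k\otimes c_k$; $\widehat\Delta$ extends $\Delta$ and $\widehat\Delta(\theta)=1\otimes\theta+\varkappa(\theta)$; and the right $\widetilde{\mathcal A}$-module structure $\circ$ restricts to the given $\mathcal A$-module structures on $\mathcal H$ and on $\mathbb V$ and satisfies, for $\xi\in\widetilde{\mathcal H}$ and $\vartheta\in S(\mathbb V)$, $$\xi\circ\vartheta=\sum_{i\ge0}\sum_{\alpha,\beta}(-1)^i\,\mathrm I\{t_{\beta i}\}\,(\xi\circ c^i_{\beta\alpha})\,\vartheta_{\alpha i}.$$ **The data.** Let $\pi\colon\mathcal A\to\mathcal H$ and $\zeta\colon\mathbb V\to\mathcal H$ be linear maps such that $$\Delta\pi=(\pi\otimes\mathrm{id})\mathrm{ad},\qquad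 \pi(a)^*=-\pi[\kappa(a)^*],\qquad \pi(ab)=\pi(a)\circ b+\epsilon(a)\pi(b),$$ $$\Delta\zeta=(\zeta\otimes\mathrm{id})\varkappa,\qquad \zeta *=*\zeta,\qquad \zeta(\theta\circ a)=\zeta(\theta)\circ a.$$ **Proposition.** The Hopf $*$-algebra $\widetilde{\mathcal A}$ and the covariant $*$-algebra $\widetilde{\mathcal H}$ exist. There is exactly one linear map $\widetilde\pi\colon\widetilde{\mathcal A}\to\widetilde{\mathcal H}$ that extends $\pi$, satisfies $$\widetilde\pi(\theta)=\zeta(\theta)-\sum_k\theta_k\pi(c_k)\qquad\Bigl(\theta\in\mathbb V,\ \varkappa(\theta)=\sum_k\theta_k\otimes c_k\Bigr),$$ and satisfies, for all $q\in\ker(\epsilon\colon\widetilde{\mathcal A}\to\mathbb C)$ and $\vartheta\in S(\mathbb V)$, $$\widetilde\pi(q\vartheta)=\sum_{i\ge0}\sum_{\alpha,\beta}(-1)^i\,\mathrm I\{t_{\beta i}\}\,\{\widetilde\pi(q)\circ c^i_{\beta\alpha}\}\,\vartheta_{\alpha i}.$$ For all $\xi,\psi\in\widetilde{\mathcal A}$,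 $$\widehat\Delta\widetilde\pi=(\widetilde\pi\otimes\mathrm{id})\mathrm{ad},\qquad \widetilde\pi(\xi)^*=-\widetilde\pi[\kappa(\xi)^*],\qquad \widetilde\pi(\xi\psi)=\widetilde\pi(\xi)\circ\psi+\epsilon(\xi)\widetilde\pi(\psi).$$ Consequently $\widetilde\pi$ defines a first-order bicovariant $*$-calculus $\Upsilon$ over $\widetilde G$: there are such a calculus $(\Upsilon,d)$ and a linear bijection $\mathrm{im}(\widetilde\pi)\leftrightarrow\Upsilon_{inv}$ onto its left-invariant part that sends $\widetilde\pi(\psi)$ to $\kappa(\psi^{(1)})\,d\psi^{(2)}$ for every $\psi\in\widetilde{\mathcal A}$ and intertwines $\circ$ on $\mathrm{im}(\widetilde\pi)$ with $\omega\circ\psi=\kappa(\psi^{(1)})\,\omega\,\psi^{(2)}$ on $\Upsilon_{inv}$. The space $\Upsilon_{inv}=\widetilde{\mathcal A}/\ker(\widetilde\pi)\leftrightarrow\mathrm{im}(\widetilde\pi)$ is a right $\widetilde{\mathcal A}$-submodule of $\widetilde{\mathcal H}$. As a right $S(\mathbb V)$-module, it is generated by $\Gamma_{inv}=\pi(\mathcal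 A)$ (the left-invariant part of the calculus $\Gamma$ over $G$ defined by $\pi$) and $\widetilde\pi(\mathbb V)$: it is the linear span of the elements $x\circ\vartheta$ with $x\in\pi(\mathcal A)\cup\widetilde\pi(\mathbb V)$ and $\vartheta\in S(\mathbb V)$. -/

import Mathlib

open scoped TensorProduct
open Coalgebra HopfAlgebra

noncomputable section

namespace AffineQG

/-- A Hopf *-algebra over `ℂ`: a Hopf algebra with an antilinear, antimultiplicative involution
for which the coproduct is hermitian. -/
class HopfStarAlgebra (A : Type*) [Ring A] [StarRing A] [HopfAlgebra ℂ A] : Prop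
    extends StarModule ℂ A where
  comul_star : ∀ a : A, comul (R := ℂ) (star a) = star (comul (R := ℂ) a)

/-- The adjoint coaction `ad(a) = a⁽²⁾ ⊗ κ(a⁽¹⁾) a⁽³⁾`. -/
def adCoact (A : Type*) [Ring A] [HopfAlgebra ℂ A] : A →ₗ[ℂ] A ⊗[ℂ] A :=
  LinearMap.lTensor A (LinearMap.mul' ℂ A ∘ₗ LinearMap.rTensor A (antipode ℂ)) ∘ₗ
    (TensorProduct.leftComm ℂ A A A).toLinearMap ∘ₗ LinearMap.lTensor A comul ∘ₗ comul

/-- The linear map `(m ⊗ c) ⊗ (a₁ ⊗ (a₂ ⊗ a₃)) ↦ (m ∘ a₂) ⊗ κ(a₁) c a₃`, where `f m a = m ∘ a`. -/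
def ydTwist {A M : Type*} [Ring A] [HopfAlgebra ℂ A] [AddCommGroup M] [Module ℂ M]
    (f : M →ₗ[ℂ] A →ₗ[ℂ] M) : (M ⊗[ℂ] A) ⊗[ℂ] (A ⊗[ℂ] (A ⊗[ℂ] A)) →ₗ[ℂ] M ⊗[ℂ] A :=
  TensorProduct.map (TensorProduct.lift f)
      (LinearMap.mul' ℂ A ∘ₗ TensorProduct.map (antipode ℂ) (LinearMap.mul' ℂ A) ∘ₗ
        (TensorProduct.leftComm ℂ A A A).toLinearMap) ∘ₗ
    (TensorProduct.tensorTensorTensorComm ℂ M A A (A ⊗[ℂ] A)).toLinearMap ∘ₗ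
    LinearMap.lTensor (M ⊗[ℂ] A) (TensorProduct.leftComm ℂ A A A).toLinearMap

/-- A right `A`-module `∘` and right `A`-comodule structure on `M` related by
`coact (m ∘ a) = ∑ₖ (mₖ ∘ a⁽²⁾) ⊗ κ(a⁽¹⁾) cₖ a⁽³⁾`, where `coact m = ∑ₖ mₖ ⊗ cₖ`. -/
class YDModule (A M : Type*) [Ring A] [HopfAlgebra ℂ A] [AddCommGroup M] [Module ℂ M] where
  act : M →ₗ[ℂ] A →ₗ[ℂ] M
  coact : M →ₗ[ℂ] M ⊗[ℂ] A
  act_one : ∀ m, act m 1 = m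
  act_mul : ∀ m a b, act m (a * b) = act (act m a) b
  coact_coassoc : ∀ m, TensorProduct.assoc ℂ M A A (coact.rTensor A (coact m)) =
    LinearMap.lTensor M comul (coact m)
  coact_counit : ∀ m, LinearMap.lTensor M counit (coact m) = m ⊗ₜ[ℂ] (1 : ℂ)
  coact_act : ∀ m a, coact (act m a) =
    ydTwist act (coact m ⊗ₜ[ℂ] LinearMap.lTensor A comul (comul (R := ℂ) a))

/-- Compatibility with the involutions: `coact` is hermitian and `(m ∘ a)* = m* ∘ κ(a)*`.
The left-invariant part of a bicovariant *-bimodule over `A` is exactly such an object. -/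
class YDStarModule (A M : Type*) [Ring A] [StarRing A] [HopfAlgebra ℂ A] [HopfStarAlgebra A]
    [AddCommGroup M] [Module ℂ M] [StarAddMonoid M] [StarModule ℂ M] [YDModule A M] : Prop where
  coact_star : ∀ m : M, YDModule.coact (A := A) (star m) = star (YDModule.coact (A := A) m)
  star_act : ∀ (m : M) (a : A),
    star (YDModule.act m a) = YDModule.act (star m) (star (antipode ℂ a))

/-- A *-algebra with such a structure for which `(x y) ∘ a = (x ∘ a⁽¹⁾)(y ∘ a⁽²⁾)`,
`1 ∘ a = ε(a) 1`, and for which the coaction is a unital homomorphism. -/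
class YDStarAlgebra (A M : Type*) [Ring A] [StarRing A] [HopfAlgebra ℂ A] [HopfStarAlgebra A]
    [Ring M] [Algebra ℂ M] [StarRing M] [StarModule ℂ M] [YDModule A M] : Prop
    extends YDStarModule A M where
  mul_act : ∀ (x y : M) (a : A), YDModule.act (x * y) a =
    TensorProduct.lift ((LinearMap.mul ℂ M).compl₁₂ (YDModule.act x) (YDModule.act y))
      (comul (R := ℂ) a)
  one_act : ∀ a : A, YDModule.act (1 : M) a = counit (R := ℂ) a • (1 : M)
  coact_mul : ∀ x y : M, YDModule.coact (A := A) (x * y) =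
    YDModule.coact (A := A) x * YDModule.coact (A := A) y
  coact_one : YDModule.coact (A := A) (1 : M) = 1

/-- `ϖ : B → X` is a quantum germs map: `coact ϖ = (ϖ ⊗ id) ad`, `ϖ(b)* = - ϖ(κ(b)*)` and
`ϖ(b c) = ϖ(b) ∘ c + ε(b) ϖ(c)`. -/
structure IsGermMap {B X : Type*} [Ring B] [StarRing B] [HopfAlgebra ℂ B]
    [AddCommGroup X] [Module ℂ X] [Star X] [YDModule B X] (ϖ : B →ₗ[ℂ] X) : Prop where
  coact_apply : ∀ b, YDModule.coact (ϖ b) = ϖ.rTensor B (adCoact B b)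
  star_apply : ∀ b, star (ϖ b) = -ϖ (star (antipode ℂ b))
  map_mul : ∀ b c, ϖ (b * c) = YDModule.act (ϖ b) c + counit (R := ℂ) b • ϖ c

/-- `ζ : V → X` intertwines coactions, involutions and the right `A`-module structures. -/
structure IsCovariantMap (A : Type*) {V X : Type*} [Ring A] [HopfAlgebra ℂ A]
    [AddCommGroup V] [Module ℂ V] [Star V] [AddCommGroup X] [Module ℂ X] [Star X]
    [YDModule A V] [YDModule A X] (ζ : V →ₗ[ℂ] X) : Prop where
  coact_apply : ∀ v, YDModule.coact (ζ v) = ζ.rTensor A (YDModule.coact v)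
  star_apply : ∀ v, star (ζ v) = ζ (star v)
  act_apply : ∀ v (a : A), ζ (YDModule.act v a) = YDModule.act (ζ v) a

section Symmetrizer

variable (A : Type*) {V : Type*} [Ring A] [HopfAlgebra ℂ A] [AddCommGroup V] [Module ℂ V]

/-- The linear map `f` on the tensor algebra with `f 1 = w` and `f (θ x) = F θ (f x)`. -/
def fold {W : Type*} [AddCommGroup W] [Module ℂ W] (F : V →ₗ[ℂ] Module.End ℂ W) (w : W) :
    TensorAlgebra ℂ V →ₗ[ℂ] W :=
  LinearMap.applyₗ w ∘ₗ (TensorAlgebra.lift ℂ F).toLinearMap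

variable [YDModule A V]

/-- `θ ⊗ a ↦ θ ∘ a` with values in the tensor algebra. -/
def actι : V →ₗ[ℂ] A →ₗ[ℂ] TensorAlgebra ℂ V :=
  (YDModule.act : V →ₗ[ℂ] A →ₗ[ℂ] V).compr₂ (TensorAlgebra.ι ℂ)

/-- The multiplicative extension of the coaction of `V` to the tensor algebra `V^⊗`. -/
def tensorCoact : TensorAlgebra ℂ V →ₐ[ℂ] TensorAlgebra ℂ V ⊗[ℂ] A :=
  TensorAlgebra.lift ℂ (LinearMap.rTensor A (TensorAlgebra.ι ℂ) ∘ₗ YDModule.coact)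

/-- For fixed `η` and `f`, the map `θ ↦ ∑ₖ ηₖ f(θ ∘ cₖ)`, where `coact η = ∑ₖ ηₖ ⊗ cₖ`: the braiding
`τ(θ ⊗ η) = ∑ₖ ηₖ ⊗ (θ ∘ cₖ)`, followed by `id ⊗ f`. -/
def braidThen : V →ₗ[ℂ] (V →ₗ[ℂ] TensorAlgebra ℂ V) →ₗ[ℂ] (V →ₗ[ℂ] TensorAlgebra ℂ V) :=
  LinearMap.mk₂ ℂ
    (fun η f =>
      { toFun := fun θ => LinearMap.mul' ℂ (TensorAlgebra ℂ V)
          (TensorProduct.map (TensorAlgebra.ι ℂ) (f ∘ₗ (YDModule.act θ : A →ₗ[ℂ] V))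
            (YDModule.coact η))
        map_add' := by intros; simp [LinearMap.comp_add, TensorProduct.map_add_right]
        map_smul' := by intros; simp [LinearMap.comp_smul, TensorProduct.map_smul_right] })
    (by intros; ext; simp)
    (by intros; ext; simp)
    (by intros; ext; simp [LinearMap.add_comp, TensorProduct.map_add_right])
    (by intros; ext; simp [LinearMap.smul_comp, TensorProduct.map_smul_right])

/-- `x ↦ (x, θ ↦ insertion of θ into x)`, see `insertion`. -/
def insertionAux : TensorAlgebra ℂ V →ₗ[ℂ]
    TensorAlgebra ℂ V × (V →ₗ[ℂ] TensorAlgebra ℂ V) :=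
  fold (LinearMap.mk₂ ℂ
    (fun η p => (TensorAlgebra.ι ℂ η * p.1,
      LinearMap.mulRight ℂ (TensorAlgebra.ι ℂ η * p.1) ∘ₗ TensorAlgebra.ι ℂ + braidThen A η p.2))
    (by intros; ext <;> simp [add_mul, mul_add, mul_assoc]; abel)
    (by intros; ext <;> simp [mul_assoc])
    (by intros; ext <;> simp [mul_add, mul_assoc]; abel)
    (by intros; ext <;> simp [mul_assoc]))
    (1, TensorAlgebra.ι ℂ)

/-- On `V ⊗ V^⊗ⁿ` this is `∑_{j=0}^{n} τ_j τ_{j-1} ⋯ τ_1` (`τ_i` is the braiding in the places `i`,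
`i+1`), the sum of the `τ_π` over the permutations `π` that preserve the order of the last `n`
factors. -/
def insertion : V →ₗ[ℂ] TensorAlgebra ℂ V →ₗ[ℂ] TensorAlgebra ℂ V :=
  (LinearMap.snd ℂ _ _ ∘ₗ insertionAux A).flip

/-- The total braided symmetrizer `Y = ⨁ₙ Yₙ`, `Yₙ = ∑_{π ∈ Sₙ} τ_π`. Every `π ∈ Sₙ₊₁` is, with
additive lengths, in a unique way the product of a permutation that preserves the order of the last
`n` letters and a permutation that fixes the first letter, so that
`Yₙ₊₁ = (∑_j τ_j ⋯ τ_1) (id ⊗ Yₙ)`. -/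
def symmetrizer : TensorAlgebra ℂ V →ₗ[ℂ] TensorAlgebra ℂ V :=
  fold (insertion A) 1

variable (V) in
/-- The braided symmetric algebra `S(V) = V^⊗ / ker Y`, as a vector space. -/
abbrev BraidedSym : Type _ := TensorAlgebra ℂ V ⧸ LinearMap.ker (symmetrizer A (V := V))

/-- `t ⊗ y ↦ ∑ₖ tₖ ⊗ (θ ∘ cₖ) y`, where the coaction of `t` is `∑ₖ tₖ ⊗ cₖ`: the letter `θ`,
placed in front of `t ⊗ y`, is braided through `t`. -/
def braidPast : V →ₗ[ℂ] Module.End ℂ (TensorAlgebra ℂ V ⊗[ℂ] TensorAlgebra ℂ V) :=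
  LinearMap.mk₂ ℂ
    (fun θ u => LinearMap.lTensor (TensorAlgebra ℂ V)
      (LinearMap.mul' ℂ (TensorAlgebra ℂ V) ∘ₗ LinearMap.rTensor (TensorAlgebra ℂ V) (actι A θ))
      (TensorProduct.assoc ℂ _ A _
        (LinearMap.rTensor (TensorAlgebra ℂ V) (tensorCoact A).toLinearMap u)))
    (by intros; simp [LinearMap.comp_add, LinearMap.lTensor_add, LinearMap.rTensor_add])
    (by intros; simp [LinearMap.comp_smul, LinearMap.lTensor_smul, LinearMap.rTensor_smul])
    (by intros; simp)
    (by intros; simp)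

/-- `M = ⨁ M_{kl}`, where `M_{kl} = ∑ τ_{π⁻¹}` (sum over the permutations `π` preserving the orders
of the first `k` and of the last `l` factors) is regarded as a map
`V^⊗(k+l) → V^⊗k ⊗ V^⊗l`: the sum over all ways of braiding `k` of the letters, their order being
kept, to the left of the others. The first letter `θ` of `θ x` either belongs to the left block,
and stays in front, or belongs to the right block, and is braided through the left block. -/
def shuffleCoproduct : TensorAlgebra ℂ V →ₗ[ℂ] TensorAlgebra ℂ V ⊗[ℂ] TensorAlgebra ℂ V :=
  fold (LinearMap.mk₂ ℂ
    (fun θ u => LinearMap.rTensor _ (LinearMap.mul ℂ (TensorAlgebra ℂ V) (TensorAlgebra.ι ℂ θ)) u +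
      braidPast A θ u)
    (by intros; simp [LinearMap.rTensor_add]; abel) (by intros; simp [LinearMap.rTensor_smul])
    (by intros; simp; abel) (by intros; simp))
    (1 ⊗ₜ[ℂ] 1)

/-- The total braided inverse `I`, which reverses the order of the letters with the help of the
braiding: `I(θ x) = ∑ₖ I(x)ₖ (θ ∘ cₖ)`, where the coaction of `I(x)` is `∑ₖ I(x)ₖ ⊗ cₖ`. -/
def braidedReverse : TensorAlgebra ℂ V →ₗ[ℂ] TensorAlgebra ℂ V :=
  fold (LinearMap.mk₂ ℂ
    (fun θ x => LinearMap.mul' ℂ (TensorAlgebra ℂ V)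
      (LinearMap.lTensor (TensorAlgebra ℂ V) (actι A θ) (tensorCoact A x)))
    (by intros; simp) (by intros; simp) (by intros; simp) (by intros; simp)) 1

/-- The map `ϑ ↦ (-1)^{deg ϑ} ϑ`. -/
def signMap : TensorAlgebra ℂ V →ₐ[ℂ] TensorAlgebra ℂ V :=
  TensorAlgebra.lift ℂ (-TensorAlgebra.ι ℂ)

/-- Let `X` be an algebra, `s : V^⊗ → X` a homomorphism and `g a = ξ ∘ a` for some `ξ ∈ X`.
This is the map
`ϑ ↦ ∑_{i ≥ 0} ∑_{α,β} (-1)^i I{t_{βi}} (ξ ∘ c^i_{βα}) ϑ_{αi}`, where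
`∑_α t_{αi} ⊗ ϑ_{αi} = M_{i,n-i}(ϑ)` for `ϑ` of degree `n` and
`∑_β t_{βi} ⊗ c^i_{βα}` is the coaction of `t_{αi}`. -/
def twistedAdjoint {X : Type*} [Ring X] [Algebra ℂ X] (s : TensorAlgebra ℂ V →ₐ[ℂ] X)
    (g : A →ₗ[ℂ] X) : TensorAlgebra ℂ V →ₗ[ℂ] X :=
  TensorProduct.lift ((LinearMap.mul ℂ X).compl₁₂
    (TensorProduct.lift ((LinearMap.mul ℂ X).compl₁₂
        (s.toLinearMap ∘ₗ braidedReverse A ∘ₗ signMap.toLinearMap) g) ∘ₗ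
      (tensorCoact A).toLinearMap)
    s.toLinearMap) ∘ₗ shuffleCoproduct A

end Symmetrizer

section Affine

variable (A V : Type*) [Ring A] [StarRing A] [HopfAlgebra ℂ A] [HopfStarAlgebra A]
  [AddCommGroup V] [Module ℂ V] [StarAddMonoid V] [StarModule ℂ V] [YDModule A V]

/-- The Hopf *-algebra `Ã` of the affine extension of `A` by `V`: it contains `A` as a Hopf
*-subalgebra and `V` as a *-invariant subspace, with
`θ a = a⁽¹⁾ (θ ∘ a⁽²⁾)`, `φ(θ) = 1 ⊗ θ + coact(θ)`, and `a ⊗ ϑ ↦ a ϑ` is a linear isomorphism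
of `A ⊗ S(V)` with `Ã`. All of the structure of `Ã` is determined by these properties. -/
structure AffineExtension where
  carrier : Type*
  [ring : Ring carrier]
  [starRing : StarRing carrier]
  [hopfAlgebra : HopfAlgebra ℂ carrier]
  [hopfStarAlgebra : HopfStarAlgebra carrier]
  incl : A →ₐc[ℂ] carrier
  trans : V →ₗ[ℂ] carrier
  trans_mul_incl : ∀ (θ : V) (a : A), trans θ * incl a =
    TensorProduct.lift ((LinearMap.mul ℂ carrier).compl₁₂ (incl : A →ₗ[ℂ] carrier)
      (trans ∘ₗ YDModule.act θ)) (comul (R := ℂ) a)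
  equiv : A ⊗[ℂ] BraidedSym A V ≃ₗ[ℂ] carrier
  equiv_tmul_mk : ∀ (a : A) (x : TensorAlgebra ℂ V),
    equiv (a ⊗ₜ Submodule.Quotient.mk x) = incl a * TensorAlgebra.lift ℂ trans x
  star_incl : ∀ a, star (incl a) = incl (star a)
  star_trans : ∀ θ, star (trans θ) = trans (star θ)
  comul_trans : ∀ θ, comul (R := ℂ) (trans θ) =
    1 ⊗ₜ[ℂ] trans θ + TensorProduct.map trans (incl : A →ₗ[ℂ] carrier) (YDModule.coact θ)

attribute [instance] AffineExtension.ring AffineExtension.starRing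
  AffineExtension.hopfAlgebra AffineExtension.hopfStarAlgebra

variable {A V}

/-- The canonical map `V^⊗ → S(V) ⊆ Ã`. -/
def AffineExtension.sym (E : AffineExtension A V) : TensorAlgebra ℂ V →ₐ[ℂ] E.carrier :=
  TensorAlgebra.lift ℂ E.trans

/-- The *-algebra `H̃ = H ⊗ S(V)` with the cross-product structure, the coaction
`H̃ → H̃ ⊗ Ã` combining those of `H` and `S(V)`, and the right `Ã`-module structure `∘` that combines
the `A`-module structures of `H` and `S(V)` and is given on `S(V)` by
`ξ ∘ ϑ = ∑ (-1)^i I{t_{βi}} (ξ ∘ c^i_{βα}) ϑ_{αi}`.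
All of the structure of `H̃` is determined by these properties. -/
structure AffineAlgebra (E : AffineExtension A V) (H : Type*) [Ring H] [Algebra ℂ H] [StarRing H]
    [StarModule ℂ H] [YDModule A H] where
  carrier : Type*
  [ring : Ring carrier]
  [algebra : Algebra ℂ carrier]
  [starRing : StarRing carrier]
  [starModule : StarModule ℂ carrier]
  [ydModule : YDModule E.carrier carrier]
  [ydStarAlgebra : YDStarAlgebra E.carrier carrier]
  incl : H →⋆ₐ[ℂ] carrier
  trans : V →ₗ[ℂ] carrier
  trans_mul_incl : ∀ (θ : V) (h : H), trans θ * incl h =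
    TensorProduct.lift ((LinearMap.mul ℂ carrier).compl₁₂ (incl : H →ₗ[ℂ] carrier)
      (trans ∘ₗ YDModule.act θ)) (YDModule.coact (A := A) h)
  equiv : H ⊗[ℂ] BraidedSym A V ≃ₗ[ℂ] carrier
  equiv_tmul_mk : ∀ (h : H) (x : TensorAlgebra ℂ V),
    equiv (h ⊗ₜ Submodule.Quotient.mk x) = incl h * TensorAlgebra.lift ℂ trans x
  star_trans : ∀ θ, star (trans θ) = trans (star θ)
  coact_incl : ∀ h, YDModule.coact (A := E.carrier) (incl h) =
    TensorProduct.map (incl : H →ₗ[ℂ] carrier) (E.incl : A →ₗ[ℂ] E.carrier) (YDModule.coact h)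
  coact_trans : ∀ θ, YDModule.coact (A := E.carrier) (trans θ) =
    1 ⊗ₜ[ℂ] E.trans θ + TensorProduct.map trans (E.incl : A →ₗ[ℂ] E.carrier) (YDModule.coact θ)
  act_incl : ∀ h a, YDModule.act (incl h) (E.incl a) = incl (YDModule.act h a)
  act_trans : ∀ θ a, YDModule.act (trans θ) (E.incl a) = trans (YDModule.act θ a)
  act_sym : ∀ ξ x, YDModule.act ξ (E.sym x) =
    twistedAdjoint A (TensorAlgebra.lift ℂ trans)
      (YDModule.act ξ ∘ₗ (E.incl : A →ₗ[ℂ] E.carrier)) x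

attribute [instance] AffineAlgebra.ring AffineAlgebra.algebra AffineAlgebra.starRing
  AffineAlgebra.starModule AffineAlgebra.ydModule AffineAlgebra.ydStarAlgebra

variable {E : AffineExtension A V} {H : Type*} [Ring H] [Algebra ℂ H] [StarRing H]
    [StarModule ℂ H] [YDModule A H]

/-- The canonical map `V^⊗ → S(V) ⊆ H̃`. -/
def AffineAlgebra.sym (R : AffineAlgebra E H) : TensorAlgebra ℂ V →ₐ[ℂ] R.carrier :=
  TensorAlgebra.lift ℂ R.trans

/-- The conditions defining `π̃ : Ã → H̃` in terms of `π : A → H` and `ζ : V → H`: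
`π̃` extends `π`, `π̃(θ) = ζ(θ) - ∑ₖ θₖ π(cₖ)` on `V`, and
`π̃(q ϑ) = ∑ (-1)^i I{t_{βi}} (π̃(q) ∘ c^i_{βα}) ϑ_{αi}` for `ε(q) = 0` and `ϑ ∈ S(V)`. -/
structure IsAffineGermMap (R : AffineAlgebra E H) (π : A →ₗ[ℂ] H) (ζ : V →ₗ[ℂ] H)
    (ϖ : E.carrier →ₗ[ℂ] R.carrier) : Prop where
  incl : ∀ a, ϖ (E.incl a) = R.incl (π a)
  trans : ∀ θ, ϖ (E.trans θ) = R.incl (ζ θ) -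
    TensorProduct.lift ((LinearMap.mul ℂ R.carrier).compl₁₂ R.trans
      ((R.incl : H →ₗ[ℂ] R.carrier) ∘ₗ π)) (YDModule.coact θ)
  mul_sym : ∀ q x, counit (R := ℂ) q = 0 → ϖ (q * E.sym x) =
    twistedAdjoint A R.sym (YDModule.act (ϖ q) ∘ₗ (E.incl : A →ₗ[ℂ] E.carrier)) x

end Affine

/-- A first-order bicovariant *-calculus over a Hopf *-algebra `B`: a bimodule `Γ` with a derivation
`d : B → Γ` such that the `a db` span `Γ`, with left and right coactions given by
`a db ↦ φ(a)(id ⊗ d)φ(b)` and `a db ↦ φ(a)(d ⊗ id)φ(b)`, and with an antilinear involution given by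
`(a db)* = d(b*) a*`. -/
structure BicovariantStarCalculus (B : Type*) [Ring B] [StarRing B] [HopfAlgebra ℂ B] where
  carrier : Type*
  [addCommGroup : AddCommGroup carrier]
  [module : Module ℂ carrier]
  lsmul : B →ₗ[ℂ] carrier →ₗ[ℂ] carrier
  rsmul : carrier →ₗ[ℂ] B →ₗ[ℂ] carrier
  one_lsmul : ∀ m, lsmul 1 m = m
  mul_lsmul : ∀ a b m, lsmul (a * b) m = lsmul a (lsmul b m)
  rsmul_one : ∀ m, rsmul m 1 = m
  rsmul_mul : ∀ m a b, rsmul m (a * b) = rsmul (rsmul m a) b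
  lsmul_rsmul : ∀ a m b, rsmul (lsmul a m) b = lsmul a (rsmul m b)
  d : B →ₗ[ℂ] carrier
  d_mul : ∀ a b, d (a * b) = rsmul (d a) b + lsmul a (d b)
  span_eq_top : Submodule.span ℂ {m | ∃ a b, m = lsmul a (d b)} = ⊤
  lcoact : carrier →ₗ[ℂ] B ⊗[ℂ] carrier
  lcoact_apply : ∀ a b, lcoact (lsmul a (d b)) =
    TensorProduct.map₂ (LinearMap.mul ℂ B) lsmul (comul (R := ℂ) a) (d.lTensor B (comul (R := ℂ) b))
  rcoact : carrier →ₗ[ℂ] carrier ⊗[ℂ] B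
  rcoact_apply : ∀ a b, rcoact (lsmul a (d b)) =
    TensorProduct.map₂ lsmul (LinearMap.mul ℂ B) (comul (R := ℂ) a) (d.rTensor B (comul (R := ℂ) b))
  conj : carrier →ₛₗ[starRingEnd ℂ] carrier
  conj_conj : ∀ m, conj (conj m) = m
  conj_apply : ∀ a b, conj (lsmul a (d b)) = rsmul (d (star b)) (star a)

attribute [instance] BicovariantStarCalculus.addCommGroup BicovariantStarCalculus.module

namespace BicovariantStarCalculus

variable {B : Type*} [Ring B] [StarRing B] [HopfAlgebra ℂ B] (Γ : BicovariantStarCalculus B)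

/-- The left-invariant elements. -/
def inv : Submodule ℂ Γ.carrier :=
  LinearMap.ker (Γ.lcoact - TensorProduct.mk ℂ B Γ.carrier 1)

/-- The quantum germs map `b ↦ κ(b⁽¹⁾) d b⁽²⁾` of the calculus. -/
def germ : B →ₗ[ℂ] Γ.carrier :=
  TensorProduct.lift (Γ.lsmul.compl₁₂ (antipode ℂ) Γ.d) ∘ₗ comul

/-- `m ∘ b = κ(b⁽¹⁾) m b⁽²⁾`. -/
def invAct (m : Γ.carrier) : B →ₗ[ℂ] Γ.carrier :=
  TensorProduct.lift (Γ.lsmul.compl₁₂ (antipode ℂ) (Γ.rsmul m)) ∘ₗ comul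

end BicovariantStarCalculus

end AffineQG

end

universe u v w

open AffineQG

/-!
The affine extension `Ã` is the quotient of the smash product `F = A # V^⊗` (`Free`), which is a
Hopf *-algebra for any covariant *-module `V`, by the kernel of `id ⊗ Y` (`Free.total`). The point
is that this kernel is a Hopf *-ideal. It is a coideal and a left ideal, because the braided
symmetrizer is a product of insertion operators that intertwine the coproduct with a coproduct
defined by deconcatenation, and it has no components in degrees zero and one. It contains every
coideal with that last property (`Free.total_eq_zero_of_mem`): removing the last letter of
`(id ⊗ Y)(f)` is evaluating the second factor of `φ(f)` at its letters, and a tensor vanishes if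
removing letters never leads to a component of degree zero. The images of the kernel under the
antipode and the involution are again such coideals (`Free.total_antipode`, `Free.total_star`), and
stability under the involution makes the left ideal two-sided.

The algebra `H̃` is the smash product `H # S(V)`. Its action of `Ã` comes from an adjoint action: the
diagonal action of `A` on `H̃` defines `A # H̃`, there is a homomorphism `j : Ã → A # H̃` that is the
inclusion on `A` and on `V`, and `x ↦ j(κ(b⁽¹⁾)) x j(b⁽²⁾)` preserves `H̃` (`AffineDatum.act`). On
`S(V)` it is given by the braided inversion (`AffineDatum.act_sym`), and its compatibility with the
coaction and the involution holds because the adjoint action of a Hopf *-algebra has it. Conversely,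
for every algebra `R` with the properties of `H̃`, the given action of `Ã` is this adjoint action
(`AffineAlgebra.datum_act`).

The quantum germs map is `π̃(b) = j(κ(b⁽¹⁾)) d(b⁽²⁾)` for a derivation `d : Ã → A # H̃` along `j`
with `d(a) = a⁽¹⁾ π(a⁽²⁾)` and `d(θ) = ζ(θ)`. Such a derivation amounts to a homomorphism to the
square-zero extension of `A # H̃`, and is determined by its values on `A` and `V`; it respects the
relations of `S(V)` because the derivation of a tensor is expressed by the coproduct of `Ã`
(`AffineAlgebra.lift_sqZero`, `AffineAlgebra.exists_derivation`). The cocycle identity for `π̃` is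
then immediate (`AffineAlgebra.exists_germMap`). For a cocycle, covariance and hermiticity pass to
products (`coact_germ_mul`, `star_germ_mul`), so they need only be checked on `A` and on `V`. The
formula for `π̃(q ϑ)` is the cocycle identity, and it determines `π̃` by induction on the degree
(`AffineAlgebra.isAffineGermMap_unique`).

The calculus is `Ã ⊗ im π̃` with `d b = b⁽¹⁾ ⊗ π̃(b⁽²⁾)` (`GermCalculus.calculus`,
`IsGermMap.exists_calculus`), where the coaction and the involution of `H̃` restrict to `im π̃` by
covariance and hermiticity.
-/

noncomputable section

namespace AffineQG

/-! ### Convolution products -/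

section Convolution

variable {M N C X Y : Type*} [AddCommGroup M] [Module ℂ M] [AddCommGroup N] [Module ℂ N]
  [Ring X] [Algebra ℂ X] [Ring Y] [Algebra ℂ Y]

/-- The linear map `m ⊗ n ↦ f m * g n`. -/
def prodMap (f : M →ₗ[ℂ] X) (g : N →ₗ[ℂ] X) : M ⊗[ℂ] N →ₗ[ℂ] X :=
  TensorProduct.lift ((LinearMap.mul ℂ X).compl₁₂ f g)

@[simp] lemma prodMap_tmul (f : M →ₗ[ℂ] X) (g : N →ₗ[ℂ] X) (m : M) (n : N) :
    prodMap f g (m ⊗ₜ n) = f m * g n := rfl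

lemma prodMap_map {M' N' : Type*} [AddCommGroup M'] [Module ℂ M'] [AddCommGroup N'] [Module ℂ N']
    (f : M →ₗ[ℂ] X) (g : N →ₗ[ℂ] X) (a : M' →ₗ[ℂ] M) (b : N' →ₗ[ℂ] N) (u : M' ⊗[ℂ] N') :
    prodMap f g (TensorProduct.map a b u) = prodMap (f ∘ₗ a) (g ∘ₗ b) u := by
  induction u with
  | zero => simp
  | tmul => simp
  | add u v hu hv => simp [hu, hv]

lemma prodMap_lTensor {N' : Type*} [AddCommGroup N'] [Module ℂ N']
    (f : M →ₗ[ℂ] X) (g : N →ₗ[ℂ] X) (b : N' →ₗ[ℂ] N) (u : M ⊗[ℂ] N') :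
    prodMap f g (LinearMap.lTensor M b u) = prodMap f (g ∘ₗ b) u :=
  prodMap_map f g LinearMap.id b u

lemma prodMap_rTensor {M' : Type*} [AddCommGroup M'] [Module ℂ M']
    (f : M →ₗ[ℂ] X) (g : N →ₗ[ℂ] X) (a : M' →ₗ[ℂ] M) (u : M' ⊗[ℂ] N) :
    prodMap f g (LinearMap.rTensor N a u) = prodMap (f ∘ₗ a) g u :=
  prodMap_map f g a LinearMap.id u

lemma algHom_prodMap (φ : X →ₐ[ℂ] Y) (f : M →ₗ[ℂ] X) (g : N →ₗ[ℂ] X) (u : M ⊗[ℂ] N) :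
    φ (prodMap f g u) = prodMap (φ.toLinearMap ∘ₗ f) (φ.toLinearMap ∘ₗ g) u := by
  induction u with
  | zero => simp
  | tmul => simp
  | add u v hu hv => simp [hu, hv]

lemma prodMap_mulLeft (x : X) (f : M →ₗ[ℂ] X) (g : N →ₗ[ℂ] X) (u : M ⊗[ℂ] N) :
    prodMap (LinearMap.mulLeft ℂ x ∘ₗ f) g u = x * prodMap f g u := by
  induction u with
  | zero => simp
  | tmul => simp [mul_assoc]
  | add u v hu hv => simp [hu, hv, mul_add]

lemma prodMap_mulRight (x : X) (f : M →ₗ[ℂ] X) (g : N →ₗ[ℂ] X) (u : M ⊗[ℂ] N) :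
    prodMap f (LinearMap.mulRight ℂ x ∘ₗ g) u = prodMap f g u * x := by
  induction u with
  | zero => simp
  | tmul => simp [mul_assoc]
  | add u v hu hv => simp [hu, hv, add_mul]

lemma prodMap_middle (x : X) (f : M →ₗ[ℂ] X) (g : N →ₗ[ℂ] X) (u : M ⊗[ℂ] N) :
    prodMap (LinearMap.mulRight ℂ x ∘ₗ f) g u = prodMap f (LinearMap.mulLeft ℂ x ∘ₗ g) u := by
  induction u with
  | zero => simp
  | tmul => simp [mul_assoc]
  | add u v hu hv => simp [hu, hv]

lemma prodMap_add_left (f f' : M →ₗ[ℂ] X) (g : N →ₗ[ℂ] X) :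
    prodMap (f + f') g = prodMap f g + prodMap f' g := by
  ext; simp [add_mul]

lemma prodMap_add_right (f : M →ₗ[ℂ] X) (g g' : N →ₗ[ℂ] X) :
    prodMap f (g + g') = prodMap f g + prodMap f g' := by
  ext; simp [mul_add]

lemma prodMap_smul_right (c : ℂ) (f : M →ₗ[ℂ] X) (g : N →ₗ[ℂ] X) :
    prodMap f (c • g) = c • prodMap f g := by
  ext; simp

lemma prodMap_smul_left (c : ℂ) (f : M →ₗ[ℂ] X) (g : N →ₗ[ℂ] X) :
    prodMap (c • f) g = c • prodMap f g := by
  ext; simp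

lemma prodMap_neg_left (f : M →ₗ[ℂ] X) (g : N →ₗ[ℂ] X) :
    prodMap (-f) g = -prodMap f g := by
  ext; simp

/-- A right comodule structure on `M` over the coalgebra `C`. -/
structure Comod (C M : Type*) [AddCommGroup C] [Module ℂ C] [Coalgebra ℂ C]
    [AddCommGroup M] [Module ℂ M] where
  /-- The coaction. -/
  δ : M →ₗ[ℂ] M ⊗[ℂ] C
  coassoc : ∀ m, TensorProduct.assoc ℂ M C C (δ.rTensor C (δ m)) = LinearMap.lTensor M comul (δ m)
  counit : ∀ m, LinearMap.lTensor M (counit (R := ℂ)) (δ m) = m ⊗ₜ[ℂ] (1 : ℂ)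

variable [AddCommGroup C] [Module ℂ C] [Coalgebra ℂ C]

variable (C) in
/-- A coalgebra as a comodule over itself. -/
@[simps] def Comod.self : Comod C C where
  δ := comul
  coassoc := Coalgebra.coassoc_apply
  counit := Coalgebra.lTensor_counit_comul

variable (D : Comod C M)

/-- The convolution product `m ↦ f(m₀) g(m₁)`, where the coaction of `m` is `m₀ ⊗ m₁`. -/
def conv (f : M →ₗ[ℂ] X) (g : C →ₗ[ℂ] X) : M →ₗ[ℂ] X := prodMap f g ∘ₗ D.δ

lemma conv_apply (f : M →ₗ[ℂ] X) (g : C →ₗ[ℂ] X) (m : M) : conv D f g m = prodMap f g (D.δ m) := rfl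

variable (C X) in
/-- The unit of the convolution product. -/
def convUnit : C →ₗ[ℂ] X := Algebra.linearMap ℂ X ∘ₗ counit

@[simp] lemma convUnit_apply (c : C) : convUnit C X c = algebraMap ℂ X (counit c) := rfl

lemma conv_assoc (f : M →ₗ[ℂ] X) (g h : C →ₗ[ℂ] X) :
    conv D (conv D f g) h = conv D f (conv (Comod.self C) g h) := by
  have key : ∀ u : (M ⊗[ℂ] C) ⊗[ℂ] C, prodMap (prodMap f g) h u =
      prodMap f (prodMap g h) (TensorProduct.assoc ℂ M C C u) := by
    intro u
    refine LinearMap.congr_fun (f := prodMap (prodMap f g) h)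
      (g := prodMap f (prodMap g h) ∘ₗ (TensorProduct.assoc ℂ M C C).toLinearMap) ?_ u
    ext; simp [mul_assoc]
  ext m
  rw [conv_apply, conv_apply, conv, ← prodMap_rTensor, key, D.coassoc, prodMap_lTensor]
  rfl

lemma conv_convUnit (f : M →ₗ[ℂ] X) : conv D f (convUnit C X) = f := by
  ext m
  rw [conv_apply, convUnit, ← prodMap_lTensor, D.counit]
  simp

lemma convUnit_conv (f : C →ₗ[ℂ] X) : conv (Comod.self C) (convUnit C X) f = f := by
  ext m
  rw [conv_apply, convUnit, ← prodMap_rTensor, Comod.self_δ, Coalgebra.rTensor_counit_comul]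
  simp

lemma conv_mulLeft (x : X) (f : M →ₗ[ℂ] X) (g : C →ₗ[ℂ] X) :
    conv D (LinearMap.mulLeft ℂ x ∘ₗ f) g = LinearMap.mulLeft ℂ x ∘ₗ conv D f g := by
  ext m; simp [conv_apply, prodMap_mulLeft]

lemma conv_mulRight (x : X) (f : M →ₗ[ℂ] X) (g : C →ₗ[ℂ] X) :
    conv D f (LinearMap.mulRight ℂ x ∘ₗ g) = LinearMap.mulRight ℂ x ∘ₗ conv D f g := by
  ext m; simp [conv_apply, prodMap_mulRight]

lemma conv_middle (x : X) (f : M →ₗ[ℂ] X) (g : C →ₗ[ℂ] X) :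
    conv D (LinearMap.mulRight ℂ x ∘ₗ f) g = conv D f (LinearMap.mulLeft ℂ x ∘ₗ g) := by
  ext m; simp [conv_apply, prodMap_middle]

lemma conv_mulLeft_right (x : X) (f : M →ₗ[ℂ] X) (g : C →ₗ[ℂ] X) (h : ∀ m, f m * x = x * f m) :
    conv D f (LinearMap.mulLeft ℂ x ∘ₗ g) = LinearMap.mulLeft ℂ x ∘ₗ conv D f g := by
  rw [← conv_middle, ← conv_mulLeft]
  congr 1
  ext m
  exact h m

lemma conv_zero_right (f : M →ₗ[ℂ] X) : conv D f (0 : C →ₗ[ℂ] X) = 0 := by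
  have : prodMap f (0 : C →ₗ[ℂ] X) = 0 := by ext; simp
  ext m; simp [conv_apply, this]

lemma conv_add_left (f f' : M →ₗ[ℂ] X) (g : C →ₗ[ℂ] X) :
    conv D (f + f') g = conv D f g + conv D f' g := by
  ext m; simp [conv_apply, prodMap_add_left]

lemma conv_add_right (f : M →ₗ[ℂ] X) (g g' : C →ₗ[ℂ] X) :
    conv D f (g + g') = conv D f g + conv D f g' := by
  ext m; simp [conv_apply, prodMap_add_right]

lemma conv_neg_left (f : M →ₗ[ℂ] X) (g : C →ₗ[ℂ] X) : conv D (-f) g = -conv D f g := by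
  ext m; simp [conv_apply, prodMap_neg_left]

lemma algHom_conv (φ : X →ₐ[ℂ] Y) (f : M →ₗ[ℂ] X) (g : C →ₗ[ℂ] X) :
    φ.toLinearMap ∘ₗ conv D f g = conv D (φ.toLinearMap ∘ₗ f) (φ.toLinearMap ∘ₗ g) := by
  ext m; simp [conv_apply, algHom_prodMap]

lemma algHom_convUnit (φ : X →ₐ[ℂ] Y) : φ.toLinearMap ∘ₗ convUnit C X = convUnit C Y := by
  ext m; simp

/-- Precomposition of a convolution product with a comodule map. -/
lemma conv_comp {N : Type*} [AddCommGroup N] [Module ℂ N] {C' : Type*} [AddCommGroup C']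
    [Module ℂ C'] [Coalgebra ℂ C'] (D' : Comod C' N) (a : N →ₗ[ℂ] M) (b : C' →ₗ[ℂ] C)
    (h : ∀ n, D.δ (a n) = TensorProduct.map a b (D'.δ n)) (f : M →ₗ[ℂ] X) (g : C →ₗ[ℂ] X) :
    conv D f g ∘ₗ a = conv D' (f ∘ₗ a) (g ∘ₗ b) := by
  ext n; simp [conv_apply, h, prodMap_map]

end Convolution

section HopfConv

variable {A X : Type*} [Ring A] [HopfAlgebra ℂ A] [Ring X] [Algebra ℂ X]

lemma antipode_conv (f : A →ₐ[ℂ] X) :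
    conv (Comod.self A) (f.toLinearMap ∘ₗ antipode ℂ) f.toLinearMap = convUnit A X := by
  have : conv (Comod.self A) (antipode ℂ) LinearMap.id = convUnit A A := by
    ext a
    rw [conv_apply, convUnit_apply, ← mul_antipode_rTensor_comul_apply, ← LinearMap.comp_id
      (antipode ℂ), ← LinearMap.id_comp LinearMap.id, ← LinearMap.id_comp (antipode ℂ),
      LinearMap.comp_assoc, ← prodMap_map]
    rfl
  rw [← algHom_convUnit f, ← this, algHom_conv]
  rfl

lemma conv_antipode (f : A →ₐ[ℂ] X) :
    conv (Comod.self A) f.toLinearMap (f.toLinearMap ∘ₗ antipode ℂ) = convUnit A X := by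
  have : conv (Comod.self A) LinearMap.id (antipode ℂ) = convUnit A A := by
    ext a
    rw [conv_apply, convUnit_apply, ← mul_antipode_lTensor_comul_apply, ← LinearMap.comp_id
      (LinearMap.id), ← LinearMap.id_comp (antipode ℂ), ← prodMap_map]
    rfl
  rw [← algHom_convUnit f, ← this, algHom_conv]
  rfl

end HopfConv

/-! ### Smash products -/

section Smash

/-- A right module structure over the Hopf algebra `A` on an algebra `B`, compatible with the
multiplication of `B`. -/
structure ModAlg (A B : Type*) [Ring A] [HopfAlgebra ℂ A] [Ring B] [Algebra ℂ B] where
  /-- The action. -/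
  act : B →ₗ[ℂ] A →ₗ[ℂ] B
  act_one : ∀ b, act b 1 = b
  act_mul : ∀ b a a', act b (a * a') = act (act b a) a'
  mul_act : ∀ b b', act (b * b') = conv (Comod.self A) (act b) (act b')
  one_act : act 1 = convUnit A B

/-- A right comodule structure over the Hopf algebra `A` on an algebra `H`, the coaction being
multiplicative. -/
structure ComodAlg (A H : Type*) [Ring A] [HopfAlgebra ℂ A] [Ring H] [Algebra ℂ H]
    extends Comod A H where
  δ_one : δ 1 = 1
  δ_mul : ∀ x y, δ (x * y) = δ x * δ y

/-- A Hopf algebra as a comodule algebra over itself. -/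
@[simps! δ] def ComodAlg.self (A : Type*) [Ring A] [HopfAlgebra ℂ A] : ComodAlg A A where
  toComod := Comod.self A
  δ_one := Bialgebra.comul_one
  δ_mul := Bialgebra.comul_mul

variable {A H B X : Type*} [Ring A] [HopfAlgebra ℂ A] [Ring H] [Algebra ℂ H] [Ring B] [Algebra ℂ B]
  [Ring X] [Algebra ℂ X] (D : ComodAlg A H) (ρ : ModAlg A B)

/-- The smash product `H # B`: the vector space `H ⊗ B` with the multiplication for which `H` and
`B` are subalgebras and `b h = h₀ (b ∘ h₁)`. -/
def Smash (_ : ComodAlg A H) (_ : ModAlg A B) : Type _ := H ⊗[ℂ] B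

instance : AddCommGroup (Smash D ρ) := inferInstanceAs (AddCommGroup (H ⊗[ℂ] B))
instance : Module ℂ (Smash D ρ) := inferInstanceAs (Module ℂ (H ⊗[ℂ] B))

namespace Smash

/-- The twist `b ⊗ h ↦ h₀ ⊗ (b ∘ h₁)`. -/
def twist : B →ₗ[ℂ] H →ₗ[ℂ] H ⊗[ℂ] B where
  toFun b := LinearMap.lTensor H (ρ.act b) ∘ₗ D.δ
  map_add' _ _ := by ext; simp [LinearMap.lTensor_add]
  map_smul' _ _ := by ext; simp [LinearMap.lTensor_smul]

lemma twist_apply (b : B) (h : H) : twist D ρ b h = LinearMap.lTensor H (ρ.act b) (D.δ h) := rfl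

/-- Left multiplication by elements of `B`. -/
def mulB : B →ₗ[ℂ] Module.End ℂ (H ⊗[ℂ] B) where
  toFun b := prodMap (twist D ρ b) (Algebra.TensorProduct.includeRight (A := H)).toLinearMap
  map_add' _ _ := by ext; simp [add_mul]
  map_smul' _ _ := by ext; simp

lemma mulB_tmul (b : B) (h : H) (y : B) :
    mulB D ρ b (h ⊗ₜ y) = twist D ρ b h * (1 ⊗ₜ y) := rfl

/-- Left multiplication by elements of `H`. -/
def mulH : H →ₗ[ℂ] Module.End ℂ (H ⊗[ℂ] B) :=
  LinearMap.mul ℂ (H ⊗[ℂ] B) ∘ₗ Algebra.TensorProduct.includeLeft.toLinearMap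

lemma mulH_apply (h : H) (u : H ⊗[ℂ] B) : mulH h u = (h ⊗ₜ 1) * u := rfl

/-- The multiplication of the smash product. -/
def mulₗ : H ⊗[ℂ] B →ₗ[ℂ] Module.End ℂ (H ⊗[ℂ] B) := prodMap mulH (mulB D ρ)

lemma prodMap_mul_mul (f : H →ₗ[ℂ] X) (g : B →ₗ[ℂ] X) (hf : ∀ x y, f (x * y) = f x * f y)
    (hg : ∀ x y, g (x * y) = g x * g y) (h : H) (w : H ⊗[ℂ] B) (b : B) :
    prodMap f g ((h ⊗ₜ 1) * w * (1 ⊗ₜ b)) = f h * prodMap f g w * g b := by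
  induction w with
  | zero => simp
  | tmul => simp [hf, hg, mul_assoc]
  | add u v hu hv => simp [hu, hv, add_mul, mul_add]

lemma prodMap_mulₗ (f : H →ₗ[ℂ] X) (g : B →ₗ[ℂ] X) (hf : ∀ x y, f (x * y) = f x * f y)
    (hg : ∀ x y, g (x * y) = g x * g y)
    (hfg : ∀ b h, g b * f h = prodMap f g (twist D ρ b h)) (u v : H ⊗[ℂ] B) :
    prodMap f g (mulₗ D ρ u v) = prodMap f g u * prodMap f g v := by
  induction u with
  | zero => simp
  | add u u' hu hu' => simp [hu, hu', add_mul]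
  | tmul h b =>
    induction v with
    | zero => simp
    | add u u' hu hu' => simp [hu, hu', mul_add]
    | tmul h' b' =>
      have : mulₗ D ρ (h ⊗ₜ b) (h' ⊗ₜ b') = (h ⊗ₜ 1) * twist D ρ b h' * (1 ⊗ₜ b') := by
        simp [mulₗ, mulH_apply, mulB_tmul, mul_assoc]
      rw [this, prodMap_mul_mul f g hf hg, ← hfg]
      simp [mul_assoc]

lemma mulB_mul (b b' : B) : mulB D ρ (b * b') = mulB D ρ b * mulB D ρ b' := by
  have hr : ∀ (b y : B) (u : H ⊗[ℂ] B),
      mulB D ρ b (u * (1 ⊗ₜ y)) = mulB D ρ b u * (1 ⊗ₜ y) := by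
    intro b y u
    induction u with
    | zero => simp
    | tmul h z => simp [mulB_tmul, mul_assoc]
    | add u v hu hv => simp [hu, hv, add_mul]
  have key : ∀ h, twist D ρ (b * b') h = mulB D ρ b (twist D ρ b' h) := by
    intro h
    have h1 : ∀ u : H ⊗[ℂ] A, mulB D ρ b (LinearMap.lTensor H (ρ.act b') u) =
        LinearMap.lTensor H (prodMap (ρ.act b) (ρ.act b'))
          (TensorProduct.assoc ℂ H A A (LinearMap.rTensor A D.δ u)) := by
      intro u
      induction u with
      | zero => simp
      | add u v hu hv => simp only [map_add, hu, hv]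
      | tmul h a =>
        simp only [LinearMap.lTensor_tmul, LinearMap.rTensor_tmul, mulB_tmul, twist_apply]
        induction D.δ h with
        | zero => simp
        | add u v hu hv => simp only [map_add, TensorProduct.add_tmul, add_mul, hu, hv]
        | tmul h c => simp
    rw [twist_apply, twist_apply, h1, D.coassoc, ρ.mul_act]
    exact LinearMap.congr_fun (LinearMap.lTensor_comp H _ _) (D.δ h)
  ext h y
  simp only [TensorProduct.AlgebraTensorModule.curry_apply, LinearMap.restrictScalars_self,
    TensorProduct.curry_apply, Module.End.mul_apply, mulB_tmul, hr, key]

lemma mulB_mulH (b : B) (h : H) :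
    mulB D ρ b * mulH h = prodMap mulH (mulB D ρ) (twist D ρ b h) := by
  ext h' y
  simp only [TensorProduct.AlgebraTensorModule.curry_apply, LinearMap.restrictScalars_self,
    TensorProduct.curry_apply, Module.End.mul_apply, mulH_apply, mulB_tmul, twist_apply, D.δ_mul,
    Algebra.TensorProduct.tmul_mul_tmul, one_mul]
  induction D.δ h with
  | zero => simp
  | add u v hu hv => simp only [map_add, add_mul, LinearMap.add_apply, hu, hv]
  | tmul h c =>
    simp only [LinearMap.lTensor_tmul, prodMap_tmul, Module.End.mul_apply, mulB_tmul, mulH_apply,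
      twist_apply, ← mul_assoc]
    congr 1
    induction D.δ h' with
    | zero => simp
    | add u v hu hv => simp only [map_add, mul_add, hu, hv]
    | tmul h c' => simp [ρ.act_mul]

lemma mulₗ_mulₗ (u v : H ⊗[ℂ] B) : mulₗ D ρ (mulₗ D ρ u v) = mulₗ D ρ u * mulₗ D ρ v :=
  prodMap_mulₗ D ρ _ _ (by intro x y; ext; simp [mulH_apply, mul_assoc])
    (mulB_mul D ρ) (mulB_mulH D ρ) u v

instance : Mul (Smash D ρ) := ⟨fun u v => mulₗ D ρ u v⟩
instance : One (Smash D ρ) := ⟨(1 ⊗ₜ 1 : H ⊗[ℂ] B)⟩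

lemma one_mul' (u : H ⊗[ℂ] B) : mulₗ D ρ (1 ⊗ₜ 1) u = u := by
  induction u with
  | zero => simp
  | add u v hu hv => simp only [map_add, hu, hv]
  | tmul h b =>
    have : twist D ρ 1 h = h ⊗ₜ 1 := by
      rw [twist_apply, ρ.one_act, convUnit, LinearMap.lTensor_comp, LinearMap.comp_apply, D.counit]
      simp
    simp [mulₗ, mulH_apply, mulB_tmul, this]

lemma mul_one' (u : H ⊗[ℂ] B) : mulₗ D ρ u (1 ⊗ₜ 1) = u := by
  induction u with
  | zero => simp
  | add u v hu hv => simp only [map_add, LinearMap.add_apply, hu, hv]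
  | tmul h b =>
    simp [mulₗ, mulH_apply, mulB_tmul, twist_apply, D.δ_one, Algebra.TensorProduct.one_def,
      ρ.act_one]

/-- The product is `(h b) (h' b') = h h'₀ (b ∘ h'₁) b'`. -/
instance : Ring (Smash D ρ) where
  mul_assoc u v w := LinearMap.congr_fun (mulₗ_mulₗ D ρ u v) w
  one_mul := one_mul' D ρ
  mul_one := mul_one' D ρ
  left_distrib u v w := map_add (mulₗ D ρ u) v w
  right_distrib u v w := LinearMap.congr_fun (map_add (mulₗ D ρ) u v) w
  zero_mul u := by
    change mulₗ D ρ (0 : H ⊗[ℂ] B) u = 0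
    rw [map_zero]; rfl
  mul_zero u := map_zero (mulₗ D ρ u)
  zsmul := fun n x => n • x
  zsmul_zero' := fun x => zero_smul _ x
  zsmul_succ' := SubNegMonoid.zsmul_succ'
  zsmul_neg' := SubNegMonoid.zsmul_neg'
  neg_add_cancel := neg_add_cancel

instance : Algebra ℂ (Smash D ρ) := Algebra.ofModule
  (fun c u v => LinearMap.congr_fun (map_smul (mulₗ D ρ) c u) v)
  (fun c u v => map_smul (mulₗ D ρ u) c v)

/-- The inclusion of `H`. -/
def inl : H →ₐ[ℂ] Smash D ρ :=
  AlgHom.ofLinearMap ((TensorProduct.mk ℂ H B).flip 1) rfl (by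
    intro x y
    change _ = mulₗ D ρ (x ⊗ₜ 1) (y ⊗ₜ 1)
    have : twist D ρ 1 y = y ⊗ₜ 1 := by
      rw [twist_apply, ρ.one_act, convUnit, LinearMap.lTensor_comp, LinearMap.comp_apply, D.counit]
      simp
    simp [mulₗ, mulH_apply, mulB_tmul, this]
    rfl)

/-- The inclusion of `B`. -/
def inr : B →ₐ[ℂ] Smash D ρ :=
  AlgHom.ofLinearMap (TensorProduct.mk ℂ H B 1) rfl (by
    intro x y
    change _ = mulₗ D ρ (1 ⊗ₜ x) (1 ⊗ₜ y)
    simp [mulₗ, mulH_apply, mulB_tmul, twist_apply, D.δ_one, Algebra.TensorProduct.one_def,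
      ρ.act_one]
    rfl)

/-- The underlying linear identification of the smash product with `H ⊗ B`. -/
def equivTensor : H ⊗[ℂ] B ≃ₗ[ℂ] Smash D ρ := LinearEquiv.refl ℂ _

lemma inl_mul_inr (h : H) (b : B) :
    inl D ρ h * inr D ρ b = equivTensor D ρ (h ⊗ₜ b) := by
  change mulₗ D ρ (h ⊗ₜ 1) (1 ⊗ₜ b) = h ⊗ₜ b
  simp [mulₗ, mulH_apply, mulB_tmul, twist_apply, D.δ_one, Algebra.TensorProduct.one_def,
      ρ.act_one]

lemma prodMap_inl_inr (u : H ⊗[ℂ] B) :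
    prodMap (inl D ρ).toLinearMap (inr D ρ).toLinearMap u = equivTensor D ρ u := by
  induction u with
  | zero => simp
  | add u v hu hv => simp only [map_add, hu, hv]
  | tmul h b => exact inl_mul_inr D ρ h b

/-- The cross-product rule. -/
lemma inr_mul_inl (b : B) (h : H) : inr D ρ b * inl D ρ h =
    conv D.toComod (inl D ρ).toLinearMap ((inr D ρ).toLinearMap ∘ₗ ρ.act b) h := by
  rw [conv_apply, ← prodMap_lTensor, prodMap_inl_inr]
  change mulₗ D ρ (1 ⊗ₜ b) (h ⊗ₜ 1) = twist D ρ b h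
  rw [mulₗ, prodMap_tmul, Module.End.mul_apply, mulH_apply, mulB_tmul,
    ← Algebra.TensorProduct.one_def, one_mul, mul_one]

@[elab_as_elim]
lemma induction {P : Smash D ρ → Prop} (hinl : ∀ h, P (inl D ρ h)) (hinr : ∀ b, P (inr D ρ b))
    (add : ∀ x y, P x → P y → P (x + y)) (mul : ∀ x y, P x → P y → P (x * y)) (x : Smash D ρ) :
    P x := by
  obtain ⟨u, rfl⟩ := (equivTensor D ρ).surjective x
  induction u with
  | zero => rw [map_zero, ← map_zero (inl D ρ)]; exact hinl 0
  | tmul h b => rw [← inl_mul_inr]; exact mul _ _ (hinl h) (hinr b)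
  | add u v hu hv => rw [map_add]; exact add _ _ hu hv

/-- The universal property of the smash product. -/
def lift (f : H →ₐ[ℂ] X) (g : B →ₐ[ℂ] X) (hfg : ∀ b h, g b * f h =
    conv D.toComod f.toLinearMap (g.toLinearMap ∘ₗ ρ.act b) h) : Smash D ρ →ₐ[ℂ] X :=
  AlgHom.ofLinearMap (prodMap f.toLinearMap g.toLinearMap)
    (by change f 1 * g 1 = 1; simp)
    (fun u v => prodMap_mulₗ D ρ f.toLinearMap g.toLinearMap (map_mul f) (map_mul g)
      (fun b h => by
        rw [twist_apply, prodMap_lTensor]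
        exact hfg b h) u v)

@[simp] lemma lift_inl (f : H →ₐ[ℂ] X) (g : B →ₐ[ℂ] X) (hfg) (h : H) :
    lift D ρ f g hfg (inl D ρ h) = f h := by
  change f h * g 1 = f h; simp

@[simp] lemma lift_inr (f : H →ₐ[ℂ] X) (g : B →ₐ[ℂ] X) (hfg) (b : B) :
    lift D ρ f g hfg (inr D ρ b) = g b := by
  change f 1 * g b = g b; simp

/-- The linear map `h b ↦ ε(h) b`. -/
def projR (ε : H →ₗ[ℂ] ℂ) : Smash D ρ →ₗ[ℂ] B :=
  (TensorProduct.lid ℂ B).toLinearMap ∘ₗ LinearMap.rTensor B ε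

lemma projR_inr (ε : H →ₗ[ℂ] ℂ) (hε : ε 1 = 1) (b : B) : projR D ρ ε (inr D ρ b) = b := by
  change ε 1 • b = b
  simp [hε]

end Smash

end Smash

/-! ### Antipodes and involutions -/

section HopfStar

variable {A X : Type*} [Ring A] [HopfAlgebra ℂ A] [Ring X] [Algebra ℂ X]

/-- The antipode reverses the coproduct. -/
lemma comul_antipode (a : A) : comul (R := ℂ) (antipode ℂ a) =
    TensorProduct.map (antipode ℂ) (antipode ℂ) (TensorProduct.comm ℂ A A (comul a)) := by
  let iL : A →ₐ[ℂ] A ⊗[ℂ] A := Algebra.TensorProduct.includeLeft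
  let iR : A →ₐ[ℂ] A ⊗[ℂ] A := Algebra.TensorProduct.includeRight
  let G : A →ₗ[ℂ] A ⊗[ℂ] A := conv (Comod.self A) (iR.toLinearMap ∘ₗ antipode ℂ)
    (iL.toLinearMap ∘ₗ antipode ℂ)
  have hG : ∀ a, G a =
      TensorProduct.map (antipode ℂ) (antipode ℂ) (TensorProduct.comm ℂ A A (comul a)) := by
    intro a
    simp only [G, conv_apply, Comod.self_δ]
    induction comul (R := ℂ) a with
    | zero => simp
    | add u v hu hv => simp only [map_add, hu, hv]
    | tmul x y => simp [iL, iR]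
  have hδ : (Bialgebra.comulAlgHom ℂ A).toLinearMap =
      conv (Comod.self A) iL.toLinearMap iR.toLinearMap := by
    ext a
    simp only [conv_apply, Comod.self_δ, AlgHom.toLinearMap_apply, Bialgebra.comulAlgHom_apply]
    induction comul (R := ℂ) a with
    | zero => simp
    | add u v hu hv => rw [map_add, ← hu, ← hv]
    | tmul x y => simp [iL, iR]
  have h1 : conv (Comod.self A) (Bialgebra.comulAlgHom ℂ A).toLinearMap G = convUnit A _ := by
    rw [hδ, conv_assoc, ← conv_assoc _ iR.toLinearMap, conv_antipode, convUnit_conv,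
      conv_antipode]
  have h2 := antipode_conv (Bialgebra.comulAlgHom ℂ A)
  rw [← hG]
  have : (Bialgebra.comulAlgHom ℂ A).toLinearMap ∘ₗ antipode ℂ = G := by
    rw [← conv_convUnit (Comod.self A) ((Bialgebra.comulAlgHom ℂ A).toLinearMap ∘ₗ antipode ℂ),
      ← h1, ← conv_assoc, h2, convUnit_conv]
  exact LinearMap.congr_fun this a

variable [StarRing A] [HopfStarAlgebra A]

lemma counit_star (a : A) : counit (R := ℂ) (star a) = star (counit (R := ℂ) a) := by
  let e : A →ₗ[ℂ] ℂ :=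
    { toFun := fun a => star (counit (R := ℂ) (star a))
      map_add' := by simp
      map_smul' := by simp }
  have h0 : conv (Comod.self A) (Algebra.linearMap ℂ A ∘ₗ e) LinearMap.id = LinearMap.id := by
    ext a
    have h3 : ∀ u : A ⊗[ℂ] A, prodMap (Algebra.linearMap ℂ A ∘ₗ e) LinearMap.id u =
        star (prodMap (convUnit A A) LinearMap.id (star u)) := by
      intro u
      induction u with
      | zero => simp
      | add u v hu hv => simp only [map_add, star_add, hu, hv]
      | tmul x y => simp [e, Algebra.algebraMap_eq_smul_one]
    rw [conv_apply, h3, Comod.self_δ, ← HopfStarAlgebra.comul_star]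
    have := LinearMap.congr_fun (convUnit_conv (LinearMap.id : A →ₗ[ℂ] A)) (star a)
    rw [conv_apply, Comod.self_δ] at this
    rw [this]
    simp
  have h1 : e = counit := by
    rw [← conv_convUnit (Comod.self A) (X := ℂ) e]
    have := congrArg (fun f => (Bialgebra.counitAlgHom ℂ A).toLinearMap ∘ₗ f) h0
    simp only [algHom_conv] at this
    have h5 : (Bialgebra.counitAlgHom ℂ A).toLinearMap ∘ₗ Algebra.linearMap ℂ A ∘ₗ e = e := by
      ext; simp
    rw [h5] at this
    ext a
    have := LinearMap.congr_fun this a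
    simp only [conv_apply, convUnit] at this ⊢
    exact this
  have := LinearMap.congr_fun h1 (star a)
  rw [← this]
  simp [e]

/-- `κ(κ(a*)*) = a`. -/
lemma antipode_star_antipode_star (a : A) :
    antipode ℂ (star (antipode ℂ (star a))) = a := by
  let S : A →ₗ[ℂ] A :=
    { toFun := fun a => antipode ℂ (star (antipode ℂ (star a)))
      map_add' := by simp
      map_smul' := by simp }
  have hid := conv_antipode (AlgHom.id ℂ A)
  have h1 : conv (Comod.self A) (antipode ℂ) S = convUnit A A := by
    ext a
    have h3 : ∀ u : A ⊗[ℂ] A, prodMap (antipode ℂ) S u =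
        antipode ℂ (star (prodMap LinearMap.id (antipode ℂ) (star u))) := by
      intro u
      induction u with
      | zero => simp
      | add u v hu hv => simp only [map_add, star_add, hu, hv]
      | tmul x y => simp [S, antipode_mul_antidistrib]
    rw [conv_apply, h3, Comod.self_δ, ← HopfStarAlgebra.comul_star]
    have := LinearMap.congr_fun hid (star a)
    simp only [conv_apply, AlgHom.toLinearMap_id, LinearMap.id_comp, Comod.self_δ] at this
    rw [this, convUnit_apply, convUnit_apply, counit_star]
    simp [Algebra.algebraMap_eq_smul_one, antipode_one]
  have h2 : S = LinearMap.id := by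
    rw [← convUnit_conv S, ← hid, conv_assoc, AlgHom.toLinearMap_id, LinearMap.id_comp, h1,
      conv_convUnit]
  exact LinearMap.congr_fun h2 a

variable [StarRing X]

/-- The involution reverses convolution products, up to the map `a ↦ κ(a)*`. -/
lemma star_conv (f g f' g' : A →ₗ[ℂ] X) (hf : ∀ a, star (f' a) = f (star (antipode ℂ a)))
    (hg : ∀ a, star (g' a) = g (star (antipode ℂ a))) (a : A) :
    star (conv (Comod.self A) f' g' a) = conv (Comod.self A) g f (star (antipode ℂ a)) := by
  have h : ∀ u : A ⊗[ℂ] A, star (prodMap f' g' u) = prodMap g f (star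
      (TensorProduct.map (antipode ℂ) (antipode ℂ) (TensorProduct.comm ℂ A A u))) := by
    intro u
    induction u with
    | zero => simp
    | add u v hu hv => simp only [map_add, star_add, hu, hv]
    | tmul x y => simp [hf, hg]
  rw [conv_apply, conv_apply, h, Comod.self_δ, HopfStarAlgebra.comul_star, comul_antipode]

end HopfStar

/-! ### The involution of a smash product -/

section SmashStar

variable {A H B : Type*} [Ring A] [HopfAlgebra ℂ A] [StarRing A] [HopfStarAlgebra A]
  [Ring H] [Algebra ℂ H] [StarRing H] [StarModule ℂ H]
  [Ring B] [Algebra ℂ B] [StarRing B] [StarModule ℂ B]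

/-- A coaction and an action compatible with the involutions. -/
class StarCompatible (D : ComodAlg A H) (ρ : ModAlg A B) : Prop where
  δ_star : ∀ h, D.δ (star h) = star (D.δ h)
  star_act : ∀ b a, star (ρ.act b a) = ρ.act (star b) (star (antipode ℂ a))

namespace Smash

variable (D : ComodAlg A H) (ρ : ModAlg A B)

/-- The linear map `h ⊗ b ↦ b h` to the smash product. -/
def mulSwap : H ⊗[ℂ] B →ₗ[ℂ] Smash D ρ :=
  prodMap (inr D ρ).toLinearMap (inl D ρ).toLinearMap ∘ₗ (TensorProduct.comm ℂ H B).toLinearMap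

/-- The involution is `(h b)* = b* h*`. -/
instance : Star (Smash D ρ) := ⟨fun x => mulSwap D ρ (star ((equivTensor D ρ).symm x))⟩

omit [StarRing A] [HopfStarAlgebra A] in
lemma star_add' (x y : Smash D ρ) : star (x + y) = star x + star y := by
  change mulSwap D ρ (star ((equivTensor D ρ).symm (x + y))) = _
  rw [map_add, star_add, map_add]; rfl

omit [StarRing A] [HopfStarAlgebra A] in
lemma star_inl_mul_inr (h : H) (b : B) :
    star (inl D ρ h * inr D ρ b) = inr D ρ (star b) * inl D ρ (star h) := by
  change mulSwap D ρ (star ((equivTensor D ρ).symm _)) = _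
  rw [inl_mul_inr]
  simp [mulSwap]

omit [StarRing A] [HopfStarAlgebra A] in
lemma star_inl (h : H) : star (inl D ρ h) = inl D ρ (star h) := by
  have := star_inl_mul_inr D ρ h 1
  simpa using this

omit [StarRing A] [HopfStarAlgebra A] in
lemma star_inr (b : B) : star (inr D ρ b) = inr D ρ (star b) := by
  have := star_inl_mul_inr D ρ 1 b
  simpa using this

omit [StarRing A] [HopfStarAlgebra A] [StarRing H] [StarModule ℂ H] [StarRing B]
  [StarModule ℂ B] in
@[elab_as_elim]
lemma ind_tmul {P : Smash D ρ → Prop} (h : ∀ h b, P (inl D ρ h * inr D ρ b))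
    (add : ∀ x y, P x → P y → P (x + y)) (x : Smash D ρ) : P x := by
  obtain ⟨u, rfl⟩ := (equivTensor D ρ).surjective x
  induction u with
  | zero =>
    have := h 0 0
    simpa using this
  | tmul x y => rw [← inl_mul_inr]; exact h x y
  | add u v hu hv => rw [map_add]; exact add _ _ hu hv

variable [hD : StarCompatible D ρ]

/-- The cross-product rule for the products in the opposite order. -/
lemma inl_mul_inr_star (h : H) (b : B) : inl D ρ (star h) * inr D ρ (star b) =
    star (conv D.toComod (inl D ρ).toLinearMap ((inr D ρ).toLinearMap ∘ₗ ρ.act b) h) := by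
  let Q (w : H ⊗[ℂ] (A ⊗[ℂ] A)) : Smash D ρ :=
    prodMap (inl D ρ).toLinearMap ((inr D ρ).toLinearMap ∘ₗ ρ.act (star b))
      (star (LinearMap.lTensor H (prodMap LinearMap.id (antipode ℂ)) w))
  have h1 : ∀ u : H ⊗[ℂ] A,
      star (prodMap (inl D ρ).toLinearMap ((inr D ρ).toLinearMap ∘ₗ ρ.act b) u) =
        Q (TensorProduct.assoc ℂ H A A (LinearMap.rTensor A D.δ u)) := by
    intro u
    induction u with
    | zero =>
      have := star_inl D ρ 0
      simp only [map_zero, star_zero] at this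
      simp [Q, this]
    | add u v hu hv => simp only [Q, map_add, star_add', star_add] at hu hv ⊢; rw [hu, hv]
    | tmul h a =>
      simp only [prodMap_tmul, LinearMap.comp_apply, AlgHom.toLinearMap_apply, star_inl_mul_inr,
        hD.star_act, inr_mul_inl, LinearMap.rTensor_tmul, conv_apply, hD.δ_star]
      induction D.δ h with
      | zero => simp [Q]
      | add u v hu hv =>
        simp only [Q, TensorProduct.add_tmul, map_add, star_add] at hu hv ⊢; rw [hu, hv]
      | tmul h c => simp [Q, ρ.act_mul]
  have h2 := conv_antipode (AlgHom.id ℂ A)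
  rw [conv_apply, h1, D.coassoc]
  simp only [Q]
  rw [← LinearMap.comp_apply (LinearMap.lTensor H _), ← LinearMap.lTensor_comp]
  change _ = prodMap _ _ (star (LinearMap.lTensor H (conv (Comod.self A) LinearMap.id _) (D.δ h)))
  simp only [AlgHom.toLinearMap_id, LinearMap.id_comp] at h2
  rw [h2, convUnit, LinearMap.lTensor_comp, LinearMap.comp_apply, D.counit]
  simp [ρ.act_one]

omit [StarRing A] [HopfStarAlgebra A] hD in
lemma star_inl_mul_mul_inr (h : H) (w : Smash D ρ) (b : B) :
    star (inl D ρ h * w * inr D ρ b) = inr D ρ (star b) * star w * inl D ρ (star h) := by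
  induction w using ind_tmul with
  | h h' b' =>
    have : inl D ρ h * (inl D ρ h' * inr D ρ b') * inr D ρ b =
        inl D ρ (h * h') * inr D ρ (b' * b) := by simp [mul_assoc]
    rw [this, star_inl_mul_inr, star_inl_mul_inr]
    simp [mul_assoc]
  | add x y hx hy => simp only [mul_add, add_mul, star_add', hx, hy]

instance : StarRing (Smash D ρ) where
  star_involutive x := by
    induction x using ind_tmul with
    | h h b =>
      rw [star_inl_mul_inr, inr_mul_inl, ← inl_mul_inr_star, star_star, star_star]
    | add x y hx hy => rw [star_add', star_add', hx, hy]
  star_add := star_add' D ρ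
  star_mul x y := by
    induction x using ind_tmul with
    | add x x' hx hy => simp only [add_mul, mul_add, star_add', hx, hy]
    | h h b =>
      induction y using ind_tmul with
      | add x x' hx hy => simp only [add_mul, mul_add, star_add', hx, hy]
      | h h' b' =>
        have : inl D ρ h * inr D ρ b * (inl D ρ h' * inr D ρ b') =
          inl D ρ h * (inr D ρ b * inl D ρ h') * inr D ρ b' := by simp only [mul_assoc]
        rw [this, star_inl_mul_mul_inr, inr_mul_inl, ← inl_mul_inr_star, star_inl_mul_inr,
          star_inl_mul_inr]
        simp only [mul_assoc]

instance : StarModule ℂ (Smash D ρ) where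
  star_smul c x := by
    change mulSwap D ρ (star ((equivTensor D ρ).symm (c • x))) = _
    rw [map_smul, star_smul, map_smul]; rfl

end Smash

end SmashStar

/-! ### Yetter–Drinfeld modules -/

section YetterDrinfeld

variable {A M : Type*} [Ring A] [HopfAlgebra ℂ A] [AddCommGroup M] [Module ℂ M] [YDModule A M]

variable (A M) in
/-- The underlying comodule. -/
def YDModule.comod : Comod A M where
  δ := YDModule.coact
  coassoc := YDModule.coact_coassoc
  counit := YDModule.coact_counit

@[simp] lemma YDModule.comod_δ : (YDModule.comod A M).δ = YDModule.coact := rfl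

/-- The bilinear map `a ⊗ b ↦ (m ∘ b)₀ ⊗ a (m ∘ b)₁`. -/
def ydLeft (m : M) : A →ₗ[ℂ] A →ₗ[ℂ] M ⊗[ℂ] A :=
  (LinearMap.lTensorHom M ∘ₗ LinearMap.mul ℂ A).compl₂ (YDModule.coact ∘ₗ YDModule.act m)

@[simp] lemma ydLeft_apply (m : M) (a b : A) : ydLeft m a b =
    LinearMap.lTensor M (LinearMap.mulLeft ℂ a) (YDModule.coact (YDModule.act m b)) := rfl

/-- The Yetter–Drinfeld condition `(m ∘ a⁽²⁾)₀ ⊗ a⁽¹⁾ (m ∘ a⁽²⁾)₁ = (m₀ ∘ a⁽¹⁾) ⊗ m₁ a⁽²⁾`, which is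
the compatibility of the action with the coaction freed of the antipode. -/
lemma yetterDrinfeld (m : M) (a : A) : TensorProduct.lift (ydLeft m) (comul a) =
    TensorProduct.map₂ YDModule.act (LinearMap.mul ℂ A) (YDModule.coact m) (comul a) := by
  let L : A →ₐ[ℂ] Module.End ℂ (M ⊗[ℂ] A) :=
    AlgHom.ofLinearMap (LinearMap.lTensorHom M ∘ₗ LinearMap.mul ℂ A) (by ext; simp)
      (by intro x y; ext; simp [mul_assoc])
  let T : A →ₗ[ℂ] Module.End ℂ (M ⊗[ℂ] A) :=
    (TensorProduct.map₂ YDModule.act (LinearMap.mul ℂ A)).flip ∘ₗ comul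
  have h1 : ∀ (u : M ⊗[ℂ] A) (w : A ⊗[ℂ] A),
      ydTwist YDModule.act (u ⊗ₜ[ℂ] LinearMap.lTensor A comul w) =
        prodMap (L.toLinearMap ∘ₗ antipode ℂ) T w u := by
    intro u w
    induction w with
    | zero => simp
    | add u v hu hv => simp only [map_add, TensorProduct.tmul_add, LinearMap.add_apply, hu, hv]
    | tmul a b =>
      simp only [LinearMap.lTensor_tmul, prodMap_tmul, Module.End.mul_apply, T,
        LinearMap.comp_apply, LinearMap.flip_apply]
      induction comul (R := ℂ) b with
      | zero => simp
      | add v w hv hw => simp only [map_add, TensorProduct.tmul_add, hv, hw]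
      | tmul b c =>
        induction u with
        | zero => simp
        | add v w hv hw =>
          simp only [map_add, TensorProduct.add_tmul, LinearMap.add_apply, hv, hw]
        | tmul m d => simp [ydTwist, L]
  have h2 : ∀ w : A ⊗[ℂ] A, TensorProduct.lift (ydLeft m) w =
      prodMap L.toLinearMap (conv (Comod.self A) (L.toLinearMap ∘ₗ antipode ℂ) T) w
        (YDModule.coact m) := by
    intro w
    induction w with
    | zero => simp
    | add u v hu hv => simp only [map_add, LinearMap.add_apply, hu, hv]
    | tmul a b =>
      simp only [TensorProduct.lift.tmul, ydLeft_apply, YDModule.coact_act, h1]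
      rfl
  have h3 : conv (Comod.self A) L.toLinearMap
      (conv (Comod.self A) (L.toLinearMap ∘ₗ antipode ℂ) T) = T := by
    rw [← conv_assoc, conv_antipode, convUnit_conv]
  rw [h2]
  exact LinearMap.congr_fun (LinearMap.congr_fun h3 a) _

variable {X : Type*} [Ring X] [Algebra ℂ X]

/-- If `f = x i` up to the cross-product rule `x i(a) = i(a⁽¹⁾) f(a⁽²⁾)`, then `f` is the adjoint
action on `x`. -/
lemma adjoint_eq (i : A →ₐ[ℂ] X) (x : X) (f : A →ₗ[ℂ] X)
    (h : ∀ a, x * i a = conv (Comod.self A) i.toLinearMap f a) :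
    conv (Comod.self A) (i.toLinearMap ∘ₗ antipode ℂ) (LinearMap.mulLeft ℂ x ∘ₗ i.toLinearMap) =
      f := by
  have : LinearMap.mulLeft ℂ x ∘ₗ i.toLinearMap = conv (Comod.self A) i.toLinearMap f := by
    ext a; exact h a
  rw [this, ← conv_assoc, antipode_conv, convUnit_conv]

/-- The cross-product rule, moved past the antipode. -/
lemma conv_antipode_of_rule (i : A →ₐ[ℂ] X) (x : X) (f : A →ₗ[ℂ] X)
    (h : ∀ a, x * i a = conv (Comod.self A) i.toLinearMap f a) (a : A) :
    conv (Comod.self A) f (i.toLinearMap ∘ₗ antipode ℂ) a = i (antipode ℂ a) * x := by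
  rw [← adjoint_eq i x f h, conv_assoc, conv_mulLeft, conv_antipode, ← conv_middle,
    conv_convUnit]
  simp

/-- If `t` and `i` satisfy the cross-product rule, then so do `t ⊗ j` after the coaction of `M` and
`i ⊗ j` after the coaction of `H`. -/
lemma coact_mul_comul {H Y : Type*} [Ring H] [Algebra ℂ H] [Ring Y] [Algebra ℂ Y] (D : Comod A H)
    (i : H →ₐ[ℂ] X) (j : A →ₐ[ℂ] Y) (t : M →ₗ[ℂ] X)
    (h : ∀ m a, t m * i a = conv D i.toLinearMap (t ∘ₗ YDModule.act m) a)
    (m : M) (a : H) :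
    TensorProduct.map t j.toLinearMap (YDModule.coact m) *
        Algebra.TensorProduct.map i j (D.δ a) =
      conv D ((Algebra.TensorProduct.map i j).toLinearMap ∘ₗ D.δ)
        (TensorProduct.map t j.toLinearMap ∘ₗ YDModule.coact ∘ₗ YDModule.act m) a := by
  let iL : X →ₐ[ℂ] X ⊗[ℂ] Y := Algebra.TensorProduct.includeLeft
  let iR : Y →ₐ[ℂ] X ⊗[ℂ] Y := Algebra.TensorProduct.includeRight
  let I : H →ₐ[ℂ] X ⊗[ℂ] Y := iL.comp i
  let J : A →ₐ[ℂ] X ⊗[ℂ] Y := iR.comp j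
  have hIJ : (Algebra.TensorProduct.map i j).toLinearMap ∘ₗ D.δ =
      conv D I.toLinearMap J.toLinearMap := by
    ext a
    simp only [LinearMap.comp_apply, conv_apply]
    induction D.δ a with
    | zero => simp
    | add u v hu hv => simp only [map_add, hu, hv]
    | tmul x y => simp [I, J, iL, iR]
  let Z : A →ₗ[ℂ] X ⊗[ℂ] Y := TensorProduct.map t j.toLinearMap ∘ₗ YDModule.coact ∘ₗ YDModule.act m
  -- The inner convolution product is evaluated with the Yetter–Drinfeld condition.
  have hJ : conv (Comod.self A) J.toLinearMap Z = TensorProduct.map t j.toLinearMap ∘ₗ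
      TensorProduct.map₂ YDModule.act (LinearMap.mul ℂ A) (YDModule.coact m) ∘ₗ comul := by
    ext a
    rw [conv_apply, Comod.self_δ, LinearMap.comp_apply, LinearMap.comp_apply, ← yetterDrinfeld]
    induction comul (R := ℂ) a with
    | zero => simp
    | add u v hu hv => simp only [map_add, hu, hv]
    | tmul a b =>
      simp only [prodMap_tmul, Z, LinearMap.comp_apply, TensorProduct.lift.tmul, ydLeft_apply]
      induction YDModule.coact (A := A) (YDModule.act m b) with
      | zero => simp
      | add u v hu hv => simp only [map_add, mul_add, hu, hv]
      | tmul m c => simp [J, iR]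
  have key : ∀ u : M ⊗[ℂ] A, conv D I.toLinearMap (TensorProduct.map t j.toLinearMap ∘ₗ
      TensorProduct.map₂ YDModule.act (LinearMap.mul ℂ A) u ∘ₗ comul) =
      LinearMap.mulLeft ℂ (TensorProduct.map t j.toLinearMap u) ∘ₗ
        conv D I.toLinearMap J.toLinearMap := by
    intro u
    induction u with
    | zero => ext a; simp [conv_zero_right]
    | add u v hu hv =>
      simp only [map_add, LinearMap.add_comp, LinearMap.comp_add, conv_add_right, hu, hv]
      ext a; simp [add_mul]
    | tmul m c =>
      have h1 : TensorProduct.map t j.toLinearMap ∘ₗ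
          TensorProduct.map₂ YDModule.act (LinearMap.mul ℂ A) (m ⊗ₜ c) ∘ₗ comul =
          LinearMap.mulLeft ℂ (1 ⊗ₜ j c) ∘ₗ conv (Comod.self A)
            (iL.toLinearMap ∘ₗ t ∘ₗ YDModule.act m) J.toLinearMap := by
        ext a
        simp only [LinearMap.comp_apply, conv_apply, Comod.self_δ]
        induction comul (R := ℂ) a with
        | zero => simp
        | add u v hu hv => simp only [map_add, hu, hv]
        | tmul x y => simp [J, iL, iR]
      have h2 : conv D I.toLinearMap (iL.toLinearMap ∘ₗ t ∘ₗ YDModule.act m) =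
          LinearMap.mulLeft ℂ (t m ⊗ₜ 1) ∘ₗ I.toLinearMap := by
        ext a
        have := congrArg iL (h m a)
        rw [conv_apply, algHom_prodMap, map_mul] at this
        exact this.symm
      rw [h1, conv_mulLeft_right, ← conv_assoc, h2, conv_mulLeft]
      · ext a; simp [← mul_assoc]
      · intro a; simp [I, iL]
  have := LinearMap.congr_fun (key (YDModule.coact m)) a
  rw [← hJ, ← conv_assoc, ← hIJ] at this
  exact this.symm

end YetterDrinfeld

/-! ### The tensor algebra of a Yetter–Drinfeld module -/

section TensorAlgebra

/-- Induction on a tensor by its first letter. -/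
@[elab_as_elim]
lemma tensor_induction {V : Type*} [AddCommGroup V] [Module ℂ V] {P : TensorAlgebra ℂ V → Prop}
    (one : P 1) (cons : ∀ θ x, P x → P (TensorAlgebra.ι ℂ θ * x))
    (add : ∀ x y, P x → P y → P (x + y)) (smul : ∀ (c : ℂ) x, P x → P (c • x))
    (x : TensorAlgebra ℂ V) : P x := by
  suffices ∀ y, P y → P (x * y) by simpa using this 1 one
  induction x using TensorAlgebra.induction with
  | algebraMap c => intro y hy; rw [← Algebra.smul_def]; exact smul c y hy
  | ι θ => exact fun y => cons θ y
  | mul a b ha hb => intro y hy; rw [mul_assoc]; exact ha _ (hb _ hy)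
  | add a b ha hb => intro y hy; rw [add_mul]; exact add _ _ (ha _ hy) (hb _ hy)

section Fold

variable {V W : Type*} [AddCommGroup V] [Module ℂ V] [AddCommGroup W] [Module ℂ W]
  (F : V →ₗ[ℂ] Module.End ℂ W) (w : W)

@[simp] lemma fold_one : fold F w 1 = w := by simp [fold]

@[simp] lemma fold_cons (θ : V) (x : TensorAlgebra ℂ V) :
    fold F w (TensorAlgebra.ι ℂ θ * x) = F θ (fold F w x) := by simp [fold]

end Fold

variable (A V : Type*) [Ring A] [HopfAlgebra ℂ A] [AddCommGroup V] [Module ℂ V] [YDModule A V]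

variable {V} in
lemma tensorCoact_ι (θ : V) : tensorCoact A (TensorAlgebra.ι ℂ θ) =
    LinearMap.rTensor A (TensorAlgebra.ι ℂ) (YDModule.coact θ) := by
  simp [tensorCoact]

/-- The coaction on the tensor algebra. -/
def tensorComod : ComodAlg A (TensorAlgebra ℂ V) where
  δ := (tensorCoact A).toLinearMap
  coassoc := by
    let f : TensorAlgebra ℂ V →ₐ[ℂ] TensorAlgebra ℂ V ⊗[ℂ] (A ⊗[ℂ] A) :=
      ((Algebra.TensorProduct.assoc ℂ ℂ ℂ (TensorAlgebra ℂ V) A A).toAlgHom.comp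
        (Algebra.TensorProduct.map (tensorCoact A) (AlgHom.id ℂ A))).comp (tensorCoact A)
    let g : TensorAlgebra ℂ V →ₐ[ℂ] TensorAlgebra ℂ V ⊗[ℂ] (A ⊗[ℂ] A) :=
      (Algebra.TensorProduct.map (AlgHom.id ℂ _) (Bialgebra.comulAlgHom ℂ A)).comp (tensorCoact A)
    have : f = g := by
      ext θ
      have h1 : ∀ u : V ⊗[ℂ] A, TensorProduct.assoc ℂ _ A A
          (LinearMap.rTensor A (tensorCoact A).toLinearMap
            (LinearMap.rTensor A (TensorAlgebra.ι ℂ) u)) =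
          LinearMap.rTensor (A ⊗[ℂ] A) (TensorAlgebra.ι ℂ)
            (TensorProduct.assoc ℂ V A A (LinearMap.rTensor A YDModule.coact u)) := by
        intro u
        induction u with
        | zero => simp
        | add u v hu hv => simp only [map_add, hu, hv]
        | tmul v a =>
          simp only [LinearMap.rTensor_tmul, AlgHom.toLinearMap_apply, tensorCoact_ι]
          induction YDModule.coact (A := A) v with
          | zero => simp
          | add u v hu hv => simp only [map_add, TensorProduct.add_tmul, hu, hv]
          | tmul v b => simp
      have h2 : ∀ u : V ⊗[ℂ] A, LinearMap.lTensor _ comul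
            (LinearMap.rTensor A (TensorAlgebra.ι ℂ) u) =
          LinearMap.rTensor (A ⊗[ℂ] A) (TensorAlgebra.ι ℂ) (LinearMap.lTensor V comul u) := by
        intro u
        induction u with
        | zero => simp
        | add u v hu hv => simp only [map_add, hu, hv]
        | tmul v a => simp
      change TensorProduct.assoc ℂ _ A A (LinearMap.rTensor A (tensorCoact A).toLinearMap
        (tensorCoact A (TensorAlgebra.ι ℂ θ))) = LinearMap.lTensor _ comul
          (tensorCoact A (TensorAlgebra.ι ℂ θ))
      rw [tensorCoact_ι, h1, h2, YDModule.coact_coassoc]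
    exact fun m => DFunLike.congr_fun this m
  counit := by
    let f : TensorAlgebra ℂ V →ₐ[ℂ] TensorAlgebra ℂ V ⊗[ℂ] ℂ :=
      (Algebra.TensorProduct.map (AlgHom.id ℂ _) (Bialgebra.counitAlgHom ℂ A)).comp (tensorCoact A)
    have : f = Algebra.TensorProduct.includeLeft := by
      ext θ
      have h2 : ∀ u : V ⊗[ℂ] A, LinearMap.lTensor _ counit
            (LinearMap.rTensor A (TensorAlgebra.ι ℂ) u) =
          LinearMap.rTensor ℂ (TensorAlgebra.ι ℂ) (LinearMap.lTensor V (counit (R := ℂ)) u) := by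
        intro u
        induction u with
        | zero => simp
        | add u v hu hv => simp only [map_add, hu, hv]
        | tmul v a => simp
      change LinearMap.lTensor _ counit (tensorCoact A (TensorAlgebra.ι ℂ θ)) = _
      rw [tensorCoact_ι, h2, YDModule.coact_counit]
      simp
    exact fun m => DFunLike.congr_fun this m
  δ_one := map_one (tensorCoact A)
  δ_mul := map_mul (tensorCoact A)

@[simp] lemma tensorComod_δ (x : TensorAlgebra ℂ V) :
    (tensorComod A V).δ x = tensorCoact A x := rfl

/-- The action on the tensor algebra as a linear map: `(θ x) ∘ a = (θ ∘ a⁽¹⁾) (x ∘ a⁽²⁾)`. -/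
def tensorAct : TensorAlgebra ℂ V →ₗ[ℂ] A →ₗ[ℂ] TensorAlgebra ℂ V :=
  fold
    { toFun := fun θ =>
        { toFun := fun f => conv (Comod.self A) (actι A θ) f
          map_add' := fun f g => conv_add_right _ _ _ _
          map_smul' := fun c f => by ext; simp [conv_apply, prodMap_smul_right] }
      map_add' := fun θ η => by ext f a : 2; simp [conv_add_left]
      map_smul' := fun c θ => by ext f a : 2; simp [conv_apply, prodMap_smul_left] }
    (convUnit A _)

lemma tensorAct_one : tensorAct A V 1 = convUnit A _ := by simp [tensorAct]

lemma tensorAct_cons (θ : V) (x : TensorAlgebra ℂ V) :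
    tensorAct A V (TensorAlgebra.ι ℂ θ * x) =
      conv (Comod.self A) (actι A θ) (tensorAct A V x) := by
  simp [tensorAct]

/-- The action of `A` on the tensor algebra, as a module algebra. -/
def tensorModAlg : ModAlg A (TensorAlgebra ℂ V) where
  act := tensorAct A V
  one_act := tensorAct_one A V
  mul_act x y := by
    induction x using tensor_induction with
    | one => rw [one_mul, tensorAct_one, convUnit_conv]
    | cons θ x hx => rw [mul_assoc, tensorAct_cons, tensorAct_cons, hx, conv_assoc]
    | add x y hx hy => rw [add_mul, map_add, map_add, conv_add_left, hx, hy]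
    | smul c x hx =>
      rw [smul_mul_assoc, map_smul, map_smul, hx]; ext; simp [conv_apply, prodMap_smul_left]
  act_one x := by
    induction x using tensor_induction with
    | one => simp [tensorAct_one]
    | cons θ x hx =>
      simp [tensorAct_cons, conv_apply, hx, Algebra.TensorProduct.one_def, actι, YDModule.act_one]
    | add x y hx hy => simp [hx, hy]
    | smul c x hx => simp [hx]
  act_mul x := by
    induction x using tensor_induction with
    | one => simp [tensorAct_one, Algebra.algebraMap_eq_smul_one, mul_smul]
    | cons θ x hx =>
      intro a b
      rw [tensorAct_cons, conv_apply, conv_apply, Comod.self_δ, Bialgebra.comul_mul]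
      induction comul (R := ℂ) a with
      | zero => simp
      | add u v hu hv => simp only [map_add, add_mul, LinearMap.add_apply, hu, hv]
      | tmul c d =>
        have hc : actι A θ c = TensorAlgebra.ι ℂ (YDModule.act θ c) := rfl
        rw [prodMap_tmul, hc, tensorAct_cons, conv_apply, Comod.self_δ]
        induction comul (R := ℂ) b with
        | zero => simp
        | add u v hu hv => simp only [map_add, mul_add, hu, hv]
        | tmul e f => simp [actι, YDModule.act_mul, hx]
    | add x y hx hy => intro a b; simp [hx, hy]
    | smul c x hx => intro a b; simp [hx]

end TensorAlgebra

/-! ### Smash products with the tensor algebra -/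

section Rule

variable {A H B X : Type*} [Ring A] [HopfAlgebra ℂ A] [Ring H] [Algebra ℂ H] [Ring B] [Algebra ℂ B]
  [Ring X] [Algebra ℂ X] (D : ComodAlg A H) (ρ : ModAlg A B) (f : H →ₐ[ℂ] X) (g : B →ₐ[ℂ] X)

/-- It suffices to check the cross-product rule on generators of `B`. -/
lemma rule_of_adjoin {s : Set B} (hs : Algebra.adjoin ℂ s = ⊤)
    (h : ∀ b ∈ s, ∀ h, g b * f h = conv D.toComod f.toLinearMap (g.toLinearMap ∘ₗ ρ.act b) h)
    (b : B) (x : H) : g b * f x = conv D.toComod f.toLinearMap (g.toLinearMap ∘ₗ ρ.act b) x := by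
  have hb : b ∈ Algebra.adjoin ℂ s := hs ▸ Algebra.mem_top
  have h1 : ∀ x : H, g 1 * f x =
      conv D.toComod f.toLinearMap (g.toLinearMap ∘ₗ ρ.act 1) x := by
    intro x
    rw [ρ.one_act, algHom_convUnit, conv_convUnit]
    simp
  induction hb using Algebra.adjoin_induction generalizing x with
  | mem b hb => exact h b hb x
  | algebraMap c =>
    rw [Algebra.algebraMap_eq_smul_one, map_smul, map_smul, LinearMap.comp_smul, smul_mul_assoc,
      h1]
    simp [conv_apply, prodMap_smul_right]
  | add b b' _ _ hb hb' =>
    rw [map_add, map_add, LinearMap.comp_add, conv_add_right, add_mul, hb, hb']; rfl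
  | mul b b' _ _ hb hb' =>
    have : LinearMap.mulLeft ℂ (g b) ∘ₗ f.toLinearMap =
      conv D.toComod f.toLinearMap (g.toLinearMap ∘ₗ ρ.act b) := by ext x; exact hb x
    rw [map_mul, mul_assoc, hb', ρ.mul_act, algHom_conv, ← conv_assoc, ← this, conv_mulLeft]
    rfl

variable {V : Type*} [AddCommGroup V] [Module ℂ V] [YDModule A V]

lemma tensorAct_ι (θ : V) :
    tensorAct A V (TensorAlgebra.ι ℂ θ) = TensorAlgebra.ι ℂ ∘ₗ YDModule.act θ := by
  rw [← mul_one (TensorAlgebra.ι ℂ θ), tensorAct_cons, tensorAct_one, conv_convUnit]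
  rfl

lemma tensor_rule (t : V →ₗ[ℂ] X) (h : ∀ θ x, t θ * f x =
      conv D.toComod f.toLinearMap (t ∘ₗ YDModule.act θ) x) (b : TensorAlgebra ℂ V) (x : H) :
    TensorAlgebra.lift ℂ t b * f x = conv D.toComod f.toLinearMap
      ((TensorAlgebra.lift ℂ t).toLinearMap ∘ₗ (tensorModAlg A V).act b) x := by
  refine rule_of_adjoin D (tensorModAlg A V) f _ TensorAlgebra.adjoin_range_ι ?_ b x
  rintro _ ⟨θ, rfl⟩ x
  rw [TensorAlgebra.lift_ι_apply, h]
  congr 2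
  ext a
  simp [tensorModAlg, tensorAct_ι]

/-- An algebra homomorphism from `H # V^⊗` is given by compatible maps on `H` and on `V`. -/
def liftTensor (t : V →ₗ[ℂ] X) (h : ∀ θ x, t θ * f x =
      conv D.toComod f.toLinearMap (t ∘ₗ YDModule.act θ) x) :
    Smash D (tensorModAlg A V) →ₐ[ℂ] X :=
  Smash.lift D _ f (TensorAlgebra.lift ℂ t) (tensor_rule D f t h)

end Rule

section AffineRule

variable {A H V X Y : Type*} [Ring A] [HopfAlgebra ℂ A] [Ring H] [Algebra ℂ H] [AddCommGroup V]
  [Module ℂ V] [YDModule A V] [Ring X] [Algebra ℂ X] [Ring Y] [Algebra ℂ Y]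
  (D : ComodAlg A H) (i : H →ₐ[ℂ] X) (j : A →ₐ[ℂ] Y) (t : V →ₗ[ℂ] X) (s : V →ₗ[ℂ] Y)

/-- The map `θ ↦ 1 ⊗ s(θ) + t(θ₀) ⊗ j(θ₁)`. -/
def affineMap : V →ₗ[ℂ] X ⊗[ℂ] Y :=
  TensorProduct.mk ℂ X Y 1 ∘ₗ s + TensorProduct.map t j.toLinearMap ∘ₗ YDModule.coact

lemma affineMap_apply (θ : V) : affineMap j t s θ =
    1 ⊗ₜ s θ + TensorProduct.map t j.toLinearMap (YDModule.coact θ) := rfl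

/-- The coaction of a comodule algebra, as an algebra homomorphism. -/
def ComodAlg.hom : H →ₐ[ℂ] H ⊗[ℂ] A := AlgHom.ofLinearMap D.δ D.δ_one D.δ_mul

/-- The homomorphism `h ↦ i(h₀) ⊗ j(h₁)`. -/
def coactMap : H →ₐ[ℂ] X ⊗[ℂ] Y := (Algebra.TensorProduct.map i j).comp D.hom

lemma coactMap_apply (h : H) : coactMap D i j h =
    TensorProduct.map i.toLinearMap j.toLinearMap (D.δ h) := rfl

lemma coactMap_eq_conv : (coactMap D i j).toLinearMap = conv D.toComod
      ((Algebra.TensorProduct.includeLeft.comp i : H →ₐ[ℂ] X ⊗[ℂ] Y)).toLinearMap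
      ((Algebra.TensorProduct.includeRight.comp j : A →ₐ[ℂ] X ⊗[ℂ] Y)).toLinearMap := by
  ext a
  simp only [AlgHom.toLinearMap_apply, coactMap_apply, conv_apply]
  induction D.δ a with
  | zero => simp
  | add u v hu hv => simp only [map_add, hu, hv]
  | tmul x y => simp

/-- The cross-product rule is inherited by `θ ↦ 1 ⊗ s(θ) + t(θ₀) ⊗ j(θ₁)`. -/
lemma affineMap_rule
    (ht : ∀ m a, t m * i a = conv D.toComod i.toLinearMap (t ∘ₗ YDModule.act m) a)
    (hs : ∀ m a, s m * j a = conv (Comod.self A) j.toLinearMap (s ∘ₗ YDModule.act m) a)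
    (m : V) (a : H) :
    affineMap j t s m * coactMap D i j a =
      conv D.toComod (coactMap D i j).toLinearMap (affineMap j t s ∘ₗ YDModule.act m) a := by
  have h1 : (coactMap D i j).toLinearMap =
      (Algebra.TensorProduct.map i j).toLinearMap ∘ₗ D.δ := rfl
  have h3 : coactMap D i j a = Algebra.TensorProduct.map i j (D.δ a) := rfl
  rw [affineMap_apply, affineMap, LinearMap.add_comp, conv_add_right, LinearMap.add_apply, h1, h3,
    add_mul, coact_mul_comul D.toComod i j t ht, ← h1]
  congr 1
  rw [coactMap_eq_conv, conv_assoc]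
  have h2 : conv (Comod.self A)
      ((Algebra.TensorProduct.includeRight.comp j : A →ₐ[ℂ] X ⊗[ℂ] Y)).toLinearMap
      ((TensorProduct.mk ℂ X Y 1 ∘ₗ s) ∘ₗ YDModule.act m) =
      LinearMap.mulLeft ℂ (1 ⊗ₜ s m) ∘ₗ
        ((Algebra.TensorProduct.includeRight.comp j : A →ₐ[ℂ] X ⊗[ℂ] Y)).toLinearMap := by
    ext a
    have := congrArg (Algebra.TensorProduct.includeRight : Y →ₐ[ℂ] X ⊗[ℂ] Y) (hs m a)
    rw [conv_apply, algHom_prodMap, map_mul] at this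
    exact this.symm
  rw [h2, conv_mulLeft_right, ← coactMap_eq_conv]
  · rfl
  · intro a; simp

lemma affineMap_rule_self (i : A →ₐ[ℂ] X)
    (ht : ∀ m a, t m * i a = conv (Comod.self A) i.toLinearMap (t ∘ₗ YDModule.act m) a)
    (hs : ∀ m a, s m * j a = conv (Comod.self A) j.toLinearMap (s ∘ₗ YDModule.act m) a)
    (m : V) (a : A) : affineMap j t s m * coactMap (ComodAlg.self A) i j a =
      conv (Comod.self A) (coactMap (ComodAlg.self A) i j).toLinearMap
        (affineMap j t s ∘ₗ YDModule.act m) a :=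
  affineMap_rule (ComodAlg.self A) i j t s ht hs m a

end AffineRule

section GeneratedCoaction

variable {A V H X B : Type*} [Ring A] [HopfAlgebra ℂ A] [AddCommGroup V] [Module ℂ V] [YDModule A V]
  [Ring H] [Algebra ℂ H] [Ring X] [Algebra ℂ X] [Ring B] [Algebra ℂ B] (D : ComodAlg A H)
  (i : H →ₐ[ℂ] X) (j : A →ₐ[ℂ] B) (t : V →ₗ[ℂ] X) (s : V →ₗ[ℂ] B)
  (δ : X →ₐ[ℂ] X ⊗[ℂ] B) (Δ : B →ₐ[ℂ] B ⊗[ℂ] B) (ε : B →ₐ[ℂ] ℂ)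

/-- Coassociativity of a coaction on the subalgebra `H`. -/
lemma assoc_coact_incl (hi : ∀ h, δ (i h) = TensorProduct.map i.toLinearMap j.toLinearMap (D.δ h))
    (hj : ∀ a, Δ (j a) = TensorProduct.map j.toLinearMap j.toLinearMap (comul a)) (h : H) :
    TensorProduct.assoc ℂ X B B (TensorProduct.map δ.toLinearMap LinearMap.id (δ (i h))) =
      TensorProduct.map LinearMap.id Δ.toLinearMap (δ (i h)) := by
  have h1 : ∀ u : H ⊗[ℂ] A, TensorProduct.assoc ℂ X B B (TensorProduct.map δ.toLinearMap
      LinearMap.id (TensorProduct.map i.toLinearMap j.toLinearMap u)) =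
      TensorProduct.map i.toLinearMap (TensorProduct.map j.toLinearMap j.toLinearMap)
        (TensorProduct.assoc ℂ H A A (LinearMap.rTensor A D.δ u)) := by
    intro u
    induction u with
    | zero => simp
    | add u v hu hv => simp only [map_add, hu, hv]
    | tmul x y =>
      simp only [TensorProduct.map_tmul, AlgHom.toLinearMap_apply, hi,
        LinearMap.rTensor_tmul, LinearMap.id_apply]
      induction D.δ x with
      | zero => simp
      | add u v hu hv => simp only [map_add, TensorProduct.add_tmul, hu, hv]
      | tmul x z => simp
  have h2 : ∀ u : H ⊗[ℂ] A, TensorProduct.map LinearMap.id Δ.toLinearMap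
      (TensorProduct.map i.toLinearMap j.toLinearMap u) =
      TensorProduct.map i.toLinearMap (TensorProduct.map j.toLinearMap j.toLinearMap)
        (LinearMap.lTensor H comul u) := by
    intro u
    induction u with
    | zero => simp
    | add u v hu hv => simp only [map_add, hu, hv]
    | tmul x y => simp [hj]
  rw [hi, h1, h2, D.coassoc]

/-- Coassociativity of a coaction on `V`. -/
lemma assoc_coact_trans
    (hj : ∀ a, Δ (j a) = TensorProduct.map j.toLinearMap j.toLinearMap (comul a))
    (ht : ∀ θ, δ (t θ) = affineMap j t s θ) (hs : ∀ θ, Δ (s θ) = affineMap j s s θ) (θ : V) :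
    TensorProduct.assoc ℂ X B B (TensorProduct.map δ.toLinearMap LinearMap.id (δ (t θ))) =
      TensorProduct.map LinearMap.id Δ.toLinearMap (δ (t θ)) := by
  have h1 : ∀ u : V ⊗[ℂ] A, TensorProduct.assoc ℂ X B B (TensorProduct.map δ.toLinearMap
      LinearMap.id (TensorProduct.map t j.toLinearMap u)) =
      1 ⊗ₜ TensorProduct.map s j.toLinearMap u +
      TensorProduct.map t (TensorProduct.map j.toLinearMap j.toLinearMap)
        (TensorProduct.assoc ℂ V A A (LinearMap.rTensor A YDModule.coact u)) := by
    intro u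
    induction u with
    | zero => simp
    | add u v hu hv => simp only [map_add, TensorProduct.tmul_add, hu, hv]; abel
    | tmul x y =>
      simp only [TensorProduct.map_tmul, AlgHom.toLinearMap_apply, ht, affineMap_apply,
        LinearMap.rTensor_tmul, LinearMap.id_apply, TensorProduct.add_tmul, map_add,
        TensorProduct.assoc_tmul]
      congr 1
      induction YDModule.coact (A := A) x with
      | zero => simp
      | add u v hu hv => simp only [map_add, TensorProduct.add_tmul, hu, hv]
      | tmul x z => simp
  have h2 : ∀ u : V ⊗[ℂ] A, TensorProduct.map LinearMap.id Δ.toLinearMap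
      (TensorProduct.map t j.toLinearMap u) =
      TensorProduct.map t (TensorProduct.map j.toLinearMap j.toLinearMap)
        (LinearMap.lTensor V comul u) := by
    intro u
    induction u with
    | zero => simp
    | add u v hu hv => simp only [map_add, hu, hv]
    | tmul x y => simp [hj]
  have h3 : δ 1 = 1 ⊗ₜ 1 := map_one δ
  rw [ht, affineMap_apply, map_add, map_add, map_add, h1, h2, YDModule.coact_coassoc]
  simp only [TensorProduct.map_tmul, AlgHom.toLinearMap_apply, h3, LinearMap.id_apply, hs,
    affineMap_apply, TensorProduct.tmul_add, TensorProduct.assoc_tmul]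
  abel

lemma map_counit_coact_incl
    (hi : ∀ h, δ (i h) = TensorProduct.map i.toLinearMap j.toLinearMap (D.δ h))
    (hεj : ∀ a, ε (j a) = counit a) (h : H) :
    TensorProduct.map LinearMap.id ε.toLinearMap (δ (i h)) = i h ⊗ₜ 1 := by
  have h1 : ∀ u : H ⊗[ℂ] A, TensorProduct.map LinearMap.id ε.toLinearMap
      (TensorProduct.map i.toLinearMap j.toLinearMap u) =
      LinearMap.rTensor ℂ i.toLinearMap (LinearMap.lTensor H counit u) := by
    intro u
    induction u with
    | zero => simp
    | add u v hu hv => simp only [map_add, hu, hv]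
    | tmul x y => simp [hεj]
  rw [hi, h1, D.counit]
  simp

lemma map_counit_coact_trans (ht : ∀ θ, δ (t θ) = affineMap j t s θ)
    (hεj : ∀ a, ε (j a) = counit a) (hεs : ∀ θ, ε (s θ) = 0)
    (θ : V) : TensorProduct.map LinearMap.id ε.toLinearMap (δ (t θ)) = t θ ⊗ₜ 1 := by
  have h1 : ∀ u : V ⊗[ℂ] A, TensorProduct.map LinearMap.id ε.toLinearMap
      (TensorProduct.map t j.toLinearMap u) =
      LinearMap.rTensor ℂ t (LinearMap.lTensor V counit u) := by
    intro u
    induction u with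
    | zero => simp
    | add u v hu hv => simp only [map_add, hu, hv]
    | tmul x y => simp [hεj]
  rw [ht, affineMap_apply, map_add, h1, YDModule.coact_counit]
  simp [hεs]

end GeneratedCoaction

section Generated

variable {A V B : Type*} [Ring A] [HopfAlgebra ℂ A] [AddCommGroup V] [Module ℂ V] [YDModule A V]
  [Ring B] [Algebra ℂ B] (i : A →ₐ[ℂ] B) (t : V →ₗ[ℂ] B) (Δ : B →ₐ[ℂ] B ⊗[ℂ] B) (ε : B →ₐ[ℂ] ℂ)

lemma counit_map_comul_incl
    (hi : ∀ a, Δ (i a) = TensorProduct.map i.toLinearMap i.toLinearMap (comul a))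
    (hεi : ∀ a, ε (i a) = counit a) (a : A) :
    TensorProduct.map ε.toLinearMap LinearMap.id (Δ (i a)) = 1 ⊗ₜ i a := by
  have h1 : ∀ u : A ⊗[ℂ] A, TensorProduct.map ε.toLinearMap LinearMap.id
      (TensorProduct.map i.toLinearMap i.toLinearMap u) =
      LinearMap.lTensor ℂ i.toLinearMap (LinearMap.rTensor A counit u) := by
    intro u
    induction u with
    | zero => simp
    | add u v hu hv => simp only [map_add, hu, hv]
    | tmul x y => simp [hεi]
  rw [hi, h1, Coalgebra.rTensor_counit_comul]
  simp

lemma counit_map_comul_trans (ht : ∀ θ, Δ (t θ) = affineMap i t t θ) (hεt : ∀ θ, ε (t θ) = 0)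
    (θ : V) : TensorProduct.map ε.toLinearMap LinearMap.id (Δ (t θ)) = 1 ⊗ₜ t θ := by
  have h1 : ∀ u : V ⊗[ℂ] A, TensorProduct.map ε.toLinearMap LinearMap.id
      (TensorProduct.map t i.toLinearMap u) = 0 := by
    intro u
    induction u with
    | zero => simp
    | add u v hu hv => simp only [map_add, hu, hv, add_zero]
    | tmul x y => simp [hεt]
  rw [ht, affineMap_apply, map_add, h1]
  simp

/-- The bialgebra structure on an algebra generated by `A` and `V`, on which the coproduct and
counit have the values prescribed for the affine extension. -/
abbrev bialgebraOfGenerated (hgen : Algebra.adjoin ℂ (Set.range i ∪ Set.range t) = ⊤)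
    (hi : ∀ a, Δ (i a) = TensorProduct.map i.toLinearMap i.toLinearMap (comul a))
    (ht : ∀ θ, Δ (t θ) = affineMap i t t θ)
    (hεi : ∀ a, ε (i a) = counit a) (hεt : ∀ θ, ε (t θ) = 0) : Bialgebra ℂ B :=
  .ofAlgHom Δ ε
    (AlgHom.ext_of_adjoin_eq_top hgen (by
      rintro _ (⟨a, rfl⟩ | ⟨θ, rfl⟩)
      · exact assoc_coact_incl (ComodAlg.self A) i i Δ Δ hi hi a
      · exact assoc_coact_trans i t t Δ Δ hi ht ht θ))
    (AlgHom.ext_of_adjoin_eq_top hgen (by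
      rintro _ (⟨a, rfl⟩ | ⟨θ, rfl⟩)
      · exact counit_map_comul_incl i Δ ε hi hεi a
      · exact counit_map_comul_trans i t Δ ε ht hεt θ))
    (AlgHom.ext_of_adjoin_eq_top hgen (by
      rintro _ (⟨a, rfl⟩ | ⟨θ, rfl⟩)
      · exact map_counit_coact_incl (ComodAlg.self A) i i Δ ε hi hεi a
      · exact map_counit_coact_trans i t t Δ ε ht hεi hεt θ))

end Generated

/-! ### The affine extension by the tensor algebra -/

section Free

variable (A V : Type*) [Ring A] [HopfAlgebra ℂ A] [AddCommGroup V] [Module ℂ V] [YDModule A V]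

/-- The smash product `A # V^⊗`. -/
abbrev Free : Type _ := Smash (ComodAlg.self A) (tensorModAlg A V)

namespace Free

/-- The inclusion of `A`. -/
def incl : A →ₐ[ℂ] Free A V := Smash.inl _ _

/-- The inclusion of `V`. -/
def trans : V →ₗ[ℂ] Free A V := (Smash.inr _ _).toLinearMap ∘ₗ TensorAlgebra.ι ℂ

lemma inr_eq_lift : Smash.inr (ComodAlg.self A) (tensorModAlg A V) =
    TensorAlgebra.lift ℂ (trans A V) := by
  ext; simp [trans]

variable {A V} in
lemma trans_mul_incl (θ : V) (a : A) : trans A V θ * incl A V a =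
    conv (Comod.self A) (incl A V).toLinearMap (trans A V ∘ₗ YDModule.act θ) a := by
  rw [trans, LinearMap.comp_apply, AlgHom.toLinearMap_apply, incl, Smash.inr_mul_inl]
  simp only [tensorModAlg, tensorAct_ι]
  rfl

variable {A V} in
@[elab_as_elim]
lemma induction {P : Free A V → Prop} (hincl : ∀ a, P (incl A V a)) (htrans : ∀ θ, P (trans A V θ))
    (add : ∀ x y, P x → P y → P (x + y)) (mul : ∀ x y, P x → P y → P (x * y)) (x : Free A V) :
    P x := by
  induction x using Smash.induction with
  | hinl h => exact hincl h
  | hinr b =>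
    induction b using TensorAlgebra.induction with
    | algebraMap c => rw [AlgHom.commutes, ← AlgHom.commutes (incl A V)]; exact hincl _
    | ι θ => exact htrans θ
    | mul a b ha hb => rw [map_mul]; exact mul _ _ ha hb
    | add a b ha hb => rw [map_add]; exact add _ _ ha hb
  | add x y hx hy => exact add _ _ hx hy
  | mul x y hx hy => exact mul _ _ hx hy

variable {A V} {X : Type*} [Ring X] [Algebra ℂ X]

lemma hom_ext {f g : Free A V →ₐ[ℂ] X} (h₁ : ∀ a, f (incl A V a) = g (incl A V a))
    (h₂ : ∀ θ, f (trans A V θ) = g (trans A V θ)) : f = g := by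
  ext x
  induction x using Free.induction with
  | hincl a => exact h₁ a
  | htrans θ => exact h₂ θ
  | add x y hx hy => simp [hx, hy]
  | mul x y hx hy => simp [hx, hy]

section lift

variable (f : A →ₐ[ℂ] X) (t : V →ₗ[ℂ] X)
  (h : ∀ θ a, t θ * f a = conv (Comod.self A) f.toLinearMap (t ∘ₗ YDModule.act θ) a)

/-- The universal property of `A # V^⊗`. -/
def lift : Free A V →ₐ[ℂ] X := liftTensor (ComodAlg.self A) f t h

@[simp] lemma lift_incl (a : A) : lift f t h (incl A V a) = f a :=
  Smash.lift_inl _ _ f _ (tensor_rule _ f t h) a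

@[simp] lemma lift_trans (θ : V) : lift f t h (trans A V θ) = t θ := by
  rw [trans, LinearMap.comp_apply]
  exact (Smash.lift_inr _ _ f _ (tensor_rule _ f t h) _).trans (TensorAlgebra.lift_ι_apply _ _)

@[simp] lemma lift_inr (x : TensorAlgebra ℂ V) :
    lift f t h (Smash.inr _ _ x) = TensorAlgebra.lift ℂ t x :=
  Smash.lift_inr _ _ f _ (tensor_rule _ f t h) x

end lift

variable (A V)

/-- The coproduct of `A # V^⊗`. -/
def comulHom : Free A V →ₐ[ℂ] Free A V ⊗[ℂ] Free A V :=
  lift (coactMap (ComodAlg.self A) (incl A V) (incl A V))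
    (affineMap (incl A V) (trans A V) (trans A V))
    (affineMap_rule_self _ _ _ _ trans_mul_incl trans_mul_incl)

/-- The counit of `A # V^⊗`. -/
def counitHom : Free A V →ₐ[ℂ] ℂ :=
  lift (Bialgebra.counitAlgHom ℂ A) 0 (by intro θ a; simp [conv_zero_right])

variable {A V}

lemma comulHom_incl (a : A) : comulHom A V (incl A V a) =
    TensorProduct.map (incl A V).toLinearMap (incl A V).toLinearMap (comul a) := by
  rw [comulHom, lift_incl]; rfl

lemma comulHom_trans (θ : V) : comulHom A V (trans A V θ) =
    1 ⊗ₜ trans A V θ + TensorProduct.map (trans A V) (incl A V).toLinearMap (YDModule.coact θ) := by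
  rw [comulHom, lift_trans]; rfl

lemma counitHom_incl (a : A) : counitHom A V (incl A V a) = counit a := by simp [counitHom]

lemma counitHom_trans (θ : V) : counitHom A V (trans A V θ) = 0 := by simp [counitHom]

lemma adjoin_eq_top :
    Algebra.adjoin ℂ (Set.range (incl A V) ∪ Set.range (trans A V)) = ⊤ := by
  rw [eq_top_iff]
  rintro x -
  induction x using Free.induction with
  | hincl a => exact Algebra.subset_adjoin (Or.inl ⟨a, rfl⟩)
  | htrans θ => exact Algebra.subset_adjoin (Or.inr ⟨θ, rfl⟩)
  | add x y hx hy => exact add_mem hx hy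
  | mul x y hx hy => exact mul_mem hx hy

instance : Bialgebra ℂ (Free A V) := bialgebraOfGenerated (incl A V) (trans A V) (comulHom A V)
  (counitHom A V) adjoin_eq_top comulHom_incl comulHom_trans counitHom_incl counitHom_trans

lemma comul_incl (a : A) : comul (R := ℂ) (incl A V a) =
    TensorProduct.map (incl A V).toLinearMap (incl A V).toLinearMap (comul a) := comulHom_incl a

lemma comul_trans (θ : V) : comul (R := ℂ) (trans A V θ) =
    1 ⊗ₜ trans A V θ + TensorProduct.map (trans A V) (incl A V).toLinearMap (YDModule.coact θ) :=
  comulHom_trans θ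

lemma counit_incl (a : A) : counit (R := ℂ) (incl A V a) = counit (R := ℂ) a := counitHom_incl a

lemma counit_trans (θ : V) : counit (R := ℂ) (trans A V θ) = 0 := counitHom_trans θ

end Free

end Free

/-! ### Antipodes of algebras generated by `A` and `V` -/

section GeneratedHopf

variable {A V B : Type*} [Ring A] [HopfAlgebra ℂ A] [AddCommGroup V] [Module ℂ V] [YDModule A V]

/-- For an antimultiplicative map, the identity `S(b⁽¹⁾) b⁽²⁾ = ε(b)` is preserved by products. -/
lemma antipode_of_antimul {B : Type*} [Ring B] [Bialgebra ℂ B] (S : B →ₗ[ℂ] B)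
    (hS : ∀ x y, S (x * y) = S y * S x) (x y : B)
    (hx : prodMap S LinearMap.id (comul x) = algebraMap ℂ B (counit x))
    (hy : prodMap S LinearMap.id (comul y) = algebraMap ℂ B (counit y)) :
    prodMap S LinearMap.id (comul (x * y)) = algebraMap ℂ B (counit (x * y)) := by
  have h : ∀ u w : B ⊗[ℂ] B, prodMap S LinearMap.id (u * w) =
      prodMap S (LinearMap.mulLeft ℂ (prodMap S LinearMap.id u)) w := by
    intro u w
    induction w with
    | zero => simp
    | add w w' hw hw' => simp only [mul_add, map_add, hw, hw']
    | tmul b b' =>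
      induction u with
      | zero => simp
      | add w w' hw hw' =>
        simp only [prodMap_tmul, LinearMap.mulLeft_apply] at hw hw' ⊢
        simp only [add_mul, mul_add, map_add, hw, hw']
      | tmul c c' => simp [hS, mul_assoc]
  rw [Bialgebra.comul_mul, h, hx]
  have : LinearMap.mulLeft ℂ (algebraMap ℂ B (counit x)) = counit (R := ℂ) x • LinearMap.id := by
    ext; simp [Algebra.smul_def]
  rw [this, prodMap_smul_right, LinearMap.smul_apply, hy, Bialgebra.counit_mul, map_mul,
    Algebra.smul_def]

lemma antipode_of_antimul' {B : Type*} [Ring B] [Bialgebra ℂ B] (S : B →ₗ[ℂ] B)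
    (hS : ∀ x y, S (x * y) = S y * S x) (x y : B)
    (hx : prodMap LinearMap.id S (comul x) = algebraMap ℂ B (counit x))
    (hy : prodMap LinearMap.id S (comul y) = algebraMap ℂ B (counit y)) :
    prodMap LinearMap.id S (comul (x * y)) = algebraMap ℂ B (counit (x * y)) := by
  have h : ∀ u w : B ⊗[ℂ] B, prodMap LinearMap.id S (u * w) =
      prodMap (LinearMap.mulRight ℂ (prodMap LinearMap.id S w)) S u := by
    intro u w
    induction u with
    | zero => simp
    | add w w' hw hw' => simp only [add_mul, map_add, hw, hw']
    | tmul b b' =>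
      induction w with
      | zero => simp
      | add w w' hw hw' =>
        simp only [prodMap_tmul, LinearMap.mulRight_apply] at hw hw' ⊢
        simp only [add_mul, mul_add, map_add, hw, hw']
      | tmul c c' => simp [hS, mul_assoc]
  rw [Bialgebra.comul_mul, h, hy]
  have : LinearMap.mulRight ℂ (algebraMap ℂ B (counit y)) = counit (R := ℂ) y • LinearMap.id := by
    ext z; simp [Algebra.smul_def, Algebra.commutes]
  rw [this, prodMap_smul_left, LinearMap.smul_apply, hx, Bialgebra.counit_mul, mul_comm, map_mul,
    Algebra.smul_def]

/-- The cross-product rule for the antipode, the products being in the opposite order. -/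
lemma antipode_rule {X : Type*} [Ring X] [Algebra ℂ X] (i : A →ₐ[ℂ] X) (t : V →ₗ[ℂ] X)
    (h : ∀ m a, t m * i a = conv (Comod.self A) i.toLinearMap (t ∘ₗ YDModule.act m) a)
    (θ : V) (a : A) :
    prodMap (conv (YDModule.comod A V) t (i.toLinearMap ∘ₗ antipode ℂ) ∘ₗ YDModule.act θ)
      (i.toLinearMap ∘ₗ antipode ℂ) (TensorProduct.comm ℂ A A (comul a)) =
      i (antipode ℂ a) * conv (YDModule.comod A V) t (i.toLinearMap ∘ₗ antipode ℂ) θ := by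
  have h1 : ∀ w : A ⊗[ℂ] A,
      prodMap (conv (YDModule.comod A V) t (i.toLinearMap ∘ₗ antipode ℂ) ∘ₗ YDModule.act θ)
      (i.toLinearMap ∘ₗ antipode ℂ) (TensorProduct.comm ℂ A A w) =
      prodMap t (i.toLinearMap ∘ₗ antipode ℂ) (TensorProduct.lift (ydLeft θ) w) := by
    intro w
    induction w with
    | zero => simp
    | add u v hu hv => simp only [map_add, hu, hv]
    | tmul a b =>
      simp only [TensorProduct.comm_tmul, prodMap_tmul, LinearMap.comp_apply, conv_apply,
        TensorProduct.lift.tmul, ydLeft_apply, YDModule.comod_δ]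
      induction YDModule.coact (A := A) (YDModule.act θ b) with
      | zero => simp
      | add u v hu hv => simp only [map_add, add_mul, hu, hv]
      | tmul m c => simp [antipode_mul_antidistrib, mul_assoc]
  rw [h1, yetterDrinfeld, conv_apply, YDModule.comod_δ]
  induction YDModule.coact (A := A) θ with
  | zero => simp
  | add u v hu hv => simp only [map_add, LinearMap.add_apply, mul_add, hu, hv]
  | tmul m c =>
    have h2 := conv_antipode_of_rule i (t m) _ (h m) a
    rw [prodMap_tmul, ← mul_assoc, ← h2, conv_apply, Comod.self_δ]
    induction comul (R := ℂ) a with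
    | zero => simp
    | add u v hu hv => simp only [map_add, add_mul, hu, hv]
    | tmul x y => simp [antipode_mul_antidistrib, mul_assoc]

/-- The antipode on generators, with values in the opposite algebra. -/
def antipodeGen {X : Type*} [Ring X] [Algebra ℂ X] (i : A →ₐ[ℂ] X) (t : V →ₗ[ℂ] X) :
    V →ₗ[ℂ] Xᵐᵒᵖ :=
  -((MulOpposite.opLinearEquiv ℂ).toLinearMap ∘ₗ
    conv (YDModule.comod A V) t (i.toLinearMap ∘ₗ antipode ℂ))

/-- The antipode on `A`, with values in the opposite of an algebra containing `A`. -/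
def antipodeOp {X : Type*} [Ring X] [Algebra ℂ X] (i : A →ₐ[ℂ] X) : A →ₐ[ℂ] Xᵐᵒᵖ :=
  (AlgHom.op i).comp (antipodeAlgHomOp ℂ A)

lemma antipodeGen_rule {X : Type*} [Ring X] [Algebra ℂ X] (i : A →ₐ[ℂ] X) (t : V →ₗ[ℂ] X)
    (h : ∀ m a, t m * i a = conv (Comod.self A) i.toLinearMap (t ∘ₗ YDModule.act m) a)
    (θ : V) (a : A) : antipodeGen i t θ * antipodeOp i a =
      conv (Comod.self A) (antipodeOp i).toLinearMap (antipodeGen i t ∘ₗ YDModule.act θ) a := by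
  apply MulOpposite.unop_injective
  have h1 := antipode_rule i t h θ a
  have h2 : ∀ w : A ⊗[ℂ] A, MulOpposite.unop (prodMap (antipodeOp i).toLinearMap
      (antipodeGen i t ∘ₗ YDModule.act θ) w) =
      -prodMap (conv (YDModule.comod A V) t (i.toLinearMap ∘ₗ antipode ℂ) ∘ₗ YDModule.act θ)
      (i.toLinearMap ∘ₗ antipode ℂ) (TensorProduct.comm ℂ A A w) := by
    intro w
    induction w with
    | zero => simp
    | add u v hu hv => simp only [map_add, MulOpposite.unop_add, hu, hv, neg_add]
    | tmul x y => simp [antipodeOp, antipodeGen]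
  rw [conv_apply, h2, Comod.self_δ, h1]
  simp [antipodeOp, antipodeGen]

variable [Ring B] [Bialgebra ℂ B] (i : A →ₐ[ℂ] B) (t : V →ₗ[ℂ] B)

/-- The Hopf algebra structure on a bialgebra generated by `A` and `V`. -/
abbrev hopfOfGenerated (hgen : Algebra.adjoin ℂ (Set.range i ∪ Set.range t) = ⊤)
    (hi : ∀ a, comul (R := ℂ) (i a) = TensorProduct.map i.toLinearMap i.toLinearMap (comul a))
    (ht : ∀ θ, comul (R := ℂ) (t θ) = affineMap i t t θ)
    (hεi : ∀ a, counit (R := ℂ) (i a) = counit (R := ℂ) a) (hεt : ∀ θ, counit (R := ℂ) (t θ) = 0)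
    (S : B →ₐ[ℂ] Bᵐᵒᵖ) (hSi : ∀ a, S (i a) = antipodeOp i a)
    (hSt : ∀ θ, S (t θ) = antipodeGen i t θ) : HopfAlgebra ℂ B :=
  let S' : B →ₗ[ℂ] B := (MulOpposite.opLinearEquiv ℂ).symm.toLinearMap ∘ₗ S.toLinearMap
  have hS : ∀ x y, S' (x * y) = S' y * S' x := by intro x y; simp [S']
  have hS1 : S' ∘ₗ i.toLinearMap = i.toLinearMap ∘ₗ antipode ℂ := by
    ext a; simp [S', hSi, antipodeOp]
  have hS2 : S' ∘ₗ t = -conv (YDModule.comod A V) t (i.toLinearMap ∘ₗ antipode ℂ) := by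
    ext a; simp [S', hSt, antipodeGen]
  have hS3 : S' 1 = 1 := by simp [S']
  have h1 : ∀ x, prodMap S' LinearMap.id (comul x) = algebraMap ℂ B (counit x) := by
    intro x
    have hx : x ∈ Algebra.adjoin ℂ (Set.range i ∪ Set.range t) := hgen ▸ Algebra.mem_top
    induction hx using Algebra.adjoin_induction with
    | mem x hx =>
      rcases hx with ⟨a, rfl⟩ | ⟨θ, rfl⟩
      · rw [hi, prodMap_map, hS1, LinearMap.id_comp, hεi]
        exact LinearMap.congr_fun (antipode_conv i) a
      · have h3 := LinearMap.congr_fun (conv_assoc (YDModule.comod A V) t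
          (i.toLinearMap ∘ₗ antipode ℂ) i.toLinearMap) θ
        rw [antipode_conv, conv_convUnit, conv_apply, YDModule.comod_δ] at h3
        rw [ht, affineMap_apply, map_add, prodMap_map, hS2, LinearMap.id_comp, prodMap_neg_left,
          LinearMap.neg_apply, h3, hεt]
        simp [hS3]
    | algebraMap c => simp [Algebra.algebraMap_eq_smul_one, hS3, Algebra.TensorProduct.one_def]
    | add x y _ _ hx hy => simp only [map_add, hx, hy]
    | mul x y _ _ hx hy => exact antipode_of_antimul S' hS x y hx hy
  have h2 : ∀ x, prodMap LinearMap.id S' (comul x) = algebraMap ℂ B (counit x) := by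
    intro x
    have hx : x ∈ Algebra.adjoin ℂ (Set.range i ∪ Set.range t) := hgen ▸ Algebra.mem_top
    induction hx using Algebra.adjoin_induction with
    | mem x hx =>
      rcases hx with ⟨a, rfl⟩ | ⟨θ, rfl⟩
      · rw [hi, prodMap_map, hS1, LinearMap.id_comp, hεi]
        exact LinearMap.congr_fun (conv_antipode i) a
      · rw [ht, affineMap_apply, map_add, prodMap_map, hS1, LinearMap.id_comp, hεt, prodMap_tmul,
          ← LinearMap.comp_apply S', hS2]
        simp [conv_apply]
    | algebraMap c => simp [Algebra.algebraMap_eq_smul_one, hS3, Algebra.TensorProduct.one_def]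
    | add x y _ _ hx hy => simp only [map_add, hx, hy]
    | mul x y _ _ hx hy => exact antipode_of_antimul' S' hS x y hx hy
  { antipode := S'
    mul_antipode_rTensor_comul := by
      ext x
      rw [LinearMap.comp_apply, LinearMap.comp_apply]
      exact (prodMap_rTensor LinearMap.id LinearMap.id S' (comul x)).trans (h1 x)
    mul_antipode_lTensor_comul := by
      ext x
      rw [LinearMap.comp_apply, LinearMap.comp_apply]
      exact (prodMap_lTensor LinearMap.id LinearMap.id S' (comul x)).trans (h2 x) }

end GeneratedHopf

section AntipodeValues

variable {A V B : Type*} [Ring A] [HopfAlgebra ℂ A] [AddCommGroup V] [Module ℂ V] [YDModule A V]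
  [Ring B] [HopfAlgebra ℂ B] (i : A →ₐ[ℂ] B) (t : V →ₗ[ℂ] B)

/-- A bialgebra homomorphism between Hopf algebras commutes with the antipodes. -/
lemma antipode_comp_bialgHom
    (hi : ∀ a, comul (R := ℂ) (i a) = TensorProduct.map i.toLinearMap i.toLinearMap (comul a))
    (hεi : ∀ a, counit (R := ℂ) (i a) = counit (R := ℂ) a) :
    antipode ℂ ∘ₗ i.toLinearMap = i.toLinearMap ∘ₗ antipode ℂ := by
  have h1 : conv (Comod.self A) (antipode ℂ ∘ₗ i.toLinearMap) i.toLinearMap = convUnit A B := by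
    have := congrArg (fun f => f ∘ₗ i.toLinearMap) (antipode_conv (AlgHom.id ℂ B))
    rw [conv_comp (Comod.self B) (Comod.self A) i.toLinearMap i.toLinearMap hi] at this
    refine Eq.trans ?_ (this.trans ?_)
    · rfl
    · ext a; simp [hεi]
  rw [← conv_convUnit (Comod.self A) (antipode ℂ ∘ₗ i.toLinearMap), ← conv_antipode i,
    ← conv_assoc, h1, convUnit_conv]

lemma antipode_comp_trans
    (ht : ∀ θ, comul (R := ℂ) (t θ) = affineMap i t t θ) (hεt : ∀ θ, counit (R := ℂ) (t θ) = 0) :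
    antipode ℂ ∘ₗ t = -conv (YDModule.comod A V) t (i.toLinearMap ∘ₗ antipode ℂ) := by
  have h1 : conv (YDModule.comod A V) (antipode ℂ ∘ₗ t) i.toLinearMap = -t := by
    ext θ
    have := LinearMap.congr_fun (antipode_conv (AlgHom.id ℂ B)) (t θ)
    rw [conv_apply, Comod.self_δ, ht, affineMap_apply, map_add, prodMap_map, convUnit_apply,
      hεt, map_zero, prodMap_tmul] at this
    simp only [AlgHom.toLinearMap_id, LinearMap.id_comp, antipode_one, one_mul,
      LinearMap.id_apply] at this
    rw [LinearMap.neg_apply, eq_neg_iff_add_eq_zero, add_comm]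
    exact this
  have h2 := congrArg (fun f => conv (YDModule.comod A V) f (i.toLinearMap ∘ₗ antipode ℂ)) h1
  simp only [conv_assoc, conv_antipode, conv_convUnit, conv_neg_left] at h2
  exact h2

end AntipodeValues

section GeneratedStar

variable {A V B : Type*} [Ring A] [HopfAlgebra ℂ A] [StarRing A] [HopfStarAlgebra A]
  [AddCommGroup V] [Module ℂ V] [StarAddMonoid V] [StarModule ℂ V] [YDModule A V]
  [YDStarModule A V]

lemma map_star {M N X Y : Type*} [AddCommGroup M] [Module ℂ M] [StarAddMonoid M] [StarModule ℂ M]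
    [AddCommGroup N] [Module ℂ N] [StarAddMonoid N] [StarModule ℂ N]
    [AddCommGroup X] [Module ℂ X] [StarAddMonoid X] [StarModule ℂ X]
    [AddCommGroup Y] [Module ℂ Y] [StarAddMonoid Y] [StarModule ℂ Y]
    (f : M →ₗ[ℂ] X) (g : N →ₗ[ℂ] Y) (hf : ∀ m, f (star m) = star (f m))
    (hg : ∀ m, g (star m) = star (g m)) (u : M ⊗[ℂ] N) :
    TensorProduct.map f g (star u) = star (TensorProduct.map f g u) := by
  induction u with
  | zero => simp
  | add u v hu hv => simp only [map_add, star_add, hu, hv]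
  | tmul m n => simp [hf, hg]

lemma affineMap_star {X Y : Type*} [Ring X] [Algebra ℂ X] [StarRing X] [StarModule ℂ X]
    [Ring Y] [Algebra ℂ Y] [StarRing Y] [StarModule ℂ Y] (j : A →ₐ[ℂ] Y)
    (t : V →ₗ[ℂ] X) (s : V →ₗ[ℂ] Y) (hj : ∀ a, j (star a) = star (j a))
    (ht : ∀ θ, t (star θ) = star (t θ)) (hs : ∀ θ, s (star θ) = star (s θ)) (θ : V) :
    affineMap j t s (star θ) = star (affineMap j t s θ) := by
  rw [affineMap_apply, affineMap_apply, YDStarModule.coact_star, map_star t j.toLinearMap ht hj]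
  simp [hs]

variable [Ring B] [HopfAlgebra ℂ B] [StarRing B] [StarModule ℂ B] (i : A →ₐ[ℂ] B) (t : V →ₗ[ℂ] B)

lemma hopfStarOfGenerated (hgen : Algebra.adjoin ℂ (Set.range i ∪ Set.range t) = ⊤)
    (hi : ∀ a, comul (R := ℂ) (i a) = TensorProduct.map i.toLinearMap i.toLinearMap (comul a))
    (ht : ∀ θ, comul (R := ℂ) (t θ) = affineMap i t t θ)
    (hsi : ∀ a, i (star a) = star (i a)) (hst : ∀ θ, t (star θ) = star (t θ)) :
    HopfStarAlgebra B where
  comul_star x := by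
    have hx : x ∈ Algebra.adjoin ℂ (Set.range i ∪ Set.range t) := hgen ▸ Algebra.mem_top
    induction hx using Algebra.adjoin_induction with
    | mem x hx =>
      rcases hx with ⟨a, rfl⟩ | ⟨θ, rfl⟩
      · rw [← hsi, hi, hi, HopfStarAlgebra.comul_star]
        exact map_star _ _ hsi hsi _
      · rw [← hst, ht, ht, affineMap_star i t t hsi hst hst]
    | algebraMap c => simp [Algebra.algebraMap_eq_smul_one]
    | add x y _ _ hx hy => simp only [map_add, star_add, hx, hy]
    | mul x y _ _ hx hy => simp only [star_mul, Bialgebra.comul_mul, hx, hy]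

end GeneratedStar

/-! ### The involution of the tensor algebra -/

section TensorStar

/-- The opposite of an algebra, with the complex conjugate scalar multiplication. -/
def ConjOp (X : Type*) : Type _ := Xᵐᵒᵖ

instance (X : Type*) [Ring X] : Ring (ConjOp X) := inferInstanceAs (Ring Xᵐᵒᵖ)

instance (X : Type*) [Ring X] [Algebra ℂ X] : Algebra ℂ (ConjOp X) :=
  Algebra.compHom Xᵐᵒᵖ (starRingEnd ℂ)

variable {V : Type*} [AddCommGroup V] [Module ℂ V] [StarAddMonoid V] [StarModule ℂ V]

/-- The antimultiplicative and antilinear extension of the involution of `V`. -/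
def tensorStar : TensorAlgebra ℂ V →ₐ[ℂ] ConjOp (TensorAlgebra ℂ V) :=
  TensorAlgebra.lift ℂ
    { toFun := fun θ => MulOpposite.op (TensorAlgebra.ι ℂ (star θ))
      map_add' := fun θ η => by rw [star_add, map_add]; rfl
      map_smul' := fun c θ => by rw [star_smul, map_smul]; rfl }

instance : Star (TensorAlgebra ℂ V) := ⟨fun x => MulOpposite.unop (tensorStar x)⟩

lemma tensor_star_ι (θ : V) : star (TensorAlgebra.ι ℂ θ) = TensorAlgebra.ι ℂ (star θ) := by
  change MulOpposite.unop (tensorStar _) = _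
  rw [tensorStar, TensorAlgebra.lift_ι_apply]
  rfl

lemma tensor_star_mul (x y : TensorAlgebra ℂ V) : star (x * y) = star y * star x := by
  change MulOpposite.unop (tensorStar _) = _
  rw [map_mul]; rfl

lemma tensor_star_add (x y : TensorAlgebra ℂ V) : star (x + y) = star x + star y := by
  change MulOpposite.unop (tensorStar _) = _
  rw [map_add]; rfl

lemma tensor_star_smul (c : ℂ) (x : TensorAlgebra ℂ V) : star (c • x) = star c • star x := by
  change MulOpposite.unop (tensorStar _) = _
  rw [map_smul]; rfl

lemma tensor_star_one : star (1 : TensorAlgebra ℂ V) = 1 := by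
  change MulOpposite.unop (tensorStar _) = _
  rw [map_one]; rfl

instance : StarRing (TensorAlgebra ℂ V) where
  star_involutive x := by
    induction x using tensor_induction with
    | one => simp only [tensor_star_one]
    | cons θ x hx =>
      rw [tensor_star_mul, tensor_star_mul, hx, tensor_star_ι, tensor_star_ι, star_star]
    | add x y hx hy => rw [tensor_star_add, tensor_star_add, hx, hy]
    | smul c x hx => rw [tensor_star_smul, tensor_star_smul, hx, star_star]
  star_add := tensor_star_add
  star_mul := tensor_star_mul

instance : StarModule ℂ (TensorAlgebra ℂ V) := ⟨tensor_star_smul⟩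

variable {A : Type*} [Ring A] [HopfAlgebra ℂ A] [StarRing A] [HopfStarAlgebra A] [YDModule A V]
  [YDStarModule A V]

lemma tensor_star_act (x : TensorAlgebra ℂ V) (a : A) : star (tensorAct A V x a) =
    tensorAct A V (star x) (star (antipode ℂ a)) := by
  induction x using tensor_induction generalizing a with
  | one => simp [tensorAct_one, Algebra.algebraMap_eq_smul_one, counit_star]
  | cons θ x hx =>
    have h := (tensorModAlg A V).mul_act (star x) (star (TensorAlgebra.ι ℂ θ))
    rw [star_mul, tensorAct_cons, star_conv (tensorAct A V (star (TensorAlgebra.ι ℂ θ)))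
      (tensorAct A V (star x))]
    · exact (LinearMap.congr_fun h _).symm
    · intro a
      rw [tensor_star_ι, tensorAct_ι]
      change star (TensorAlgebra.ι ℂ (YDModule.act θ a)) = _
      rw [tensor_star_ι, YDStarModule.star_act]
      rfl
    · exact hx
  | add x y hx hy => simp [hx, hy]
  | smul c x hx => simp [hx]

instance : StarCompatible (ComodAlg.self A) (tensorModAlg A V) where
  δ_star := HopfStarAlgebra.comul_star
  star_act := tensor_star_act

end TensorStar

namespace Free

section

variable {A V : Type*} [Ring A] [HopfAlgebra ℂ A] [AddCommGroup V] [Module ℂ V] [YDModule A V]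

instance : HopfAlgebra ℂ (Free A V) := hopfOfGenerated (incl A V) (trans A V) adjoin_eq_top
  comul_incl comul_trans counit_incl counit_trans
  (lift (antipodeOp (incl A V)) (antipodeGen (incl A V) (trans A V))
    (antipodeGen_rule _ _ trans_mul_incl))
  (fun a => by rw [lift_incl]) (fun θ => by rw [lift_trans])

end

variable {A V : Type*} [Ring A] [HopfAlgebra ℂ A] [StarRing A] [HopfStarAlgebra A]
  [AddCommGroup V] [Module ℂ V] [StarAddMonoid V] [StarModule ℂ V] [YDModule A V]
  [YDStarModule A V]

omit [YDStarModule A V] in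
lemma star_incl (a : A) : star (incl A V a) = incl A V (star a) := Smash.star_inl _ _ a

omit [YDStarModule A V] in
lemma star_trans (θ : V) : star (trans A V θ) = trans A V (star θ) := by
  rw [trans, LinearMap.comp_apply, AlgHom.toLinearMap_apply, Smash.star_inr, tensor_star_ι]
  rfl

instance : HopfStarAlgebra (Free A V) := hopfStarOfGenerated (incl A V) (trans A V) adjoin_eq_top
  comul_incl comul_trans (fun a => (star_incl a).symm) (fun θ => (star_trans θ).symm)

end Free

/-! ### The braided symmetrizer and the deconcatenation coproduct -/

section Insertion

variable {A V : Type*} [Ring A] [HopfAlgebra ℂ A] [AddCommGroup V] [Module ℂ V] [YDModule A V]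

lemma conv_coact_right {X Y : Type*} [Ring X] [Algebra ℂ X] [Ring Y] [Algebra ℂ Y]
    (t : V →ₗ[ℂ] X) (j : A →ₐ[ℂ] Y) : TensorProduct.map t j.toLinearMap ∘ₗ YDModule.coact =
      conv (YDModule.comod A V)
        ((Algebra.TensorProduct.includeLeft : X →ₐ[ℂ] X ⊗[ℂ] Y).toLinearMap ∘ₗ t)
        (((Algebra.TensorProduct.includeRight : Y →ₐ[ℂ] X ⊗[ℂ] Y).comp j).toLinearMap) := by
  ext θ
  simp only [LinearMap.comp_apply, conv_apply, YDModule.comod_δ]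
  induction YDModule.coact (A := A) θ with
  | zero => simp
  | add u v hu hv => simp only [map_add, hu, hv]
  | tmul x y => simp

/-- The Yetter–Drinfeld condition in an algebra containing images of `V` and `A`. -/
lemma conv_coact_act {X Y : Type*} [Ring X] [Algebra ℂ X] [Ring Y] [Algebra ℂ Y]
    (t : V →ₗ[ℂ] X) (j : A →ₐ[ℂ] Y) (θ : V) : conv (Comod.self A)
      (((Algebra.TensorProduct.includeRight : Y →ₐ[ℂ] X ⊗[ℂ] Y).comp j).toLinearMap)
      ((TensorProduct.map t j.toLinearMap ∘ₗ YDModule.coact) ∘ₗ YDModule.act θ) =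
      TensorProduct.map t j.toLinearMap ∘ₗ
      TensorProduct.map₂ YDModule.act (LinearMap.mul ℂ A) (YDModule.coact θ) ∘ₗ comul := by
  ext a
  rw [conv_apply, Comod.self_δ, LinearMap.comp_apply, LinearMap.comp_apply, ← yetterDrinfeld]
  induction comul (R := ℂ) a with
  | zero => simp
  | add u v hu hv => simp only [map_add, hu, hv]
  | tmul a b =>
    simp only [prodMap_tmul, LinearMap.comp_apply, TensorProduct.lift.tmul, ydLeft_apply]
    induction YDModule.coact (A := A) (YDModule.act θ b) with
    | zero => simp
    | add u v hu hv => simp only [map_add, mul_add, hu, hv]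
    | tmul m c => simp

/-- The recursion of the insertion operators is inherited by `θ ↦ 1 ⊗ s(θ) + t(θ₀) ⊗ j(θ₁)`. -/
lemma affineMap_insertion {X Y : Type*} [Ring X] [Algebra ℂ X] [Ring Y] [Algebra ℂ Y]
    (l t : V →ₗ[ℂ] X) (j : A →ₐ[ℂ] Y) (s : V →ₗ[ℂ] Y)
    (hs : ∀ m a, s m * j a = conv (Comod.self A) j.toLinearMap (s ∘ₗ YDModule.act m) a)
    (ht : ∀ θ, LinearMap.mulLeft ℂ (t θ) ∘ₗ l = LinearMap.mulLeft ℂ (l θ) ∘ₗ l +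
      conv (YDModule.comod A V) l (t ∘ₗ YDModule.act θ)) (θ : V) :
    LinearMap.mulLeft ℂ (affineMap j t s θ) ∘ₗ
        (TensorProduct.map l j.toLinearMap ∘ₗ YDModule.coact) =
      LinearMap.mulLeft ℂ (TensorProduct.map l j.toLinearMap (YDModule.coact θ)) ∘ₗ
        (TensorProduct.map l j.toLinearMap ∘ₗ YDModule.coact) +
      conv (YDModule.comod A V) (TensorProduct.map l j.toLinearMap ∘ₗ YDModule.coact)
        (affineMap j t s ∘ₗ YDModule.act θ) := by
  let iL : X →ₐ[ℂ] X ⊗[ℂ] Y := Algebra.TensorProduct.includeLeft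
  let iR : Y →ₐ[ℂ] X ⊗[ℂ] Y := Algebra.TensorProduct.includeRight
  let J : A →ₐ[ℂ] X ⊗[ℂ] Y := iR.comp j
  have hcomm : ∀ (x : X) (y : Y), iL x * iR y = iR y * iL x := by intro x y; simp [iL, iR]
  let D := YDModule.comod A V
  -- The summand `1 ⊗ s(θ)` is moved past the second factor by the cross-product rule.
  have h1 : conv D (TensorProduct.map l j.toLinearMap ∘ₗ YDModule.coact)
      ((TensorProduct.mk ℂ X Y 1 ∘ₗ s) ∘ₗ YDModule.act θ) =
      LinearMap.mulLeft ℂ (1 ⊗ₜ s θ) ∘ₗ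
        (TensorProduct.map l j.toLinearMap ∘ₗ YDModule.coact) := by
    rw [conv_coact_right, conv_assoc]
    have : conv (Comod.self A) J.toLinearMap ((TensorProduct.mk ℂ X Y 1 ∘ₗ s) ∘ₗ YDModule.act θ) =
        LinearMap.mulLeft ℂ (1 ⊗ₜ s θ) ∘ₗ J.toLinearMap := by
      ext a
      have := congrArg iR (hs θ a)
      rw [conv_apply, algHom_prodMap, map_mul] at this
      exact this.symm
    change conv D (iL.toLinearMap ∘ₗ l) (conv (Comod.self A) J.toLinearMap _) = _
    rw [this, conv_mulLeft_right]
    intro m; exact hcomm (l m) (s θ)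
  -- For the summand `t(θ₀) ⊗ j(θ₁)`, the recursion of `t` is applied on the first factor; the
  -- Yetter–Drinfeld condition `conv_coact_act` brings it to the required form.
  have h2 : ∀ u : V ⊗[ℂ] A, conv D (iL.toLinearMap ∘ₗ l) (TensorProduct.map t j.toLinearMap ∘ₗ
      TensorProduct.map₂ YDModule.act (LinearMap.mul ℂ A) u ∘ₗ comul) =
      LinearMap.mulLeft ℂ
        (TensorProduct.map t j.toLinearMap u - TensorProduct.map l j.toLinearMap u) ∘ₗ
        (TensorProduct.map l j.toLinearMap ∘ₗ YDModule.coact) := by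
    intro u
    induction u with
    | zero => ext a; simp [conv_zero_right]
    | add u v hu hv =>
      simp only [map_add, LinearMap.add_comp, LinearMap.comp_add, conv_add_right, hu, hv]
      ext a
      simp only [LinearMap.add_apply, LinearMap.comp_apply, LinearMap.mulLeft_apply]
      rw [← add_mul]
      congr 1; abel
    | tmul m c =>
      have h1 : TensorProduct.map t j.toLinearMap ∘ₗ
          TensorProduct.map₂ YDModule.act (LinearMap.mul ℂ A) (m ⊗ₜ c) ∘ₗ comul =
          LinearMap.mulLeft ℂ (1 ⊗ₜ j c) ∘ₗ conv (Comod.self A)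
            (iL.toLinearMap ∘ₗ t ∘ₗ YDModule.act m) J.toLinearMap := by
        ext a
        simp only [LinearMap.comp_apply, conv_apply, Comod.self_δ]
        induction comul (R := ℂ) a with
        | zero => simp
        | add u v hu hv => simp only [map_add, hu, hv]
        | tmul x y => simp [J, iL, iR]
      have h2 : conv D (iL.toLinearMap ∘ₗ l) (iL.toLinearMap ∘ₗ t ∘ₗ YDModule.act m) =
          LinearMap.mulLeft ℂ (iL (t m) - iL (l m)) ∘ₗ iL.toLinearMap ∘ₗ l := by
        have hl : conv D l (t ∘ₗ YDModule.act m) =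
            LinearMap.mulLeft ℂ (t m) ∘ₗ l - LinearMap.mulLeft ℂ (l m) ∘ₗ l := by
          rw [ht]; simp [D]
        rw [← algHom_conv, hl]
        ext a
        simp [sub_mul]
      rw [h1, conv_mulLeft_right, ← conv_assoc, h2, conv_mulLeft, conv_coact_right]
      · ext a
        simp only [LinearMap.comp_apply, LinearMap.mulLeft_apply, TensorProduct.map_tmul,
          ← TensorProduct.sub_tmul, ← mul_assoc]
        congr 1
        simp [iL, ← TensorProduct.sub_tmul]
      · intro v; exact hcomm (l v) (j c)
  have h3 : conv D (TensorProduct.map l j.toLinearMap ∘ₗ YDModule.coact)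
      ((TensorProduct.map t j.toLinearMap ∘ₗ YDModule.coact) ∘ₗ YDModule.act θ) =
      LinearMap.mulLeft ℂ (TensorProduct.map t j.toLinearMap (YDModule.coact θ) -
        TensorProduct.map l j.toLinearMap (YDModule.coact θ))
        ∘ₗ (TensorProduct.map l j.toLinearMap ∘ₗ YDModule.coact) := by
    rw [← h2, ← conv_coact_act, conv_coact_right l, conv_assoc]
  rw [affineMap, LinearMap.add_comp, conv_add_right, h1, h3]
  ext a
  simp only [LinearMap.add_apply, LinearMap.comp_apply, LinearMap.mulLeft_apply,
    TensorProduct.mk_apply, sub_mul, add_mul]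
  abel

lemma algHom_affineMap_insertion {X Y Z : Type*} [Ring X] [Algebra ℂ X] [Ring Y] [Algebra ℂ Y]
    [Ring Z] [Algebra ℂ Z] (Φ : X ⊗[ℂ] Y →ₐ[ℂ] Z)
    (l t : V →ₗ[ℂ] X) (j : A →ₐ[ℂ] Y) (s : V →ₗ[ℂ] Y)
    (hs : ∀ m a, s m * j a = conv (Comod.self A) j.toLinearMap (s ∘ₗ YDModule.act m) a)
    (ht : ∀ θ, LinearMap.mulLeft ℂ (t θ) ∘ₗ l = LinearMap.mulLeft ℂ (l θ) ∘ₗ l +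
      conv (YDModule.comod A V) l (t ∘ₗ YDModule.act θ)) (θ η : V) :
    Φ (affineMap j t s θ) * Φ (TensorProduct.map l j.toLinearMap (YDModule.coact η)) =
      Φ (TensorProduct.map l j.toLinearMap (YDModule.coact θ)) *
        Φ (TensorProduct.map l j.toLinearMap (YDModule.coact η)) +
      conv (YDModule.comod A V)
        (Φ.toLinearMap ∘ₗ TensorProduct.map l j.toLinearMap ∘ₗ YDModule.coact)
        ((Φ.toLinearMap ∘ₗ affineMap j t s) ∘ₗ YDModule.act θ) η := by
  have h := congrArg Φ (LinearMap.congr_fun (affineMap_insertion l t j s hs ht θ) η)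
  rw [LinearMap.add_apply, map_add, conv_apply, algHom_prodMap] at h
  simp only [LinearMap.comp_apply, LinearMap.mulLeft_apply, map_mul] at h
  exact h

lemma insertion_one (θ : V) : insertion A θ 1 = TensorAlgebra.ι ℂ θ := by
  simp [insertion, insertionAux]

lemma insertionAux_fst (x : TensorAlgebra ℂ V) : (insertionAux A x).1 = x := by
  induction x using tensor_induction with
  | one => simp [insertionAux]
  | cons θ x hx => rw [insertionAux, fold_cons]; change _ * (insertionAux A x).1 = _; rw [hx]
  | add x y hx hy => rw [map_add, Prod.fst_add, hx, hy]
  | smul c x hx => rw [map_smul, Prod.smul_fst, hx]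

lemma insertion_cons (θ η : V) (x : TensorAlgebra ℂ V) :
    insertion A θ (TensorAlgebra.ι ℂ η * x) = TensorAlgebra.ι ℂ θ * (TensorAlgebra.ι ℂ η * x) +
      prodMap (TensorAlgebra.ι ℂ) ((insertion A).flip x ∘ₗ YDModule.act θ)
        (YDModule.coact (A := A) η) := by
  have h : ∀ x, (insertionAux A x).2 = (insertion A (V := V)).flip x := by
    intro x; rfl
  rw [← LinearMap.flip_apply, ← h, insertionAux, fold_cons]
  change (TensorAlgebra.ι ℂ θ * (TensorAlgebra.ι ℂ η * (insertionAux A x).1)) +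
    braidThen A η (insertionAux A x).2 θ = _
  rw [insertionAux_fst, h]
  congr 1
  change LinearMap.mul' ℂ _ (TensorProduct.map _ _ _) = _
  induction YDModule.coact (A := A) η with
  | zero => simp
  | add u v hu hv => simp only [map_add, hu, hv]
  | tmul v a => simp

@[simp] lemma symmetrizer_one : symmetrizer A (1 : TensorAlgebra ℂ V) = 1 := by simp [symmetrizer]

@[simp] lemma symmetrizer_cons (θ : V) (x : TensorAlgebra ℂ V) :
    symmetrizer A (TensorAlgebra.ι ℂ θ * x) = insertion A θ (symmetrizer A x) := by
  simp [symmetrizer]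

end Insertion

section Deconcatenation

/-- Operators on the factors act on a tensor product. -/
def endTensor (M N : Type*) [AddCommGroup M] [Module ℂ M] [AddCommGroup N] [Module ℂ N] :
    Module.End ℂ M ⊗[ℂ] Module.End ℂ N →ₐ[ℂ] Module.End ℂ (M ⊗[ℂ] N) :=
  Module.endTensorEndAlgHom (R := ℂ) (S := ℂ) (A := ℂ)

@[simp] lemma endTensor_tmul {M N : Type*} [AddCommGroup M] [Module ℂ M] [AddCommGroup N]
    [Module ℂ N] (f : Module.End ℂ M) (g : Module.End ℂ N) (m : M) (n : N) :
    endTensor M N (f ⊗ₜ g) (m ⊗ₜ n) = f m ⊗ₜ g n := rfl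

variable (A V : Type*) [Ring A] [HopfAlgebra ℂ A] [AddCommGroup V] [Module ℂ V] [YDModule A V]

omit [YDModule A V] in
/-- The left multiplication of `A` on `A ⊗ V^⊗`. -/
def leftMul : A →ₐ[ℂ] Module.End ℂ (A ⊗[ℂ] TensorAlgebra ℂ V) :=
  AlgHom.ofLinearMap (LinearMap.rTensorHom (TensorAlgebra ℂ V) ∘ₗ LinearMap.mul ℂ A)
    (by ext; simp) (by intro x y; ext; simp [mul_assoc])

omit [YDModule A V] in
@[simp] lemma leftMul_tmul (a b : A) (x : TensorAlgebra ℂ V) :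
    leftMul A V a (b ⊗ₜ x) = (a * b) ⊗ₜ x := rfl

variable {V} in
/-- For fixed `θ`, the map from `A` to operators on `A ⊗ V^⊗` given by
`b ↦ (c ⊗ z ↦ b⁽¹⁾ c ⊗ insertion(θ ∘ b⁽²⁾) z)`. -/
def insertConv (θ : V) : A →ₗ[ℂ] Module.End ℂ (A ⊗[ℂ] TensorAlgebra ℂ V) :=
  conv (Comod.self A) (leftMul A V).toLinearMap
    ((LinearMap.lTensorHom A ∘ₗ insertion A) ∘ₗ YDModule.act θ)

/-- The operators `b ⊗ z ↦ b⁽¹⁾ ⊗ insertion(θ ∘ b⁽²⁾) z`, by which `V ⊆ A # V^⊗` acts on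
`A ⊗ V^⊗`. -/
def insertMul : V →ₗ[ℂ] Module.End ℂ (A ⊗[ℂ] TensorAlgebra ℂ V) where
  toFun θ := TensorProduct.lift (LinearMap.lcomp ℂ _ (TensorProduct.mk ℂ A (TensorAlgebra ℂ V) 1) ∘ₗ
    insertConv A θ)
  map_add' := by
    intro θ η; ext b z
    simp [insertConv, LinearMap.comp_add, conv_add_right]
  map_smul' := by
    intro c θ; ext b z
    simp [insertConv, LinearMap.comp_smul, conv_apply, prodMap_smul_right]

lemma insertMul_tmul (θ : V) (b : A) (z : TensorAlgebra ℂ V) :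
    insertMul A V θ (b ⊗ₜ z) = insertConv A θ b (1 ⊗ₜ z) := rfl

lemma insertMul_one_tmul (θ : V) (z : TensorAlgebra ℂ V) :
    insertMul A V θ (1 ⊗ₜ z) = 1 ⊗ₜ insertion A θ z := by
  rw [insertMul_tmul, insertConv, conv_apply]
  simp [Algebra.TensorProduct.one_def, YDModule.act_one]

lemma insertMul_rule (θ : V) (a : A) : insertMul A V θ * leftMul A V a =
    conv (Comod.self A) (leftMul A V).toLinearMap (insertMul A V ∘ₗ YDModule.act θ) a := by
  ext b z
  simp only [TensorProduct.AlgebraTensorModule.curry_apply, LinearMap.restrictScalars_self,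
    TensorProduct.curry_apply, Module.End.mul_apply, leftMul_tmul, insertMul_tmul, insertConv,
    conv_apply, Comod.self_δ, Bialgebra.comul_mul]
  induction comul (R := ℂ) a with
  | zero => simp
  | add u v hu hv => simp only [map_add, add_mul, LinearMap.add_apply, hu, hv]
  | tmul a a' =>
    simp only [prodMap_tmul, LinearMap.comp_apply, AlgHom.toLinearMap_apply, Module.End.mul_apply,
      insertMul_tmul, insertConv, conv_apply, Comod.self_δ]
    induction comul (R := ℂ) b with
    | zero => simp
    | add u v hu hv => simp only [map_add, mul_add, LinearMap.add_apply, hu, hv]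
    | tmul b b' => simp [YDModule.act_mul, mul_assoc]

/-- The operators on `V^⊗ ⊗ (A ⊗ V^⊗)` by which the coaction of a letter acts on the
deconcatenation coproduct. -/
def deconcatLetter : V →ₗ[ℂ] Module.End ℂ (TensorAlgebra ℂ V ⊗[ℂ] (A ⊗[ℂ] TensorAlgebra ℂ V)) :=
  (endTensor _ _).toLinearMap ∘ₗ
    TensorProduct.map (LinearMap.mul ℂ (TensorAlgebra ℂ V) ∘ₗ TensorAlgebra.ι ℂ)
      (leftMul A V).toLinearMap ∘ₗ YDModule.coact

/-- A tensor together with its deconcatenation coproduct. -/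
def deconcatAux : TensorAlgebra ℂ V →ₗ[ℂ]
    TensorAlgebra ℂ V × (TensorAlgebra ℂ V ⊗[ℂ] (A ⊗[ℂ] TensorAlgebra ℂ V)) :=
  fold (LinearMap.mk₂ ℂ
    (fun η p => (TensorAlgebra.ι ℂ η * p.1,
      1 ⊗ₜ (1 ⊗ₜ (TensorAlgebra.ι ℂ η * p.1)) + deconcatLetter A V η p.2))
    (by intros; ext <;> simp [add_mul, TensorProduct.tmul_add]; abel)
    (by intros; ext <;> simp)
    (by intros; ext <;> simp [mul_add, TensorProduct.tmul_add]; abel)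
    (by intros; ext <;> simp))
    (1, 1 ⊗ₜ (1 ⊗ₜ 1))

/-- The deconcatenation coproduct `z ↦ z⁽¹⁾ ⊗ (c ⊗ z⁽²⁾)`, the sum over all ways to split `z` in a
left and a right part, where the left part is replaced by its coaction `z⁽¹⁾ ⊗ c`. -/
def deconcat : TensorAlgebra ℂ V →ₗ[ℂ] TensorAlgebra ℂ V ⊗[ℂ] (A ⊗[ℂ] TensorAlgebra ℂ V) :=
  LinearMap.snd ℂ _ _ ∘ₗ deconcatAux A V

lemma deconcat_one : deconcat A V 1 = 1 ⊗ₜ (1 ⊗ₜ 1) := by simp [deconcat, deconcatAux]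

lemma deconcatAux_fst (x : TensorAlgebra ℂ V) : (deconcatAux A V x).1 = x := by
  induction x using tensor_induction with
  | one => simp [deconcatAux]
  | cons θ x hx => rw [deconcatAux, fold_cons]; change _ * (deconcatAux A V x).1 = _; rw [hx]
  | add x y hx hy => rw [map_add, Prod.fst_add, hx, hy]
  | smul c x hx => rw [map_smul, Prod.smul_fst, hx]

lemma deconcat_cons (η : V) (x : TensorAlgebra ℂ V) : deconcat A V (TensorAlgebra.ι ℂ η * x) =
    1 ⊗ₜ (1 ⊗ₜ (TensorAlgebra.ι ℂ η * x)) + deconcatLetter A V η (deconcat A V x) := by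
  conv_lhs => rw [deconcat, LinearMap.comp_apply, deconcatAux, fold_cons]
  change 1 ⊗ₜ (1 ⊗ₜ (TensorAlgebra.ι ℂ η * (deconcatAux A V x).1)) +
    deconcatLetter A V η (deconcat A V x) = _
  rw [deconcatAux_fst]

/-- The operators by which `φ(θ)`, for a letter `θ`, acts on `V^⊗ ⊗ (A ⊗ V^⊗)`. -/
def insertComul : V →ₗ[ℂ] Module.End ℂ (TensorAlgebra ℂ V ⊗[ℂ] (A ⊗[ℂ] TensorAlgebra ℂ V)) :=
  (endTensor _ _).toLinearMap ∘ₗ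
    affineMap (leftMul A V) (insertion A) (insertMul A V)

lemma insertComul_apply (θ : V) (x : TensorAlgebra ℂ V) (u : A ⊗[ℂ] TensorAlgebra ℂ V) :
    insertComul A V θ (x ⊗ₜ u) = x ⊗ₜ insertMul A V θ u +
      TensorProduct.map ((insertion A).flip x) ((leftMul A V).toLinearMap.flip u)
        (YDModule.coact (A := A) θ) := by
  rw [insertComul, LinearMap.comp_apply, affineMap_apply, map_add, LinearMap.add_apply]
  congr 1
  induction YDModule.coact (A := A) θ with
  | zero => simp
  | add u v hu hv => simp only [map_add, LinearMap.add_apply, hu, hv]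
  | tmul v a => simp

lemma deconcatLetter_apply (θ : V) (x : TensorAlgebra ℂ V) (u : A ⊗[ℂ] TensorAlgebra ℂ V) :
    deconcatLetter A V θ (x ⊗ₜ u) =
      TensorProduct.map (LinearMap.mulRight ℂ x ∘ₗ TensorAlgebra.ι ℂ)
        ((leftMul A V).toLinearMap.flip u) (YDModule.coact (A := A) θ) := by
  rw [deconcatLetter, LinearMap.comp_apply, LinearMap.comp_apply]
  induction YDModule.coact (A := A) θ with
  | zero => simp
  | add u v hu hv => simp only [map_add, LinearMap.add_apply, hu, hv]
  | tmul v a => simp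

/-- The recursion of the insertion operators for `θ ↦ φ(θ)`, acting on `V^⊗ ⊗ (A ⊗ V^⊗)`, and the
operators that describe deconcatenation after left multiplication by a letter. It makes the braided
symmetrizer compatible with the coproducts. -/
lemma insertComul_deconcatLetter (θ η : V) : insertComul A V θ * deconcatLetter A V η =
    deconcatLetter A V θ * deconcatLetter A V η +
      conv (YDModule.comod A V) (deconcatLetter A V) (insertComul A V ∘ₗ YDModule.act θ) η := by
  refine algHom_affineMap_insertion (X := Module.End ℂ (TensorAlgebra ℂ V))
    (Y := Module.End ℂ (A ⊗[ℂ] TensorAlgebra ℂ V))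
    (Z := Module.End ℂ (TensorAlgebra ℂ V ⊗[ℂ] (A ⊗[ℂ] TensorAlgebra ℂ V)))
    (endTensor (TensorAlgebra ℂ V) (A ⊗[ℂ] TensorAlgebra ℂ V))
    (LinearMap.mul ℂ (TensorAlgebra ℂ V) ∘ₗ TensorAlgebra.ι ℂ) (insertion A) (leftMul A V)
    (insertMul A V) (insertMul_rule A V) ?_ θ η
  intro θ
  ext η x
  simp only [LinearMap.comp_apply, LinearMap.mulLeft_apply, Module.End.mul_apply,
    LinearMap.mul_apply_apply, insertion_cons, LinearMap.add_apply, conv_apply]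
  congr 1
  rw [YDModule.comod_δ]
  induction YDModule.coact (A := A) η with
  | zero => simp
  | add u v hu hv => simp only [map_add, LinearMap.add_apply, hu, hv]
  | tmul v a => simp

/-- Insertion of a letter corresponds, under the deconcatenation coproduct, to multiplication with
the coproduct of the letter. -/
lemma deconcat_insertion (θ : V) (z : TensorAlgebra ℂ V) :
    deconcat A V (insertion A θ z) = insertComul A V θ (deconcat A V z) := by
  induction z using tensor_induction generalizing θ with
  | one =>
    rw [insertion_one, ← mul_one (TensorAlgebra.ι ℂ θ), deconcat_cons, deconcat_one, mul_one,
      insertComul_apply, deconcatLetter_apply, insertMul_one_tmul, insertion_one]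
    congr 3
    ext; simp [insertion_one]
  | cons η z hz =>
    have h1 : ∀ u : V ⊗[ℂ] A, deconcat A V (prodMap (TensorAlgebra.ι ℂ)
        ((insertion A).flip z ∘ₗ YDModule.act θ) u) =
        1 ⊗ₜ (1 ⊗ₜ prodMap (TensorAlgebra.ι ℂ) ((insertion A).flip z ∘ₗ YDModule.act θ) u) +
        prodMap (X := Module.End ℂ (TensorAlgebra ℂ V ⊗[ℂ] (A ⊗[ℂ] TensorAlgebra ℂ V)))
          (deconcatLetter A V) (insertComul A V ∘ₗ YDModule.act θ) u (deconcat A V z) := by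
      intro u
      induction u with
      | zero => simp
      | add u v hu hv =>
        simp only [map_add, LinearMap.add_apply, hu, hv, TensorProduct.tmul_add]; abel
      | tmul v a => simp [deconcat_cons, hz]
    rw [insertion_cons, map_add, deconcat_cons, deconcat_cons, map_add, h1, map_add,
      ← Module.End.mul_apply (insertComul A V θ), insertComul_deconcatLetter, insertComul_apply,
      insertMul_one_tmul, insertion_cons, deconcatLetter_apply]
    simp only [LinearMap.add_apply, Module.End.mul_apply, conv_apply, YDModule.comod_δ,
      TensorProduct.tmul_add]
    have h2 : ∀ u : V ⊗[ℂ] A, TensorProduct.map (LinearMap.mulRight ℂ 1 ∘ₗ TensorAlgebra.ι ℂ)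
        ((leftMul A V).toLinearMap.flip (1 ⊗ₜ (TensorAlgebra.ι ℂ η * z))) u =
        TensorProduct.map ((insertion A).flip 1)
          ((leftMul A V).toLinearMap.flip (1 ⊗ₜ (TensorAlgebra.ι ℂ η * z))) u := by
      intro u
      congr 2
      ext; simp [insertion_one]
    rw [h2]
    abel
  | add x y hx hy => simp only [map_add, hx, hy]
  | smul c x hx => simp only [map_smul, hx]

end Deconcatenation

/-! ### Separation of tensors by removing the last letters -/

section Separation

variable {V : Type*} [AddCommGroup V] [Module ℂ V]

/-- The component of degree zero of a tensor. -/
abbrev degZero : TensorAlgebra ℂ V →ₐ[ℂ] ℂ := TensorAlgebra.algebraMapInv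

lemma degZero_ι (θ : V) : degZero (TensorAlgebra.ι ℂ θ) = 0 := by
  simp [TensorAlgebra.algebraMapInv]

lemma degZero_cons (θ : V) (x : TensorAlgebra ℂ V) : degZero (TensorAlgebra.ι ℂ θ * x) = 0 := by
  rw [map_mul, degZero_ι, zero_mul]

/-- The components of degree zero and one of a tensor. -/
def degAux : TensorAlgebra ℂ V →ₗ[ℂ] ℂ × V :=
  fold
    { toFun := fun θ =>
        LinearMap.inr ℂ ℂ V ∘ₗ LinearMap.toSpanSingleton ℂ V θ ∘ₗ LinearMap.fst ℂ ℂ V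
      map_add' := fun θ η => by ext <;> simp
      map_smul' := fun c θ => by ext <;> simp } (1, 0)

/-- The component of degree one of a tensor. -/
def degOne : TensorAlgebra ℂ V →ₗ[ℂ] V := LinearMap.snd ℂ _ _ ∘ₗ degAux

@[simp] lemma degOne_one : degOne (1 : TensorAlgebra ℂ V) = 0 := by simp [degOne, degAux]

lemma degAux_fst (x : TensorAlgebra ℂ V) : (degAux x).1 = degZero x := by
  induction x using tensor_induction with
  | one => simp [degAux]
  | cons θ x hx => rw [degAux, fold_cons, degZero_cons]; rfl
  | add x y hx hy => rw [map_add, Prod.fst_add, hx, hy, map_add]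
  | smul c x hx => rw [map_smul, Prod.smul_fst, hx, map_smul]

@[simp] lemma degOne_cons (θ : V) (x : TensorAlgebra ℂ V) :
    degOne (TensorAlgebra.ι ℂ θ * x) = degZero x • θ := by
  rw [← degAux_fst, degOne, LinearMap.comp_apply]
  conv_lhs => rw [degAux, fold_cons]
  rfl

@[simp] lemma degOne_ι (θ : V) : degOne (TensorAlgebra.ι ℂ θ) = θ := by
  rw [← mul_one (TensorAlgebra.ι ℂ θ), degOne_cons]; simp

/-- Linear functionals separate the vectors of a tensor product. -/
lemma tensor_eq_zero {M N : Type*} [AddCommGroup M] [Module ℂ M] [AddCommGroup N] [Module ℂ N]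
    (u : M ⊗[ℂ] N)
    (h : ∀ l : M →ₗ[ℂ] ℂ, TensorProduct.lid ℂ N (LinearMap.rTensor N l u) = 0) : u = 0 := by
  classical
  let b := Module.Basis.ofVectorSpace ℂ M
  apply (TensorProduct.equivFinsuppOfBasisLeft (N := N) b).injective
  rw [map_zero]
  ext i
  rw [TensorProduct.equivFinsuppOfBasisLeft_apply]
  exact h (b.coord i)

variable {s : (V →ₗ[ℂ] ℂ) → Module.End ℂ (TensorAlgebra ℂ V)}

/-- A tensor vanishes if all its images under products of operators that remove the last letter
have vanishing components of degree zero. -/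
lemma eq_zero_of_strip (hs1 : ∀ χ, s χ 1 = 0)
    (hs : ∀ χ x θ, s χ (x * TensorAlgebra.ι ℂ θ) = χ θ • x) (x : TensorAlgebra ℂ V)
    (hx : ∀ l : List (V →ₗ[ℂ] ℂ), degZero (l.foldl (fun y χ => s χ y) x) = 0) : x = 0 := by
  classical
  let b := Module.Basis.ofVectorSpace ℂ V
  -- The words in a basis of `V` and the products of coordinate operators are dual to each other.
  let word : List (Module.Basis.ofVectorSpaceIndex ℂ V) → TensorAlgebra ℂ V :=
    List.foldr (fun i y => y * TensorAlgebra.ι ℂ (b i)) 1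
  have hspan : Submodule.span ℂ (Set.range word) = ⊤ := by
    have hmul : ∀ (x y : TensorAlgebra ℂ V), x ∈ Submodule.span ℂ (Set.range word) →
        x * y ∈ Submodule.span ℂ (Set.range word) := by
      intro x y
      induction y using TensorAlgebra.induction generalizing x with
      | algebraMap c =>
        intro hx
        rw [Algebra.algebraMap_eq_smul_one, mul_smul_comm, mul_one]
        exact Submodule.smul_mem _ _ hx
      | ι θ =>
        intro hx
        induction hx using Submodule.span_induction with
        | mem x hx =>
          obtain ⟨l, rfl⟩ := hx
          have hθ : θ ∈ Submodule.span ℂ (Set.range b) := by rw [b.span_eq]; trivial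
          induction hθ using Submodule.span_induction with
          | mem θ hθ =>
            obtain ⟨i, rfl⟩ := hθ
            exact Submodule.subset_span ⟨i :: l, rfl⟩
          | zero => simp
          | add θ η _ _ h1 h2 => rw [map_add, mul_add]; exact add_mem h1 h2
          | smul c θ _ h1 => rw [map_smul, mul_smul_comm]; exact Submodule.smul_mem _ _ h1
        | zero => simp
        | add x y _ _ h1 h2 => rw [add_mul]; exact add_mem h1 h2
        | smul c x _ h1 => rw [smul_mul_assoc]; exact Submodule.smul_mem _ _ h1
      | mul y z hy hz => intro hx; rw [← mul_assoc]; exact hz _ (hy _ hx)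
      | add y z hy hz => intro hx; rw [mul_add]; exact add_mem (hy _ hx) (hz _ hx)
    rw [eq_top_iff]
    intro y _
    have := hmul 1 y (Submodule.subset_span ⟨[], rfl⟩)
    rwa [one_mul] at this
  -- The functional reading off the coefficient of a word.
  let F : List (Module.Basis.ofVectorSpaceIndex ℂ V) → TensorAlgebra ℂ V →ₗ[ℂ] ℂ :=
    List.foldr (fun i f => f ∘ₗ s (b.coord i)) degZero.toLinearMap
  have hF : ∀ l m, F l (word m) = if m = l then 1 else 0 := by
    intro l
    induction l with
    | nil =>
      rintro (_ | ⟨i, m⟩)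
      · change degZero 1 = _; simp
      · change degZero (_ * TensorAlgebra.ι ℂ (b i)) = _
        rw [map_mul, degZero_ι]; simp
    | cons j l ih =>
      rintro (_ | ⟨i, m⟩)
      · change F l (s _ 1) = _
        rw [hs1]; simp
      · change F l (s _ (word m * TensorAlgebra.ι ℂ (b i))) = _
        rw [hs, map_smul, ih, Module.Basis.coord_apply, Module.Basis.repr_self,
          Finsupp.single_apply]
        by_cases h1 : i = j <;> by_cases h2 : m = l <;> simp [h1, h2]
  have hFx : ∀ l y, F l y = degZero ((l.map b.coord).foldl (fun y χ => s χ y) y) := by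
    intro l
    induction l with
    | nil => intro y; rfl
    | cons j l ih => intro y; exact ih _
  have hxs : x ∈ Submodule.span ℂ (Set.range word) := hspan ▸ Submodule.mem_top
  obtain ⟨c, rfl⟩ := Finsupp.mem_span_range_iff_exists_finsupp.mp hxs
  have hc : c = 0 := by
    ext l
    have := hFx l (c.sum fun i a => a • word i)
    rw [hx, Finsupp.sum, map_sum] at this
    simp only [map_smul, hF, smul_eq_mul, mul_ite, mul_one, mul_zero] at this
    rw [Finset.sum_ite_eq'] at this
    by_contra h
    rw [if_pos (Finsupp.mem_support_iff.mpr h)] at this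
    exact h this
  simp [hc]

/-- A space of tensors with coefficients in `M` that is stable under the removal of last letters
and has no components of degree zero vanishes. -/
lemma eq_zero_of_strip_stable {M : Type*} [AddCommGroup M] [Module ℂ M] (hs1 : ∀ χ, s χ 1 = 0)
    (hs : ∀ χ x θ, s χ (x * TensorAlgebra.ι ℂ θ) = χ θ • x)
    (W : Submodule ℂ (M ⊗[ℂ] TensorAlgebra ℂ V))
    (hW : ∀ χ, ∀ u ∈ W, LinearMap.lTensor M (s χ) u ∈ W)
    (h0 : ∀ u ∈ W, LinearMap.lTensor M degZero.toLinearMap u = 0) (u) (hu : u ∈ W) : u = 0 := by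
  apply tensor_eq_zero
  intro l
  apply eq_zero_of_strip hs1 hs
  intro L
  have hcomm : ∀ (χ) (u : M ⊗[ℂ] TensorAlgebra ℂ V),
      s χ (TensorProduct.lid ℂ _ (LinearMap.rTensor _ l u)) =
        TensorProduct.lid ℂ _ (LinearMap.rTensor _ l (LinearMap.lTensor M (s χ) u)) := by
    intro χ u
    induction u with
    | zero => simp
    | add u v hu hv => simp only [map_add, hu, hv]
    | tmul m x => simp
  have hcomm0 : ∀ (u : M ⊗[ℂ] TensorAlgebra ℂ V),
      degZero (TensorProduct.lid ℂ _ (LinearMap.rTensor _ l u)) =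
        TensorProduct.lid ℂ _
          (LinearMap.rTensor _ l (LinearMap.lTensor M degZero.toLinearMap u)) := by
    intro u
    induction u with
    | zero => simp
    | add u v hu hv => simp only [map_add, hu, hv]
    | tmul m x => simp
  induction L generalizing u with
  | nil => rw [List.foldl_nil, hcomm0, h0 u hu]; simp
  | cons χ L ih => rw [List.foldl_cons, hcomm]; exact ih _ (hW χ u hu)

end Separation

section Strip

variable (A V : Type*) [Ring A] [HopfAlgebra ℂ A] [AddCommGroup V] [Module ℂ V] [YDModule A V]

omit [YDModule A V] in
/-- The linear map `b ⊗ z ↦ ε(b) z₁`, where `z₁` is the component of degree one of `z`. -/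
def letterPart : A ⊗[ℂ] TensorAlgebra ℂ V →ₗ[ℂ] V :=
  (TensorProduct.lid ℂ V).toLinearMap ∘ₗ TensorProduct.map counit degOne

omit [YDModule A V] in
@[simp] lemma letterPart_tmul (b : A) (z : TensorAlgebra ℂ V) :
    letterPart A V (b ⊗ₜ z) = counit (R := ℂ) b • degOne z := rfl

omit [YDModule A V] in
lemma letterPart_leftMul (b : A) (u : A ⊗[ℂ] TensorAlgebra ℂ V) :
    letterPart A V (leftMul A V b u) = counit (R := ℂ) b • letterPart A V u := by
  induction u with
  | zero => simp
  | add u v hu hv => simp only [map_add, smul_add, hu, hv]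
  | tmul c z => simp [mul_smul]

/-- The operator that removes the last letter and evaluates it with a linear functional. -/
def strip (χ : V →ₗ[ℂ] ℂ) : Module.End ℂ (TensorAlgebra ℂ V) :=
  (TensorProduct.rid ℂ _).toLinearMap ∘ₗ LinearMap.lTensor _ (χ ∘ₗ letterPart A V) ∘ₗ deconcat A V

lemma strip_one (χ : V →ₗ[ℂ] ℂ) : strip A V χ 1 = 0 := by simp [strip, deconcat_one]

lemma strip_cons (χ : V →ₗ[ℂ] ℂ) (η : V) (z : TensorAlgebra ℂ V) :
    strip A V χ (TensorAlgebra.ι ℂ η * z) =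
      (degZero z * χ η) • (1 : TensorAlgebra ℂ V) + TensorAlgebra.ι ℂ η * strip A V χ z := by
  have h : ∀ w : TensorAlgebra ℂ V ⊗[ℂ] (A ⊗[ℂ] TensorAlgebra ℂ V),
      TensorProduct.rid ℂ _ (LinearMap.lTensor _ (χ ∘ₗ letterPart A V) (deconcatLetter A V η w)) =
      TensorAlgebra.ι ℂ η *
        TensorProduct.rid ℂ _ (LinearMap.lTensor _ (χ ∘ₗ letterPart A V) w) := by
    intro w
    induction w with
    | zero => simp
    | add u v hu hv => simp only [map_add, mul_add, hu, hv]
    | tmul x u =>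
      rw [deconcatLetter_apply]
      have h1 : ∀ v : V ⊗[ℂ] A, TensorProduct.rid ℂ _ (LinearMap.lTensor _ (χ ∘ₗ letterPart A V)
          (TensorProduct.map (LinearMap.mulRight ℂ x ∘ₗ TensorAlgebra.ι ℂ)
            ((leftMul A V).toLinearMap.flip u) v)) =
          χ (letterPart A V u) • (TensorAlgebra.ι ℂ (TensorProduct.rid ℂ _
            (LinearMap.lTensor V counit v)) * x) := by
        intro v
        induction v with
        | zero => simp
        | add v w hv hw => simp only [map_add, add_mul, smul_add, hv, hw]
        | tmul v a => simp [letterPart_leftMul, smul_smul, mul_comm]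
      rw [h1, YDModule.coact_counit]
      simp
  rw [strip, LinearMap.comp_apply, LinearMap.comp_apply, deconcat_cons, map_add, map_add]
  congr 1
  · simp
  · exact h _

lemma strip_mul_ι (χ : V →ₗ[ℂ] ℂ) (x : TensorAlgebra ℂ V) (θ : V) :
    strip A V χ (x * TensorAlgebra.ι ℂ θ) = χ θ • x := by
  induction x using tensor_induction with
  | one =>
    have := strip_cons A V χ θ 1
    rw [strip_one] at this
    simpa using this
  | cons η x hx => rw [mul_assoc, strip_cons, hx, map_mul, degZero_ι]; simp
  | add x y hx hy => rw [add_mul, map_add, hx, hy, smul_add]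
  | smul c x hx => rw [smul_mul_assoc, map_smul, hx, smul_comm]

end Strip

section Symmetrizer

variable {A V : Type*} [Ring A] [HopfAlgebra ℂ A] [AddCommGroup V] [Module ℂ V] [YDModule A V]

lemma degZero_insertion (θ : V) (x : TensorAlgebra ℂ V) : degZero (insertion A θ x) = 0 := by
  induction x using tensor_induction with
  | one => rw [insertion_one, degZero_ι]
  | cons η x hx =>
    rw [insertion_cons, map_add, degZero_cons, zero_add, algHom_prodMap]
    have : degZero.toLinearMap ∘ₗ TensorAlgebra.ι ℂ (M := V) = 0 := by ext; simp [degZero_ι]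
    rw [this]
    generalize YDModule.coact (A := A) η = u
    induction u with
    | zero => simp
    | add u v hu hv => rw [map_add, hu, hv, add_zero]
    | tmul => simp
  | add x y hx hy => rw [map_add, map_add, hx, hy, add_zero]
  | smul c x hx => rw [map_smul, map_smul, hx, smul_zero]

lemma degOne_insertion (θ : V) (x : TensorAlgebra ℂ V) :
    degOne (insertion A θ x) = degZero x • θ := by
  induction x using tensor_induction with
  | one => rw [insertion_one]; simp
  | cons η x hx =>
    rw [insertion_cons, map_add, degOne_cons, degZero_cons]
    generalize YDModule.coact (A := A) η = u
    induction u with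
    | zero => simp
    | add u v hu hv => simp only [map_add, zero_smul, zero_add] at hu hv ⊢; rw [hu, hv, zero_add]
    | tmul => simp [degZero_insertion]
  | add x y hx hy => rw [map_add, map_add, hx, hy, map_add, add_smul]
  | smul c x hx => rw [map_smul, map_smul, hx, map_smul, smul_assoc]

lemma degZero_symmetrizer (x : TensorAlgebra ℂ V) : degZero (symmetrizer A x) = degZero x := by
  induction x using tensor_induction with
  | one => simp
  | cons η x hx => rw [symmetrizer_cons, degZero_insertion, degZero_cons]
  | add x y hx hy => simp only [map_add, hx, hy]
  | smul c x hx => simp only [map_smul, hx]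

lemma degOne_symmetrizer (x : TensorAlgebra ℂ V) : degOne (symmetrizer A x) = degOne x := by
  induction x using tensor_induction with
  | one => simp
  | cons η x hx => rw [symmetrizer_cons, degOne_insertion, degZero_symmetrizer, degOne_cons]
  | add x y hx hy => simp only [map_add, hx, hy]
  | smul c x hx => simp only [map_smul, hx]

end Symmetrizer

/-! ### The kernel of the total symmetrizer is a Hopf *-ideal -/

namespace Free

section Total

variable (A V : Type*) [Ring A] [HopfAlgebra ℂ A] [AddCommGroup V] [Module ℂ V] [YDModule A V]

/-- The representation of `A # V^⊗` on `A ⊗ V^⊗` in which letters act by insertion. -/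
def rep : Free A V →ₐ[ℂ] Module.End ℂ (A ⊗[ℂ] TensorAlgebra ℂ V) :=
  lift (leftMul A V) (insertMul A V) (insertMul_rule A V)

/-- The map `id ⊗ Y` on `A # V^⊗`, as an orbit map. -/
def total : Free A V →ₗ[ℂ] A ⊗[ℂ] TensorAlgebra ℂ V :=
  LinearMap.applyₗ (1 ⊗ₜ[ℂ] (1 : TensorAlgebra ℂ V) : A ⊗[ℂ] TensorAlgebra ℂ V) ∘ₗ
    (rep A V).toLinearMap

variable {A V}

lemma total_apply (f : Free A V) : total A V f = rep A V f (1 ⊗ₜ 1) := rfl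

lemma rep_incl (a : A) : rep A V (incl A V a) = leftMul A V a := by simp [rep]

lemma rep_trans (θ : V) : rep A V (trans A V θ) = insertMul A V θ := by simp [rep]

lemma total_mul (f g : Free A V) : total A V (f * g) = rep A V f (total A V g) := by
  rw [total_apply, map_mul]; rfl

lemma total_inr (x : TensorAlgebra ℂ V) :
    total A V (Smash.inr _ _ x) = 1 ⊗ₜ symmetrizer A x := by
  induction x using tensor_induction with
  | one => simp [total_apply]
  | cons θ x hx =>
    rw [map_mul, total_mul, hx]
    change rep A V (trans A V θ) _ = _
    rw [rep_trans, insertMul_one_tmul, symmetrizer_cons]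
  | add x y hx hy => simp only [map_add, hx, hy, TensorProduct.tmul_add]
  | smul c x hx => simp only [map_smul, hx, TensorProduct.tmul_smul]

lemma total_incl_mul_inr (a : A) (x : TensorAlgebra ℂ V) :
    total A V (incl A V a * Smash.inr _ _ x) = a ⊗ₜ symmetrizer A x := by
  rw [total_mul, rep_incl, total_inr, leftMul_tmul, mul_one]

lemma total_equivTensor (u : A ⊗[ℂ] TensorAlgebra ℂ V) :
    total A V (Smash.equivTensor _ _ u) = LinearMap.lTensor A (symmetrizer A) u := by
  induction u with
  | zero => simp
  | add u v hu hv => simp only [map_add, hu, hv]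
  | tmul a x => rw [← Smash.inl_mul_inr]; exact total_incl_mul_inr a x

variable (A V)

/-- The action of `A # V^⊗`, through its coproduct, on the tensor square of `A ⊗ V^⊗`. -/
def comulRep : Free A V →ₐ[ℂ] Module.End ℂ ((A ⊗[ℂ] TensorAlgebra ℂ V) ⊗[ℂ]
    (A ⊗[ℂ] TensorAlgebra ℂ V)) :=
  (endTensor _ _).comp ((Algebra.TensorProduct.map (rep A V) (rep A V)).comp
    (Bialgebra.comulAlgHom ℂ (Free A V)))

/-- The coproduct of `A ⊗ V^⊗` that combines the coproduct of `A` with deconcatenation. -/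
def totalComul : A ⊗[ℂ] TensorAlgebra ℂ V →ₗ[ℂ]
    (A ⊗[ℂ] TensorAlgebra ℂ V) ⊗[ℂ] (A ⊗[ℂ] TensorAlgebra ℂ V) :=
  TensorProduct.lift (LinearMap.lcomp ℂ _ (LinearMap.rTensor (A ⊗[ℂ] TensorAlgebra ℂ V)
    (TensorProduct.mk ℂ A (TensorAlgebra ℂ V) 1) ∘ₗ deconcat A V) ∘ₗ
      (comulRep A V).toLinearMap ∘ₗ (incl A V).toLinearMap)

variable {A V}

lemma totalComul_tmul (b : A) (z : TensorAlgebra ℂ V) : totalComul A V (b ⊗ₜ z) =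
    comulRep A V (incl A V b) (LinearMap.rTensor (A ⊗[ℂ] TensorAlgebra ℂ V)
      (TensorProduct.mk ℂ A (TensorAlgebra ℂ V) 1) (deconcat A V z)) := rfl

lemma comulRep_apply (f : Free A V) : comulRep A V f =
    endTensor _ _ (Algebra.TensorProduct.map (rep A V) (rep A V) (comul (R := ℂ) f)) := rfl

lemma comulRep_trans (θ : V) (w : TensorAlgebra ℂ V ⊗[ℂ] (A ⊗[ℂ] TensorAlgebra ℂ V)) :
    comulRep A V (trans A V θ) (LinearMap.rTensor _
      (TensorProduct.mk ℂ A (TensorAlgebra ℂ V) 1) w) =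
    LinearMap.rTensor _ (TensorProduct.mk ℂ A (TensorAlgebra ℂ V) 1) (insertComul A V θ w) := by
  induction w with
  | zero => simp
  | add u v hu hv => simp only [map_add, hu, hv]
  | tmul x u =>
    have h : ∀ v : V ⊗[ℂ] A, endTensor _ _ (Algebra.TensorProduct.map (rep A V) (rep A V)
          (TensorProduct.map (trans A V) (incl A V).toLinearMap v)) ((1 ⊗ₜ x) ⊗ₜ u) =
        LinearMap.rTensor _ (TensorProduct.mk ℂ A (TensorAlgebra ℂ V) 1) (TensorProduct.map
          ((insertion A).flip x) ((leftMul A V).toLinearMap.flip u) v) := by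
      intro v
      induction v with
      | zero => simp
      | add v w hv hw => simp only [map_add, LinearMap.add_apply, hv, hw]
      | tmul v a => simp [rep_trans, rep_incl, insertMul_one_tmul]
    rw [comulRep_apply, comul_trans, map_add, map_add, LinearMap.add_apply, LinearMap.rTensor_tmul,
      TensorProduct.mk_apply, h, insertComul_apply, map_add]
    congr 1
    simp [rep_trans]

/-- The coproduct of `A ⊗ V^⊗` is compatible with the module structures over `A # V^⊗`. -/
lemma totalComul_rep (f : Free A V) (g : A ⊗[ℂ] TensorAlgebra ℂ V) :
    totalComul A V (rep A V f g) = comulRep A V f (totalComul A V g) := by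
  induction f using Free.induction generalizing g with
  | hincl a =>
    induction g with
    | zero => simp
    | add u v hu hv => simp only [map_add, hu, hv]
    | tmul b z =>
      rw [rep_incl, leftMul_tmul, totalComul_tmul, totalComul_tmul, map_mul, map_mul]; rfl
  | htrans θ =>
    induction g with
    | zero => simp
    | add u v hu hv => simp only [map_add, hu, hv]
    | tmul b z =>
      have h1 : (b ⊗ₜ z : A ⊗[ℂ] TensorAlgebra ℂ V) = rep A V (incl A V b) (1 ⊗ₜ z) := by
        rw [rep_incl, leftMul_tmul, mul_one]
      have h2 : ∀ u : A ⊗[ℂ] A, totalComul A V (rep A V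
          (prodMap (incl A V).toLinearMap (trans A V ∘ₗ YDModule.act θ) u) (1 ⊗ₜ z)) =
          comulRep A V (prodMap (incl A V).toLinearMap (trans A V ∘ₗ YDModule.act θ) u)
            (LinearMap.rTensor _ (TensorProduct.mk ℂ A (TensorAlgebra ℂ V) 1)
              (deconcat A V z)) := by
        intro u
        induction u with
        | zero => simp
        | add v w hv hw => simp only [map_add, LinearMap.add_apply, hv, hw]
        | tmul a c =>
          simp only [prodMap_tmul, map_mul, AlgHom.toLinearMap_apply, LinearMap.comp_apply,
            Module.End.mul_apply, comulRep_trans, rep_trans, insertMul_one_tmul, rep_incl,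
            leftMul_tmul, mul_one, totalComul_tmul, deconcat_insertion]
      rw [totalComul_tmul, ← Module.End.mul_apply, ← map_mul, trans_mul_incl, conv_apply, ← h2, h1,
        ← Module.End.mul_apply, ← map_mul, trans_mul_incl, conv_apply]
  | add x y hx hy => simp only [map_add, LinearMap.add_apply, hx, hy]
  | mul x y hx hy => rw [map_mul, map_mul, Module.End.mul_apply, Module.End.mul_apply, hx, hy]

lemma totalComul_total (f : Free A V) : totalComul A V (total A V f) =
    TensorProduct.map (total A V) (total A V) (comul f) := by
  rw [total_apply, totalComul_rep, totalComul_tmul, map_one, map_one, Module.End.one_apply,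
    deconcat_one, comulRep_apply, LinearMap.rTensor_tmul, TensorProduct.mk_apply]
  induction comul (R := ℂ) f with
  | zero => simp
  | add u v hu hv => simp only [map_add, LinearMap.add_apply, hu, hv]
  | tmul x y => simp [total_apply]

lemma comulRep_incl_strip (χ : V →ₗ[ℂ] ℂ) (b : A)
    (w : (A ⊗[ℂ] TensorAlgebra ℂ V) ⊗[ℂ] (A ⊗[ℂ] TensorAlgebra ℂ V)) :
    TensorProduct.rid ℂ _ (LinearMap.lTensor _ (χ ∘ₗ letterPart A V)
      (comulRep A V (incl A V b) w)) =
    leftMul A V b (TensorProduct.rid ℂ _ (LinearMap.lTensor _ (χ ∘ₗ letterPart A V) w)) := by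
  rw [comulRep_apply, comul_incl]
  induction w with
  | zero => simp
  | add u v hu hv => simp only [map_add, hu, hv]
  | tmul u v =>
    have h : ∀ c : A ⊗[ℂ] A, TensorProduct.rid ℂ _ (LinearMap.lTensor _ (χ ∘ₗ letterPart A V)
        (endTensor _ _ (Algebra.TensorProduct.map (rep A V) (rep A V)
          (TensorProduct.map (incl A V).toLinearMap (incl A V).toLinearMap c)) (u ⊗ₜ v))) =
        χ (letterPart A V v) •
          leftMul A V (TensorProduct.rid ℂ _ (LinearMap.lTensor A counit c)) u := by
      intro c
      induction c with
      | zero => simp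
      | add v w hv hw => simp only [map_add, LinearMap.add_apply, smul_add, hv, hw]
      | tmul a b => simp [rep_incl, letterPart_leftMul, smul_smul, mul_comm]
    rw [h, Coalgebra.lTensor_counit_comul]
    simp

/-- Evaluating the second leg of the coproduct at its letters removes the last letter. -/
lemma strip_totalComul (χ : V →ₗ[ℂ] ℂ) (g : A ⊗[ℂ] TensorAlgebra ℂ V) :
    TensorProduct.rid ℂ _ (LinearMap.lTensor _ (χ ∘ₗ letterPart A V) (totalComul A V g)) =
      LinearMap.lTensor A (strip A V χ) g := by
  induction g with
  | zero => simp
  | add u v hu hv => simp only [map_add, hu, hv]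
  | tmul b z =>
    rw [totalComul_tmul, comulRep_incl_strip, LinearMap.lTensor_tmul, strip, LinearMap.comp_apply,
      LinearMap.comp_apply]
    have : ∀ w : TensorAlgebra ℂ V ⊗[ℂ] (A ⊗[ℂ] TensorAlgebra ℂ V), TensorProduct.rid ℂ _
        (LinearMap.lTensor _ (χ ∘ₗ letterPart A V) (LinearMap.rTensor _
          (TensorProduct.mk ℂ A (TensorAlgebra ℂ V) 1) w)) =
        1 ⊗ₜ TensorProduct.rid ℂ _ (LinearMap.lTensor _ (χ ∘ₗ letterPart A V) w) := by
      intro w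
      induction w with
      | zero => simp
      | add u v hu hv => simp only [map_add, TensorProduct.tmul_add, hu, hv]
      | tmul x u => simp
    rw [this, leftMul_tmul, mul_one]
    rfl

variable (A V)

/-- The projection of `A # V^⊗` onto `A` that kills the letters. -/
def proj : Free A V →ₐ[ℂ] A := lift (AlgHom.id ℂ A) 0 (by intro θ a; simp [conv_zero_right])

/-- The map `a x ↦ ε(a) x₁` on `A # V^⊗`, where `x₁` is the component of degree one of `x`. -/
def letter : Free A V →ₗ[ℂ] V := letterPart A V ∘ₗ (Smash.equivTensor _ _).symm.toLinearMap

variable {A V}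

lemma proj_incl (a : A) : proj A V (incl A V a) = a := by simp [proj]

lemma proj_trans (θ : V) : proj A V (trans A V θ) = 0 := by simp [proj]

lemma proj_inr (x : TensorAlgebra ℂ V) :
    proj A V (Smash.inr _ _ x) = algebraMap ℂ A (degZero x) := by
  rw [proj, lift_inr]
  induction x using tensor_induction with
  | one => simp
  | cons θ x hx => rw [map_mul, degZero_cons]; simp
  | add x y hx hy => simp only [map_add, hx, hy]
  | smul c x hx => rw [map_smul, hx, map_smul, smul_eq_mul, map_mul, Algebra.smul_def]

lemma letter_incl_mul_inr (a : A) (x : TensorAlgebra ℂ V) :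
    letter A V (incl A V a * Smash.inr _ _ x) = counit (R := ℂ) a • degOne x := by
  rw [letter, LinearMap.comp_apply, incl, Smash.inl_mul_inr]
  simp

lemma letterPart_total (f : Free A V) : letterPart A V (total A V f) = letter A V f := by
  induction f using Smash.ind_tmul with
  | h a x => 
    change letterPart A V (total A V (incl A V a * _)) = letter A V (incl A V a * _)
    rw [total_incl_mul_inr, letter_incl_mul_inr, letterPart_tmul, degOne_symmetrizer]
  | add x y hx hy => simp only [map_add, hx, hy]

lemma degZero_total (f : Free A V) : LinearMap.lTensor A degZero.toLinearMap (total A V f) =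
    proj A V f ⊗ₜ 1 := by
  induction f using Smash.ind_tmul with
  | h a x => 
    change LinearMap.lTensor A degZero.toLinearMap (total A V (incl A V a * _)) =
      proj A V (incl A V a * _) ⊗ₜ 1
    rw [total_incl_mul_inr, map_mul, proj_incl, proj_inr, Algebra.algebraMap_eq_smul_one]
    simp [degZero_symmetrizer, TensorProduct.smul_tmul]
  | add x y hx hy => simp only [map_add, hx, hy, TensorProduct.add_tmul]

/-- The kernel of `id ⊗ Y` contains every coideal `J` without components of degree zero and one.
Removing the last letter of `(id ⊗ Y)(f)` amounts to evaluating the second factor of `φ(f)` at its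
letters; as `J` has no letters, the coideal property makes `(id ⊗ Y)(J)` stable under this removal,
and its elements have no components of degree zero. -/
lemma total_eq_zero_of_mem (J : Submodule ℂ (Free A V)) (hproj : ∀ f ∈ J, proj A V f = 0)
    (hletter : ∀ f ∈ J, letter A V f = 0)
    (hcomul : ∀ f ∈ J, ∀ α β : Free A V →ₗ[ℂ] ℂ, (∀ g ∈ J, α g = 0) → (∀ g ∈ J, β g = 0) →
      LinearMap.mul' ℂ ℂ (TensorProduct.map α β (comul f)) = 0)
    (f : Free A V) (hf : f ∈ J) : total A V f = 0 := by
  refine eq_zero_of_strip_stable (strip_one A V) (strip_mul_ι A V) (J.map (total A V)) ?_ ?_ _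
    ⟨f, hf, rfl⟩
  · rintro χ _ ⟨f, hf, rfl⟩
    refine ⟨TensorProduct.rid ℂ _ (LinearMap.lTensor _ (χ ∘ₗ letter A V) (comul f)), ?_, ?_⟩
    · -- Otherwise a functional vanishing on `J` does not vanish on this element.
      by_contra hmem
      obtain ⟨α, hα, hα'⟩ := Submodule.exists_le_ker_of_notMem hmem
      apply hα
      have := hcomul f hf α (χ ∘ₗ letter A V) (fun g hg => hα' hg)
        (fun g hg => by simp [hletter g hg])
      rw [← this]
      induction comul (R := ℂ) f with
      | zero => simp
      | add u v hu hv => simp only [map_add, hu, hv]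
      | tmul x y => simp [mul_comm]
    · rw [← strip_totalComul, totalComul_total]
      induction comul (R := ℂ) f with
      | zero => simp
      | add u v hu hv => simp only [map_add, hu, hv]
      | tmul x y => simp [letterPart_total]
  · rintro _ ⟨f, hf, rfl⟩
    rw [degZero_total, hproj f hf, TensorProduct.zero_tmul]

end Total

end Free

section QuotientStar

variable {F : Type*} [Ring F] [HopfAlgebra ℂ F] [StarRing F] [HopfStarAlgebra F]
  (J : Ideal F) [J.IsTwoSided] [J.IsHopfIdeal ℂ] (hJ : ∀ x ∈ J, star x ∈ J)

/-- The involution on the quotient by a *-ideal. -/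
abbrev quotientStarRing : StarRing (F ⧸ J) where
  star := Quotient.map' star (by
    intro x y h
    rw [Submodule.quotientRel_def] at h ⊢
    rw [← star_sub]; exact hJ _ h)
  star_involutive x := by
    obtain ⟨x, rfl⟩ := Ideal.Quotient.mk_surjective x
    exact congrArg (Ideal.Quotient.mk J) (star_star x)
  star_add x y := by
    obtain ⟨x, rfl⟩ := Ideal.Quotient.mk_surjective x
    obtain ⟨y, rfl⟩ := Ideal.Quotient.mk_surjective y
    exact congrArg (Ideal.Quotient.mk J) (star_add x y)
  star_mul x y := by
    obtain ⟨x, rfl⟩ := Ideal.Quotient.mk_surjective x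
    obtain ⟨y, rfl⟩ := Ideal.Quotient.mk_surjective y
    exact congrArg (Ideal.Quotient.mk J) (star_mul x y)

lemma quotient_hopfStarAlgebra :
    letI := quotientStarRing J hJ; HopfStarAlgebra (F ⧸ J) :=
  letI := quotientStarRing J hJ
  have hs : ∀ x : F, star (Ideal.Quotient.mk J x) = Ideal.Quotient.mk J (star x) := fun x => rfl
  have hm : StarModule ℂ (F ⧸ J) := ⟨fun c x => by
    obtain ⟨x, rfl⟩ := Ideal.Quotient.mk_surjective x
    exact congrArg (Ideal.Quotient.mk J) (star_smul c x)⟩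
  { star_smul := hm.star_smul
    comul_star := fun x => by
      obtain ⟨x, rfl⟩ := Ideal.Quotient.mk_surjective x
      rw [hs, Bialgebra.Quotient.comul_mk, Bialgebra.Quotient.comul_mk,
        HopfStarAlgebra.comul_star]
      exact map_star _ _ (fun _ => rfl) (fun _ => rfl) _ }

end QuotientStar

namespace Free

section Ideal

variable {A V : Type*} [Ring A] [HopfAlgebra ℂ A] [AddCommGroup V] [Module ℂ V] [YDModule A V]

lemma counit_eq_proj (f : Free A V) : counit (R := ℂ) f = counit (R := ℂ) (proj A V f) := by
  have : Bialgebra.counitAlgHom ℂ (Free A V) = (Bialgebra.counitAlgHom ℂ A).comp (proj A V) :=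
    hom_ext (fun a => by simp [proj_incl, counit_incl])
      (fun θ => by simp [proj_trans, counit_trans])
  exact DFunLike.congr_fun this f

lemma letter_incl (a : A) : letter A V (incl A V a) = 0 := by
  have := letter_incl_mul_inr (V := V) a 1
  simpa using this

lemma letter_trans (θ : V) : letter A V (trans A V θ) = θ := by
  have := letter_incl_mul_inr (1 : A) (TensorAlgebra.ι ℂ θ)
  rw [map_one, one_mul, Bialgebra.counit_one, one_smul, degOne_ι] at this
  exact this

/-- The letter map is a cocycle along the projection to `A`, so that it vanishes on products of two
elements of the kernel of this projection. -/
lemma letter_mul (f g : Free A V) : letter A V (f * g) =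
    YDModule.act (letter A V f) (proj A V g) + counit (R := ℂ) f • letter A V g := by
  induction f using Free.induction generalizing g with
  | hincl a =>
    rw [letter_incl, counit_incl, map_zero, LinearMap.zero_apply, zero_add]
    induction g using Smash.ind_tmul with
    | h b y =>
      change letter A V (incl A V a * (incl A V b * _)) = _ • letter A V (incl A V b * _)
      rw [← mul_assoc, ← map_mul, letter_incl_mul_inr, letter_incl_mul_inr, Bialgebra.counit_mul,
        mul_smul]
    | add x y hx hy => simp only [mul_add, map_add, smul_add, hx, hy]
  | htrans θ =>
    rw [letter_trans, counit_trans, zero_smul, add_zero]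
    induction g using Smash.ind_tmul with
    | h b y =>
      change letter A V (trans A V θ * (incl A V b * _)) =
        YDModule.act θ (proj A V (incl A V b * _))
      rw [map_mul (proj A V), proj_incl, proj_inr, ← mul_assoc, trans_mul_incl, conv_apply]
      have h : ∀ u : A ⊗[ℂ] A, letter A V (prodMap (incl A V).toLinearMap
          (trans A V ∘ₗ YDModule.act θ) u * Smash.inr _ _ y) =
          degZero y • YDModule.act θ (TensorProduct.lid ℂ A (LinearMap.rTensor A counit u)) := by
        intro u
        induction u with
        | zero => simp
        | add v w hv hw => simp only [map_add, add_mul, smul_add, hv, hw]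
        | tmul a c =>
          have : prodMap (incl A V).toLinearMap (trans A V ∘ₗ YDModule.act θ) (a ⊗ₜ c) *
              Smash.inr _ _ y =
              incl A V a * Smash.inr _ _ (TensorAlgebra.ι ℂ (YDModule.act θ c) * y) := by
            rw [map_mul, ← mul_assoc]; rfl
          rw [this, letter_incl_mul_inr, degOne_cons, LinearMap.rTensor_tmul,
            TensorProduct.lid_tmul, map_smul, smul_comm]
      rw [h, Comod.self_δ, Coalgebra.rTensor_counit_comul, TensorProduct.lid_tmul, one_smul,
        Algebra.algebraMap_eq_smul_one, mul_smul_comm, mul_one, map_smul]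
    | add x y hx hy => simp only [mul_add, map_add, hx, hy]
  | add x y hx hy =>
    simp only [add_mul, map_add, hx, hy, LinearMap.add_apply, add_smul]
    abel
  | mul x y hx hy =>
    rw [mul_assoc, hx, hy, hx y, map_mul, map_add, LinearMap.add_apply, YDModule.act_mul,
      Bialgebra.counit_mul, map_smul, LinearMap.smul_apply, smul_add, mul_smul, add_assoc]

variable (A V)

/-- The square of the kernel of the projection to `A`, that is, the span of the elements `a x` with
`x` of degree at least two. -/
def projSq : Submodule ℂ (Free A V) :=
  LinearMap.ker (proj A V).toLinearMap * LinearMap.ker (proj A V).toLinearMap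

variable {A V}

lemma proj_of_mem_projSq {f : Free A V} (hf : f ∈ projSq A V) : proj A V f = 0 := by
  induction hf using Submodule.mul_induction_on' with
  | mem_mul_mem x hx y hy =>
    have hx : proj A V x = 0 := hx
    rw [map_mul, hx, zero_mul]
  | add x _ y _ hx hy => rw [map_add, hx, hy, add_zero]

lemma letter_of_mem_projSq {f : Free A V} (hf : f ∈ projSq A V) : letter A V f = 0 := by
  induction hf using Submodule.mul_induction_on' with
  | mem_mul_mem x hx y hy =>
    have hx : proj A V x = 0 := hx
    have hy : proj A V y = 0 := hy
    rw [letter_mul, counit_eq_proj, hx, hy]; simp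
  | add x _ y _ hx hy => rw [map_add, hx, hy, add_zero]

/-- The part of degree at most one of a tensor. -/
def lowPart : TensorAlgebra ℂ V →ₗ[ℂ] TensorAlgebra ℂ V :=
  (Algebra.linearMap ℂ (TensorAlgebra ℂ V)) ∘ₗ degZero.toLinearMap + TensorAlgebra.ι ℂ ∘ₗ degOne

lemma incl_mul_inr_sub_mem (a : A) (x : TensorAlgebra ℂ V) :
    incl A V a * Smash.inr _ _ (x - lowPart x) ∈ projSq A V := by
  induction x using tensor_induction with
  | one =>
    have : (1 : TensorAlgebra ℂ V) - lowPart 1 = 0 := by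
      rw [lowPart, LinearMap.add_apply, LinearMap.comp_apply, LinearMap.comp_apply, degOne_one,
        map_zero, AlgHom.toLinearMap_apply, map_one, Algebra.linearMap_apply, map_one, add_zero,
        sub_self]
    rw [this, map_zero, mul_zero]
    exact zero_mem _
  | cons θ x _ =>
    have h : TensorAlgebra.ι ℂ θ * x - lowPart (TensorAlgebra.ι ℂ θ * x) =
        TensorAlgebra.ι ℂ θ * (x - algebraMap ℂ _ (degZero x)) := by
      rw [lowPart, LinearMap.add_apply, LinearMap.comp_apply, LinearMap.comp_apply, degOne_cons,
        AlgHom.toLinearMap_apply, degZero_cons, map_zero, zero_add, mul_sub, map_smul,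
        Algebra.algebraMap_eq_smul_one, mul_smul_comm, mul_one]
    rw [h, map_mul, ← mul_assoc]
    apply Submodule.mul_mem_mul
    · change proj A V (incl A V a * Smash.inr _ _ _) = 0
      rw [map_mul, proj_inr, degZero_ι]; simp
    · change proj A V (Smash.inr _ _ _) = 0
      rw [proj_inr]; simp
  | add x y hx hy =>
    have : x + y - lowPart (x + y) = (x - lowPart x) + (y - lowPart y) := by
      rw [map_add]; abel
    rw [this, map_add, mul_add]; exact add_mem hx hy
  | smul c x hx =>
    rw [map_smul, ← smul_sub, map_smul, mul_smul_comm]; exact Submodule.smul_mem _ _ hx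

/-- The symmetrizer is the identity in degrees zero and one, so that the kernel of `id ⊗ Y` lies in
degrees at least two. -/
lemma mem_projSq_of_total {f : Free A V} (hf : total A V f = 0) : f ∈ projSq A V := by
  obtain ⟨u, rfl⟩ := (Smash.equivTensor _ _).surjective f
  rw [total_equivTensor] at hf
  have h1 : lowPart ∘ₗ symmetrizer A (V := V) = lowPart := by
    ext x; simp [lowPart, degZero_symmetrizer, degOne_symmetrizer]
  have h2 : LinearMap.lTensor A lowPart u = 0 := by
    rw [← h1, LinearMap.lTensor_comp, LinearMap.comp_apply, hf, map_zero]
  have h3 : ∀ u : A ⊗[ℂ] TensorAlgebra ℂ V, Smash.equivTensor (ComodAlg.self A)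
      (tensorModAlg A V) (u - LinearMap.lTensor A lowPart u) ∈ projSq A V := by
    intro u
    induction u with
    | zero => simp
    | add u v hu hv =>
      have : u + v - LinearMap.lTensor A lowPart (u + v) =
        (u - LinearMap.lTensor A lowPart u) + (v - LinearMap.lTensor A lowPart v) := by
        rw [map_add]; abel
      rw [this, map_add]; exact add_mem hu hv
    | tmul a x =>
      rw [LinearMap.lTensor_tmul, ← TensorProduct.tmul_sub, ← Smash.inl_mul_inr]
      exact incl_mul_inr_sub_mem a x
  have := h3 u
  rwa [h2, sub_zero] at this

/-- A functional that vanishes on the kernel of `id ⊗ Y` factors through `id ⊗ Y`. -/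
lemma exists_comp_total (α : Free A V →ₗ[ℂ] ℂ) (hα : ∀ g, total A V g = 0 → α g = 0) :
    ∃ α' : A ⊗[ℂ] TensorAlgebra ℂ V →ₗ[ℂ] ℂ, α' ∘ₗ total A V = α := by
  have : α ∈ LinearMap.range (total A V).dualMap := by
    rw [LinearMap.range_dualMap_eq_dualAnnihilator_ker, Submodule.mem_dualAnnihilator]
    exact fun g hg => hα g hg
  obtain ⟨α', h⟩ := this
  exact ⟨α', h⟩

/-- The kernel of `id ⊗ Y` is a coideal, because `id ⊗ Y` intertwines `φ` with a coproduct on its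
target. -/
lemma comul_of_total (f : Free A V) (hf : total A V f = 0) (α β : Free A V →ₗ[ℂ] ℂ)
    (hα : ∀ g, total A V g = 0 → α g = 0) (hβ : ∀ g, total A V g = 0 → β g = 0) :
    LinearMap.mul' ℂ ℂ (TensorProduct.map α β (comul f)) = 0 := by
  obtain ⟨α', rfl⟩ := exists_comp_total α hα
  obtain ⟨β', rfl⟩ := exists_comp_total β hβ
  rw [TensorProduct.map_comp, LinearMap.comp_apply, ← totalComul_total, hf]
  simp

lemma proj_antipode (f : Free A V) : proj A V (antipode ℂ f) = antipode ℂ (proj A V f) := by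
  have h : (Bialgebra.comulAlgHom ℂ A).comp (proj A V) =
      (Algebra.TensorProduct.map (proj A V) (proj A V)).comp
        (Bialgebra.comulAlgHom ℂ (Free A V)) := by
    refine hom_ext (fun a => ?_) (fun θ => ?_)
    · simp only [AlgHom.comp_apply, Bialgebra.comulAlgHom_apply, comul_incl, proj_incl]
      induction comul (R := ℂ) a with
      | zero => simp
      | add u v hu hv => rw [map_add, map_add, ← hu, ← hv]
      | tmul x y => simp [proj_incl]
    · simp only [AlgHom.comp_apply, Bialgebra.comulAlgHom_apply, comul_trans, proj_trans, map_add]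
      generalize YDModule.coact (A := A) θ = u
      induction u with
      | zero => simp [proj_trans]
      | add u v hu hv => rw [map_add, map_add, ← add_assoc, ← hu]; simpa [proj_trans] using hv
      | tmul x y => simp [proj_trans]
  exact (LinearMap.congr_fun (antipode_comp_bialgHom (proj A V)
    (fun f => DFunLike.congr_fun h f) (fun f => (counit_eq_proj f).symm)) f).symm

lemma antipode_mem_projSq {f : Free A V} (hf : f ∈ projSq A V) : antipode ℂ f ∈ projSq A V := by
  induction hf using Submodule.mul_induction_on' with
  | mem_mul_mem x hx y hy =>
    have hx : proj A V x = 0 := hx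
    have hy : proj A V y = 0 := hy
    rw [antipode_mul_antidistrib]
    refine Submodule.mul_mem_mul ?_ ?_ <;> change proj A V (antipode ℂ _) = 0
    · rw [proj_antipode, hy, map_zero]
    · rw [proj_antipode, hx, map_zero]
  | add x _ y _ hx hy => rw [map_add]; exact add_mem hx hy

/-- The kernel of `id ⊗ Y` is stable under the antipode: its image is a coideal without components
of degree zero and one. -/
lemma total_antipode {f : Free A V} (hf : total A V f = 0) : total A V (antipode ℂ f) = 0 := by
  refine total_eq_zero_of_mem ((LinearMap.ker (total A V)).map (antipode ℂ)) ?_ ?_ ?_ _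
    ⟨f, hf, rfl⟩
  · rintro _ ⟨g, hg, rfl⟩
    exact proj_of_mem_projSq (antipode_mem_projSq (mem_projSq_of_total hg))
  · rintro _ ⟨g, hg, rfl⟩
    exact letter_of_mem_projSq (antipode_mem_projSq (mem_projSq_of_total hg))
  · rintro _ ⟨g, hg, rfl⟩ α β hα hβ
    rw [comul_antipode]
    have := comul_of_total g hg (β ∘ₗ antipode ℂ) (α ∘ₗ antipode ℂ)
      (fun g hg => hβ _ ⟨g, hg, rfl⟩) (fun g hg => hα _ ⟨g, hg, rfl⟩)
    rw [← this]
    induction comul (R := ℂ) g with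
    | zero => simp
    | add u v hu hv => simp only [map_add, hu, hv]
    | tmul x y => simp [mul_comm]

variable (A V) in
/-- The kernel of `id ⊗ Y`. -/
def symIdeal : Ideal (Free A V) where
  carrier := {f | total A V f = 0}
  add_mem' := fun {x y} hx hy => by
    simp only [Set.mem_ofPred_eq, map_add] at hx hy ⊢; rw [hx, hy, add_zero]
  zero_mem' := by simp
  smul_mem' := fun c x hx => by
    simp only [Set.mem_ofPred_eq, smul_eq_mul, total_mul] at hx ⊢; rw [hx, map_zero]

lemma mem_symIdeal {f : Free A V} : f ∈ symIdeal A V ↔ total A V f = 0 := Iff.rfl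

section Star

variable [StarRing A] [HopfStarAlgebra A] [StarAddMonoid V] [StarModule ℂ V] [YDStarModule A V]

lemma proj_star (f : Free A V) : proj A V (star f) = star (proj A V f) := by
  induction f using Free.induction with
  | hincl a => rw [star_incl, proj_incl, proj_incl]
  | htrans θ => rw [star_trans, proj_trans, proj_trans, star_zero]
  | add x y hx hy => simp only [map_add, star_add, hx, hy]
  | mul x y hx hy => simp only [map_mul, star_mul, hx, hy]

lemma star_mem_projSq {f : Free A V} (hf : f ∈ projSq A V) : star f ∈ projSq A V := by
  induction hf using Submodule.mul_induction_on' with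
  | mem_mul_mem x hx y hy =>
    have hx : proj A V x = 0 := hx
    have hy : proj A V y = 0 := hy
    rw [star_mul]
    refine Submodule.mul_mem_mul ?_ ?_ <;> change proj A V (star _) = 0
    · rw [proj_star, hy, star_zero]
    · rw [proj_star, hx, star_zero]
  | add x _ y _ hx hy => rw [star_add]; exact add_mem hx hy

/-- The kernel of `id ⊗ Y` is stable under the involution: its image is a coideal without components
of degree zero and one. -/
lemma total_star {f : Free A V} (hf : total A V f = 0) : total A V (star f) = 0 := by
  let J : Submodule ℂ (Free A V) :=
    { carrier := {f | total A V (star f) = 0}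
      add_mem' := fun {x y} hx hy => by
        simp only [Set.mem_ofPred_eq, star_add, map_add] at hx hy ⊢; rw [hx, hy, add_zero]
      zero_mem' := by simp
      smul_mem' := fun c x hx => by
        simp only [Set.mem_ofPred_eq, star_smul, map_smul] at hx ⊢; rw [hx, smul_zero] }
  have hJ : ∀ g ∈ J, g ∈ projSq A V := by
    intro g hg
    have := star_mem_projSq (mem_projSq_of_total hg)
    rwa [star_star] at this
  refine total_eq_zero_of_mem J (fun g hg => proj_of_mem_projSq (hJ g hg))
    (fun g hg => letter_of_mem_projSq (hJ g hg)) ?_ _ (by simpa [J] using hf)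
  intro g hg α β hα hβ
  let conj (α : Free A V →ₗ[ℂ] ℂ) : Free A V →ₗ[ℂ] ℂ :=
    { toFun := fun x => star (α (star x))
      map_add' := by simp
      map_smul' := by simp }
  have := comul_of_total (star g) hg (conj α) (conj β)
    (fun x hx => by change star (α (star x)) = 0; rw [hα _ (by simpa [J] using hx), star_zero])
    (fun x hx => by change star (β (star x)) = 0; rw [hβ _ (by simpa [J] using hx), star_zero])
  rw [HopfStarAlgebra.comul_star] at this
  rw [← star_eq_zero, ← this]
  induction comul (R := ℂ) g with
  | zero => simp
  | add u v hu hv => simp only [map_add, star_add, hu, hv]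
  | tmul x y => simp [conj]

/-- The kernel of `id ⊗ Y` is a right ideal, being a left ideal stable under the involution. -/
lemma total_mul_eq_zero {f : Free A V} (hf : total A V f = 0) (g : Free A V) :
    total A V (f * g) = 0 := by
  rw [← star_star (f * g), star_mul]
  apply total_star
  rw [total_mul, total_star hf, map_zero]

instance : (symIdeal A V).IsTwoSided := ⟨fun {_} g hf => total_mul_eq_zero hf g⟩

omit [StarRing A] [HopfStarAlgebra A] [StarAddMonoid V] [StarModule ℂ V] [YDStarModule A V] in
lemma map_mkQ_comul (f : Free A V) (hf : total A V f = 0) : TensorProduct.map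
    ((symIdeal A V).restrictScalars ℂ).mkQ ((symIdeal A V).restrictScalars ℂ).mkQ
      (comul f) = 0 := by
  apply tensor_eq_zero
  intro l
  have hz : ∀ g, total A V g = 0 → ((symIdeal A V).restrictScalars ℂ).mkQ g = 0 :=
    fun g hg => (Submodule.Quotient.mk_eq_zero _).mpr hg
  by_contra h
  obtain ⟨m, hm, -⟩ := Submodule.exists_le_ker_of_notMem (K := ℂ)
    (p := (⊥ : Submodule ℂ (Free A V ⧸ (symIdeal A V).restrictScalars ℂ))) h
  apply hm
  have := comul_of_total f hf (l ∘ₗ ((symIdeal A V).restrictScalars ℂ).mkQ)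
    (m ∘ₗ ((symIdeal A V).restrictScalars ℂ).mkQ)
    (fun g hg => by rw [LinearMap.comp_apply, hz g hg, map_zero])
    (fun g hg => by rw [LinearMap.comp_apply, hz g hg, map_zero])
  rw [← this]
  induction comul (R := ℂ) f with
  | zero => simp
  | add u v hu hv => simp only [map_add, hu, hv]
  | tmul x y => simp

instance : (symIdeal A V).IsHopfIdeal ℂ where
  counit_eq_zero f hf := by
    rw [counit_eq_proj, proj_of_mem_projSq (mem_projSq_of_total hf), map_zero]
  map_mkQ_comul_eq_zero f hf := map_mkQ_comul f hf
  antipode_mem f hf := total_antipode hf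

end Star

end Ideal

end Free

/-! ### Existence of the affine extension -/

section EquivOfKer

variable {M N P : Type*} [AddCommGroup M] [Module ℂ M] [AddCommGroup N] [Module ℂ N]
  [AddCommGroup P] [Module ℂ P]

/-- The identification of the images of two surjective maps with the same kernel. -/
def equivOfKerEq (p : M →ₗ[ℂ] N) (q : M →ₗ[ℂ] P) (hp : Function.Surjective p)
    (hq : Function.Surjective q) (h : LinearMap.ker p = LinearMap.ker q) : N ≃ₗ[ℂ] P :=
  (p.quotKerEquivOfSurjective hp).symm ≪≫ₗ Submodule.quotEquivOfEq _ _ h ≪≫ₗ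
    q.quotKerEquivOfSurjective hq

lemma equivOfKerEq_apply (p : M →ₗ[ℂ] N) (q : M →ₗ[ℂ] P) (hp : Function.Surjective p)
    (hq : Function.Surjective q) (h : LinearMap.ker p = LinearMap.ker q) (m : M) :
    equivOfKerEq p q hp hq h (p m) = q m := by
  have : (p.quotKerEquivOfSurjective hp).symm (p m) = Submodule.Quotient.mk m := by
    rw [LinearEquiv.symm_apply_eq]; rfl
  simp only [equivOfKerEq, LinearEquiv.trans_apply, this]
  rfl

/-- The kernel of `id ⊗ f` is that of the quotient map `id ⊗ (N → N / ker f)`. -/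
lemma ker_lTensor_mkQ (f : N →ₗ[ℂ] P) : LinearMap.ker (LinearMap.lTensor M f) =
    LinearMap.ker (LinearMap.lTensor M (LinearMap.ker f).mkQ) := by
  have h : f = (LinearMap.ker f).liftQ f le_rfl ∘ₗ (LinearMap.ker f).mkQ := by ext; rfl
  have hi : Function.Injective ((LinearMap.ker f).liftQ f le_rfl) := by
    rw [← LinearMap.ker_eq_bot]; exact Submodule.ker_liftQ_eq_bot _ _ _ le_rfl
  conv_lhs => rw [h, LinearMap.lTensor_comp]
  exact LinearMap.ker_comp_of_ker_eq_bot _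
    (LinearMap.ker_eq_bot.mpr (Module.Flat.lTensor_preserves_injective_linearMap _ hi))

end EquivOfKer

namespace Free

variable {A V : Type*} [Ring A] [HopfAlgebra ℂ A] [AddCommGroup V] [Module ℂ V] [YDModule A V]
  [StarRing A] [HopfStarAlgebra A] [StarAddMonoid V] [StarModule ℂ V] [YDStarModule A V]

variable (A V) in
/-- The inclusion of `A`, as a homomorphism of bialgebras. -/
def inclBialg : A →ₐc[ℂ] Free A V :=
  .ofAlgHom (incl A V) (by ext a; exact counit_incl a) (by ext a; exact (comul_incl a).symm)

variable (A V) in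
/-- The quotient map `A ⊗ V^⊗ → (A # V^⊗) / ker (id ⊗ Y)`. -/
def toQuotient : A ⊗[ℂ] TensorAlgebra ℂ V →ₗ[ℂ] Free A V ⧸ symIdeal A V :=
  (Ideal.Quotient.mkₐ ℂ (symIdeal A V)).toLinearMap ∘ₗ (Smash.equivTensor _ _).toLinearMap

lemma toQuotient_surjective : Function.Surjective (toQuotient A V) :=
  Ideal.Quotient.mk_surjective.comp (Smash.equivTensor _ _).surjective

lemma ker_toQuotient : LinearMap.ker (LinearMap.lTensor A
    (LinearMap.ker (symmetrizer A (V := V))).mkQ) = LinearMap.ker (toQuotient A V) := by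
  rw [← ker_lTensor_mkQ]
  ext u
  rw [LinearMap.mem_ker, LinearMap.mem_ker, ← total_equivTensor, ← mem_symIdeal,
    ← Ideal.Quotient.eq_zero_iff_mem]
  rfl

end Free

/-- The affine extension is the quotient of the smash product `A # V^⊗` by the kernel of
`id ⊗ Y`. -/
lemma nonempty_affineExtension (A : Type u) (V : Type v) [Ring A] [HopfAlgebra ℂ A]
    [AddCommGroup V] [Module ℂ V] [YDModule A V] [StarRing A] [HopfStarAlgebra A]
    [StarAddMonoid V] [StarModule ℂ V] [YDStarModule A V] :
    Nonempty (AffineExtension.{u, v, max u v} A V) :=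
  letI := quotientStarRing (Free.symIdeal A V) (fun _ => Free.total_star)
  letI := quotient_hopfStarAlgebra (Free.symIdeal A V) (fun _ => Free.total_star)
  let p := Ideal.Quotient.mkₐ ℂ (Free.symIdeal A V)
  have hlift : ∀ x, TensorAlgebra.lift ℂ (p.toLinearMap ∘ₗ Free.trans A V) x =
      p (Smash.inr _ _ x) := by
    intro x
    rw [Free.inr_eq_lift, ← AlgHom.comp_apply]
    congr 1
    ext θ
    simp
  ⟨{carrier := Free A V ⧸ Free.symIdeal A V
    incl := (Bialgebra.Quotient.mkBialgHom (Free.symIdeal A V)).comp (Free.inclBialg A V)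
    trans := p.toLinearMap ∘ₗ Free.trans A V
    trans_mul_incl := fun θ a => by
      have := congrArg p (Free.trans_mul_incl θ a)
      rw [map_mul, conv_apply, algHom_prodMap] at this
      exact this
    equiv := equivOfKerEq (LinearMap.lTensor A (LinearMap.ker (symmetrizer A (V := V))).mkQ)
      (Free.toQuotient A V) (LinearMap.lTensor_surjective _ (Submodule.mkQ_surjective _))
      Free.toQuotient_surjective Free.ker_toQuotient
    equiv_tmul_mk := fun a x => by
      refine (equivOfKerEq_apply _ _ _ _ _ (a ⊗ₜ x)).trans ?_
      rw [hlift]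
      change p (Smash.equivTensor _ _ (a ⊗ₜ x)) = p _ * p _
      rw [← Smash.inl_mul_inr, map_mul]
      rfl
    star_incl := fun a => congrArg p (Free.star_incl a)
    star_trans := fun θ => congrArg p (Free.star_trans θ)
    comul_trans := fun θ => by
      change TensorProduct.map p.toLinearMap p.toLinearMap (comul (R := ℂ) (Free.trans A V θ)) = _
      rw [Free.comul_trans, map_add, ← LinearMap.comp_apply (TensorProduct.map _ _),
        ← TensorProduct.map_comp, TensorProduct.map_tmul]
      congr 1 }⟩

/-! ### Structure of an affine extension -/

namespace AffineExtension

variable {A V : Type*} [Ring A] [StarRing A] [HopfAlgebra ℂ A]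
  [AddCommGroup V] [Module ℂ V] [StarAddMonoid V] [YDModule A V]
  (E : AffineExtension A V)

/-- The inclusion of `A`, as a homomorphism of algebras. -/
def inclHom : A →ₐ[ℂ] E.carrier := (E.incl : A →ₐ[ℂ] E.carrier)

lemma trans_mul_inclHom (θ : V) (a : A) : E.trans θ * E.inclHom a =
    conv (Comod.self A) E.inclHom.toLinearMap (E.trans ∘ₗ YDModule.act θ) a :=
  E.trans_mul_incl θ a

lemma comul_inclHom (a : A) : comul (R := ℂ) (E.inclHom a) =
    TensorProduct.map E.inclHom.toLinearMap E.inclHom.toLinearMap (comul a) :=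
  (CoalgHomClass.map_comp_comul_apply E.incl a).symm

lemma counit_inclHom (a : A) : counit (R := ℂ) (E.inclHom a) = counit (R := ℂ) a :=
  CoalgHomClass.counit_comp_apply E.incl a

lemma comul_trans_eq (θ : V) : comul (R := ℂ) (E.trans θ) = affineMap E.inclHom E.trans E.trans θ :=
  E.comul_trans θ

@[simp] lemma sym_ι (θ : V) : E.sym (TensorAlgebra.ι ℂ θ) = E.trans θ :=
  TensorAlgebra.lift_ι_apply _ _

lemma sym_mul_inclHom (x : TensorAlgebra ℂ V) (a : A) : E.sym x * E.inclHom a =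
    conv (Comod.self A) E.inclHom.toLinearMap (E.sym.toLinearMap ∘ₗ tensorAct A V x) a :=
  tensor_rule (ComodAlg.self A) E.inclHom E.trans E.trans_mul_inclHom x a

@[elab_as_elim]
lemma ind_mul_sym {P : E.carrier → Prop} (h : ∀ a x, P (E.inclHom a * E.sym x))
    (add : ∀ x y, P x → P y → P (x + y)) (e : E.carrier) : P e := by
  obtain ⟨u, rfl⟩ := E.equiv.surjective e
  induction u with
  | zero => have := h 0 0; simpa using this
  | tmul a x =>
    obtain ⟨x, rfl⟩ := Submodule.Quotient.mk_surjective _ x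
    rw [E.equiv_tmul_mk]; exact h a x
  | add u v hu hv => rw [map_add]; exact add _ _ hu hv

@[elab_as_elim]
lemma induction {P : E.carrier → Prop} (hincl : ∀ a, P (E.inclHom a))
    (htrans : ∀ θ, P (E.trans θ)) (add : ∀ x y, P x → P y → P (x + y))
    (mul : ∀ x y, P x → P y → P (x * y)) (e : E.carrier) : P e := by
  induction e using E.ind_mul_sym with
  | h a x =>
    refine mul _ _ (hincl a) ?_
    induction x using TensorAlgebra.induction with
    | algebraMap c => rw [AlgHom.commutes, ← AlgHom.commutes E.inclHom]; exact hincl _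
    | ι θ => rw [sym_ι]; exact htrans θ
    | mul a b ha hb => rw [map_mul]; exact mul _ _ ha hb
    | add a b ha hb => rw [map_add]; exact add _ _ ha hb
  | add x y hx hy => exact add _ _ hx hy

lemma sym_eq_zero_iff (x : TensorAlgebra ℂ V) : E.sym x = 0 ↔ symmetrizer A x = 0 := by
  have h := E.equiv_tmul_mk 1 x
  rw [map_one, one_mul] at h
  change _ = E.sym x at h
  rw [← h, LinearEquiv.map_eq_zero_iff]
  constructor
  · intro hx
    have := congrArg (fun u => TensorProduct.lid ℂ _ (LinearMap.rTensor _ (counit (R := ℂ)) u)) hx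
    simp only [LinearMap.rTensor_tmul, TensorProduct.lid_tmul, Bialgebra.counit_one, one_smul,
      map_zero] at this
    exact (Submodule.Quotient.mk_eq_zero _).mp this
  · intro hx
    rw [(Submodule.Quotient.mk_eq_zero _).mpr hx, TensorProduct.tmul_zero]

section lift

variable {X : Type*} [Ring X] [Algebra ℂ X]

lemma hom_ext {f g : E.carrier →ₐ[ℂ] X} (h₁ : ∀ a, f (E.inclHom a) = g (E.inclHom a))
    (h₂ : ∀ θ, f (E.trans θ) = g (E.trans θ)) : f = g := by
  ext x
  induction x using E.induction with
  | hincl a => exact h₁ a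
  | htrans θ => exact h₂ θ
  | add x y hx hy => simp [hx, hy]
  | mul x y hx hy => simp [hx, hy]

/-- The homomorphism from `A # V^⊗`. -/
def ofFree : Free A V →ₐ[ℂ] E.carrier := Free.lift E.inclHom E.trans E.trans_mul_inclHom

lemma ofFree_apply (a : A) (x : TensorAlgebra ℂ V) :
    E.ofFree (Free.incl A V a * Smash.inr _ _ x) = E.inclHom a * E.sym x := by
  rw [map_mul, ofFree, Free.lift_incl, Free.lift_inr]; rfl

lemma ofFree_surjective : Function.Surjective E.ofFree := by
  intro e
  induction e using E.ind_mul_sym with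
  | h a x => exact ⟨_, E.ofFree_apply a x⟩
  | add x y hx hy =>
    obtain ⟨x, rfl⟩ := hx
    obtain ⟨y, rfl⟩ := hy
    exact ⟨x + y, map_add _ _ _⟩

variable (f : A →ₐ[ℂ] X) (t : V →ₗ[ℂ] X)
  (h : ∀ θ a, t θ * f a = conv (Comod.self A) f.toLinearMap (t ∘ₗ YDModule.act θ) a)
  (hk : ∀ x, symmetrizer A x = 0 → TensorAlgebra.lift ℂ t x = 0)

/-- The linear map `a x ↦ f(a) t(x)`. -/
def liftLinear : E.carrier →ₗ[ℂ] X :=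
  prodMap f.toLinearMap ((LinearMap.ker (symmetrizer A (V := V))).liftQ
    (TensorAlgebra.lift ℂ t).toLinearMap hk) ∘ₗ E.equiv.symm.toLinearMap

lemma liftLinear_ofFree (z : Free A V) : E.liftLinear f t hk (E.ofFree z) = Free.lift f t h z := by
  induction z using Smash.ind_tmul with
  | h a x =>
    change E.liftLinear f t hk (E.ofFree (Free.incl A V a * _)) =
      Free.lift f t h (Free.incl A V a * _)
    rw [ofFree_apply, map_mul (Free.lift f t h), Free.lift_incl, Free.lift_inr]
    have : E.inclHom a * E.sym x = E.equiv (a ⊗ₜ Submodule.Quotient.mk x) :=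
      (E.equiv_tmul_mk a x).symm
    rw [this, liftLinear, LinearMap.comp_apply, LinearEquiv.coe_coe, LinearEquiv.symm_apply_apply]
    rfl
  | add x y hx hy => simp only [map_add, hx, hy]

/-- The universal property of an affine extension. -/
def lift : E.carrier →ₐ[ℂ] X :=
  AlgHom.ofLinearMap (E.liftLinear f t hk)
    (by rw [← map_one E.ofFree, E.liftLinear_ofFree f t h, map_one])
    (by
      intro x y
      obtain ⟨x, rfl⟩ := E.ofFree_surjective x
      obtain ⟨y, rfl⟩ := E.ofFree_surjective y
      rw [← map_mul, E.liftLinear_ofFree f t h, E.liftLinear_ofFree f t h,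
        E.liftLinear_ofFree f t h, map_mul])

lemma lift_ofFree (z : Free A V) : E.lift f t h hk (E.ofFree z) = Free.lift f t h z :=
  E.liftLinear_ofFree f t h hk z

@[simp] lemma lift_inclHom (a : A) : E.lift f t h hk (E.inclHom a) = f a := by
  have := E.lift_ofFree f t h hk (Free.incl A V a)
  rwa [Free.lift_incl, ofFree, Free.lift_incl] at this

@[simp] lemma lift_trans (θ : V) : E.lift f t h hk (E.trans θ) = t θ := by
  have := E.lift_ofFree f t h hk (Free.trans A V θ)
  rwa [Free.lift_trans, ofFree, Free.lift_trans] at this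

end lift

lemma counit_trans (θ : V) : counit (R := ℂ) (E.trans θ) = 0 := by
  have h1 := Coalgebra.lTensor_counit_comul (R := ℂ) (E.trans θ)
  have h2 : ∀ u : V ⊗[ℂ] A, LinearMap.lTensor E.carrier counit
      (TensorProduct.map E.trans E.inclHom.toLinearMap u) =
      LinearMap.rTensor ℂ E.trans (LinearMap.lTensor V counit u) := by
    intro u
    induction u with
    | zero => simp
    | add u v hu hv => simp only [map_add, hu, hv]
    | tmul v a => simp [counit_inclHom]
  rw [comul_trans_eq, affineMap_apply, map_add, h2, YDModule.coact_counit, LinearMap.lTensor_tmul,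
    LinearMap.rTensor_tmul, add_eq_right] at h1
  have := congrArg (LinearMap.mul' ℂ ℂ ∘ₗ LinearMap.rTensor ℂ counit) h1
  simpa using this

lemma antipode_inclHom (a : A) :
    antipode ℂ (E.inclHom a) = E.inclHom (antipode ℂ a) :=
  LinearMap.congr_fun (antipode_comp_bialgHom E.inclHom E.comul_inclHom E.counit_inclHom) a

lemma antipode_trans (θ : V) : antipode ℂ (E.trans θ) =
    -conv (YDModule.comod A V) E.trans (E.inclHom.toLinearMap ∘ₗ antipode ℂ) θ :=
  LinearMap.congr_fun (antipode_comp_trans E.inclHom E.trans E.comul_trans_eq E.counit_trans) θ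

lemma star_inclHom (a : A) : star (E.inclHom a) = E.inclHom (star a) := E.star_incl a

variable [StarModule ℂ V] in
/-- The canonical map `V^⊗ → S(V)` is compatible with the involutions. -/
lemma sym_star (x : TensorAlgebra ℂ V) : E.sym (star x) = star (E.sym x) := by
  induction x using tensor_induction with
  | one => simp
  | cons θ x hx => rw [star_mul, map_mul, hx, tensor_star_ι, sym_ι, map_mul, star_mul, sym_ι,
      E.star_trans]
  | add x y hx hy => simp only [star_add, map_add, hx, hy]
  | smul c x hx => simp only [star_smul, map_smul, hx]

end AffineExtension

/-! ### The adjoint action along a homomorphism from a Hopf algebra -/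

section Adjoint

variable {B K : Type*} [Ring B] [HopfAlgebra ℂ B] [Ring K] [Algebra ℂ K] (j : B →ₐ[ℂ] K)

/-- The adjoint action `x ◁ b = j(κ(b⁽¹⁾)) x j(b⁽²⁾)`. -/
def adjointAct : K →ₗ[ℂ] B →ₗ[ℂ] K where
  toFun x := conv (Comod.self B) (j.toLinearMap ∘ₗ antipode ℂ)
    (LinearMap.mulLeft ℂ x ∘ₗ j.toLinearMap)
  map_add' x y := by
    rw [← conv_add_right]; congr 1; ext; simp [add_mul]
  map_smul' c x := by
    ext b
    have : LinearMap.mulLeft ℂ (c • x) ∘ₗ j.toLinearMap =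
      c • (LinearMap.mulLeft ℂ x ∘ₗ j.toLinearMap) := by ext; simp
    simp [this, conv_apply, prodMap_smul_right]

lemma adjointAct_eq (x : K) : adjointAct j x = conv (Comod.self B) (j.toLinearMap ∘ₗ antipode ℂ)
    (LinearMap.mulLeft ℂ x ∘ₗ j.toLinearMap) := rfl

lemma adjointAct_one_right (x : K) : adjointAct j x 1 = x := by
  simp [adjointAct_eq, conv_apply, Algebra.TensorProduct.one_def, antipode_one]

lemma adjointAct_mul (x : K) (b c : B) :
    adjointAct j x (b * c) = adjointAct j (adjointAct j x b) c := by
  have h : ∀ u w : B ⊗[ℂ] B, prodMap (j.toLinearMap ∘ₗ antipode ℂ)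
      (LinearMap.mulLeft ℂ x ∘ₗ j.toLinearMap) (u * w) =
      prodMap (j.toLinearMap ∘ₗ antipode ℂ) (LinearMap.mulLeft ℂ (prodMap
        (j.toLinearMap ∘ₗ antipode ℂ) (LinearMap.mulLeft ℂ x ∘ₗ j.toLinearMap) u) ∘ₗ
        j.toLinearMap) w := by
    intro u w
    induction w with
    | zero => simp
    | add w w' hw hw' => simp only [mul_add, map_add, hw, hw']
    | tmul c c' =>
      induction u with
      | zero => simp
      | add u u' hu hu' =>
        simp only [prodMap_tmul, LinearMap.comp_apply, LinearMap.mulLeft_apply] at hu hu' ⊢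
        simp only [add_mul, mul_add, map_add, hu, hu']
      | tmul b b' => simp [antipode_mul_antidistrib, mul_assoc]
  simp only [adjointAct_eq, conv_apply, Comod.self_δ, Bialgebra.comul_mul, h]

lemma adjointAct_one_left : adjointAct j 1 = convUnit B K := by
  rw [adjointAct_eq, ← antipode_conv j]
  congr 1
  ext; simp

/-- `x j(b) = j(b⁽¹⁾) (x ◁ b⁽²⁾)`. -/
lemma conv_adjointAct (x : K) : conv (Comod.self B) j.toLinearMap (adjointAct j x) =
    LinearMap.mulLeft ℂ x ∘ₗ j.toLinearMap := by
  rw [adjointAct_eq, ← conv_assoc, conv_antipode, convUnit_conv]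

lemma adjointAct_mul_left (x y : K) :
    adjointAct j (x * y) = conv (Comod.self B) (adjointAct j x) (adjointAct j y) := by
  rw [adjointAct_eq, adjointAct_eq j x, conv_assoc, conv_mulLeft, conv_adjointAct]
  congr 1
  ext; simp

lemma adjointAct_comp {A : Type*} [Ring A] [HopfAlgebra ℂ A] (i : A →ₐ[ℂ] B)
    (hi : ∀ a, comul (R := ℂ) (i a) = TensorProduct.map i.toLinearMap i.toLinearMap (comul a))
    (hεi : ∀ a, counit (R := ℂ) (i a) = counit (R := ℂ) a) (x : K) :
    adjointAct j x ∘ₗ i.toLinearMap = adjointAct (j.comp i) x := by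
  rw [adjointAct_eq, conv_comp (Comod.self B) (Comod.self A) i.toLinearMap i.toLinearMap hi,
    LinearMap.comp_assoc, antipode_comp_bialgHom i hi hεi]
  rfl

end Adjoint

/-! ### Algebras on which the affine extension acts -/

/-- An algebra `X` with an action of `A` and a map `V → X` compatible with the actions, which
factors through the braided symmetric algebra. -/
structure AffineDatum (A V X : Type*) [Ring A] [HopfAlgebra ℂ A] [AddCommGroup V] [Module ℂ V]
    [YDModule A V] [Ring X] [Algebra ℂ X] where
  /-- The action of `A`. -/
  ρ : ModAlg A X
  /-- The map from `V`. -/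
  t : V →ₗ[ℂ] X
  act_t : ∀ θ a, ρ.act (t θ) a = t (YDModule.act θ a)
  lift_eq_zero : ∀ x, symmetrizer A x = 0 → TensorAlgebra.lift ℂ t x = 0

namespace AffineDatum

variable {A V X : Type*} [Ring A] [HopfAlgebra ℂ A] [AddCommGroup V] [Module ℂ V]
    [YDModule A V] [Ring X] [Algebra ℂ X] (P : AffineDatum A V X)

/-- The smash product `A # X`. -/
abbrev Cross : Type _ := Smash (ComodAlg.self A) P.ρ

/-- The inclusion of `X`. -/
abbrev inX : X →ₐ[ℂ] P.Cross := Smash.inr (ComodAlg.self A) P.ρ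

lemma inX_injective : Function.Injective P.inX := by
  intro x y h
  have := congrArg (Smash.projR _ P.ρ (counit (R := ℂ))) h
  rwa [Smash.projR_inr _ _ _ Bialgebra.counit_one, Smash.projR_inr _ _ _ Bialgebra.counit_one]
    at this

variable [StarRing A] [StarAddMonoid V] (E : AffineExtension A V)

/-- The homomorphism `Ã → A # X`. -/
def hom : E.carrier →ₐ[ℂ] P.Cross :=
  E.lift (Smash.inl _ P.ρ) (P.inX.toLinearMap ∘ₗ P.t)
    (by
      intro θ a
      rw [LinearMap.comp_apply, AlgHom.toLinearMap_apply, Smash.inr_mul_inl]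
      congr 2
      ext b
      simp [P.act_t])
    (by
      intro x hx
      have : TensorAlgebra.lift ℂ (P.inX.toLinearMap ∘ₗ P.t) =
        P.inX.comp (TensorAlgebra.lift ℂ P.t) := by ext; simp
      rw [this, AlgHom.comp_apply, P.lift_eq_zero x hx, map_zero])

@[simp] lemma hom_inclHom (a : A) : P.hom E (E.inclHom a) = Smash.inl _ P.ρ a :=
  E.lift_inclHom _ _ _ _ a

@[simp] lemma hom_trans (θ : V) : P.hom E (E.trans θ) = P.inX (P.t θ) :=
  E.lift_trans _ _ _ _ θ

lemma hom_sym (x : TensorAlgebra ℂ V) :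
    P.hom E (E.sym x) = P.inX (TensorAlgebra.lift ℂ P.t x) := by
  rw [← AlgHom.comp_apply, ← AlgHom.comp_apply]
  congr 1
  ext θ
  simp

lemma adjointAct_inclHom (x : X) (a : A) :
    adjointAct (P.hom E) (P.inX x) (E.inclHom a) = P.inX (P.ρ.act x a) := by
  have h := adjointAct_comp (P.hom E) E.inclHom E.comul_inclHom E.counit_inclHom (P.inX x)
  have h2 : (P.hom E).comp E.inclHom = Smash.inl _ P.ρ := by ext a; simp
  rw [h2] at h
  refine (LinearMap.congr_fun h a).trans ?_
  exact LinearMap.congr_fun (adjoint_eq _ _ _ (Smash.inr_mul_inl (ComodAlg.self A) P.ρ x)) a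

/-- On the generators, `x ∘ θ = x θ - θ₀ (x ∘ θ₁)`. -/
lemma adjointAct_trans (x : X) (θ : V) :
    adjointAct (P.hom E) (P.inX x) (E.trans θ) =
      P.inX (x * P.t θ - prodMap P.t (P.ρ.act x) (YDModule.coact θ)) := by
  have h1 : (P.hom E).toLinearMap ∘ₗ antipode ℂ ∘ₗ E.trans =
      -conv (YDModule.comod A V) (P.inX.toLinearMap ∘ₗ P.t)
        ((Smash.inl (ComodAlg.self A) P.ρ).toLinearMap ∘ₗ antipode ℂ) := by
    have h2 : (P.hom E).toLinearMap ∘ₗ E.trans = P.inX.toLinearMap ∘ₗ P.t := by ext; simp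
    have h3 : (P.hom E).toLinearMap ∘ₗ E.inclHom.toLinearMap ∘ₗ antipode ℂ =
        (Smash.inl (ComodAlg.self A) P.ρ).toLinearMap ∘ₗ antipode ℂ := by ext; simp
    have h4 : antipode ℂ ∘ₗ E.trans = -conv (YDModule.comod A V) E.trans
        (E.inclHom.toLinearMap ∘ₗ antipode ℂ) := by
      ext θ; exact E.antipode_trans θ
    rw [h4, LinearMap.comp_neg, algHom_conv, h2, h3]
  have h5 : (LinearMap.mulLeft ℂ (P.inX x) ∘ₗ (P.hom E).toLinearMap) ∘ₗ E.inclHom.toLinearMap =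
      LinearMap.mulLeft ℂ (P.inX x) ∘ₗ (Smash.inl (ComodAlg.self A) P.ρ).toLinearMap := by
    ext; simp
  have h6 := adjoint_eq (Smash.inl (ComodAlg.self A) P.ρ) (P.inX x) _
    (Smash.inr_mul_inl (ComodAlg.self A) P.ρ x)
  rw [adjointAct_eq, conv_apply, Comod.self_δ, E.comul_trans_eq, affineMap_apply, map_add,
    prodMap_map, LinearMap.comp_assoc, h1, h5]
  have h7 := congrArg (fun f => conv (YDModule.comod A V) (P.inX.toLinearMap ∘ₗ P.t) f θ) h6
  simp only [← conv_assoc] at h7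
  rw [prodMap_neg_left, LinearMap.neg_apply]
  simp only [conv_apply, YDModule.comod_δ] at h7 ⊢
  rw [h7, ← algHom_prodMap]
  simp [antipode_one, sub_eq_add_neg]

/-- The adjoint action preserves `X`. -/
lemma exists_inX_eq (b : E.carrier) (x : X) :
    ∃ y, P.inX y = adjointAct (P.hom E) (P.inX x) b := by
  induction b using E.induction generalizing x with
  | hincl a => exact ⟨_, (P.adjointAct_inclHom E x a).symm⟩
  | htrans θ => exact ⟨_, (P.adjointAct_trans E x θ).symm⟩
  | add b c hb hc =>
    obtain ⟨y, hy⟩ := hb x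
    obtain ⟨z, hz⟩ := hc x
    exact ⟨y + z, by rw [map_add, map_add, hy, hz]⟩
  | mul b c hb hc =>
    obtain ⟨y, hy⟩ := hb x
    obtain ⟨z, hz⟩ := hc y
    exact ⟨z, by rw [adjointAct_mul, ← hy, hz]⟩

/-- The action of the affine extension on `X`, by the adjoint action inside `A # X`. -/
def act : X →ₗ[ℂ] E.carrier →ₗ[ℂ] X :=
  (adjointAct (P.hom E) ∘ₗ P.inX.toLinearMap).compr₂ (Smash.projR _ P.ρ (counit (R := ℂ)))

lemma inX_act (x : X) (b : E.carrier) :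
    P.inX (P.act E x b) = adjointAct (P.hom E) (P.inX x) b := by
  obtain ⟨y, hy⟩ := P.exists_inX_eq E b x
  have : P.act E x b = Smash.projR _ P.ρ (counit (R := ℂ)) (adjointAct (P.hom E) (P.inX x) b) := rfl
  rw [this, ← hy, Smash.projR_inr _ _ _ Bialgebra.counit_one]

lemma inX_comp_act (x : X) :
    P.inX.toLinearMap ∘ₗ P.act E x = adjointAct (P.hom E) (P.inX x) := by
  ext b; exact P.inX_act E x b

lemma act_inclHom (x : X) (a : A) : P.act E x (E.inclHom a) = P.ρ.act x a :=
  P.inX_injective (by rw [inX_act, adjointAct_inclHom])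

lemma act_trans (x : X) (θ : V) : P.act E x (E.trans θ) =
    x * P.t θ - prodMap P.t (P.ρ.act x) (YDModule.coact θ) :=
  P.inX_injective (by rw [inX_act, adjointAct_trans])

/-- The action of the affine extension on `X`, as a module algebra. -/
def modAlg : ModAlg E.carrier X where
  act := P.act E
  act_one x := P.inX_injective (by rw [inX_act, adjointAct_one_right])
  act_mul x b c := P.inX_injective (by rw [inX_act, inX_act, inX_act, adjointAct_mul])
  mul_act x y := by
    ext b
    apply P.inX_injective
    have := LinearMap.congr_fun (algHom_conv (Comod.self E.carrier) P.inX (P.act E x) (P.act E y)) b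
    rw [inX_act, map_mul, adjointAct_mul_left, ← inX_comp_act, ← inX_comp_act, ← this]
    rfl
  one_act := by
    ext b
    apply P.inX_injective
    rw [inX_act, map_one, adjointAct_one_left, ← algHom_convUnit P.inX]
    rfl

end AffineDatum

/-! ### The adjoint action of the braided symmetric algebra -/

section Shuffle

variable {A V X Y : Type*} [Ring A] [HopfAlgebra ℂ A] [AddCommGroup V] [Module ℂ V] [YDModule A V]
  [Ring X] [Algebra ℂ X] [Ring Y] [Algebra ℂ Y]

lemma coactMap_tensor_ι (t : V →ₗ[ℂ] X) (j : A →ₐ[ℂ] Y) (θ : V) :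
    coactMap (tensorComod A V) (TensorAlgebra.lift ℂ t) j (TensorAlgebra.ι ℂ θ) =
      TensorProduct.map t j.toLinearMap (YDModule.coact θ) := by
  rw [coactMap_apply, tensorComod_δ, tensorCoact_ι]
  induction YDModule.coact (A := A) θ with
  | zero => simp
  | add u v hu hv => simp only [map_add, hu, hv]
  | tmul x y => simp

lemma conv_coactMap_right {H : Type*} [Ring H] [Algebra ℂ H] (D : ComodAlg A H) (i : H →ₐ[ℂ] X)
    (j : A →ₐ[ℂ] Y) (f : A →ₗ[ℂ] Y) (y : Y)
    (h : ∀ a, y * j a = conv (Comod.self A) j.toLinearMap f a) :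
    conv D.toComod (coactMap D i j).toLinearMap
      ((Algebra.TensorProduct.includeRight : Y →ₐ[ℂ] X ⊗[ℂ] Y).toLinearMap ∘ₗ f) =
      LinearMap.mulLeft ℂ (1 ⊗ₜ y) ∘ₗ (coactMap D i j).toLinearMap := by
  have h2 : conv (Comod.self A)
      ((Algebra.TensorProduct.includeRight.comp j : A →ₐ[ℂ] X ⊗[ℂ] Y)).toLinearMap
      ((Algebra.TensorProduct.includeRight : Y →ₐ[ℂ] X ⊗[ℂ] Y).toLinearMap ∘ₗ f) =
      LinearMap.mulLeft ℂ (1 ⊗ₜ y) ∘ₗ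
        ((Algebra.TensorProduct.includeRight.comp j : A →ₐ[ℂ] X ⊗[ℂ] Y)).toLinearMap := by
    ext a
    have := congrArg (Algebra.TensorProduct.includeRight : Y →ₐ[ℂ] X ⊗[ℂ] Y) (h a)
    rw [conv_apply, algHom_prodMap, map_mul] at this
    exact this.symm
  rw [coactMap_eq_conv, conv_assoc, h2, conv_mulLeft_right]
  intro a; simp

/-- The homomorphism with `θ ↦ 1 ⊗ s(θ) + t(θ₀) ⊗ j(θ₁)`, in terms of the shuffle coproduct. -/
lemma lift_affineMap (j : A →ₐ[ℂ] Y) (t : V →ₗ[ℂ] X) (s : V →ₗ[ℂ] Y)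
    (hs : ∀ m a, s m * j a = conv (Comod.self A) j.toLinearMap (s ∘ₗ YDModule.act m) a)
    (z : TensorAlgebra ℂ V) : TensorAlgebra.lift ℂ (affineMap j t s) z =
      prodMap (coactMap (tensorComod A V) (TensorAlgebra.lift ℂ t) j).toLinearMap
        ((Algebra.TensorProduct.includeRight : Y →ₐ[ℂ] X ⊗[ℂ] Y).toLinearMap ∘ₗ
          (TensorAlgebra.lift ℂ s).toLinearMap) (shuffleCoproduct A z) := by
  induction z using tensor_induction with
  | one => simp [shuffleCoproduct, Algebra.TensorProduct.one_def]
  | add x y hx hy => simp only [map_add, hx, hy]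
  | smul c x hx => simp only [map_smul, hx]
  | cons θ x hx =>
    rw [map_mul, TensorAlgebra.lift_ι_apply, hx, shuffleCoproduct, fold_cons, ← shuffleCoproduct]
    generalize shuffleCoproduct A x = u
    simp only [LinearMap.mk₂_apply, map_add]
    induction u with
    | zero => simp
    | add u v hu hv => simp only [map_add, mul_add, hu, hv]; abel
    | tmul a y =>
      have h1 := LinearMap.congr_fun (conv_coactMap_right (tensorComod A V)
        (TensorAlgebra.lift ℂ t) j _ (s θ) (hs θ)) a
      have h2 : ∀ v : TensorAlgebra ℂ V ⊗[ℂ] A,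
          prodMap (coactMap (tensorComod A V) (TensorAlgebra.lift ℂ t) j).toLinearMap
          ((Algebra.TensorProduct.includeRight : Y →ₐ[ℂ] X ⊗[ℂ] Y).toLinearMap ∘ₗ
            (TensorAlgebra.lift ℂ s).toLinearMap)
          (LinearMap.lTensor (TensorAlgebra ℂ V)
            (LinearMap.mul' ℂ (TensorAlgebra ℂ V) ∘ₗ
              LinearMap.rTensor (TensorAlgebra ℂ V) (actι A θ))
            (TensorProduct.assoc ℂ _ A _ (v ⊗ₜ y))) =
          prodMap (coactMap (tensorComod A V) (TensorAlgebra.lift ℂ t) j).toLinearMap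
            ((Algebra.TensorProduct.includeRight : Y →ₐ[ℂ] X ⊗[ℂ] Y).toLinearMap ∘ₗ
              s ∘ₗ YDModule.act θ) v * (1 ⊗ₜ TensorAlgebra.lift ℂ s y) := by
        intro v
        induction v with
        | zero => simp
        | add u v hu hv => simp only [map_add, add_mul, TensorProduct.add_tmul, hu, hv]
        | tmul b c => simp [actι, mul_assoc]
      have h3 : braidPast A θ (a ⊗ₜ y) = LinearMap.lTensor (TensorAlgebra ℂ V)
            (LinearMap.mul' ℂ (TensorAlgebra ℂ V) ∘ₗ
              LinearMap.rTensor (TensorAlgebra ℂ V) (actι A θ))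
            (TensorProduct.assoc ℂ _ A _ (tensorCoact A a ⊗ₜ y)) := rfl
      rw [conv_apply, tensorComod_δ] at h1
      rw [h3, h2, h1, affineMap_apply, ← coactMap_tensor_ι]
      simp only [LinearMap.rTensor_tmul, prodMap_tmul, LinearMap.mul_apply',
        AlgHom.toLinearMap_apply, map_mul, LinearMap.comp_apply, add_mul, mul_assoc,
        LinearMap.mulLeft_apply, Algebra.TensorProduct.includeRight_apply]
      abel

end Shuffle

section Reverse

variable {A V : Type*} [Ring A] [HopfAlgebra ℂ A] [AddCommGroup V] [Module ℂ V] [YDModule A V]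

lemma braidedReverse_one : braidedReverse A (1 : TensorAlgebra ℂ V) = 1 := by
  simp [braidedReverse]

lemma braidedReverse_cons' (θ : V) (x : TensorAlgebra ℂ V) :
    braidedReverse A (TensorAlgebra.ι ℂ θ * x) =
      prodMap LinearMap.id (actι A θ) (tensorCoact A (braidedReverse A x)) := by
  rw [braidedReverse, fold_cons, ← braidedReverse, LinearMap.mk₂_apply]
  induction tensorCoact A (braidedReverse A x) with
  | zero => simp
  | add u v hu hv => simp only [map_add, hu, hv]
  | tmul a b => simp

lemma coact_signMap (x : TensorAlgebra ℂ V) : tensorCoact A (signMap x) =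
    LinearMap.rTensor A signMap.toLinearMap (tensorCoact A x) := by
  have : (tensorCoact A).comp signMap =
      (Algebra.TensorProduct.map signMap (AlgHom.id ℂ A)).comp (tensorCoact A (V := V)) := by
    ext θ
    simp only [signMap, AlgHom.toLinearMap_apply, LinearMap.comp_apply, AlgHom.comp_apply,
      TensorAlgebra.lift_ι_apply, LinearMap.neg_apply, map_neg, tensorCoact_ι]
    induction YDModule.coact (A := A) θ with
    | zero => simp
    | add u v hu hv => simp only [map_add, neg_add, hu, hv]
    | tmul a b => simp [TensorProduct.neg_tmul]
  exact DFunLike.congr_fun this x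

lemma signMap_cons (θ : V) (x : TensorAlgebra ℂ V) :
    signMap (TensorAlgebra.ι ℂ θ * x) = -(TensorAlgebra.ι ℂ θ * signMap x) := by
  simp [signMap]

lemma rTensor_coact_eq_conv {X : Type*} [Ring X] [Algebra ℂ X] {C M : Type*} [AddCommGroup M]
    [Module ℂ M] [Ring C] [HopfAlgebra ℂ C] (D : Comod C M) (f : M →ₗ[ℂ] X) :
    LinearMap.rTensor C f ∘ₗ D.δ = conv D
      ((Algebra.TensorProduct.includeLeft : X →ₐ[ℂ] X ⊗[ℂ] C).toLinearMap ∘ₗ f)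
      (Algebra.TensorProduct.includeRight : C →ₐ[ℂ] X ⊗[ℂ] C).toLinearMap := by
  ext m
  rw [LinearMap.comp_apply, conv_apply]
  induction D.δ m with
  | zero => simp
  | add u v hu hv => simp only [map_add, hu, hv]
  | tmul a b => simp

/-- The braided inverse intertwines the coactions. -/
lemma coact_braidedReverse (x : TensorAlgebra ℂ V) : tensorCoact A (braidedReverse A x) =
    LinearMap.rTensor A (braidedReverse A) (tensorCoact A x) := by
  induction x using tensor_induction with
  | one => simp [braidedReverse_one, Algebra.TensorProduct.one_def]
  | add x y hx hy => simp only [map_add, hx, hy]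
  | smul c x hx => simp only [map_smul, hx]
  | cons θ x hx =>
    let D := (tensorComod A V).toComod
    let L : TensorAlgebra ℂ V →ₐ[ℂ] TensorAlgebra ℂ V ⊗[ℂ] A := Algebra.TensorProduct.includeLeft
    let R : A →ₐ[ℂ] TensorAlgebra ℂ V ⊗[ℂ] A := Algebra.TensorProduct.includeRight
    let G (u : V ⊗[ℂ] A) : A →ₗ[ℂ] TensorAlgebra ℂ V ⊗[ℂ] A :=
      LinearMap.rTensor A (TensorAlgebra.ι ℂ) ∘ₗ
        TensorProduct.map₂ YDModule.act (LinearMap.mul ℂ A) u ∘ₗ comul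
    have hD : (tensorCoact A).toLinearMap = conv D L.toLinearMap R.toLinearMap := by
      have := rTensor_coact_eq_conv D LinearMap.id
      rwa [LinearMap.rTensor_id, LinearMap.id_comp] at this
    have hG : conv (Comod.self A) R.toLinearMap ((tensorCoact A).toLinearMap ∘ₗ actι A θ) =
        G (YDModule.coact θ) := by
      have h1 := conv_coact_act (TensorAlgebra.ι ℂ) (AlgHom.id ℂ A) θ
      have h2 : (tensorCoact A).toLinearMap ∘ₗ actι A θ =
        (TensorProduct.map (TensorAlgebra.ι ℂ) (AlgHom.id ℂ A).toLinearMap ∘ₗ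
          YDModule.coact) ∘ₗ YDModule.act θ := by
        ext a; exact tensorCoact_ι A _
      rw [h2]
      exact h1
    have hl : tensorCoact A (braidedReverse A (TensorAlgebra.ι ℂ θ * x)) =
        conv D L.toLinearMap (G (YDModule.coact θ)) (braidedReverse A x) := by
      rw [braidedReverse_cons', algHom_prodMap, ← hG, ← conv_assoc, ← hD]
      rfl
    have hr : ∀ u : V ⊗[ℂ] A, LinearMap.rTensor A (braidedReverse A)
        (LinearMap.rTensor A (TensorAlgebra.ι ℂ) u * tensorCoact A x) =
        conv D L.toLinearMap (G u) (braidedReverse A x) := by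
      intro u
      induction u with
      | zero => simp [G, conv_zero_right]
      | add u v hu hv =>
        have : G (u + v) = G u + G v := by simp [G, LinearMap.comp_add, LinearMap.add_comp]
        simp only [map_add, add_mul, hu, hv, this, conv_add_right, LinearMap.add_apply]
      | tmul m c =>
        have h1 : G (m ⊗ₜ c) = conv (Comod.self A) (L.toLinearMap ∘ₗ actι A m)
            (LinearMap.mulLeft ℂ (1 ⊗ₜ c) ∘ₗ R.toLinearMap) := by
          ext a
          simp only [G, LinearMap.comp_apply, conv_apply, Comod.self_δ]
          induction comul (R := ℂ) a with
          | zero => simp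
          | add u v hu hv => simp only [map_add, hu, hv]
          | tmul x y => simp [L, R, actι]
        have h2 : conv D L.toLinearMap (L.toLinearMap ∘ₗ actι A m) =
            L.toLinearMap ∘ₗ conv D LinearMap.id (actι A m) := by
          rw [algHom_conv]; rfl
        have h3 : ∀ v : TensorAlgebra ℂ V ⊗[ℂ] A, LinearMap.rTensor A (braidedReverse A)
            ((TensorAlgebra.ι ℂ m ⊗ₜ c) * v) =
            prodMap (L.toLinearMap ∘ₗ conv D LinearMap.id (actι A m))
              (LinearMap.mulLeft ℂ (1 ⊗ₜ c) ∘ₗ R.toLinearMap)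
              (LinearMap.rTensor A (braidedReverse A) v) := by
          intro v
          induction v with
          | zero => simp
          | add u v hu hv => simp only [map_add, mul_add, hu, hv]
          | tmul a b => simp [L, R, D, braidedReverse_cons', conv_apply]
        rw [h1, ← conv_assoc, h2, LinearMap.rTensor_tmul, h3, ← hx]
        rfl
    rw [hl, map_mul, tensorCoact_ι, hr]

lemma braidedReverse_cons (θ : V) (x : TensorAlgebra ℂ V) :
    braidedReverse A (TensorAlgebra.ι ℂ θ * x) =
      conv (tensorComod A V).toComod (braidedReverse A) (actι A θ) x := by
  rw [braidedReverse_cons', coact_braidedReverse, prodMap_rTensor]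
  rfl

end Reverse

namespace AffineExtension

variable {A V : Type*} [Ring A] [StarRing A] [HopfAlgebra ℂ A]
  [AddCommGroup V] [Module ℂ V] [StarAddMonoid V] [YDModule A V] (E : AffineExtension A V)

lemma comul_sym (x : TensorAlgebra ℂ V) : comul (R := ℂ) (E.sym x) =
    TensorAlgebra.lift ℂ (affineMap E.inclHom E.trans E.trans) x := by
  have : (Bialgebra.comulAlgHom ℂ E.carrier).comp E.sym =
      TensorAlgebra.lift ℂ (affineMap E.inclHom E.trans E.trans) := by
    ext θ
    simp [E.comul_trans_eq]
  exact DFunLike.congr_fun this x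

/-- The antipode on the braided symmetric algebra:
`κ(x) = (-1)^{deg x} I(x₀) κ(x₁)`. -/
lemma antipode_sym (x : TensorAlgebra ℂ V) : antipode ℂ (E.sym x) =
    conv (tensorComod A V).toComod
      (E.sym.toLinearMap ∘ₗ braidedReverse A ∘ₗ signMap.toLinearMap)
      (E.inclHom.toLinearMap ∘ₗ antipode ℂ) x := by
  let D := (tensorComod A V).toComod
  let F := E.sym.toLinearMap ∘ₗ braidedReverse A ∘ₗ signMap.toLinearMap
  let k := E.inclHom.toLinearMap ∘ₗ antipode ℂ
  have hF : ∀ (θ : V) (x : TensorAlgebra ℂ V), F (TensorAlgebra.ι ℂ θ * x) =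
      -conv D F (E.trans ∘ₗ YDModule.act θ) x := by
    intro θ x
    have h1 : E.sym.toLinearMap ∘ₗ actι A θ = E.trans ∘ₗ YDModule.act θ := by
      ext a; exact E.sym_ι _
    have h2 := LinearMap.congr_fun (algHom_conv D E.sym (braidedReverse A) (actι A θ)) (signMap x)
    have h3 := braidedReverse_cons (A := A) θ (signMap x)
    rw [h1, conv_apply] at h2
    simp only [F, LinearMap.comp_apply, AlgHom.toLinearMap_apply, signMap_cons, map_neg, h3] at h2 ⊢
    rw [h2, tensorComod_δ, coact_signMap, prodMap_rTensor]
    rfl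
  induction x using tensor_induction with
  | one => simp [conv_apply, Algebra.TensorProduct.one_def, braidedReverse_one, antipode_one]
  | add x y hx hy => simp only [map_add, hx, hy]
  | smul c x hx => simp only [map_smul, hx]
  | cons θ x hx =>
    change antipode ℂ (E.sym (TensorAlgebra.ι ℂ θ * x)) = conv D F k (TensorAlgebra.ι ℂ θ * x)
    change antipode ℂ (E.sym x) = conv D F k x at hx
    have h1 : ∀ u : V ⊗[ℂ] A, prodMap F k
        (LinearMap.rTensor A (TensorAlgebra.ι ℂ) u * tensorCoact A x) =
        -(conv D F k x * prodMap E.trans k u) := by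
      intro u
      induction u with
      | zero => simp
      | add u v hu hv => simp only [map_add, add_mul, mul_add, neg_add, hu, hv]
      | tmul m c =>
        have h2 : ∀ v : TensorAlgebra ℂ V ⊗[ℂ] A, prodMap F k ((TensorAlgebra.ι ℂ m ⊗ₜ c) * v) =
            -(prodMap (conv D F (E.trans ∘ₗ YDModule.act m)) k v * k c) := by
          intro v
          induction v with
          | zero => simp
          | add u v hu hv => simp only [map_add, mul_add, add_mul, neg_add, hu, hv]
          | tmul a b => simp [hF, k, antipode_mul_antidistrib, mul_assoc]
        have h3 : conv (Comod.self A) (E.trans ∘ₗ YDModule.act m) k =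
            LinearMap.mulRight ℂ (E.trans m) ∘ₗ k := by
          ext a
          exact conv_antipode_of_rule E.inclHom (E.trans m) _ (E.trans_mul_inclHom m) a
        have h4 := LinearMap.congr_fun (conv_assoc D F (E.trans ∘ₗ YDModule.act m) k) x
        rw [h3, conv_mulRight] at h4
        rw [LinearMap.rTensor_tmul, h2]
        rw [conv_apply] at h4
        change -(prodMap (conv D F (E.trans ∘ₗ YDModule.act m)) k (D.δ x) * k c) = _
        rw [h4, prodMap_tmul, ← mul_assoc]
        rfl
    rw [map_mul, antipode_mul_antidistrib, sym_ι, hx, antipode_trans, conv_apply D F k (_ * _)]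
    change _ = prodMap F k (tensorCoact A (TensorAlgebra.ι ℂ θ * x))
    rw [map_mul, tensorCoact_ι, h1, mul_neg]
    rfl

end AffineExtension

namespace AffineDatum

variable {A V X : Type*} [Ring A] [HopfAlgebra ℂ A] [AddCommGroup V] [Module ℂ V]
    [YDModule A V] [Ring X] [Algebra ℂ X] (P : AffineDatum A V X)
    [StarRing A] [StarAddMonoid V] (E : AffineExtension A V)

/-- The adjoint action of the braided symmetric algebra is given by the shuffle coproduct and the
braided inverse. -/
lemma act_sym (ξ : X) (x : TensorAlgebra ℂ V) : P.act E ξ (E.sym x) =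
    twistedAdjoint A (TensorAlgebra.lift ℂ P.t) (P.ρ.act ξ) x := by
  let D := (tensorComod A V).toComod
  let s := TensorAlgebra.lift ℂ P.t
  let F := s.toLinearMap ∘ₗ braidedReverse A ∘ₗ signMap.toLinearMap
  let J := P.hom E
  let il := Smash.inl (ComodAlg.self A) P.ρ
  let k := J.toLinearMap ∘ₗ antipode ℂ
  let m := LinearMap.mulLeft ℂ (P.inX ξ) ∘ₗ J.toLinearMap
  have hJs : J.toLinearMap ∘ₗ E.sym.toLinearMap = P.inX.toLinearMap ∘ₗ s.toLinearMap := by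
    ext x; exact P.hom_sym E x
  have hJi : J.toLinearMap ∘ₗ E.inclHom.toLinearMap = il.toLinearMap := by
    ext a; exact P.hom_inclHom E a
  have hk : k ∘ₗ E.sym.toLinearMap = conv D (P.inX.toLinearMap ∘ₗ F)
      (il.toLinearMap ∘ₗ antipode ℂ) := by
    have h1 : antipode ℂ ∘ₗ E.sym.toLinearMap = _ := LinearMap.ext E.antipode_sym
    rw [LinearMap.comp_assoc, h1, algHom_conv, ← LinearMap.comp_assoc, hJs, ← LinearMap.comp_assoc
      (antipode ℂ), hJi]
    rfl
  have hm : m ∘ₗ E.inclHom.toLinearMap = LinearMap.mulLeft ℂ (P.inX ξ) ∘ₗ il.toLinearMap := by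
    rw [LinearMap.comp_assoc, hJi]
  have h0 : conv D (k ∘ₗ E.sym.toLinearMap) (m ∘ₗ E.inclHom.toLinearMap) =
      P.inX.toLinearMap ∘ₗ conv D F (P.ρ.act ξ) := by
    have := adjoint_eq il (P.inX ξ) _ (Smash.inr_mul_inl (ComodAlg.self A) P.ρ ξ)
    rw [hk, hm, conv_assoc, this, algHom_conv]
  apply P.inX_injective
  rw [inX_act, adjointAct_eq, conv_apply, Comod.self_δ, E.comul_sym,
    lift_affineMap _ _ _ E.trans_mul_inclHom, twistedAdjoint, LinearMap.comp_apply]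
  change prodMap k m _ = P.inX (prodMap (conv D F (P.ρ.act ξ)) s.toLinearMap _)
  generalize shuffleCoproduct A x = u
  induction u with
  | zero => simp
  | add u v hu hv => simp only [map_add, hu, hv]
  | tmul a y =>
    have h1 : ∀ w : E.carrier ⊗[ℂ] E.carrier, prodMap k m (w * (1 ⊗ₜ E.sym y)) =
        prodMap k m w * P.inX (s y) := by
      intro w
      induction w with
      | zero => simp
      | add u v hu hv => simp only [map_add, add_mul, hu, hv]
      | tmul b c => simp [m, mul_assoc, J, hom_sym, s]
    have h2 := LinearMap.congr_fun h0 a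
    rw [conv_apply, ← prodMap_map] at h2
    rw [prodMap_tmul, prodMap_tmul, map_mul P.inX]
    refine (h1 _).trans ?_
    exact congrArg (· * _) h2

end AffineDatum

/-! ### Diagonal actions on smash products -/

section Diagonal

variable {A H B X : Type*} [Ring A] [HopfAlgebra ℂ A] [Ring H] [Algebra ℂ H] [Ring B] [Algebra ℂ B]
  [Ring X] [Algebra ℂ X]

lemma toConv_mul_toConv (f g : A →ₗ[ℂ] X) :
    WithConv.toConv f * WithConv.toConv g = WithConv.toConv (conv (Comod.self A) f g) := by
  have : prodMap f g = LinearMap.mul' ℂ X ∘ₗ TensorProduct.map f g := by ext; simp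
  ext a
  simp [conv_apply, this]

lemma toConv_convUnit : WithConv.toConv (convUnit A X) = 1 := rfl

/-- The action of a module algebra, as a homomorphism to a convolution algebra. -/
def ModAlg.convHom (ρ : ModAlg A B) (φ : B →ₐ[ℂ] X) : B →ₐ[ℂ] WithConv (A →ₗ[ℂ] X) :=
  AlgHom.ofLinearMap ((WithConv.linearEquiv ℂ (A →ₗ[ℂ] X)).symm.toLinearMap ∘ₗ
      ρ.act.compr₂ φ.toLinearMap)
    (by
      change WithConv.toConv (φ.toLinearMap ∘ₗ ρ.act 1) = 1
      rw [ρ.one_act, algHom_convUnit, toConv_convUnit])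
    (fun x y => by
      change WithConv.toConv (φ.toLinearMap ∘ₗ ρ.act (x * y)) =
        WithConv.toConv (φ.toLinearMap ∘ₗ ρ.act x) * WithConv.toConv (φ.toLinearMap ∘ₗ ρ.act y)
      rw [ρ.mul_act, algHom_conv, toConv_mul_toConv])

lemma ModAlg.convHom_apply (ρ : ModAlg A B) (φ : B →ₐ[ℂ] X) (b : B) :
    ρ.convHom φ b = WithConv.toConv (φ.toLinearMap ∘ₗ ρ.act b) := rfl

/-- A module algebra structure from the homomorphism to the convolution algebra. -/
def ModAlg.ofConvHom (F : X →ₐ[ℂ] WithConv (A →ₗ[ℂ] X)) {s : Set X} (hs : Algebra.adjoin ℂ s = ⊤)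
    (h_one : ∀ x ∈ s, (F x).ofConv 1 = x)
    (h_mul : ∀ x ∈ s, ∀ a b, (F x).ofConv (a * b) = (F ((F x).ofConv a)).ofConv b) :
    ModAlg A X where
  act := (WithConv.linearEquiv ℂ (A →ₗ[ℂ] X)).toLinearMap ∘ₗ F.toLinearMap
  act_one x := by
    change (F x).ofConv 1 = x
    have hx : x ∈ Algebra.adjoin ℂ s := hs ▸ Algebra.mem_top
    induction hx using Algebra.adjoin_induction with
    | mem x hx => exact h_one x hx
    | algebraMap c =>
      rw [AlgHom.commutes, Algebra.algebraMap_eq_smul_one, ← toConv_convUnit]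
      simp [Algebra.algebraMap_eq_smul_one]
    | add x y _ _ hx hy => simp [hx, hy]
    | mul x y _ _ hx hy => simp [hx, hy, Algebra.TensorProduct.one_def]
  act_mul x a b := by
    change (F x).ofConv (a * b) = (F ((F x).ofConv a)).ofConv b
    have hx : x ∈ Algebra.adjoin ℂ s := hs ▸ Algebra.mem_top
    induction hx using Algebra.adjoin_induction generalizing a b with
    | mem x hx => exact h_mul x hx a b
    | algebraMap c =>
      have h : ∀ (c : ℂ) (a : A), (F (algebraMap ℂ X c)).ofConv a =
          algebraMap ℂ X (c * counit (R := ℂ) a) := by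
        intro c a
        rw [AlgHom.commutes, Algebra.algebraMap_eq_smul_one, ← toConv_convUnit, map_mul,
          WithConv.ofConv_smul, LinearMap.smul_apply]
        simp [Algebra.smul_def]
      simp only [h, Bialgebra.counit_mul, mul_assoc]
    | add x y _ _ hx hy => simp [hx, hy]
    | mul x y _ _ hx hy =>
      have h : ∀ x y : X, ∀ a, (F (x * y)).ofConv a =
          prodMap (F x).ofConv (F y).ofConv (comul a) := by
        intro x y a
        rw [map_mul]
        change (WithConv.toConv (F x).ofConv * WithConv.toConv (F y).ofConv).ofConv a = _
        rw [toConv_mul_toConv]; rfl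
      rw [h, h, Bialgebra.comul_mul]
      induction comul (R := ℂ) a with
      | zero => simp
      | add u v hu hv =>
        simp only [map_add, add_mul, hu, hv, WithConv.ofConv_add, LinearMap.add_apply]
      | tmul c d =>
        rw [prodMap_tmul, h]
        induction comul (R := ℂ) b with
        | zero => simp
        | add u v hu hv => simp only [map_add, mul_add, hu, hv]
        | tmul e f => simp [hx, hy]
  mul_act x y := by
    change (F (x * y)).ofConv = conv (Comod.self A) (F x).ofConv (F y).ofConv
    rw [map_mul]
    exact congrArg WithConv.ofConv (toConv_mul_toConv (F x).ofConv (F y).ofConv)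
  one_act := by
    change (F 1).ofConv = _
    rw [map_one]; rfl

lemma adjoin_smash (D : ComodAlg A H) (ρ : ModAlg A B) :
    Algebra.adjoin ℂ (Set.range (Smash.inl D ρ) ∪ Set.range (Smash.inr D ρ)) = ⊤ := by
  rw [eq_top_iff]
  rintro x -
  induction x using Smash.induction with
  | hinl a => exact Algebra.subset_adjoin (Or.inl ⟨a, rfl⟩)
  | hinr b => exact Algebra.subset_adjoin (Or.inr ⟨b, rfl⟩)
  | add x y hx hy => exact add_mem hx hy
  | mul x y hx hy => exact mul_mem hx hy

end Diagonal

section YDStarAlgebra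

variable (A H : Type*) [Ring A] [StarRing A] [HopfAlgebra ℂ A] [HopfStarAlgebra A]
  [Ring H] [Algebra ℂ H] [StarRing H] [StarModule ℂ H] [YDModule A H] [YDStarAlgebra A H]

/-- The underlying comodule algebra. -/
def YDStarAlgebra.comodAlg : ComodAlg A H where
  toComod := YDModule.comod A H
  δ_one := YDStarAlgebra.coact_one
  δ_mul := YDStarAlgebra.coact_mul

/-- The underlying module algebra. -/
def YDStarAlgebra.modAlg : ModAlg A H where
  act := YDModule.act
  act_one := YDModule.act_one
  act_mul := YDModule.act_mul
  mul_act x y := LinearMap.ext (YDStarAlgebra.mul_act x y)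
  one_act := LinearMap.ext fun a => by
    rw [YDStarAlgebra.one_act, convUnit_apply, Algebra.algebraMap_eq_smul_one]

variable {A H} {B : Type*} [Ring B] [Algebra ℂ B] (ρ : ModAlg A B)

/-- The diagonal action on `H # B`, with values in the convolution algebra. -/
def diagonalHom : Smash (YDStarAlgebra.comodAlg A H) ρ →ₐ[ℂ]
    WithConv (A →ₗ[ℂ] Smash (YDStarAlgebra.comodAlg A H) ρ) :=
  Smash.lift _ _ ((YDStarAlgebra.modAlg A H).convHom (Smash.inl _ ρ))
    (ρ.convHom (Smash.inr (YDStarAlgebra.comodAlg A H) ρ)) (by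
      intro b h
      let D := YDStarAlgebra.comodAlg A H
      let il := Smash.inl D ρ
      let ir := Smash.inr D ρ
      have h1 : ∀ (u : H ⊗[ℂ] A) (a : A),
          (prodMap ((YDStarAlgebra.modAlg A H).convHom il).toLinearMap
            ((ρ.convHom ir).toLinearMap ∘ₗ ρ.act b) u).ofConv a =
          prodMap il.toLinearMap (ir.toLinearMap ∘ₗ ρ.act b)
            (TensorProduct.map₂ YDModule.act (LinearMap.mul ℂ A) u (comul a)) := by
        intro u a
        induction u with
        | zero => simp
        | add u v hu hv =>
          simp only [map_add, WithConv.ofConv_add, LinearMap.add_apply, hu, hv]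
        | tmul h c =>
          rw [prodMap_tmul, LinearMap.comp_apply, AlgHom.toLinearMap_apply,
            AlgHom.toLinearMap_apply, ModAlg.convHom_apply, ModAlg.convHom_apply,
            toConv_mul_toConv]
          change conv (Comod.self A) _ _ a = _
          rw [conv_apply, Comod.self_δ]
          induction comul (R := ℂ) a with
          | zero => simp
          | add u v hu hv => simp only [map_add, hu, hv]
          | tmul x y => simp [ρ.act_mul, YDStarAlgebra.modAlg]
      have h2 : ∀ w : A ⊗[ℂ] A, prodMap (ir.toLinearMap ∘ₗ ρ.act b)
          (il.toLinearMap ∘ₗ YDModule.act h) w =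
          prodMap il.toLinearMap (ir.toLinearMap ∘ₗ ρ.act b) (TensorProduct.lift (ydLeft h) w) := by
        intro w
        induction w with
        | zero => simp
        | add u v hu hv => simp only [map_add, hu, hv]
        | tmul x y =>
          have := Smash.inr_mul_inl D ρ (ρ.act b x) (YDModule.act h y)
          rw [conv_apply] at this
          rw [prodMap_tmul, TensorProduct.lift.tmul, ydLeft_apply, prodMap_lTensor]
          refine this.trans ?_
          have h3 : (ir.toLinearMap ∘ₗ ρ.act b) ∘ₗ LinearMap.mulLeft ℂ x =
            ir.toLinearMap ∘ₗ ρ.act (ρ.act b x) := by ext; simp [ρ.act_mul]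
          rw [h3]
          rfl
      rw [ModAlg.convHom_apply, ModAlg.convHom_apply, toConv_mul_toConv]
      ext a
      refine Eq.trans ?_ (h1 (YDModule.coact h) a).symm
      rw [← yetterDrinfeld, ← h2]
      rfl)

lemma diagonalHom_inl (h : H) : diagonalHom ρ (Smash.inl _ ρ h) =
    WithConv.toConv ((Smash.inl (YDStarAlgebra.comodAlg A H) ρ).toLinearMap ∘ₗ YDModule.act h) := by
  rw [diagonalHom, Smash.lift_inl]; rfl

lemma diagonalHom_inr (b : B) : diagonalHom ρ (Smash.inr _ ρ b) =
    WithConv.toConv ((Smash.inr (YDStarAlgebra.comodAlg A H) ρ).toLinearMap ∘ₗ ρ.act b) := by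
  rw [diagonalHom, Smash.lift_inr]; rfl

/-- The diagonal action `(h b) ∘ a = (h ∘ a⁽¹⁾) (b ∘ a⁽²⁾)` on `H # B`. -/
def diagonal : ModAlg A (Smash (YDStarAlgebra.comodAlg A H) ρ) :=
  ModAlg.ofConvHom (diagonalHom ρ) (adjoin_smash _ ρ)
    (by
      rintro _ (⟨h, rfl⟩ | ⟨b, rfl⟩)
      · rw [diagonalHom_inl]
        exact congrArg (Smash.inl _ ρ) (YDModule.act_one h)
      · rw [diagonalHom_inr]
        exact congrArg (Smash.inr _ ρ) (ρ.act_one b))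
    (by
      rintro _ (⟨h, rfl⟩ | ⟨b, rfl⟩) a c
      · rw [diagonalHom_inl]
        simp only [LinearMap.comp_apply, AlgHom.toLinearMap_apply, diagonalHom_inl,
          YDModule.act_mul]
      · rw [diagonalHom_inr]
        simp only [LinearMap.comp_apply, AlgHom.toLinearMap_apply, diagonalHom_inr,
          ρ.act_mul])

lemma diagonal_inl (h : H) (a : A) : (diagonal ρ).act (Smash.inl _ ρ h) a =
    Smash.inl (YDStarAlgebra.comodAlg A H) ρ (YDModule.act h a) := by
  change (diagonalHom ρ _).ofConv a = _
  rw [diagonalHom_inl]; rfl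

lemma diagonal_inr (b : B) (a : A) : (diagonal ρ).act (Smash.inr _ ρ b) a =
    Smash.inr (YDStarAlgebra.comodAlg A H) ρ (ρ.act b a) := by
  change (diagonalHom ρ _).ofConv a = _
  rw [diagonalHom_inr]; rfl

end YDStarAlgebra

/-! ### Coactions and involutions compatible with the adjoint action -/

section AdjointCoaction

variable {B K K' : Type*} [Ring B] [HopfAlgebra ℂ B] [Ring K] [Algebra ℂ K] [Ring K'] [Algebra ℂ K']

lemma algHom_adjointAct (φ : K →ₐ[ℂ] K') (j : B →ₐ[ℂ] K) (x : K) (b : B) :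
    φ (adjointAct j x b) = adjointAct (φ.comp j) (φ x) b := by
  have := LinearMap.congr_fun (algHom_conv (Comod.self B) φ (j.toLinearMap ∘ₗ antipode ℂ)
    (LinearMap.mulLeft ℂ x ∘ₗ j.toLinearMap)) b
  refine this.trans ?_
  rw [adjointAct_eq]
  congr 2
  ext; simp

lemma ydTwist_tmul (f : K →ₗ[ℂ] B →ₗ[ℂ] K) (x : K) (c b : B) :
    ydTwist f ((x ⊗ₜ c) ⊗ₜ LinearMap.lTensor B comul (comul b)) =
      conv (Comod.self B)
        ((Algebra.TensorProduct.includeRight : B →ₐ[ℂ] K ⊗[ℂ] B).toLinearMap ∘ₗ antipode ℂ)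
        (conv (Comod.self B) ((Algebra.TensorProduct.includeLeft : K →ₐ[ℂ] K ⊗[ℂ] B).toLinearMap ∘ₗ
          f x) (LinearMap.mulLeft ℂ (1 ⊗ₜ c) ∘ₗ
            (Algebra.TensorProduct.includeRight : B →ₐ[ℂ] K ⊗[ℂ] B).toLinearMap)) b := by
  rw [conv_apply, Comod.self_δ]
  induction comul (R := ℂ) b with
  | zero => simp
  | add u v hu hv => simp only [map_add, TensorProduct.tmul_add, hu, hv]
  | tmul p q =>
    simp only [LinearMap.lTensor_tmul, prodMap_tmul, conv_apply, Comod.self_δ]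
    induction comul (R := ℂ) q with
    | zero => simp
    | add u v hu hv => simp only [map_add, mul_add, TensorProduct.tmul_add, hu, hv]
    | tmul r s => simp [ydTwist]

/-- The adjoint action along `(j ⊗ id) φ`. -/
lemma adjointAct_comul (j : B →ₐ[ℂ] K) (v : K ⊗[ℂ] B) (b : B) :
    adjointAct
        ((Algebra.TensorProduct.map j (AlgHom.id ℂ B)).comp (Bialgebra.comulAlgHom ℂ B)) v b =
      ydTwist (adjointAct j) (v ⊗ₜ LinearMap.lTensor B comul (comul b)) := by
  induction v with
  | zero => simp
  | add u v hu hv => simp only [map_add, LinearMap.add_apply, TensorProduct.add_tmul, hu, hv]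
  | tmul x c =>
    let L : K →ₐ[ℂ] K ⊗[ℂ] B := Algebra.TensorProduct.includeLeft
    let R : B →ₐ[ℂ] K ⊗[ℂ] B := Algebra.TensorProduct.includeRight
    let J := (Algebra.TensorProduct.map j (AlgHom.id ℂ B)).comp (Bialgebra.comulAlgHom ℂ B)
    have hJ : J.toLinearMap = conv (Comod.self B) (L.comp j).toLinearMap R.toLinearMap :=
      coactMap_eq_conv (ComodAlg.self B) j (AlgHom.id ℂ B)
    rw [ydTwist_tmul]
    refine LinearMap.congr_fun (adjoint_eq J (x ⊗ₜ c) _ fun a => ?_) b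
    have h1 : conv (Comod.self B) (L.comp j).toLinearMap (L.toLinearMap ∘ₗ adjointAct j x) =
        LinearMap.mulLeft ℂ (L x) ∘ₗ (L.comp j).toLinearMap := by
      have := algHom_conv (Comod.self B) L j.toLinearMap (adjointAct j x)
      rw [conv_adjointAct] at this
      refine this.symm.trans ?_
      ext; simp
    have h2 : ∀ f : B →ₗ[ℂ] K ⊗[ℂ] B, conv (Comod.self B) R.toLinearMap
        (conv (Comod.self B) (R.toLinearMap ∘ₗ antipode ℂ) f) = f := by
      intro f
      rw [← conv_assoc, conv_antipode, convUnit_conv]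
    have h3 : conv (Comod.self B) J.toLinearMap (conv (Comod.self B) (R.toLinearMap ∘ₗ antipode ℂ)
        (conv (Comod.self B) (L.toLinearMap ∘ₗ adjointAct j x)
          (LinearMap.mulLeft ℂ (1 ⊗ₜ c) ∘ₗ R.toLinearMap))) =
        LinearMap.mulLeft ℂ (x ⊗ₜ c) ∘ₗ J.toLinearMap := by
      rw [hJ, conv_assoc, h2, ← conv_assoc, h1, conv_mulLeft, conv_mulLeft_right]
      · ext a; simp [L, ← mul_assoc]
      · intro a; simp [L]
    exact (LinearMap.congr_fun h3 a).symm

end AdjointCoaction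

lemma rTensor_ydTwist {B K X : Type*} [Ring B] [HopfAlgebra ℂ B] [AddCommGroup K] [Module ℂ K]
    [AddCommGroup X] [Module ℂ X] (i : X →ₗ[ℂ] K)
    (f : X →ₗ[ℂ] B →ₗ[ℂ] X) (g : K →ₗ[ℂ] B →ₗ[ℂ] K) (h : ∀ x b, i (f x b) = g (i x) b)
    (u : X ⊗[ℂ] B) (w : B ⊗[ℂ] (B ⊗[ℂ] B)) :
    LinearMap.rTensor B i (ydTwist f (u ⊗ₜ w)) = ydTwist g (LinearMap.rTensor B i u ⊗ₜ w) := by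
  induction u with
  | zero => simp
  | add u v hu hv => simp only [map_add, TensorProduct.add_tmul, hu, hv]
  | tmul x c =>
    induction w with
    | zero => simp
    | add u v hu hv => simp only [map_add, TensorProduct.tmul_add, hu, hv]
    | tmul p q =>
      induction q with
      | zero => simp
      | add u v hu hv => simp only [map_add, TensorProduct.tmul_add, hu, hv]
      | tmul r s => simp [ydTwist, h]

namespace AffineDatum

variable {A V X : Type*} [Ring A] [StarRing A] [HopfAlgebra ℂ A] [AddCommGroup V] [Module ℂ V]
    [StarAddMonoid V] [YDModule A V] [Ring X] [Algebra ℂ X] (P : AffineDatum A V X)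
    (E : AffineExtension A V)

section Coaction

variable (δ : X →ₐ[ℂ] X ⊗[ℂ] E.carrier)
  (hδt : ∀ θ, δ (P.t θ) = affineMap E.inclHom P.t E.trans θ)
  (hδ : ∀ x a, LinearMap.rTensor E.carrier P.inX.toLinearMap (δ x) *
    coactMap (ComodAlg.self A) (Smash.inl (ComodAlg.self A) P.ρ) E.inclHom a =
    conv (Comod.self A)
      (coactMap (ComodAlg.self A) (Smash.inl (ComodAlg.self A) P.ρ) E.inclHom).toLinearMap
      (LinearMap.rTensor E.carrier P.inX.toLinearMap ∘ₗ δ.toLinearMap ∘ₗ P.ρ.act x) a)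

/-- The coaction on `A # X` that combines the coproduct of `A` with the coaction of `X`. -/
def crossCoact : P.Cross →ₐ[ℂ] P.Cross ⊗[ℂ] E.carrier :=
  Smash.lift (ComodAlg.self A) P.ρ
    (coactMap (ComodAlg.self A) (Smash.inl (ComodAlg.self A) P.ρ) E.inclHom)
    ((Algebra.TensorProduct.map P.inX (AlgHom.id ℂ E.carrier)).comp δ)
    (fun x a => hδ x a)

lemma crossCoact_inl (a : A) : P.crossCoact E δ hδ (Smash.inl _ P.ρ a) =
    TensorProduct.map (Smash.inl (ComodAlg.self A) P.ρ).toLinearMap E.inclHom.toLinearMap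
      (comul a) :=
  Smash.lift_inl (ComodAlg.self A) P.ρ _ _ _ a

lemma crossCoact_inX (x : X) : P.crossCoact E δ hδ (P.inX x) =
    LinearMap.rTensor E.carrier P.inX.toLinearMap (δ x) :=
  Smash.lift_inr (ComodAlg.self A) P.ρ _ _ _ x

include hδt in
lemma crossCoact_comp_hom : (P.crossCoact E δ hδ).comp (P.hom E) =
    (Algebra.TensorProduct.map (P.hom E) (AlgHom.id ℂ E.carrier)).comp
      (Bialgebra.comulAlgHom ℂ E.carrier) := by
  apply E.hom_ext
  · intro a
    have h : ∀ u : A ⊗[ℂ] A, TensorProduct.map (Smash.inl (ComodAlg.self A) P.ρ).toLinearMap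
        E.inclHom.toLinearMap u = TensorProduct.map (P.hom E).toLinearMap LinearMap.id
          (TensorProduct.map E.inclHom.toLinearMap E.inclHom.toLinearMap u) := by
      intro u
      induction u with
      | zero => simp
      | add u v hu hv => simp only [map_add, hu, hv]
      | tmul x y => simp
    rw [AlgHom.comp_apply, hom_inclHom, crossCoact_inl, h, ← E.comul_inclHom]
    rfl
  · intro θ
    have h : ∀ u : V ⊗[ℂ] A, LinearMap.rTensor E.carrier P.inX.toLinearMap
        (TensorProduct.map P.t E.inclHom.toLinearMap u) =
          TensorProduct.map (P.hom E).toLinearMap LinearMap.id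
            (TensorProduct.map E.trans E.inclHom.toLinearMap u) := by
      intro u
      induction u with
      | zero => simp
      | add u v hu hv => simp only [map_add, hu, hv]
      | tmul x y => simp
    rw [AlgHom.comp_apply, hom_trans, crossCoact_inX, hδt, affineMap_apply, map_add, h,
      AlgHom.comp_apply, Bialgebra.comulAlgHom_apply, E.comul_trans_eq, affineMap_apply]
    simp only [map_add, Algebra.TensorProduct.map_tmul, LinearMap.rTensor_tmul, map_one,
      AlgHom.toLinearMap_apply, AlgHom.id_apply]
    rfl

include hδt hδ in
lemma coact_act (x : X) (b : E.carrier) : δ (P.act E x b) =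
    ydTwist (P.act E) (δ x ⊗ₜ LinearMap.lTensor E.carrier comul (comul b)) := by
  have hinj : Function.Injective (LinearMap.rTensor E.carrier P.inX.toLinearMap) :=
    Module.Flat.rTensor_preserves_injective_linearMap _ P.inX_injective
  apply hinj
  rw [← P.crossCoact_inX E δ hδ, inX_act, algHom_adjointAct, P.crossCoact_comp_hom E δ hδt hδ,
    crossCoact_inX, adjointAct_comul,
    rTensor_ydTwist _ _ (adjointAct (P.hom E))]
  exact P.inX_act E

end Coaction

section Star

variable [HopfStarAlgebra A] [StarRing X] [StarModule ℂ X] [StarCompatible (ComodAlg.self A) P.ρ]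
  (ht : ∀ θ, star (P.t θ) = P.t (star θ))

include ht in
lemma hom_star (b : E.carrier) : star (P.hom E b) = P.hom E (star b) := by
  induction b using E.induction with
  | hincl a => rw [hom_inclHom, E.star_inclHom, hom_inclHom, Smash.star_inl]
  | htrans θ => rw [hom_trans, E.star_trans, hom_trans, Smash.star_inr, ht]
  | add x y hx hy => simp only [map_add, star_add, hx, hy]
  | mul x y hx hy => simp only [map_mul, star_mul, hx, hy]

include ht in
lemma star_act (x : X) (b : E.carrier) :
    star (P.act E x b) = P.act E (star x) (star (antipode ℂ b)) := by
  apply P.inX_injective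
  rw [← Smash.star_inr, inX_act, inX_act, adjointAct_eq, adjointAct_eq,
    star_conv (P.hom E).toLinearMap
      (LinearMap.mulRight ℂ (P.inX (star x)) ∘ₗ (P.hom E).toLinearMap ∘ₗ antipode ℂ),
    conv_middle]
  · intro b
    simp [P.hom_star E ht]
  · intro b
    have := antipode_star_antipode_star (star b)
    rw [star_star] at this
    simp [P.hom_star E ht, this, Smash.star_inr]

end Star

end AffineDatum

/-! ### Existence of the covariant algebra -/

section Descend

variable {M N P : Type*} [AddCommGroup M] [Module ℂ M] [AddCommGroup N] [Module ℂ N]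
  [AddCommGroup P] [Module ℂ P]

/-- The factorization of a linear map through a surjection. -/
def descend (p : M →ₗ[ℂ] N) (hp : Function.Surjective p) (f : M →ₗ[ℂ] P)
    (h : ∀ m, p m = 0 → f m = 0) : N →ₗ[ℂ] P :=
  (LinearMap.ker p).liftQ f h ∘ₗ (p.quotKerEquivOfSurjective hp).symm.toLinearMap

lemma descend_apply (p : M →ₗ[ℂ] N) (hp : Function.Surjective p) (f : M →ₗ[ℂ] P)
    (h : ∀ m, p m = 0 → f m = 0) (m : M) : descend p hp f h (p m) = f m := by
  have : (p.quotKerEquivOfSurjective hp).symm (p m) = Submodule.Quotient.mk m := by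
    rw [LinearEquiv.symm_apply_eq]; rfl
  rw [descend, LinearMap.comp_apply, LinearEquiv.coe_coe, this]
  rfl

end Descend

namespace AffineExtension

variable {A V : Type*} [Ring A] [StarRing A] [HopfAlgebra ℂ A]
  [AddCommGroup V] [Module ℂ V] [StarAddMonoid V] [YDModule A V]
  (E : AffineExtension A V)

/-- The braided symmetric algebra, as a quotient of the tensor algebra by the kernel of its map
to the affine extension. -/
def SymAlg : Type _ := TensorAlgebra ℂ V ⧸ RingHom.ker E.sym

instance : Ring E.SymAlg := inferInstanceAs (Ring (TensorAlgebra ℂ V ⧸ RingHom.ker E.sym))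
instance : Algebra ℂ E.SymAlg :=
  inferInstanceAs (Algebra ℂ (TensorAlgebra ℂ V ⧸ RingHom.ker E.sym))

/-- The quotient map. -/
def symMk : TensorAlgebra ℂ V →ₐ[ℂ] E.SymAlg := Ideal.Quotient.mkₐ ℂ (RingHom.ker E.sym)

lemma symMk_surjective : Function.Surjective E.symMk := Ideal.Quotient.mk_surjective

lemma symMk_eq_zero_iff (x : TensorAlgebra ℂ V) : E.symMk x = 0 ↔ E.sym x = 0 :=
  Ideal.Quotient.eq_zero_iff_mem

/-- Homomorphisms from the braided symmetric algebra. -/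
def symLift {X : Type*} [Ring X] [Algebra ℂ X] (f : TensorAlgebra ℂ V →ₐ[ℂ] X)
    (h : ∀ x, E.sym x = 0 → f x = 0) : E.SymAlg →ₐ[ℂ] X :=
  Ideal.Quotient.liftₐ (RingHom.ker E.sym) f h

@[simp] lemma symLift_symMk {X : Type*} [Ring X] [Algebra ℂ X] (f : TensorAlgebra ℂ V →ₐ[ℂ] X)
    (h : ∀ x, E.sym x = 0 → f x = 0) (x : TensorAlgebra ℂ V) : E.symLift f h (E.symMk x) = f x :=
  rfl

/-- The inclusion into the affine extension. -/
def symIncl : E.SymAlg →ₐ[ℂ] E.carrier := E.symLift E.sym fun _ h => h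

lemma symIncl_injective : Function.Injective E.symIncl := by
  rw [injective_iff_map_eq_zero]
  intro x hx
  obtain ⟨x, rfl⟩ := E.symMk_surjective x
  exact (E.symMk_eq_zero_iff x).mpr hx

/-- The map from `V` to the braided symmetric algebra. -/
def symι : V →ₗ[ℂ] E.SymAlg := E.symMk.toLinearMap ∘ₗ TensorAlgebra.ι ℂ

lemma adjoin_symι : Algebra.adjoin ℂ (Set.range E.symι) = ⊤ := by
  have : Set.range E.symι =
      E.symMk '' Set.range (TensorAlgebra.ι ℂ) := by
    rw [← Set.range_comp]; rfl
  rw [this, ← AlgHom.map_adjoin, TensorAlgebra.adjoin_range_ι, Algebra.map_top]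
  exact (AlgHom.range_eq_top _).mpr E.symMk_surjective

lemma sym_tensorAct (x : TensorAlgebra ℂ V) :
    E.sym.toLinearMap ∘ₗ tensorAct A V x = adjointAct E.inclHom (E.sym x) :=
  (adjoint_eq E.inclHom (E.sym x) _ (E.sym_mul_inclHom x)).symm

/-- The action of `A` on the braided symmetric algebra. -/
def symAct : E.SymAlg →ₗ[ℂ] A →ₗ[ℂ] E.SymAlg :=
  descend E.symMk.toLinearMap E.symMk_surjective ((tensorAct A V).compr₂ E.symMk.toLinearMap)
    (by
      intro x hx
      ext a
      have h := LinearMap.congr_fun (E.sym_tensorAct x) a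
      rw [(E.symMk_eq_zero_iff x).mp hx, map_zero] at h
      exact (E.symMk_eq_zero_iff _).mpr h)

lemma symAct_symMk (x : TensorAlgebra ℂ V) :
    E.symAct (E.symMk x) = E.symMk.toLinearMap ∘ₗ tensorAct A V x :=
  descend_apply E.symMk.toLinearMap E.symMk_surjective _ _ x

/-- The braided symmetric algebra as a module algebra. -/
def symMod : ModAlg A E.SymAlg where
  act := E.symAct
  act_one x := by
    obtain ⟨x, rfl⟩ := E.symMk_surjective x
    rw [symAct_symMk]
    exact congrArg E.symMk ((tensorModAlg A V).act_one x)
  act_mul x a b := by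
    obtain ⟨x, rfl⟩ := E.symMk_surjective x
    rw [symAct_symMk, LinearMap.comp_apply, LinearMap.comp_apply, AlgHom.toLinearMap_apply,
      AlgHom.toLinearMap_apply, symAct_symMk]
    exact congrArg E.symMk ((tensorModAlg A V).act_mul x a b)
  mul_act x y := by
    obtain ⟨x, rfl⟩ := E.symMk_surjective x
    obtain ⟨y, rfl⟩ := E.symMk_surjective y
    rw [← map_mul, symAct_symMk, symAct_symMk, symAct_symMk, ← algHom_conv]
    exact congrArg _ ((tensorModAlg A V).mul_act x y)
  one_act := by
    rw [← map_one E.symMk, symAct_symMk, tensorAct_one, algHom_convUnit]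

lemma symMod_symι (θ : V) : E.symMod.act (E.symι θ) = E.symι ∘ₗ YDModule.act θ := by
  change E.symAct (E.symMk (TensorAlgebra.ι ℂ θ)) = _
  rw [symAct_symMk, tensorAct_ι]; rfl

lemma map_affineMap {X X' : Type*} [Ring X] [Algebra ℂ X] [Ring X'] [Algebra ℂ X']
    (φ : X →ₐ[ℂ] X') (t : V →ₗ[ℂ] X) (θ : V) :
    LinearMap.rTensor E.carrier φ.toLinearMap (affineMap E.inclHom t E.trans θ) =
      affineMap E.inclHom (φ.toLinearMap ∘ₗ t) E.trans θ := by
  rw [affineMap_apply, affineMap_apply, map_add, LinearMap.rTensor_tmul,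
    AlgHom.toLinearMap_apply, map_one]
  congr 1
  induction YDModule.coact (A := A) θ with
  | zero => simp
  | add u v hu hv => simp only [map_add, hu, hv]
  | tmul x y => simp

/-- The coaction of the affine extension on the braided symmetric algebra. -/
def symCoact : E.SymAlg →ₐ[ℂ] E.SymAlg ⊗[ℂ] E.carrier :=
  E.symLift (TensorAlgebra.lift ℂ (affineMap E.inclHom E.symι E.trans))
    (by
      intro x hx
      have hinj : Function.Injective (LinearMap.rTensor E.carrier E.symIncl.toLinearMap) :=
        Module.Flat.rTensor_preserves_injective_linearMap _ E.symIncl_injective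
      apply hinj
      have h1 : (Algebra.TensorProduct.map E.symIncl (AlgHom.id ℂ E.carrier)).comp
          (TensorAlgebra.lift ℂ (affineMap E.inclHom E.symι E.trans)) =
          (Bialgebra.comulAlgHom ℂ E.carrier).comp E.sym := by
        ext θ
        simp only [AlgHom.toLinearMap_apply, LinearMap.comp_apply, AlgHom.comp_apply,
          TensorAlgebra.lift_ι_apply, sym_ι, Bialgebra.comulAlgHom_apply, E.comul_trans_eq]
        refine (E.map_affineMap E.symIncl E.symι θ).trans ?_
        congr 2
        ext θ
        exact E.sym_ι θ
      have h2 := DFunLike.congr_fun h1 x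
      rw [AlgHom.comp_apply (Bialgebra.comulAlgHom ℂ E.carrier), hx, map_zero] at h2
      rw [map_zero]
      exact h2)

lemma symCoact_symι (θ : V) :
    E.symCoact (E.symι θ) = affineMap E.inclHom E.symι E.trans θ := by
  change E.symCoact (E.symMk (TensorAlgebra.ι ℂ θ)) = _
  rw [symCoact, symLift_symMk, TensorAlgebra.lift_ι_apply]

section Star

variable [StarModule ℂ V]

instance : StarRing E.SymAlg where
  star := Quotient.map' star (by
    intro x y h
    rw [Submodule.quotientRel_def, RingHom.mem_ker] at h ⊢
    rw [← star_sub, sym_star, h, star_zero])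
  star_involutive x := by
    obtain ⟨x, rfl⟩ := E.symMk_surjective x
    exact congrArg E.symMk (star_star x)
  star_add x y := by
    obtain ⟨x, rfl⟩ := E.symMk_surjective x
    obtain ⟨y, rfl⟩ := E.symMk_surjective y
    exact congrArg E.symMk (star_add x y)
  star_mul x y := by
    obtain ⟨x, rfl⟩ := E.symMk_surjective x
    obtain ⟨y, rfl⟩ := E.symMk_surjective y
    exact congrArg E.symMk (star_mul x y)

lemma star_symMk (x : TensorAlgebra ℂ V) : star (E.symMk x) = E.symMk (star x) := rfl

instance : StarModule ℂ E.SymAlg where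
  star_smul c x := by
    obtain ⟨x, rfl⟩ := E.symMk_surjective x
    exact congrArg E.symMk (star_smul c x)

lemma star_symAct [HopfStarAlgebra A] [YDStarModule A V] (x : E.SymAlg) (a : A) :
    star (E.symMod.act x a) = E.symMod.act (star x) (star (antipode ℂ a)) := by
  obtain ⟨x, rfl⟩ := E.symMk_surjective x
  rw [star_symMk, symMod, symAct_symMk, symAct_symMk, LinearMap.comp_apply, LinearMap.comp_apply,
    ← tensor_star_act]
  rfl

end Star

end AffineExtension

namespace AffineExtension

section Model

variable {A V : Type*} [Ring A] [StarRing A] [HopfAlgebra ℂ A] [HopfStarAlgebra A]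
  [AddCommGroup V] [Module ℂ V] [StarAddMonoid V] [YDModule A V]
  (E : AffineExtension A V) (H : Type*)
  [Ring H] [Algebra ℂ H] [StarRing H] [StarModule ℂ H] [YDModule A H] [YDStarAlgebra A H]

/-- The cross product of `H` with the braided symmetric algebra. -/
abbrev Model : Type _ := Smash (YDStarAlgebra.comodAlg A H) E.symMod

/-- The inclusion of `H`. -/
abbrev modelIncl : H →ₐ[ℂ] E.Model H := Smash.inl _ E.symMod

/-- The inclusion of the braided symmetric algebra. -/
abbrev modelSym : E.SymAlg →ₐ[ℂ] E.Model H := Smash.inr (YDStarAlgebra.comodAlg A H) E.symMod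

/-- The inclusion of `V`. -/
def modelTrans : V →ₗ[ℂ] E.Model H :=
  (E.modelSym H).toLinearMap ∘ₗ E.symι

lemma lift_modelTrans (x : TensorAlgebra ℂ V) :
    TensorAlgebra.lift ℂ (E.modelTrans H) x = E.modelSym H (E.symMk x) := by
  rw [← AlgHom.comp_apply (E.modelSym H)]
  congr 1
  ext θ
  simp [modelTrans, symι]

variable {H} in
@[elab_as_elim]
lemma model_induction {P : E.Model H → Prop} (hincl : ∀ h, P (E.modelIncl H h))
    (htrans : ∀ θ, P (E.modelTrans H θ)) (add : ∀ x y, P x → P y → P (x + y))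
    (mul : ∀ x y, P x → P y → P (x * y)) (x : E.Model H) : P x := by
  induction x using Smash.induction with
  | hinl h => exact hincl h
  | hinr b =>
    obtain ⟨x, rfl⟩ := E.symMk_surjective b
    induction x using TensorAlgebra.induction with
    | algebraMap c =>
      rw [AlgHom.commutes, AlgHom.commutes, ← AlgHom.commutes (E.modelIncl H)]; exact hincl _
    | ι θ => exact htrans θ
    | mul a b ha hb => rw [map_mul, map_mul]; exact mul _ _ ha hb
    | add a b ha hb => rw [map_add, map_add]; exact add _ _ ha hb
  | add x y hx hy => exact add _ _ hx hy
  | mul x y hx hy => exact mul _ _ hx hy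

lemma adjoin_model :
    Algebra.adjoin ℂ (Set.range (E.modelIncl H) ∪ Set.range (E.modelTrans H)) = ⊤ := by
  rw [eq_top_iff]
  rintro x -
  induction x using E.model_induction with
  | hincl a => exact Algebra.subset_adjoin (Or.inl ⟨a, rfl⟩)
  | htrans b => exact Algebra.subset_adjoin (Or.inr ⟨b, rfl⟩)
  | add x y hx hy => exact add_mem hx hy
  | mul x y hx hy => exact mul_mem hx hy

lemma modelTrans_mul_modelIncl (θ : V) (h : H) : E.modelTrans H θ * E.modelIncl H h =
    conv (YDModule.comod A H) (E.modelIncl H).toLinearMap (E.modelTrans H ∘ₗ YDModule.act θ) h := by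
  refine (Smash.inr_mul_inl _ E.symMod _ h).trans ?_
  rw [symMod_symι]
  rfl

/-- The diagonal action of `A` on the cross product, and the inclusion of `V`. -/
def modelDatum : AffineDatum A V (E.Model H) where
  ρ := diagonal E.symMod
  t := E.modelTrans H
  act_t θ a := by
    refine (diagonal_inr E.symMod _ a).trans ?_
    rw [symMod_symι]
    rfl
  lift_eq_zero x hx := by
    rw [lift_modelTrans, (E.symMk_eq_zero_iff x).mpr ((E.sym_eq_zero_iff x).mpr hx), map_zero]

/-- The coaction of the affine extension on the braided symmetric algebra, with values in the
cross product. -/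
def modelSymCoact : E.SymAlg →ₐ[ℂ] E.Model H ⊗[ℂ] E.carrier :=
  (Algebra.TensorProduct.map (E.modelSym H) (AlgHom.id ℂ E.carrier)).comp E.symCoact

lemma modelSymCoact_symι (θ : V) : E.modelSymCoact H (E.symι θ) =
    affineMap E.inclHom (E.modelTrans H) E.trans θ := by
  rw [modelSymCoact, AlgHom.comp_apply, symCoact_symι]
  exact E.map_affineMap (E.modelSym H) E.symι θ

/-- The coaction of the affine extension on the cross product. -/
def modelCoact : E.Model H →ₐ[ℂ] E.Model H ⊗[ℂ] E.carrier :=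
  Smash.lift _ E.symMod (coactMap (YDStarAlgebra.comodAlg A H) (E.modelIncl H) E.inclHom)
    (E.modelSymCoact H)
    (rule_of_adjoin _ _ _ _ E.adjoin_symι (by
      rintro _ ⟨θ, rfl⟩ h
      have h1 : (E.modelSymCoact H).toLinearMap ∘ₗ E.symMod.act (E.symι θ) =
          affineMap E.inclHom (E.modelTrans H) E.trans ∘ₗ YDModule.act θ := by
        ext a
        rw [symMod_symι]
        exact E.modelSymCoact_symι H _
      rw [h1, modelSymCoact_symι]
      exact affineMap_rule _ _ _ _ _ (E.modelTrans_mul_modelIncl H) E.trans_mul_inclHom θ h))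

lemma modelCoact_incl (h : H) : E.modelCoact H (E.modelIncl H h) =
    TensorProduct.map (E.modelIncl H).toLinearMap E.inclHom.toLinearMap (YDModule.coact h) :=
  Smash.lift_inl _ E.symMod _ _ _ h

lemma modelCoact_trans (θ : V) : E.modelCoact H (E.modelTrans H θ) =
    affineMap E.inclHom (E.modelTrans H) E.trans θ :=
  (Smash.lift_inr _ E.symMod _ _ _ _).trans (E.modelSymCoact_symι H θ)

/-- The coaction is compatible with the cross-product rule for `A`. -/
lemma modelCoact_rule (x : E.Model H) (a : A) :
    LinearMap.rTensor E.carrier (E.modelDatum H).inX.toLinearMap (E.modelCoact H x) *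
      coactMap (ComodAlg.self A) (Smash.inl (ComodAlg.self A) (E.modelDatum H).ρ) E.inclHom a =
    conv (Comod.self A)
      (coactMap (ComodAlg.self A) (Smash.inl (ComodAlg.self A) (E.modelDatum H).ρ)
        E.inclHom).toLinearMap
      (LinearMap.rTensor E.carrier (E.modelDatum H).inX.toLinearMap ∘ₗ
        (E.modelCoact H).toLinearMap ∘ₗ (E.modelDatum H).ρ.act x) a := by
  let P := E.modelDatum H
  let il := Smash.inl (ComodAlg.self A) P.ρ
  refine rule_of_adjoin (ComodAlg.self A) P.ρ (coactMap (ComodAlg.self A) il E.inclHom)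
    ((Algebra.TensorProduct.map P.inX (AlgHom.id ℂ E.carrier)).comp (E.modelCoact H))
    (E.adjoin_model H) ?_ x a
  have hrule := Smash.inr_mul_inl (ComodAlg.self A) P.ρ
  rintro _ (⟨h, rfl⟩ | ⟨θ, rfl⟩) a
  · have h1 : ∀ h, Algebra.TensorProduct.map P.inX (AlgHom.id ℂ E.carrier)
        (E.modelCoact H (E.modelIncl H h)) = TensorProduct.map
          (P.inX.toLinearMap ∘ₗ (E.modelIncl H).toLinearMap) E.inclHom.toLinearMap
          (YDModule.coact h) := by
      intro h
      rw [modelCoact_incl]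
      induction YDModule.coact (A := A) h with
      | zero => simp
      | add u v hu hv => simp only [map_add, hu, hv]
      | tmul x y => simp
    have h2 : ∀ (h : H) (a : A), P.ρ.act (E.modelIncl H h) a = E.modelIncl H (YDModule.act h a) :=
      diagonal_inl E.symMod
    have h3 := coact_mul_comul (Comod.self A) il E.inclHom
      (P.inX.toLinearMap ∘ₗ (E.modelIncl H).toLinearMap) (by
        intro h a
        refine (hrule (E.modelIncl H h) a).trans ?_
        congr 2
        ext a
        exact congrArg P.inX (h2 h a)) h a
    rw [AlgHom.comp_apply, h1]
    refine h3.trans ?_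
    congr 2
    ext a
    rw [LinearMap.comp_apply, LinearMap.comp_apply, LinearMap.comp_apply, h2]
    exact (h1 _).symm
  · have h1 : ∀ θ, Algebra.TensorProduct.map P.inX (AlgHom.id ℂ E.carrier)
        (E.modelCoact H (E.modelTrans H θ)) =
          affineMap E.inclHom (P.inX.toLinearMap ∘ₗ E.modelTrans H) E.trans θ := by
      intro θ
      rw [modelCoact_trans]
      exact E.map_affineMap P.inX (E.modelTrans H) θ
    have h2 : ∀ (θ : V) (a : A), P.ρ.act (E.modelTrans H θ) a =
        E.modelTrans H (YDModule.act θ a) := P.act_t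
    have h3 := affineMap_rule_self E.inclHom (P.inX.toLinearMap ∘ₗ E.modelTrans H) E.trans il (by
        intro θ a
        refine (hrule (E.modelTrans H θ) a).trans ?_
        congr 2
        ext a
        exact congrArg P.inX (h2 θ a)) E.trans_mul_inclHom θ a
    rw [AlgHom.comp_apply, h1]
    refine h3.trans ?_
    congr 2
    ext a
    rw [LinearMap.comp_apply, LinearMap.comp_apply, h2]
    exact (h1 _).symm

lemma modelCoact_coassoc :
    ((Algebra.TensorProduct.assoc ℂ ℂ ℂ (E.Model H) E.carrier E.carrier).toAlgHom.comp
      (Algebra.TensorProduct.map (E.modelCoact H) (AlgHom.id ℂ E.carrier))).comp (E.modelCoact H) =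
    (Algebra.TensorProduct.map (AlgHom.id ℂ (E.Model H)) (Bialgebra.comulAlgHom ℂ E.carrier)).comp
      (E.modelCoact H) :=
  AlgHom.ext_of_adjoin_eq_top (E.adjoin_model H) (by
    rintro _ (⟨h, rfl⟩ | ⟨θ, rfl⟩)
    · exact assoc_coact_incl (YDStarAlgebra.comodAlg A H) (E.modelIncl H) E.inclHom
        (E.modelCoact H) (Bialgebra.comulAlgHom ℂ E.carrier) (E.modelCoact_incl H)
        E.comul_inclHom h
    · exact assoc_coact_trans E.inclHom (E.modelTrans H) E.trans (E.modelCoact H)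
        (Bialgebra.comulAlgHom ℂ E.carrier) E.comul_inclHom (E.modelCoact_trans H)
        E.comul_trans_eq θ)

lemma modelCoact_counit :
    (Algebra.TensorProduct.map (AlgHom.id ℂ (E.Model H)) (Bialgebra.counitAlgHom ℂ E.carrier)).comp
      (E.modelCoact H) = Algebra.TensorProduct.includeLeft :=
  AlgHom.ext_of_adjoin_eq_top (E.adjoin_model H) (by
    rintro _ (⟨h, rfl⟩ | ⟨θ, rfl⟩)
    · exact map_counit_coact_incl (YDStarAlgebra.comodAlg A H) (E.modelIncl H) E.inclHom
        (E.modelCoact H) (Bialgebra.counitAlgHom ℂ E.carrier) (E.modelCoact_incl H)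
        E.counit_inclHom h
    · exact map_counit_coact_trans E.inclHom (E.modelTrans H) E.trans (E.modelCoact H)
        (Bialgebra.counitAlgHom ℂ E.carrier) (E.modelCoact_trans H) E.counit_inclHom
        E.counit_trans θ)

/-- The covariant module structure on the cross product. -/
abbrev modelYD : YDModule E.carrier (E.Model H) where
  act := (E.modelDatum H).act E
  coact := (E.modelCoact H).toLinearMap
  act_one := ((E.modelDatum H).modAlg E).act_one
  act_mul := ((E.modelDatum H).modAlg E).act_mul
  coact_coassoc := DFunLike.congr_fun (E.modelCoact_coassoc H)
  coact_counit := DFunLike.congr_fun (E.modelCoact_counit H)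
  coact_act x b := (E.modelDatum H).coact_act E (E.modelCoact H) (E.modelCoact_trans H)
    (E.modelCoact_rule H) x b

variable [StarModule ℂ V] [YDStarModule A V]

instance : StarCompatible (YDStarAlgebra.comodAlg A H) E.symMod where
  δ_star := YDStarModule.coact_star
  star_act := E.star_symAct

instance : StarCompatible (ComodAlg.self A) (E.modelDatum H).ρ where
  δ_star := HopfStarAlgebra.comul_star
  star_act x a := by
    let ρ := (E.modelDatum H).ρ
    induction x using Smash.induction generalizing a with
    | hinl h =>
      have h1 : ∀ h a, ρ.act (E.modelIncl H h) a = E.modelIncl H (YDModule.act h a) :=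
        diagonal_inl E.symMod
      rw [Smash.star_inl, h1, h1, Smash.star_inl, YDStarModule.star_act]
    | hinr b =>
      have h1 : ∀ b a, ρ.act (E.modelSym H b) a = E.modelSym H (E.symMod.act b a) :=
        diagonal_inr E.symMod
      rw [Smash.star_inr, h1, h1, Smash.star_inr, star_symAct]
    | add x y hx hy => simp only [map_add, LinearMap.add_apply, star_add, hx, hy]
    | mul x y hx hy =>
      rw [ρ.mul_act, star_mul, ρ.mul_act, star_conv _ _ _ _ hx hy]

omit [YDStarModule A V] in
lemma star_modelTrans (θ : V) : star (E.modelTrans H θ) = E.modelTrans H (star θ) := by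
  rw [modelTrans, LinearMap.comp_apply, LinearMap.comp_apply, AlgHom.toLinearMap_apply,
    AlgHom.toLinearMap_apply, Smash.star_inr, symι, LinearMap.comp_apply, LinearMap.comp_apply,
    AlgHom.toLinearMap_apply, AlgHom.toLinearMap_apply, star_symMk, tensor_star_ι]

lemma modelCoact_star (x : E.Model H) : E.modelCoact H (star x) = star (E.modelCoact H x) := by
  induction x using E.model_induction with
  | hincl h =>
    rw [Smash.star_inl, modelCoact_incl, modelCoact_incl, YDStarModule.coact_star]
    exact map_star _ _ (fun h => (Smash.star_inl _ E.symMod h).symm)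
      (fun a => (E.star_inclHom a).symm) _
  | htrans θ =>
    rw [star_modelTrans, modelCoact_trans, modelCoact_trans]
    exact affineMap_star _ _ _ (fun a => (E.star_inclHom a).symm)
      (fun θ => (E.star_modelTrans H θ).symm) (fun θ => (E.star_trans θ).symm) θ
  | add x y hx hy => simp only [map_add, star_add, hx, hy]
  | mul x y hx hy => simp only [map_mul, star_mul, hx, hy]

lemma model_ydStarAlgebra : letI := E.modelYD H; YDStarAlgebra E.carrier (E.Model H) :=
  letI := E.modelYD H
  { coact_star := E.modelCoact_star H
    star_act := (E.modelDatum H).star_act E (E.star_modelTrans H)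
    mul_act := fun x y => LinearMap.congr_fun (((E.modelDatum H).modAlg E).mul_act x y)
    one_act := fun a => by
      rw [← Algebra.algebraMap_eq_smul_one]
      exact LinearMap.congr_fun ((E.modelDatum H).modAlg E).one_act a
    coact_mul := map_mul (E.modelCoact H)
    coact_one := map_one (E.modelCoact H) }

/-- The identification of `H ⊗ S(V)` with the cross product. -/
def modelEquiv : H ⊗[ℂ] BraidedSym A V ≃ₗ[ℂ] E.Model H :=
  TensorProduct.congr (LinearEquiv.refl ℂ H)
    (equivOfKerEq (LinearMap.ker (symmetrizer A (V := V))).mkQ E.symMk.toLinearMap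
      (Submodule.mkQ_surjective _) E.symMk_surjective (by
        ext x
        rw [Submodule.ker_mkQ, LinearMap.mem_ker, LinearMap.mem_ker, AlgHom.toLinearMap_apply,
          symMk_eq_zero_iff, sym_eq_zero_iff])) ≪≫ₗ
  Smash.equivTensor _ E.symMod

omit [StarModule ℂ V] [YDStarModule A V] in
lemma modelEquiv_tmul_mk (h : H) (x : TensorAlgebra ℂ V) :
    E.modelEquiv H (h ⊗ₜ Submodule.Quotient.mk x) =
      E.modelIncl H h * TensorAlgebra.lift ℂ (E.modelTrans H) x := by
  rw [lift_modelTrans]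
  refine Eq.trans ?_ (Smash.inl_mul_inr _ E.symMod h (E.symMk x)).symm
  refine congrArg (fun y => Smash.equivTensor _ E.symMod (h ⊗ₜ y)) ?_
  exact equivOfKerEq_apply _ _ _ _ _ x

end Model

/-- The covariant algebra is the cross product `H # S(V)`, on which the affine extension acts by the
adjoint action inside `A # (H # S(V))`. -/
lemma nonempty_affineAlgebra {A : Type u} {V : Type v} [Ring A] [StarRing A] [HopfAlgebra ℂ A]
    [HopfStarAlgebra A] [AddCommGroup V] [Module ℂ V] [StarAddMonoid V] [StarModule ℂ V]
    [YDModule A V] [YDStarModule A V] (E : AffineExtension.{u, v, max u v} A V) (H : Type w)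
    [Ring H] [Algebra ℂ H] [StarRing H] [StarModule ℂ H] [YDModule A H] [YDStarAlgebra A H] :
    Nonempty (AffineAlgebra.{u, v, w, max v w, max u v} E H) :=
  letI := E.modelYD H
  letI := E.model_ydStarAlgebra H
  ⟨{carrier := E.Model H
    incl := { E.modelIncl H with map_star' := fun h => (Smash.star_inl _ E.symMod h).symm }
    trans := E.modelTrans H
    trans_mul_incl := E.modelTrans_mul_modelIncl H
    equiv := E.modelEquiv H
    equiv_tmul_mk := E.modelEquiv_tmul_mk H
    star_trans := E.star_modelTrans H
    coact_incl := E.modelCoact_incl H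
    coact_trans := E.modelCoact_trans H
    act_incl := fun h a => by
      refine ((E.modelDatum H).act_inclHom E _ a).trans ?_
      exact diagonal_inl E.symMod h a
    act_trans := fun θ a => by
      refine ((E.modelDatum H).act_inclHom E _ a).trans ?_
      exact (E.modelDatum H).act_t θ a
    act_sym := fun ξ x => by
      refine ((E.modelDatum H).act_sym E ξ x).trans ?_
      refine congrArg (fun g => twistedAdjoint A (TensorAlgebra.lift ℂ (E.modelTrans H)) g x) ?_
      ext a
      exact ((E.modelDatum H).act_inclHom E ξ a).symm }⟩

end AffineExtension

/-! ### Derivations and germs -/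

section Germ

variable {B K : Type*} [Ring B] [HopfAlgebra ℂ B] [Ring K] [Algebra ℂ K] (j : B →ₐ[ℂ] K)
  (d : B →ₗ[ℂ] K) (hd : ∀ b c, d (b * c) = d b * j c + j b * d c)

/-- The map `b ↦ j(κ(b⁽¹⁾)) d(b⁽²⁾)`. -/
def convGerm : B →ₗ[ℂ] K := conv (Comod.self B) (j.toLinearMap ∘ₗ antipode ℂ) d

include hd in
/-- If `d` is a derivation along `j`, then `b ↦ j(κ(b⁽¹⁾)) d(b⁽²⁾)` is a cocycle for the adjoint
action. -/
lemma convGerm_mul (b c : B) : convGerm j d (b * c) =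
    adjointAct j (convGerm j d b) c + counit (R := ℂ) b • convGerm j d c := by
  let k := j.toLinearMap ∘ₗ antipode ℂ
  have h : ∀ u w : B ⊗[ℂ] B, prodMap k d (u * w) =
      prodMap k (LinearMap.mulLeft ℂ (prodMap k d u) ∘ₗ j.toLinearMap) w +
      prodMap k (LinearMap.mulLeft ℂ (prodMap k j.toLinearMap u) ∘ₗ d) w := by
    intro u w
    induction w with
    | zero => simp
    | add w w' hw hw' => simp only [mul_add, map_add, hw, hw']; abel
    | tmul c c' =>
      induction u with
      | zero => simp
      | add u u' hu hu' =>
        simp only [prodMap_tmul, LinearMap.comp_apply, LinearMap.mulLeft_apply] at hu hu' ⊢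
        simp only [add_mul, mul_add, map_add, hu, hu']; abel
      | tmul b b' => simp [k, antipode_mul_antidistrib, hd, mul_add, mul_assoc]
  have h1 : prodMap k j.toLinearMap (comul b) = algebraMap ℂ K (counit b) :=
    LinearMap.congr_fun (antipode_conv j) b
  have h2 : LinearMap.mulLeft ℂ (algebraMap ℂ K (counit b)) ∘ₗ d = counit (R := ℂ) b • d := by
    ext; simp [Algebra.smul_def]
  rw [convGerm, conv_apply, Comod.self_δ, Bialgebra.comul_mul]
  refine (h _ _).trans ?_
  rw [h1, h2, prodMap_smul_right]
  rfl

end Germ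

namespace AffineExtension

variable {A V : Type*} [Ring A] [StarRing A] [HopfAlgebra ℂ A]
  [AddCommGroup V] [Module ℂ V] [StarAddMonoid V] [YDModule A V]
  (E : AffineExtension A V)

lemma symIncl_symCoact (s : E.SymAlg) :
    LinearMap.rTensor E.carrier E.symIncl.toLinearMap (E.symCoact s) = comul (E.symIncl s) := by
  obtain ⟨x, rfl⟩ := E.symMk_surjective s
  have h1 : (Algebra.TensorProduct.map E.symIncl (AlgHom.id ℂ E.carrier)).comp
      (E.symCoact.comp E.symMk) = (Bialgebra.comulAlgHom ℂ E.carrier).comp E.sym := by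
    ext θ
    have h2 := E.map_affineMap E.symIncl E.symι θ
    rw [← symCoact_symι] at h2
    refine h2.trans ?_
    simp only [AlgHom.toLinearMap_apply, LinearMap.comp_apply, AlgHom.comp_apply, sym_ι,
      Bialgebra.comulAlgHom_apply, E.comul_trans_eq]
    congr 2
    ext θ
    exact E.sym_ι θ
  exact DFunLike.congr_fun h1 x

/-- The projection of the braided symmetric algebra to its part of degree zero. -/
def symCounit : E.SymAlg →ₐ[ℂ] ℂ := (Bialgebra.counitAlgHom ℂ E.carrier).comp E.symIncl

lemma symCounit_symMk (x : TensorAlgebra ℂ V) : E.symCounit (E.symMk x) = degZero x := by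
  have : E.symCounit.comp E.symMk = degZero := by
    ext θ
    change counit (R := ℂ) (E.sym (TensorAlgebra.ι ℂ θ)) = degZero (TensorAlgebra.ι ℂ θ)
    rw [sym_ι, counit_trans, degZero_ι]
  exact DFunLike.congr_fun this x

lemma prodMap_symCounit {X : Type*} [Ring X] [Algebra ℂ X] (f : E.carrier →ₗ[ℂ] X) (s : E.SymAlg) :
    prodMap (Algebra.linearMap ℂ X ∘ₗ E.symCounit.toLinearMap) f (E.symCoact s) =
      f (E.symIncl s) := by
  have h := LinearMap.congr_fun (convUnit_conv f) (E.symIncl s)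
  rw [conv_apply, Comod.self_δ, ← symIncl_symCoact, prodMap_rTensor] at h
  exact h

/-- The projection of the braided symmetric algebra to its part of degree one. -/
def symLetter : E.SymAlg →ₗ[ℂ] V := descend E.symMk.toLinearMap E.symMk_surjective degOne (by
  intro x hx
  have hx' := (E.sym_eq_zero_iff x).mp ((E.symMk_eq_zero_iff x).mp hx)
  rw [← degOne_symmetrizer (A := A), hx', map_zero])

lemma symLetter_symMk (x : TensorAlgebra ℂ V) : E.symLetter (E.symMk x) = degOne x :=
  descend_apply E.symMk.toLinearMap E.symMk_surjective degOne _ x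

lemma symLetter_symι_mul (θ : V) (s : E.SymAlg) :
    E.symLetter (E.symι θ * s) = E.symCounit s • θ := by
  obtain ⟨x, rfl⟩ := E.symMk_surjective s
  change E.symLetter (E.symMk (TensorAlgebra.ι ℂ θ) * _) = _
  rw [← map_mul, symLetter_symMk, degOne_cons, symCounit_symMk]

lemma symLetter_one : E.symLetter 1 = 0 := by
  rw [← map_one E.symMk, symLetter_symMk, degOne_one]

/-- Let `z : V → K` commute with the images of `V` under `j : Ã → K`. Then `ϑ ↦ z(ϑ₁) j(ϑ₂)`, the
first factor being projected to degree one, is a derivation along `j` on the braided symmetric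
algebra. -/
lemma prodMap_symLetter_cons {K : Type*} [Ring K] [Algebra ℂ K] (j : E.carrier →ₐ[ℂ] K)
    (z : V →ₗ[ℂ] K) (hz : ∀ θ η, j (E.trans θ) * z η = z η * j (E.trans θ)) (θ : V)
    (s : E.SymAlg) :
    prodMap (z ∘ₗ E.symLetter) j.toLinearMap (E.symCoact (E.symι θ * s)) =
      j (E.trans θ) * prodMap (z ∘ₗ E.symLetter) j.toLinearMap (E.symCoact s) +
      conv (YDModule.comod A V) z (j.comp E.inclHom).toLinearMap θ * j (E.symIncl s) := by
  have h1 : ∀ w : E.SymAlg ⊗[ℂ] E.carrier,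
      prodMap (z ∘ₗ E.symLetter) j.toLinearMap ((1 ⊗ₜ E.trans θ) * w) =
        j (E.trans θ) * prodMap (z ∘ₗ E.symLetter) j.toLinearMap w := by
    intro w
    induction w with
    | zero => simp
    | add u v hu hv => simp only [map_add, mul_add, hu, hv]
    | tmul x y => simp [← mul_assoc, hz]
  have h2 : ∀ (m : V) (c : E.carrier) (w : E.SymAlg ⊗[ℂ] E.carrier),
      prodMap (z ∘ₗ E.symLetter) j.toLinearMap ((E.symι m ⊗ₜ c) * w) =
        z m * j c * prodMap (Algebra.linearMap ℂ K ∘ₗ E.symCounit.toLinearMap) j.toLinearMap w := by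
    intro m c w
    induction w with
    | zero => simp
    | add u v hu hv => simp only [map_add, mul_add, hu, hv]
    | tmul x y => simp [symLetter_symι_mul, mul_assoc, ← Algebra.smul_def]
  have h3 : ∀ u : V ⊗[ℂ] A, prodMap (z ∘ₗ E.symLetter) j.toLinearMap
      (TensorProduct.map E.symι E.inclHom.toLinearMap u * E.symCoact s) =
        prodMap z (j.comp E.inclHom).toLinearMap u * j (E.symIncl s) := by
    intro u
    induction u with
    | zero => simp
    | add u v hu hv => simp only [map_add, add_mul, hu, hv]
    | tmul m a =>
      rw [TensorProduct.map_tmul, h2, prodMap_symCounit]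
      rfl
  rw [map_mul, symCoact_symι, affineMap_apply, add_mul, map_add, h1, h3]
  rfl

end AffineExtension

namespace AffineAlgebra

variable {A V H : Type*} [Ring A] [StarRing A] [HopfAlgebra ℂ A]
  [AddCommGroup V] [Module ℂ V] [StarAddMonoid V] [YDModule A V]
  {E : AffineExtension A V} [Ring H] [Algebra ℂ H] [StarRing H]
  [StarModule ℂ H] [YDModule A H] (R : AffineAlgebra E H)

/-- The inclusion of `H`, as a homomorphism of algebras. -/
def inclHom : H →ₐ[ℂ] R.carrier := (R.incl : H →ₐ[ℂ] R.carrier)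

lemma trans_mul_inclHom (θ : V) (h : H) : R.trans θ * R.inclHom h =
    conv (YDModule.comod A H) R.inclHom.toLinearMap (R.trans ∘ₗ YDModule.act θ) h :=
  R.trans_mul_incl θ h

/-- The restriction of the action to `A`. -/
def restrictMod : ModAlg A R.carrier where
  act := YDModule.act.compl₂ E.inclHom.toLinearMap
  act_one x := by
    change YDModule.act x (E.inclHom 1) = x
    rw [map_one, YDModule.act_one]
  act_mul x a b := by
    change YDModule.act x (E.inclHom (a * b)) = _
    rw [map_mul, YDModule.act_mul]; rfl
  mul_act x y := by
    have := (YDStarAlgebra.modAlg E.carrier R.carrier).mul_act x y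
    change YDModule.act (x * y) = _ at this
    change YDModule.act (x * y) ∘ₗ E.inclHom.toLinearMap = _
    rw [this, conv_comp (Comod.self E.carrier) (Comod.self A) E.inclHom.toLinearMap
      E.inclHom.toLinearMap E.comul_inclHom]
    rfl
  one_act := by
    ext a
    change YDModule.act 1 (E.inclHom a) = _
    rw [YDStarAlgebra.one_act, E.counit_inclHom, convUnit_apply, Algebra.algebraMap_eq_smul_one]

lemma restrictMod_act (x : R.carrier) (a : A) :
    R.restrictMod.act x a = YDModule.act x (E.inclHom a) := rfl

/-- The action of `A` and the inclusion of `V`. -/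
def datum : AffineDatum A V R.carrier where
  ρ := R.restrictMod
  t := R.trans
  act_t := R.act_trans
  lift_eq_zero x hx := by
    have h := R.equiv_tmul_mk 1 x
    have h0 : (Submodule.Quotient.mk x : BraidedSym A V) = 0 :=
      (Submodule.Quotient.mk_eq_zero _).mpr hx
    rw [h0, TensorProduct.tmul_zero, map_zero, map_one, one_mul] at h
    exact h.symm

/-- The action of the affine extension is the adjoint action in `A # H̃`. -/
lemma datum_act : R.datum.act E = YDModule.act := by
  ext ξ b
  induction b using E.ind_mul_sym with
  | h a x =>
    have h1 : ∀ ξ x, R.datum.act E ξ (E.sym x) = YDModule.act ξ (E.sym x) := fun ξ x =>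
      (R.datum.act_sym E ξ x).trans (R.act_sym ξ x).symm
    have h2 : R.datum.act E ξ (E.inclHom a * E.sym x) =
        R.datum.act E (R.datum.act E ξ (E.inclHom a)) (E.sym x) :=
      (R.datum.modAlg E).act_mul ξ _ _
    rw [h2, h1, R.datum.act_inclHom, YDModule.act_mul]
    rfl
  | add x y hx hy => rw [map_add, map_add, hx, hy]

end AffineAlgebra

/-! ### Existence of the quantum germs map -/

section AdCoact

variable {A : Type*} [Ring A] [HopfAlgebra ℂ A]

lemma adCoact_eq_conv : adCoact A = conv (Comod.self A)
    ((Algebra.TensorProduct.includeRight : A →ₐ[ℂ] A ⊗[ℂ] A).toLinearMap ∘ₗ antipode ℂ)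
    comul := by
  ext a
  simp only [adCoact, LinearMap.comp_apply, conv_apply, Comod.self_δ]
  induction comul (R := ℂ) a with
  | zero => simp
  | add u v hu hv => simp only [map_add, hu, hv]
  | tmul x y =>
    simp only [LinearMap.lTensor_tmul, prodMap_tmul, LinearMap.comp_apply]
    induction comul (R := ℂ) y with
    | zero => simp
    | add u v hu hv => simp only [map_add, mul_add, TensorProduct.tmul_add, hu, hv]
    | tmul p q => simp

/-- `a⁽¹⁾ ad(a⁽²⁾) = φ(a)`. -/
lemma conv_adCoact : conv (Comod.self A)
    (Algebra.TensorProduct.includeRight : A →ₐ[ℂ] A ⊗[ℂ] A).toLinearMap (adCoact A) = comul := by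
  rw [adCoact_eq_conv, ← conv_assoc, conv_antipode, convUnit_conv]

end AdCoact

section DerivHom

variable {M N B K : Type*} [AddCommGroup M] [Module ℂ M] [AddCommGroup N] [Module ℂ N] [Ring B]
  [Algebra ℂ B] [Ring K] [Algebra ℂ K]

/-- The map `m ↦ f(m) + g(m)` to the square zero extension of `K` by `K`. -/
def sqZero (f g : M →ₗ[ℂ] K) : M →ₗ[ℂ] TrivSqZeroExt K K where
  toFun m := TrivSqZeroExt.inl (f m) + TrivSqZeroExt.inr (g m)
  map_add' x y := by ext <;> simp
  map_smul' c x := by ext <;> simp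

@[simp] lemma sqZero_fst (f g : M →ₗ[ℂ] K) (m : M) : (sqZero f g m).fst = f m := by simp [sqZero]
@[simp] lemma sqZero_snd (f g : M →ₗ[ℂ] K) (m : M) : (sqZero f g m).snd = g m := by simp [sqZero]

/-- A homomorphism `j` and a derivation `d` along `j` define a homomorphism to the square zero
extension. -/
def derivHom (j : B →ₐ[ℂ] K) (d : B →ₗ[ℂ] K) (h1 : d 1 = 0)
    (hd : ∀ b c, d (b * c) = d b * j c + j b * d c) : B →ₐ[ℂ] TrivSqZeroExt K K :=
  AlgHom.ofLinearMap (sqZero j.toLinearMap d) (by ext <;> simp [h1])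
    (fun b c => by ext <;> simp [hd, add_comm])

lemma prodMap_sqZero (f g : M →ₗ[ℂ] K) (f' g' : N →ₗ[ℂ] K) :
    prodMap (sqZero f g) (sqZero f' g') =
      sqZero (prodMap f f') (prodMap f g' + prodMap g f') := by
  ext <;> simp

end DerivHom

namespace AffineAlgebra

variable {A V H : Type*} [Ring A] [StarRing A] [HopfAlgebra ℂ A]
  [AddCommGroup V] [Module ℂ V] [StarAddMonoid V] [YDModule A V]
  {E : AffineExtension A V} [Ring H] [Algebra ℂ H] [StarRing H]
  [StarModule ℂ H] [YDModule A H] (R : AffineAlgebra E H)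

section Derivation

variable (π : A →ₗ[ℂ] H) (ζ : V →ₗ[ℂ] H)

lemma inX_mul_inl (x : R.carrier) (a : A) :
    R.datum.inX x * Smash.inl (ComodAlg.self A) R.datum.ρ a =
      conv (Comod.self A) (Smash.inl (ComodAlg.self A) R.datum.ρ).toLinearMap
        (R.datum.inX.toLinearMap ∘ₗ R.restrictMod.act x) a :=
  Smash.inr_mul_inl (ComodAlg.self A) R.datum.ρ x a

lemma inX_trans_mul_inl (θ : V) (a : A) :
    R.datum.inX (R.trans θ) * Smash.inl (ComodAlg.self A) R.datum.ρ a =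
      conv (Comod.self A) (Smash.inl (ComodAlg.self A) R.datum.ρ).toLinearMap
        ((R.datum.inX.toLinearMap ∘ₗ R.trans) ∘ₗ YDModule.act θ) a := by
  rw [inX_mul_inl]
  congr 2
  ext a
  exact congrArg R.datum.inX (R.act_trans θ a)

lemma act_inclHom (h : H) (a : A) :
    YDModule.act (R.inclHom h) (E.inclHom a) = R.inclHom (YDModule.act h a) := R.act_incl h a

/-- The values of the derivation on `A`: `a ↦ a⁽¹⁾ π(a⁽²⁾)`. -/
def derivA : A →ₗ[ℂ] R.datum.Cross :=
  conv (Comod.self A) (Smash.inl (ComodAlg.self A) R.datum.ρ).toLinearMap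
    ((R.datum.inX.comp R.inclHom).toLinearMap ∘ₗ π)

/-- The values of the derivation on `V`. -/
def derivV : V →ₗ[ℂ] R.datum.Cross := (R.datum.inX.comp R.inclHom).toLinearMap ∘ₗ ζ

variable {π ζ}

lemma derivA_mul (hπ : ∀ a b, π (a * b) = YDModule.act (π a) b + counit (R := ℂ) a • π b)
    (a b : A) : R.derivA π (a * b) =
      R.derivA π a * Smash.inl (ComodAlg.self A) R.datum.ρ b +
        Smash.inl (ComodAlg.self A) R.datum.ρ a * R.derivA π b := by
  let il := Smash.inl (ComodAlg.self A) R.datum.ρ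
  let q := (R.datum.inX.comp R.inclHom).toLinearMap ∘ₗ π
  let g : H → A →ₗ[ℂ] R.datum.Cross := fun h =>
    (R.datum.inX.comp R.inclHom).toLinearMap ∘ₗ YDModule.act h
  have h1 : ∀ (x y : A) (w : A ⊗[ℂ] A), prodMap il.toLinearMap q ((x ⊗ₜ y) * w) =
      il x * (prodMap il.toLinearMap (g (π y)) w +
        counit (R := ℂ) y • prodMap il.toLinearMap q w) := by
    intro x y w
    induction w with
    | zero => simp
    | add u v hu hv => simp only [map_add, mul_add, smul_add, hu, hv]; abel
    | tmul p r => simp [q, g, hπ, mul_add, mul_assoc]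
  have h2 : ∀ h : H, prodMap il.toLinearMap (g h) (comul b) =
      R.datum.inX (R.inclHom h) * il b := by
    intro h
    refine Eq.trans ?_ (R.inX_mul_inl (R.inclHom h) b).symm
    refine congrArg (fun f => conv (Comod.self A) il.toLinearMap f b) ?_
    ext c
    exact congrArg R.datum.inX (R.act_inclHom h c).symm
  have h3 : ∀ u : A ⊗[ℂ] A, prodMap il.toLinearMap q (u * comul b) =
      prodMap il.toLinearMap q u * il b +
        prodMap il.toLinearMap (Algebra.linearMap ℂ R.datum.Cross ∘ₗ counit) u *
          R.derivA π b := by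
    intro u
    induction u with
    | zero => simp
    | add u v hu hv => simp only [map_add, add_mul, hu, hv]; abel
    | tmul x y =>
      have h4 : prodMap il.toLinearMap q (comul b) = R.derivA π b := rfl
      rw [h1, h2, h4]
      simp only [prodMap_tmul, LinearMap.comp_apply, Algebra.linearMap_apply, mul_assoc, mul_add,
        Algebra.smul_def, q, AlgHom.toLinearMap_apply, AlgHom.comp_apply]
  have h5 : prodMap il.toLinearMap (Algebra.linearMap ℂ R.datum.Cross ∘ₗ counit) (comul a) =
      il a := LinearMap.congr_fun (conv_convUnit (D := Comod.self A) il.toLinearMap) a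
  rw [← h5]
  refine Eq.trans ?_ (h3 (comul a))
  rw [← Bialgebra.comul_mul]
  rfl

/-- The commutation relation between the images of `V` and `π`, which expresses the covariance
of `π`. -/
lemma conv_trans_germ (hπ : ∀ a, YDModule.coact (π a) = π.rTensor A (adCoact A a)) (θ : V) :
    conv (Comod.self A) (R.trans ∘ₗ YDModule.act θ) (R.inclHom.toLinearMap ∘ₗ π) =
      conv (Comod.self A) (R.inclHom.toLinearMap ∘ₗ π) (R.trans ∘ₗ YDModule.act θ) := by
  let Ri : A →ₐ[ℂ] A ⊗[ℂ] A := Algebra.TensorProduct.includeRight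
  let f := R.inclHom.toLinearMap ∘ₗ π
  let g := R.trans ∘ₗ (YDModule.act θ : A →ₗ[ℂ] V)
  have h : ∀ w : A ⊗[ℂ] A, prodMap g f w = prodMap f g (prodMap Ri.toLinearMap (adCoact A) w) := by
    intro w
    induction w with
    | zero => simp
    | add u v hu hv => simp only [map_add, hu, hv]
    | tmul a b =>
      have h1 := R.trans_mul_inclHom (YDModule.act θ a) (π b)
      rw [conv_apply, YDModule.comod_δ, hπ, prodMap_rTensor] at h1
      refine h1.trans ?_
      rw [prodMap_tmul]
      induction adCoact A b with
      | zero => simp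
      | add u v hu hv => simp only [map_add, mul_add, hu, hv]
      | tmul x y => simp [f, g, Ri, YDModule.act_mul]
  ext a
  have h2 := LinearMap.congr_fun (conv_adCoact (A := A)) a
  rw [conv_apply, h]
  exact congrArg (prodMap f g) h2

lemma trans_mul_zeta (hζ : ∀ v, YDModule.coact (ζ v) = ζ.rTensor A (YDModule.coact v)) (θ : V) :
    LinearMap.mulLeft ℂ (R.trans θ) ∘ₗ R.inclHom.toLinearMap ∘ₗ ζ =
      conv (YDModule.comod A V) (R.inclHom.toLinearMap ∘ₗ ζ) (R.trans ∘ₗ YDModule.act θ) := by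
  ext η
  refine (R.trans_mul_inclHom θ (ζ η)).trans ?_
  rw [conv_apply, YDModule.comod_δ, hζ, prodMap_rTensor]
  rfl

lemma derivV_mul_inl (hζ : ∀ v (a : A), ζ (YDModule.act v a) = YDModule.act (ζ v) a) (θ : V)
    (a : A) : R.derivV ζ θ * Smash.inl (ComodAlg.self A) R.datum.ρ a =
      conv (Comod.self A) (Smash.inl (ComodAlg.self A) R.datum.ρ).toLinearMap
        (R.derivV ζ ∘ₗ YDModule.act θ) a := by
  refine (R.inX_mul_inl (R.inclHom (ζ θ)) a).trans ?_
  congr 2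
  ext a
  change R.datum.inX (YDModule.act (R.inclHom (ζ θ)) (E.inclHom a)) =
    R.datum.inX (R.inclHom (ζ (YDModule.act θ a)))
  rw [act_inclHom, hζ]

lemma trans_mul_derivA (hπ : ∀ a, YDModule.coact (π a) = π.rTensor A (adCoact A a)) (θ : V)
    (a : A) : R.datum.inX (R.trans θ) * R.derivA π a = conv (Comod.self A) (R.derivA π)
      ((R.datum.inX.toLinearMap ∘ₗ R.trans) ∘ₗ YDModule.act θ) a := by
  have h1 := congrArg (fun f => R.datum.inX.toLinearMap ∘ₗ f) (R.conv_trans_germ hπ θ)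
  simp only [algHom_conv] at h1
  have h2 : LinearMap.mulLeft ℂ (R.datum.inX (R.trans θ)) ∘ₗ
      (Smash.inl (ComodAlg.self A) R.datum.ρ).toLinearMap = _ :=
    LinearMap.ext (R.inX_trans_mul_inl θ)
  rw [derivA, conv_assoc]
  refine Eq.trans ?_ (LinearMap.congr_fun (congrArg (conv (Comod.self A) _) h1) a)
  rw [← LinearMap.comp_assoc, ← conv_assoc]
  refine Eq.trans ?_ (LinearMap.congr_fun (congrArg (fun f => conv (Comod.self A) f
    ((R.datum.inX.comp R.inclHom).toLinearMap ∘ₗ π)) h2) a)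
  rw [conv_mulLeft]
  rfl

/-- The derivation on the braided symmetric algebra is well defined: it is
`ϑ ↦ ζ(θ₀) κ(θ₁) ϑ₂`, where `θ` is the part of degree one of the first factor of the coaction. -/
lemma lift_sqZero (hζ : ∀ v, YDModule.coact (ζ v) = ζ.rTensor A (YDModule.coact v))
    (x : TensorAlgebra ℂ V) :
    TensorAlgebra.lift ℂ (sqZero (R.datum.inX.toLinearMap ∘ₗ R.trans) (R.derivV ζ)) x =
      sqZero ((R.datum.hom E).comp E.symIncl).toLinearMap
        (prodMap (conv (YDModule.comod A V) (R.derivV ζ)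
            ((Smash.inl (ComodAlg.self A) R.datum.ρ).toLinearMap ∘ₗ antipode ℂ) ∘ₗ E.symLetter)
          (R.datum.hom E).toLinearMap ∘ₗ E.symCoact.toLinearMap) (E.symMk x) := by
  let J := R.datum.hom E
  let il := Smash.inl (ComodAlg.self A) R.datum.ρ
  let T := R.datum.inX.toLinearMap ∘ₗ R.trans
  let z := conv (YDModule.comod A V) (R.derivV ζ) (il.toLinearMap ∘ₗ antipode ℂ)
  have hJ : ∀ θ, J (E.trans θ) = T θ := R.datum.hom_trans E
  have hz : ∀ θ η, J (E.trans θ) * z η = z η * J (E.trans θ) := by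
    intro θ η
    have h1 : LinearMap.mulLeft ℂ (T θ) ∘ₗ R.derivV ζ =
        conv (YDModule.comod A V) (R.derivV ζ) (T ∘ₗ YDModule.act θ) := by
      have h := congrArg (fun f => R.datum.inX.toLinearMap ∘ₗ f) (R.trans_mul_zeta hζ θ)
      simp only [algHom_conv] at h
      refine Eq.trans ?_ h
      ext η
      simp [derivV, T]
    have h2 : conv (Comod.self A) (T ∘ₗ YDModule.act θ) (il.toLinearMap ∘ₗ antipode ℂ) =
        LinearMap.mulRight ℂ (T θ) ∘ₗ il.toLinearMap ∘ₗ antipode ℂ := by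
      ext a
      exact conv_antipode_of_rule il (T θ) _ (R.inX_trans_mul_inl θ) a
    have h3 : LinearMap.mulLeft ℂ (T θ) ∘ₗ z = LinearMap.mulRight ℂ (T θ) ∘ₗ z := by
      rw [← conv_mulLeft, h1, conv_assoc, h2, conv_mulRight]
    rw [hJ]
    exact LinearMap.congr_fun h3 η
  have hz' : conv (YDModule.comod A V) z (J.comp E.inclHom).toLinearMap = R.derivV ζ := by
    have : J.comp E.inclHom = il := by ext a; exact R.datum.hom_inclHom E a
    rw [this, conv_assoc, antipode_conv, conv_convUnit]
  induction x using tensor_induction with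
  | one =>
    rw [map_one, map_one]
    ext
    · simp
    · simp [Algebra.TensorProduct.one_def, E.symLetter_one]
  | add x y hx hy => simp only [map_add, hx, hy]
  | smul c x hx => simp only [map_smul, hx]
  | cons θ x hx =>
    have h1 := E.prodMap_symLetter_cons J z hz θ (E.symMk x)
    rw [hz'] at h1
    have h2 : E.symMk (TensorAlgebra.ι ℂ θ * x) = E.symι θ * E.symMk x := map_mul _ _ _
    have h3 : E.symIncl (E.symι θ) = E.trans θ := E.sym_ι θ
    rw [map_mul, TensorAlgebra.lift_ι_apply, hx, h2]
    ext
    · simp only [TrivSqZeroExt.fst_mul, sqZero_fst, AlgHom.toLinearMap_apply, AlgHom.comp_apply,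
        map_mul, h3]
      exact congrArg (· * _) (hJ θ).symm
    · simp only [TrivSqZeroExt.snd_mul, sqZero_snd, sqZero_fst]
      refine Eq.trans ?_ h1.symm
      rw [hJ]
      rfl

end Derivation

end AffineAlgebra

namespace AffineExtension

variable {A V : Type*} [Ring A] [StarRing A] [HopfAlgebra ℂ A]
  [AddCommGroup V] [Module ℂ V] [StarAddMonoid V] [YDModule A V]
  (E : AffineExtension A V) {K : Type*} [Ring K] [Algebra ℂ K]

/-- A derivation along a homomorphism `Ã → K` is determined by its values on `A` and `V`, which can
be prescribed subject to the relations of `Ã`. -/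
lemma exists_derivation (J : E.carrier →ₐ[ℂ] K) (f : A →ₐ[ℂ] K) (T : V →ₗ[ℂ] K)
    (hJA : ∀ a, J (E.inclHom a) = f a) (hJV : ∀ θ, J (E.trans θ) = T θ)
    (dA : A →ₗ[ℂ] K) (dV : V →ₗ[ℂ] K) (h1 : dA 1 = 0)
    (hd : ∀ a b, dA (a * b) = dA a * f b + f a * dA b)
    (hT : ∀ θ a, T θ * f a = conv (Comod.self A) f.toLinearMap (T ∘ₗ YDModule.act θ) a)
    (hdV : ∀ θ a, dV θ * f a = conv (Comod.self A) f.toLinearMap (dV ∘ₗ YDModule.act θ) a)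
    (hdA : ∀ θ a, T θ * dA a = conv (Comod.self A) dA (T ∘ₗ YDModule.act θ) a)
    (hk : ∀ x, E.sym x = 0 → TensorAlgebra.lift ℂ (sqZero T dV) x = 0) :
    ∃ d : E.carrier →ₗ[ℂ] K, (∀ b c, d (b * c) = d b * J c + J b * d c) ∧
      (∀ a, d (E.inclHom a) = dA a) ∧ ∀ θ, d (E.trans θ) = dV θ := by
  let φ := derivHom f dA h1 hd
  have hφ : φ.toLinearMap = sqZero f.toLinearMap dA := rfl
  have hrule : ∀ (θ : V) (a : A), sqZero T dV θ * φ a =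
      conv (Comod.self A) φ.toLinearMap (sqZero T dV ∘ₗ YDModule.act θ) a := by
    intro θ a
    have h2 : sqZero T dV ∘ₗ YDModule.act θ =
        sqZero (T ∘ₗ YDModule.act θ) (dV ∘ₗ (YDModule.act θ : A →ₗ[ℂ] V)) := rfl
    have h3 : φ a = sqZero f.toLinearMap dA a := rfl
    rw [hφ, h2, h3, conv_apply, prodMap_sqZero]
    refine TrivSqZeroExt.ext ?_ ?_
    · rw [TrivSqZeroExt.fst_mul, sqZero_fst, sqZero_fst, sqZero_fst]
      exact hT θ a
    · rw [TrivSqZeroExt.snd_mul, sqZero_snd, sqZero_fst, sqZero_snd, sqZero_snd, sqZero_fst,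
        LinearMap.add_apply, add_comm]
      exact congrArg₂ (· + ·) (hdV θ a) (hdA θ a)
  have hk' : ∀ x, symmetrizer A x = 0 → TensorAlgebra.lift ℂ (sqZero T dV) x = 0 :=
    fun x hx => hk x ((E.sym_eq_zero_iff x).mpr hx)
  let Φ : E.carrier →ₐ[ℂ] TrivSqZeroExt K K := E.lift φ (sqZero T dV) hrule hk'
  have hΦA : ∀ a, Φ (E.inclHom a) = sqZero f.toLinearMap dA a := E.lift_inclHom _ _ _ _
  have hΦV : ∀ θ, Φ (E.trans θ) = sqZero T dV θ := E.lift_trans _ _ _ _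
  have hfst : (TrivSqZeroExt.fstHom ℂ K K).comp Φ = J := by
    refine E.hom_ext (fun a => ?_) (fun θ => ?_)
    · rw [AlgHom.comp_apply, hΦA, hJA]
      exact sqZero_fst _ _ a
    · rw [AlgHom.comp_apply, hΦV, hJV]
      exact sqZero_fst _ _ θ
  have hfst' : ∀ b, (Φ b).fst = J b := fun b => DFunLike.congr_fun hfst b
  refine ⟨(TrivSqZeroExt.sndHom K K).restrictScalars ℂ ∘ₗ Φ.toLinearMap,
    fun b c => ?_, fun a => ?_, fun θ => ?_⟩
  · change (Φ (b * c)).snd = (Φ b).snd * _ + _ * (Φ c).snd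
    rw [map_mul, TrivSqZeroExt.snd_mul, hfst', hfst', add_comm]
    rfl
  · exact (congrArg TrivSqZeroExt.snd (hΦA a)).trans (sqZero_snd _ _ a)
  · exact (congrArg TrivSqZeroExt.snd (hΦV θ)).trans (sqZero_snd _ _ θ)

end AffineExtension

namespace AffineAlgebra

variable {A V H : Type*} [Ring A] [StarRing A] [HopfAlgebra ℂ A]
  [AddCommGroup V] [Module ℂ V] [StarAddMonoid V] [YDModule A V]
  {E : AffineExtension A V} [Ring H] [Algebra ℂ H] [StarRing H]
  [StarModule ℂ H] [YDModule A H] (R : AffineAlgebra E H) {π : A →ₗ[ℂ] H} {ζ : V →ₗ[ℂ] H}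

lemma derivA_one (hπ : ∀ a b, π (a * b) = YDModule.act (π a) b + counit (R := ℂ) a • π b) :
    R.derivA π 1 = 0 := by
  have h := R.derivA_mul hπ 1 1
  rw [map_one (Smash.inl (ComodAlg.self A) R.datum.ρ), mul_one, mul_one, one_mul] at h
  exact left_eq_add.mp h

/-- There is a derivation along `Ã → A # H̃` with `a ↦ a⁽¹⁾ π(a⁽²⁾)` and `θ ↦ ζ(θ)`. -/
lemma exists_derivation
    (hπ : ∀ a b, π (a * b) = YDModule.act (π a) b + counit (R := ℂ) a • π b)
    (hπc : ∀ a, YDModule.coact (π a) = π.rTensor A (adCoact A a))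
    (hζa : ∀ v (a : A), ζ (YDModule.act v a) = YDModule.act (ζ v) a)
    (hζ : ∀ v, YDModule.coact (ζ v) = ζ.rTensor A (YDModule.coact v)) :
    ∃ d : E.carrier →ₗ[ℂ] R.datum.Cross,
      (∀ b c, d (b * c) = d b * R.datum.hom E c + R.datum.hom E b * d c) ∧
      (∀ a, d (E.inclHom a) = R.derivA π a) ∧ ∀ θ, d (E.trans θ) = R.derivV ζ θ := by
  refine E.exists_derivation (R.datum.hom E) (Smash.inl (ComodAlg.self A) R.datum.ρ)
    (R.datum.inX.toLinearMap ∘ₗ R.trans) (R.datum.hom_inclHom E) (R.datum.hom_trans E)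
    (R.derivA π) (R.derivV ζ) (R.derivA_one hπ) (R.derivA_mul hπ) R.inX_trans_mul_inl
    (R.derivV_mul_inl hζa) (R.trans_mul_derivA hπc) (fun x hx => ?_)
  rw [R.lift_sqZero hζ x, (E.symMk_eq_zero_iff x).mpr hx, map_zero]

/-- The quantum germs map of the derivation of `exists_derivation`. It has values in `H̃` because it
has on the generators, and is a cocycle for the adjoint action. -/
lemma exists_germMap
    (hπ : ∀ a b, π (a * b) = YDModule.act (π a) b + counit (R := ℂ) a • π b)
    (hπc : ∀ a, YDModule.coact (π a) = π.rTensor A (adCoact A a))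
    (hζa : ∀ v (a : A), ζ (YDModule.act v a) = YDModule.act (ζ v) a)
    (hζ : ∀ v, YDModule.coact (ζ v) = ζ.rTensor A (YDModule.coact v)) :
    ∃ ϖ : E.carrier →ₗ[ℂ] R.carrier, (∀ a, ϖ (E.inclHom a) = R.inclHom (π a)) ∧
      (∀ θ, ϖ (E.trans θ) = R.inclHom (ζ θ) -
        prodMap R.trans (R.inclHom.toLinearMap ∘ₗ π) (YDModule.coact θ)) ∧
      ∀ b c, ϖ (b * c) = YDModule.act (ϖ b) c + counit (R := ℂ) b • ϖ c := by
  obtain ⟨d, hd, hdA, hdV⟩ := R.exists_derivation hπ hπc hζa hζ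
  let P := R.datum
  let J := P.hom E
  let il := Smash.inl (ComodAlg.self A) P.ρ
  let T := P.inX.toLinearMap ∘ₗ R.trans
  let q := (P.inX.comp R.inclHom).toLinearMap ∘ₗ π
  have hJA : J.toLinearMap ∘ₗ E.inclHom.toLinearMap = il.toLinearMap := by
    ext a; exact P.hom_inclHom E a
  have hJV : J.toLinearMap ∘ₗ E.trans = T := by ext θ; exact P.hom_trans E θ
  have hdA' : d ∘ₗ E.inclHom.toLinearMap = R.derivA π := by ext a; exact hdA a
  have hqa : conv (Comod.self A) (il.toLinearMap ∘ₗ antipode ℂ) (R.derivA π) = q := by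
    change conv _ _ (conv _ il.toLinearMap q) = q
    rw [← conv_assoc, antipode_conv, convUnit_conv]
  -- `κ(a⁽¹⁾) d(a⁽²⁾) = κ(a⁽¹⁾) a⁽²⁾ π(a⁽³⁾) = π(a)`.
  have hA : ∀ a, convGerm J d (E.inclHom a) = P.inX (R.inclHom (π a)) := by
    intro a
    have h := conv_comp (Comod.self E.carrier) (Comod.self A) E.inclHom.toLinearMap
      E.inclHom.toLinearMap E.comul_inclHom (J.toLinearMap ∘ₗ antipode ℂ) d
    rw [hdA', LinearMap.comp_assoc, antipode_comp_bialgHom E.inclHom E.comul_inclHom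
      E.counit_inclHom, ← LinearMap.comp_assoc, hJA, hqa] at h
    exact LinearMap.congr_fun h a
  -- For `φ(θ) = 1 ⊗ θ + θ₀ ⊗ θ₁` and `κ(θ) = -θ₀ κ(θ₁)`, the germ of `θ` is
  -- `d(θ) - θ₀ κ(θ₁) d(θ₂) = ζ(θ) - θ₀ π(θ₁)`.
  have hV : ∀ θ, convGerm J d (E.trans θ) = P.inX (R.inclHom (ζ θ) -
      prodMap R.trans (R.inclHom.toLinearMap ∘ₗ π) (YDModule.coact θ)) := by
    intro θ
    have h1 : J.toLinearMap ∘ₗ antipode ℂ ∘ₗ E.trans =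
        -conv (YDModule.comod A V) T (il.toLinearMap ∘ₗ antipode ℂ) := by
      have h3 : J.toLinearMap ∘ₗ E.inclHom.toLinearMap ∘ₗ antipode ℂ =
          il.toLinearMap ∘ₗ antipode ℂ := by rw [← LinearMap.comp_assoc, hJA]
      have h4 : antipode ℂ ∘ₗ E.trans = -conv (YDModule.comod A V) E.trans
          (E.inclHom.toLinearMap ∘ₗ antipode ℂ) := by
        ext θ; exact E.antipode_trans θ
      rw [h4, LinearMap.comp_neg, algHom_conv, hJV, h3]
    have h7 : conv (YDModule.comod A V) (conv (YDModule.comod A V) T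
        (il.toLinearMap ∘ₗ antipode ℂ)) (R.derivA π) = conv (YDModule.comod A V) T q := by
      rw [conv_assoc, hqa]
    have h8 : conv (YDModule.comod A V) T q =
        P.inX.toLinearMap ∘ₗ conv (YDModule.comod A V) R.trans (R.inclHom.toLinearMap ∘ₗ π) := by
      rw [algHom_conv]; rfl
    rw [convGerm, conv_apply, Comod.self_δ, E.comul_trans_eq, affineMap_apply, map_add,
      prodMap_map, LinearMap.comp_assoc, h1, hdA', prodMap_neg_left, LinearMap.neg_apply]
    have h9 := LinearMap.congr_fun (h7.trans h8) θ
    rw [conv_apply, YDModule.comod_δ] at h9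
    rw [h9, prodMap_tmul, hdV, map_sub, sub_eq_add_neg]
    simp only [LinearMap.comp_apply, antipode_one, AlgHom.toLinearMap_apply, map_one, one_mul]
    rfl
  have hmem : ∀ b, ∃ y, P.inX y = convGerm J d b := by
    intro b
    induction b using E.induction with
    | hincl a => exact ⟨_, (hA a).symm⟩
    | htrans θ => exact ⟨_, (hV θ).symm⟩
    | add b c hb hc =>
      obtain ⟨y, hy⟩ := hb
      obtain ⟨z, hz⟩ := hc
      exact ⟨y + z, by rw [map_add, map_add, hy, hz]⟩
    | mul b c hb hc =>
      obtain ⟨y, hy⟩ := hb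
      obtain ⟨z, hz⟩ := hc
      exact ⟨P.act E y c + counit (R := ℂ) b • z, by
        rw [convGerm_mul J d hd, map_add, P.inX_act, hy, map_smul, hz]⟩
  let ϖ : E.carrier →ₗ[ℂ] R.carrier := Smash.projR _ P.ρ (counit (R := ℂ)) ∘ₗ convGerm J d
  have hϖ : ∀ b, P.inX (ϖ b) = convGerm J d b := by
    intro b
    obtain ⟨y, hy⟩ := hmem b
    have : ϖ b = Smash.projR _ P.ρ (counit (R := ℂ)) (convGerm J d b) := rfl
    rw [this, ← hy, Smash.projR_inr _ _ _ Bialgebra.counit_one]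
  refine ⟨ϖ, fun a => P.inX_injective ?_, fun θ => P.inX_injective ?_,
    fun b c => P.inX_injective ?_⟩
  · rw [hϖ, hA]
  · rw [hϖ, hV]
  · rw [hϖ, convGerm_mul J d hd, map_add, map_smul, hϖ, ← hϖ b, ← R.datum_act]
    exact congrArg (· + _) (P.inX_act E (ϖ b) c).symm

end AffineAlgebra

/-! ### Covariance and hermiticity of the quantum germs map -/

section Generic

variable {B X : Type*} [Ring B] [HopfAlgebra ℂ B]

/-- `κ(a⁽²⁾*)* a⁽¹⁾ = ε(a) 1`. -/
lemma prodMap_star_antipode_star [StarRing B] [HopfStarAlgebra B] (s : B →ₗ[ℂ] B)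
    (hs : ∀ b, s b = star (antipode ℂ (star b))) (b : B) :
    prodMap s LinearMap.id (TensorProduct.comm ℂ B B (comul b)) = algebraMap ℂ B (counit b) := by
  have h : ∀ u : B ⊗[ℂ] B, prodMap s LinearMap.id (TensorProduct.comm ℂ B B u) =
      star (prodMap LinearMap.id (antipode ℂ) (star u)) := by
    intro u
    induction u with
    | zero => simp
    | add u v hu hv => simp only [map_add, star_add, hu, hv]
    | tmul x y => simp [hs]
  have h2 := LinearMap.congr_fun (conv_antipode (AlgHom.id ℂ B)) (star b)
  simp only [conv_apply, AlgHom.toLinearMap_id, LinearMap.id_comp, Comod.self_δ] at h2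
  rw [h, ← HopfStarAlgebra.comul_star, h2, convUnit_apply, counit_star]
  simp [Algebra.algebraMap_eq_smul_one]

lemma counit_star_antipode [StarRing B] [HopfStarAlgebra B] (b : B) :
    counit (R := ℂ) (star (antipode ℂ b)) = star (counit (R := ℂ) b) := by
  rw [counit_star, HopfAlgebra.counit_antipode]

variable [AddCommGroup X] [Module ℂ X]

/-- The map `b⁽¹⁾ ⊗ b⁽²⁾ ⊗ b⁽³⁾ ↦ f(b⁽²⁾) ⊗ κ(b⁽¹⁾) s b⁽³⁾`. -/
def adTriple (f : B →ₗ[ℂ] X) : B →ₗ[ℂ] B ⊗[ℂ] (B ⊗[ℂ] B) →ₗ[ℂ] X ⊗[ℂ] B :=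
  LinearMap.mk₂ ℂ (fun s u => TensorProduct.map f
    (LinearMap.mul' ℂ B ∘ₗ TensorProduct.map (antipode ℂ) (LinearMap.mulLeft ℂ s))
      (TensorProduct.leftComm ℂ B B B u))
    (by intro s s' u
        have : LinearMap.mulLeft ℂ (s + s') = LinearMap.mulLeft ℂ s + LinearMap.mulLeft ℂ s' := by
          ext; simp [add_mul]
        rw [this, TensorProduct.map_add_right, LinearMap.comp_add, TensorProduct.map_add_right]
        rfl)
    (by intro c s u
        have : LinearMap.mulLeft ℂ (c • s) = c • LinearMap.mulLeft ℂ s := by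
          ext; simp
        rw [this, TensorProduct.map_smul_right, LinearMap.comp_smul, TensorProduct.map_smul_right]
        rfl)
    (by intros; simp) (by intros; simp)

@[simp] lemma adTriple_tmul (f : B →ₗ[ℂ] X) (s b c d : B) :
    adTriple f s (b ⊗ₜ (c ⊗ₜ d)) = f c ⊗ₜ (antipode ℂ b * (s * d)) := rfl

lemma rTensor_adCoact (f : B →ₗ[ℂ] X) (b : B) : f.rTensor B (adCoact B b) =
    adTriple f 1 (LinearMap.lTensor B comul (comul b)) := by
  have h : ∀ u : B ⊗[ℂ] (B ⊗[ℂ] B), f.rTensor B ((LinearMap.lTensor B (LinearMap.mul' ℂ B ∘ₗ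
      LinearMap.rTensor B (antipode ℂ)) ∘ₗ (TensorProduct.leftComm ℂ B B B).toLinearMap) u) =
      adTriple f 1 u := by
    intro u
    refine LinearMap.congr_fun (f := f.rTensor B ∘ₗ _) (g := adTriple f 1) ?_ u
    ext b c d
    simp
  exact h _

variable (B) in
/-- The map `b⁽¹⁾ ⊗ b⁽²⁾ ⊗ b⁽³⁾ ↦ κ(b⁽¹⁾) ε(b⁽²⁾) b⁽³⁾`. -/
def antipodeCounit : B ⊗[ℂ] (B ⊗[ℂ] B) →ₗ[ℂ] B :=
  prodMap (antipode ℂ) (prodMap (convUnit B B) LinearMap.id)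

lemma antipodeCounit_comul (b : B) :
    antipodeCounit B (LinearMap.lTensor B (comul (R := ℂ)) (comul (R := ℂ) b)) =
      algebraMap ℂ B (counit b) := by
  have h1 : prodMap (convUnit B B) LinearMap.id ∘ₗ comul = LinearMap.id :=
    convUnit_conv (LinearMap.id : B →ₗ[ℂ] B)
  have h2 := LinearMap.congr_fun (antipode_conv (AlgHom.id ℂ B)) b
  rw [antipodeCounit, prodMap_lTensor, h1]
  exact h2

variable [YDModule B X] {ϖ : B →ₗ[ℂ] X}
  (hϖ : ∀ b c, ϖ (b * c) = YDModule.act (ϖ b) c + counit (R := ℂ) b • ϖ c)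

include hϖ in
lemma germ_one : ϖ 1 = 0 := by
  have h := hϖ 1 1
  rw [mul_one, YDModule.act_one, Bialgebra.counit_one, one_smul] at h
  exact left_eq_add.mp h

include hϖ in
lemma adTriple_mul (u w : B ⊗[ℂ] (B ⊗[ℂ] B)) : adTriple ϖ 1 (u * w) =
    ydTwist YDModule.act (adTriple ϖ 1 u ⊗ₜ w) + adTriple ϖ (antipodeCounit B u) w := by
  induction u with
  | zero => simp
  | add u v hu hv =>
    simp only [add_mul, map_add, TensorProduct.add_tmul, LinearMap.add_apply, hu, hv]; abel
  | tmul b u =>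
    induction u with
    | zero => simp
    | add u v hu hv =>
      simp only [add_mul, map_add, TensorProduct.add_tmul, TensorProduct.tmul_add,
        LinearMap.add_apply, hu, hv]; abel
    | tmul c d =>
      induction w with
      | zero => simp
      | add u v hu hv => simp only [mul_add, map_add, TensorProduct.tmul_add, hu, hv]; abel
      | tmul p w =>
        induction w with
        | zero => simp
        | add u v hu hv => simp only [mul_add, map_add, TensorProduct.tmul_add, hu, hv]; abel
        | tmul q r =>
          simp [ydTwist, antipodeCounit, hϖ, antipode_mul_antidistrib, TensorProduct.add_tmul,
            mul_assoc, Algebra.algebraMap_eq_smul_one, TensorProduct.smul_tmul]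

include hϖ in
/-- Covariance of a cocycle is preserved by products. -/
lemma coact_germ_mul {b c : B} (hb : YDModule.coact (ϖ b) = ϖ.rTensor B (adCoact B b))
    (hc : YDModule.coact (ϖ c) = ϖ.rTensor B (adCoact B c)) :
    YDModule.coact (ϖ (b * c)) = ϖ.rTensor B (adCoact B (b * c)) := by
  have h : LinearMap.lTensor B comul (comul (R := ℂ) (b * c)) =
      LinearMap.lTensor B comul (comul b) * LinearMap.lTensor B comul (comul c) := by
    rw [Bialgebra.comul_mul]
    exact map_mul (Algebra.TensorProduct.map (AlgHom.id ℂ B) (Bialgebra.comulAlgHom ℂ B)) _ _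
  rw [hϖ, map_add, map_smul, YDModule.coact_act, hb, hc, rTensor_adCoact, rTensor_adCoact,
    rTensor_adCoact, h, adTriple_mul hϖ, antipodeCounit_comul, Algebra.algebraMap_eq_smul_one,
    map_smul]
  rfl

include hϖ in
/-- Hermiticity of a cocycle is preserved by products. -/
lemma star_germ_mul [StarRing B] [HopfStarAlgebra B] [StarAddMonoid X] [StarModule ℂ X]
    [YDStarModule B X] {b c : B} (hb : star (ϖ b) = -ϖ (star (antipode ℂ b)))
    (hc : star (ϖ c) = -ϖ (star (antipode ℂ c))) :
    star (ϖ (b * c)) = -ϖ (star (antipode ℂ (b * c))) := by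
  rw [hϖ, star_add, star_smul, YDStarModule.star_act, hb, hc, antipode_mul_antidistrib, star_mul,
    hϖ, counit_star_antipode]
  simp [add_comm]

end Generic

/-- Bialgebra homomorphisms intertwine the adjoint coactions. -/
lemma adCoact_bialgHom {A B : Type*} [Ring A] [HopfAlgebra ℂ A] [Ring B] [HopfAlgebra ℂ B]
    (i : A →ₐ[ℂ] B)
    (hi : ∀ a, comul (R := ℂ) (i a) = TensorProduct.map i.toLinearMap i.toLinearMap (comul a))
    (hεi : ∀ a, counit (R := ℂ) (i a) = counit (R := ℂ) a) (a : A) :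
    adCoact B (i a) = TensorProduct.map i.toLinearMap i.toLinearMap (adCoact A a) := by
  have h1 := conv_comp (Comod.self B) (Comod.self A) i.toLinearMap i.toLinearMap hi
    ((Algebra.TensorProduct.includeRight : B →ₐ[ℂ] B ⊗[ℂ] B).toLinearMap ∘ₗ antipode ℂ) comul
  have h2 := algHom_conv (Comod.self A) (Algebra.TensorProduct.map i i)
    ((Algebra.TensorProduct.includeRight : A →ₐ[ℂ] A ⊗[ℂ] A).toLinearMap ∘ₗ antipode ℂ) comul
  have h3 : (comul : B →ₗ[ℂ] B ⊗[ℂ] B) ∘ₗ i.toLinearMap =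
      (Algebra.TensorProduct.map i i).toLinearMap ∘ₗ comul := by ext a; exact hi a
  have h4 : (Algebra.TensorProduct.map i i).toLinearMap ∘ₗ
      (Algebra.TensorProduct.includeRight : A →ₐ[ℂ] A ⊗[ℂ] A).toLinearMap ∘ₗ antipode ℂ =
      ((Algebra.TensorProduct.includeRight : B →ₐ[ℂ] B ⊗[ℂ] B).toLinearMap ∘ₗ antipode ℂ) ∘ₗ
        i.toLinearMap := by
    rw [LinearMap.comp_assoc, antipode_comp_bialgHom i hi hεi]
    ext a; simp
  rw [h3, ← h4, ← h2, ← adCoact_eq_conv, ← adCoact_eq_conv] at h1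
  exact LinearMap.congr_fun h1 a

namespace AffineAlgebra

variable {A V H : Type*} [Ring A] [StarRing A] [HopfAlgebra ℂ A] [HopfStarAlgebra A]
  [AddCommGroup V] [Module ℂ V] [StarAddMonoid V] [StarModule ℂ V] [YDModule A V]
  {E : AffineExtension A V} [Ring H] [Algebra ℂ H] [StarRing H]
  [StarModule ℂ H] [YDModule A H] (R : AffineAlgebra E H) {π : A →ₗ[ℂ] H} {ζ : V →ₗ[ℂ] H}

section Star

variable [YDStarModule A V]

/-- Hermiticity on `V`. Let `s(a) = κ(a*)*` and `w = ϰ(θ*)`, so that `κ(θ)* = -s(w₁) w₀`. The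
cocycle identity brings the germ of `s(w₁) w₀` to terms with `π(s(a⁽²⁾)) ∘ a⁽¹⁾`, which is `-π(a)` as
`s(a⁽²⁾) a⁽¹⁾ = ε(a)`. -/
lemma star_germ_trans {ϖ : E.carrier →ₗ[ℂ] R.carrier} (hπ : IsGermMap π) (hζ : IsCovariantMap A ζ)
    (hA : ∀ a, ϖ (E.inclHom a) = R.inclHom (π a))
    (hV : ∀ θ, ϖ (E.trans θ) = R.inclHom (ζ θ) -
        prodMap R.trans (R.inclHom.toLinearMap ∘ₗ π) (YDModule.coact θ))
    (hϖ : ∀ b c, ϖ (b * c) = YDModule.act (ϖ b) c + counit (R := ℂ) b • ϖ c) (θ : V) :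
    star (ϖ (E.trans θ)) = -ϖ (star (antipode ℂ (E.trans θ))) := by
  let s : A →ₗ[ℂ] A :=
    { toFun := fun a => star (antipode ℂ (star a))
      map_add' := by simp
      map_smul' := by simp }
  have hs : ∀ a, s a = star (antipode ℂ (star a)) := fun a => rfl
  have hεs : ∀ a, counit (R := ℂ) (s a) = counit (R := ℂ) a := by
    intro a; rw [hs, counit_star_antipode, counit_star, star_star]
  let p := R.inclHom.toLinearMap ∘ₗ π
  have hstar : ∀ h, star (R.inclHom h) = R.inclHom (star h) := fun h =>
    (StarHomClass.map_star R.incl h).symm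
  have hact : ∀ x θ, YDModule.act x (E.trans θ) = x * R.trans θ -
      prodMap R.trans (R.restrictMod.act x) (YDModule.coact θ) := by
    intro x θ
    rw [← R.datum_act]
    exact R.datum.act_trans E x θ
  -- Both sides are expressed by the coaction of `θ*`.
  have h1 : ∀ w : V ⊗[ℂ] A, star (prodMap R.trans p (star w)) =
      -prodMap (p ∘ₗ s) R.trans (TensorProduct.comm ℂ V A w) := by
    intro w
    induction w with
    | zero => simp
    | add u v hu hv => simp only [map_add, star_add, hu, hv, neg_add]
    | tmul v a => simp [p, hstar, hπ.star_apply, R.star_trans, hs]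
  have h2 : ∀ w : V ⊗[ℂ] A, star (prodMap E.trans (E.inclHom.toLinearMap ∘ₗ antipode ℂ) (star w)) =
      prodMap (E.inclHom.toLinearMap ∘ₗ s) E.trans (TensorProduct.comm ℂ V A w) := by
    intro w
    induction w with
    | zero => simp
    | add u v hu hv => simp only [map_add, star_add, hu, hv]
    | tmul v a => simp [E.star_inclHom, E.star_trans, hs]
  let m : A ⊗[ℂ] A →ₗ[ℂ] R.carrier := R.inclHom.toLinearMap ∘ₗ
    TensorProduct.lift (YDModule.act ∘ₗ π ∘ₗ s) ∘ₗ (TensorProduct.comm ℂ A A).toLinearMap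
  have h3 : ∀ w : V ⊗[ℂ] A,
      ϖ (prodMap (E.inclHom.toLinearMap ∘ₗ s) E.trans (TensorProduct.comm ℂ V A w)) =
        prodMap (p ∘ₗ s) R.trans (TensorProduct.comm ℂ V A w) -
          prodMap R.trans m (TensorProduct.assoc ℂ V A A (LinearMap.rTensor A YDModule.coact w)) +
          ϖ (E.trans (TensorProduct.rid ℂ V (LinearMap.lTensor V counit w))) := by
    intro w
    induction w with
    | zero => simp
    | add u v hu hv => simp only [map_add, hu, hv]; abel
    | tmul v a =>
      have h : ∀ u : V ⊗[ℂ] A, prodMap R.trans (R.restrictMod.act (R.inclHom (π (s a)))) u =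
          prodMap R.trans m (TensorProduct.assoc ℂ V A A (u ⊗ₜ a)) := by
        intro u
        induction u with
        | zero => simp
        | add u v hu hv => simp only [map_add, TensorProduct.add_tmul, hu, hv]
        | tmul v b => simp [m, restrictMod_act, act_inclHom]
      simp only [TensorProduct.comm_tmul, prodMap_tmul, LinearMap.comp_apply,
        AlgHom.toLinearMap_apply, hϖ, hA, hact, E.counit_inclHom, hεs, LinearMap.rTensor_tmul,
        LinearMap.lTensor_tmul, TensorProduct.rid_tmul, map_smul, h, p]
  have h4 : m ∘ₗ comul = -p := by
    have hm : ∀ u : A ⊗[ℂ] A, m u = p (prodMap s LinearMap.id (TensorProduct.comm ℂ A A u)) -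
        p (prodMap (Algebra.linearMap ℂ A ∘ₗ counit) LinearMap.id
          (TensorProduct.comm ℂ A A u)) := by
      intro u
      induction u with
      | zero => simp
      | add u v hu hv => simp only [map_add, hu, hv]; abel
      | tmul a b =>
        simp [m, p, hπ.map_mul, hεs, ← Algebra.smul_def]
    have hm' : ∀ u : A ⊗[ℂ] A,
        prodMap (Algebra.linearMap ℂ A ∘ₗ counit) LinearMap.id (TensorProduct.comm ℂ A A u) =
        prodMap LinearMap.id (Algebra.linearMap ℂ A ∘ₗ counit) u := by
      intro u
      induction u with
      | zero => simp
      | add u v hu hv => simp only [map_add, hu, hv]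
      | tmul a b => simp [Algebra.algebraMap_eq_smul_one]
    ext a
    have h5 := LinearMap.congr_fun (conv_convUnit (Comod.self A) (LinearMap.id : A →ₗ[ℂ] A)) a
    rw [LinearMap.comp_apply, hm, hm', prodMap_star_antipode_star s hs,
      Algebra.algebraMap_eq_smul_one, map_smul]
    have h6 : p 1 = 0 := by simp [p, germ_one hπ.map_mul]
    rw [h6, smul_zero, zero_sub]
    exact congrArg (fun z => -p z) h5
  have h5 : YDModule.coact (A := A) θ = star (YDModule.coact (A := A) (star θ)) := by
    rw [YDStarModule.coact_star, star_star]
  rw [E.antipode_trans, conv_apply, YDModule.comod_δ, star_neg, map_neg, neg_neg, hV, star_sub,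
    hstar, hζ.star_apply, h5, h1, h2, h3, YDModule.coact_coassoc, prodMap_lTensor, h4,
    YDModule.coact_counit, TensorProduct.rid_tmul, one_smul, hV]
  have h7 : prodMap R.trans (-p) = -prodMap R.trans p := by ext; simp
  rw [h7]
  simp only [LinearMap.neg_apply]
  abel

end Star

end AffineAlgebra

lemma map_eq_prodMap {M N X Y : Type*} [AddCommGroup M] [Module ℂ M] [AddCommGroup N] [Module ℂ N]
    [Ring X] [Algebra ℂ X] [Ring Y] [Algebra ℂ Y] (f : M →ₗ[ℂ] X) (g : N →ₗ[ℂ] Y) :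
    TensorProduct.map f g =
      prodMap ((Algebra.TensorProduct.includeLeft : X →ₐ[ℂ] X ⊗[ℂ] Y).toLinearMap ∘ₗ f)
        ((Algebra.TensorProduct.includeRight : Y →ₐ[ℂ] X ⊗[ℂ] Y).toLinearMap ∘ₗ g) := by
  ext; simp

/-- Multiplication by elements of the second factor commutes with maps of the first factor. -/
lemma map_prodMap_includeRight {M N X X' Y Y' : Type*} [AddCommGroup M] [Module ℂ M]
    [AddCommGroup N] [Module ℂ N] [Ring X] [Algebra ℂ X] [Ring X'] [Algebra ℂ X'] [Ring Y]
    [Algebra ℂ Y] [Ring Y'] [Algebra ℂ Y'] (φ : X →ₗ[ℂ] X') (i : Y →ₐ[ℂ] Y') (f : M →ₗ[ℂ] Y)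
    (g : N →ₗ[ℂ] X ⊗[ℂ] Y) (u : M ⊗[ℂ] N) :
    TensorProduct.map φ i.toLinearMap (prodMap
        ((Algebra.TensorProduct.includeRight : Y →ₐ[ℂ] X ⊗[ℂ] Y).toLinearMap ∘ₗ f) g u) =
      prodMap ((Algebra.TensorProduct.includeRight : Y' →ₐ[ℂ] X' ⊗[ℂ] Y').toLinearMap ∘ₗ
        i.toLinearMap ∘ₗ f) (TensorProduct.map φ i.toLinearMap ∘ₗ g) u := by
  have h : ∀ (y : Y) (z : X ⊗[ℂ] Y), TensorProduct.map φ i.toLinearMap ((1 ⊗ₜ y) * z) =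
      (1 ⊗ₜ i y) * TensorProduct.map φ i.toLinearMap z := by
    intro y z
    induction z with
    | zero => simp
    | add u v hu hv => simp only [map_add, mul_add, hu, hv]
    | tmul a b => simp
  induction u with
  | zero => simp
  | add u v hu hv => simp only [map_add, hu, hv]
  | tmul m n => simp [h]

namespace AffineAlgebra

variable {A V H : Type*} [Ring A] [StarRing A] [HopfAlgebra ℂ A]
  [AddCommGroup V] [Module ℂ V] [StarAddMonoid V] [YDModule A V]
  {E : AffineExtension A V} [Ring H] [Algebra ℂ H] [StarRing H]
  [StarModule ℂ H] [YDModule A H] (R : AffineAlgebra E H) {π : A →ₗ[ℂ] H} {ζ : V →ₗ[ℂ] H}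
  {ϖ : E.carrier →ₗ[ℂ] R.carrier}

lemma coact_germ_inclHom (hπ : ∀ a, YDModule.coact (π a) = π.rTensor A (adCoact A a))
    (hA : ∀ a, ϖ (E.inclHom a) = R.inclHom (π a)) (a : A) :
    YDModule.coact (ϖ (E.inclHom a)) = ϖ.rTensor E.carrier (adCoact E.carrier (E.inclHom a)) := by
  have h : ∀ u : A ⊗[ℂ] A, TensorProduct.map R.inclHom.toLinearMap E.inclHom.toLinearMap
      (π.rTensor A u) = ϖ.rTensor E.carrier
        (TensorProduct.map E.inclHom.toLinearMap E.inclHom.toLinearMap u) := by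
    intro u
    induction u with
    | zero => simp
    | add u v hu hv => simp only [map_add, hu, hv]
    | tmul x y => simp [hA]
  rw [adCoact_bialgHom E.inclHom E.comul_inclHom E.counit_inclHom, ← h, ← hπ, hA]
  exact R.coact_incl (π a)

/-- Covariance on `V`. Both sides are equal to
`ζ(θ₀) ⊗ θ₁ - θ₀ π(θ₁) ⊗ θ₂ - π(θ₂) ⊗ θ₀ κ(θ₁) θ₃`, written with convolution products. -/
lemma coact_germ_trans (hπ : ∀ a, YDModule.coact (π a) = π.rTensor A (adCoact A a))
    (hζ : ∀ v, YDModule.coact (ζ v) = ζ.rTensor A (YDModule.coact v))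
    (hA : ∀ a, ϖ (E.inclHom a) = R.inclHom (π a))
    (hV : ∀ θ, ϖ (E.trans θ) = R.inclHom (ζ θ) -
        prodMap R.trans (R.inclHom.toLinearMap ∘ₗ π) (YDModule.coact θ))
    (h1 : ϖ 1 = 0) (θ : V) :
    YDModule.coact (ϖ (E.trans θ)) = ϖ.rTensor E.carrier (adCoact E.carrier (E.trans θ)) := by
  let Li : R.carrier →ₐ[ℂ] R.carrier ⊗[ℂ] E.carrier := Algebra.TensorProduct.includeLeft
  let Ri : E.carrier →ₐ[ℂ] R.carrier ⊗[ℂ] E.carrier := Algebra.TensorProduct.includeRight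
  let RE : E.carrier →ₐ[ℂ] E.carrier ⊗[ℂ] E.carrier := Algebra.TensorProduct.includeRight
  let D := YDModule.comod A V
  let i := E.inclHom.toLinearMap
  let p := R.inclHom.toLinearMap ∘ₗ π
  let z := R.inclHom.toLinearMap ∘ₗ ζ
  let M := TensorProduct.map p i
  let C : R.carrier →ₐ[ℂ] R.carrier ⊗[ℂ] E.carrier :=
    AlgHom.ofLinearMap YDModule.coact YDStarAlgebra.coact_one YDStarAlgebra.coact_mul
  have hCt : C.toLinearMap ∘ₗ R.trans =
      Ri.toLinearMap ∘ₗ E.trans + conv D (Li.toLinearMap ∘ₗ R.trans) (Ri.toLinearMap ∘ₗ i) := by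
    ext θ
    refine (R.coact_trans θ).trans (congrArg (_ + ·) ?_)
    exact LinearMap.congr_fun (map_eq_prodMap R.trans i) _
  have hMc : M ∘ₗ comul = conv (Comod.self A) (Li.toLinearMap ∘ₗ p) (Ri.toLinearMap ∘ₗ i) :=
    congrArg (· ∘ₗ comul) (map_eq_prodMap p i)
  have hCp : C.toLinearMap ∘ₗ p =
      conv (Comod.self A) (Ri.toLinearMap ∘ₗ i ∘ₗ antipode ℂ) (M ∘ₗ comul) := by
    ext a
    refine (R.coact_incl (π a)).trans ?_
    rw [hπ, adCoact_eq_conv]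
    refine Eq.trans ?_ (map_prodMap_includeRight p E.inclHom (antipode ℂ) comul (comul a))
    exact LinearMap.congr_fun (TensorProduct.map_comp _ _ _ _).symm _
  have hCz : ∀ θ, C (z θ) = conv D (Li.toLinearMap ∘ₗ z) (Ri.toLinearMap ∘ₗ i) θ := by
    intro θ
    refine (R.coact_incl (ζ θ)).trans ?_
    rw [hζ]
    refine Eq.trans ?_ (LinearMap.congr_fun (map_eq_prodMap z i) _)
    exact LinearMap.congr_fun (TensorProduct.map_comp _ _ _ _).symm _
  -- The coaction of `ζ(θ) - θ₀ π(θ₁)`, as `C` is multiplicative.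
  have hleft : C (ϖ (E.trans θ)) = conv D (Li.toLinearMap ∘ₗ z) (Ri.toLinearMap ∘ₗ i) θ -
      (conv D (Ri.toLinearMap ∘ₗ E.trans)
          (conv (Comod.self A) (Ri.toLinearMap ∘ₗ i ∘ₗ antipode ℂ) (M ∘ₗ comul)) θ +
        conv D (Li.toLinearMap ∘ₗ R.trans) (M ∘ₗ comul) θ) := by
    have h2 := LinearMap.congr_fun (algHom_conv D C R.trans p) θ
    rw [hCt, hCp, conv_add_left] at h2
    have h3 : conv D (conv D (Li.toLinearMap ∘ₗ R.trans) (Ri.toLinearMap ∘ₗ i))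
        (conv (Comod.self A) (Ri.toLinearMap ∘ₗ i ∘ₗ antipode ℂ) (M ∘ₗ comul)) =
        conv D (Li.toLinearMap ∘ₗ R.trans) (M ∘ₗ comul) := by
      have h4 := conv_antipode (Ri.comp E.inclHom)
      rw [conv_assoc, ← conv_assoc (Comod.self A)]
      change conv D _ (conv _ (conv _ (Ri.comp E.inclHom).toLinearMap
        ((Ri.comp E.inclHom).toLinearMap ∘ₗ antipode ℂ)) _) = _
      rw [h4, convUnit_conv]
    rw [h3] at h2
    rw [hV, map_sub]
    exact congrArg₂ (· - ·) (hCz θ) h2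
  refine hleft.trans ?_
  have hr : ∀ u, ϖ.rTensor E.carrier u = TensorProduct.map ϖ
    (AlgHom.id ℂ E.carrier).toLinearMap u := fun u => rfl
  have hϖM : ϖ.rTensor E.carrier ∘ₗ comul ∘ₗ i = M ∘ₗ comul := by
    ext a
    simp only [LinearMap.comp_apply, i, AlgHom.toLinearMap_apply, E.comul_inclHom]
    have h : ∀ u : A ⊗[ℂ] A, ϖ.rTensor E.carrier
        (TensorProduct.map E.inclHom.toLinearMap E.inclHom.toLinearMap u) = M u := by
      intro u
      induction u with
      | zero => simp
      | add u v hu hv => simp only [map_add, hu, hv]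
      | tmul x y => simp [hA, M, p, i]
    exact h _
  have hϖt : ϖ ∘ₗ E.trans = z - conv D R.trans p := by ext θ; exact hV θ
  have hS : RE.toLinearMap ∘ₗ antipode ℂ ∘ₗ E.trans =
      -(RE.toLinearMap ∘ₗ conv D E.trans (i ∘ₗ antipode ℂ)) := by
    ext θ
    change RE (antipode ℂ (E.trans θ)) = -RE _
    rw [E.antipode_trans, map_neg]
  -- The adjoint coaction `θ⁽²⁾ ⊗ κ(θ⁽¹⁾) θ⁽³⁾` of `θ`, from `φ(θ) = 1 ⊗ θ + θ₀ ⊗ θ₁`.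
  rw [adCoact_eq_conv, conv_apply (Comod.self E.carrier), Comod.self_δ, E.comul_trans_eq,
    affineMap_apply, map_add, prodMap_tmul, prodMap_map, map_add]
  change _ = ϖ.rTensor E.carrier (RE (antipode ℂ 1) * _) + ϖ.rTensor E.carrier
    (prodMap (RE.toLinearMap ∘ₗ antipode ℂ ∘ₗ E.trans) (comul ∘ₗ i) _)
  rw [antipode_one, map_one, one_mul, E.comul_trans_eq, affineMap_apply, map_add,
    LinearMap.rTensor_tmul, h1, TensorProduct.zero_tmul, zero_add, hS]
  have h5 : ϖ.rTensor E.carrier (TensorProduct.map E.trans E.inclHom.toLinearMap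
      (YDModule.coact θ)) = conv D (Li.toLinearMap ∘ₗ z) (Ri.toLinearMap ∘ₗ i) θ -
        conv D (Li.toLinearMap ∘ₗ R.trans) (M ∘ₗ comul) θ := by
    have h6 : conv D (Li.toLinearMap ∘ₗ conv D R.trans p) (Ri.toLinearMap ∘ₗ i) =
        conv D (Li.toLinearMap ∘ₗ R.trans) (M ∘ₗ comul) := by
      rw [algHom_conv, conv_assoc, hMc]
    have h7 : ϖ.rTensor E.carrier (TensorProduct.map E.trans E.inclHom.toLinearMap
        (YDModule.coact θ)) = TensorProduct.map (ϖ ∘ₗ E.trans) i (YDModule.coact θ) :=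
      LinearMap.congr_fun (TensorProduct.map_comp _ _ _ _).symm _
    rw [h7, hϖt, map_eq_prodMap, LinearMap.comp_sub, sub_eq_add_neg, prodMap_add_left,
      prodMap_neg_left, ← h6, sub_eq_add_neg]
    rfl
  have h8 : ϖ.rTensor E.carrier (prodMap (RE.toLinearMap ∘ₗ conv D E.trans (i ∘ₗ antipode ℂ))
      (comul ∘ₗ i) (YDModule.coact θ)) = conv D (Ri.toLinearMap ∘ₗ E.trans)
          (conv (Comod.self A) (Ri.toLinearMap ∘ₗ i ∘ₗ antipode ℂ) (M ∘ₗ comul)) θ := by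
    rw [hr, map_prodMap_includeRight, ← conv_assoc, ← algHom_conv, ← hϖM]
    rfl
  rw [h5, prodMap_neg_left, LinearMap.neg_apply, map_neg]
  refine Eq.trans ?_ (congrArg (fun y => _ + -y) h8.symm)
  abel

end AffineAlgebra

namespace AffineAlgebra

variable {A V H : Type*} [Ring A] [StarRing A] [HopfAlgebra ℂ A]
  [AddCommGroup V] [Module ℂ V] [StarAddMonoid V] [YDModule A V]
  {E : AffineExtension A V} [Ring H] [Algebra ℂ H] [StarRing H]
  [StarModule ℂ H] [YDModule A H] (R : AffineAlgebra E H) {π : A →ₗ[ℂ] H} {ζ : V →ₗ[ℂ] H}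
  {ϖ : E.carrier →ₗ[ℂ] R.carrier}

lemma isAffineGermMap (hA : ∀ a, ϖ (E.inclHom a) = R.inclHom (π a))
    (hV : ∀ θ, ϖ (E.trans θ) = R.inclHom (ζ θ) -
        prodMap R.trans (R.inclHom.toLinearMap ∘ₗ π) (YDModule.coact θ))
    (hϖ : ∀ b c, ϖ (b * c) = YDModule.act (ϖ b) c + counit (R := ℂ) b • ϖ c) :
    IsAffineGermMap R π ζ ϖ where
  incl := hA
  trans := hV
  mul_sym q x hq := by
    rw [hϖ, hq, zero_smul, add_zero]
    exact R.act_sym (ϖ q) x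

/-! ### Uniqueness and generation of the image of the quantum germs map -/

/-- The elements `a ϑ` span `Ã`. The conditions on `a - ε(a)` reduce the statement to `a = 1`, and
those on `θ ∈ V` reduce it to degree zero. -/
lemma isAffineGermMap_unique {ϖ ϖ' : E.carrier →ₗ[ℂ] R.carrier} (h : IsAffineGermMap R π ζ ϖ)
    (h' : IsAffineGermMap R π ζ ϖ') : ϖ' = ϖ := by
  have hq : ∀ q x, counit (R := ℂ) q = 0 → ϖ' q = ϖ q → ϖ' (q * E.sym x) = ϖ (q * E.sym x) := by
    intro q x hq hqq
    rw [h.mul_sym q x hq, h'.mul_sym q x hq, hqq]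
  have hA : ∀ a, ϖ' (E.inclHom a) = ϖ (E.inclHom a) := fun a =>
    (h'.incl a).trans (h.incl a).symm
  have hsym : ∀ x, ϖ' (E.sym x) = ϖ (E.sym x) := by
    intro x
    induction x using tensor_induction with
    | one => rw [map_one, ← map_one E.inclHom, hA]
    | cons θ x hx =>
      rw [map_mul, E.sym_ι]
      exact hq _ x (E.counit_trans θ) ((h'.trans θ).trans (h.trans θ).symm)
    | add x y hx hy => simp only [map_add, hx, hy]
    | smul c x hx => simp only [map_smul, hx]
  ext b
  induction b using E.ind_mul_sym with
  | h a x =>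
    have h1 : E.inclHom a * E.sym x =
        E.inclHom (a - counit (R := ℂ) a • 1) * E.sym x + counit (R := ℂ) a • E.sym x := by
      rw [map_sub, map_smul, map_one, sub_mul, smul_one_mul, sub_add_cancel]
    rw [h1, map_add, map_add, map_smul, map_smul, hsym, hq _ _ ?_ (hA _)]
    rw [E.counit_inclHom, map_sub, map_smul, Bialgebra.counit_one, smul_eq_mul, mul_one, sub_self]
  | add x y hx hy => rw [map_add, map_add, hx, hy]

lemma isGermMap [HopfStarAlgebra A] [StarModule ℂ V] [YDStarModule A V]
    (hπ : IsGermMap π) (hζ : IsCovariantMap A ζ)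
    (hA : ∀ a, ϖ (E.inclHom a) = R.inclHom (π a))
    (hV : ∀ θ, ϖ (E.trans θ) = R.inclHom (ζ θ) -
        prodMap R.trans (R.inclHom.toLinearMap ∘ₗ π) (YDModule.coact θ))
    (hϖ : ∀ b c, ϖ (b * c) = YDModule.act (ϖ b) c + counit (R := ℂ) b • ϖ c) :
    IsGermMap ϖ where
  coact_apply b := by
    induction b using E.induction with
    | hincl a => exact R.coact_germ_inclHom hπ.coact_apply hA a
    | htrans θ =>
      exact R.coact_germ_trans hπ.coact_apply hζ.coact_apply hA hV (germ_one hϖ) θ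
    | add b c hb hc => simp only [map_add, hb, hc]
    | mul b c hb hc => exact coact_germ_mul hϖ hb hc
  star_apply b := by
    induction b using E.induction with
    | hincl a =>
      rw [hA, E.antipode_inclHom, E.star_inclHom, hA, ← map_neg, ← hπ.star_apply]
      exact (StarHomClass.map_star R.incl (π a)).symm
    | htrans θ => exact R.star_germ_trans hπ hζ hA hV hϖ θ
    | add b c hb hc => simp only [map_add, star_add, hb, hc, neg_add]
    | mul b c hb hc => exact star_germ_mul hϖ hb hc
  map_mul := hϖ

/-- The image of the quantum germs map is generated, as a module over the braided symmetric
algebra, by the images of `A` and `V`: `π̃(a ϑ) = π(a) ∘ ϑ + ε(a) π̃(ϑ)` and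
`π̃(θ ϑ) = π̃(θ) ∘ ϑ`. -/
lemma range_germ_eq_span (hA : ∀ a, ϖ (E.inclHom a) = R.inclHom (π a))
    (hϖ : ∀ b c, ϖ (b * c) = YDModule.act (ϖ b) c + counit (R := ℂ) b • ϖ c) :
    LinearMap.range ϖ = Submodule.span ℂ
      {z | ∃ x : R.carrier, ((∃ a, x = R.incl (π a)) ∨ ∃ θ, x = ϖ (E.trans θ)) ∧
        ∃ t : TensorAlgebra ℂ V, z = YDModule.act x (E.sym t)} := by
  apply le_antisymm
  · rintro _ ⟨b, rfl⟩
    induction b using E.ind_mul_sym with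
    | h a x =>
      rw [hϖ, hA]
      refine Submodule.add_mem _
        (Submodule.subset_span ⟨_, Or.inl ⟨a, rfl⟩, x, rfl⟩) (Submodule.smul_mem _ _ ?_)
      induction x using tensor_induction with
      | one =>
        rw [map_one, germ_one hϖ]
        exact Submodule.zero_mem _
      | cons θ x hx =>
        rw [map_mul, E.sym_ι, hϖ, E.counit_trans, zero_smul, add_zero]
        exact Submodule.subset_span ⟨_, Or.inr ⟨θ, rfl⟩, x, rfl⟩
      | add x y hx hy => rw [map_add, map_add]; exact Submodule.add_mem _ hx hy
      | smul c x hx => rw [map_smul, map_smul]; exact Submodule.smul_mem _ _ hx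
    | add x y hx hy => rw [map_add]; exact Submodule.add_mem _ hx hy
  · rw [Submodule.span_le]
    have hmem : ∀ b c, YDModule.act (ϖ b) c ∈ LinearMap.range ϖ := fun b c =>
      ⟨b * c - counit (R := ℂ) b • c, by rw [map_sub, map_smul, hϖ, add_sub_cancel_right]⟩
    rintro _ ⟨x, ⟨a, rfl⟩ | ⟨θ, rfl⟩, t, rfl⟩
    · have := hmem (E.inclHom a) (E.sym t)
      rwa [hA] at this
    · exact hmem _ _

end AffineAlgebra

/-! ### The bicovariant calculus of a surjective quantum germs map -/

namespace GermCalculus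

variable {B N : Type*} [Ring B] [HopfAlgebra ℂ B] [AddCommGroup N] [Module ℂ N]

variable (B N) in
/-- The left multiplication of `B ⊗ N`. -/
def lsmul : B →ₗ[ℂ] B ⊗[ℂ] N →ₗ[ℂ] B ⊗[ℂ] N := LinearMap.rTensorHom N ∘ₗ LinearMap.mul ℂ B

@[simp] lemma lsmul_tmul (a b : B) (m : N) : lsmul B N a (b ⊗ₜ m) = (a * b) ⊗ₜ m := rfl

/-- `κ(b⁽¹⁾) b⁽²⁾ ⊗ g(b⁽³⁾) = 1 ⊗ g(b)`. -/
lemma antipode_lTensor_comul (g : B →ₗ[ℂ] N) (b : B) :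
    TensorProduct.lift ((lsmul B N).compl₁₂ (antipode ℂ) (g.lTensor B ∘ₗ comul)) (comul b) =
      1 ⊗ₜ g b := by
  have h : ∀ u : B ⊗[ℂ] B,
      TensorProduct.lift ((lsmul B N).compl₁₂ (antipode ℂ) (g.lTensor B ∘ₗ comul)) u =
        g.lTensor B (LinearMap.rTensor B (prodMap (antipode ℂ) LinearMap.id)
          ((TensorProduct.assoc ℂ B B B).symm (LinearMap.lTensor B comul u))) := by
    intro u
    induction u with
    | zero => simp
    | add u v hu hv => simp only [map_add, hu, hv]
    | tmul x y =>
      simp only [TensorProduct.lift.tmul, LinearMap.compl₁₂_apply, LinearMap.comp_apply,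
        LinearMap.lTensor_tmul]
      induction comul (R := ℂ) y with
      | zero => simp
      | add u v hu hv => simp only [map_add, TensorProduct.tmul_add, hu, hv]
      | tmul p q => simp
  have h1 : prodMap (antipode ℂ) LinearMap.id ∘ₗ comul = convUnit B B :=
    antipode_conv (AlgHom.id ℂ B)
  rw [h, Coalgebra.coassoc_symm_apply, ← LinearMap.comp_apply (LinearMap.rTensor B _),
    ← LinearMap.rTensor_comp, h1, convUnit, LinearMap.rTensor_comp, LinearMap.comp_apply,
    Coalgebra.rTensor_counit_comul]
  simp

variable (B N) in
/-- The left coaction of `B ⊗ N`. -/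
def lcoact : B ⊗[ℂ] N →ₗ[ℂ] B ⊗[ℂ] (B ⊗[ℂ] N) :=
  (TensorProduct.assoc ℂ B B N).toLinearMap ∘ₗ LinearMap.rTensor N comul

lemma lcoact_lsmul (a : B) (w : B ⊗[ℂ] N) : lcoact B N (lsmul B N a w) =
    TensorProduct.map₂ (LinearMap.mul ℂ B) (lsmul B N) (comul a) (lcoact B N w) := by
  induction w with
  | zero => simp
  | add u v hu hv => simp only [map_add, hu, hv]
  | tmul b m =>
    simp only [lsmul_tmul, lcoact, LinearMap.comp_apply, LinearMap.rTensor_tmul,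
      Bialgebra.comul_mul]
    generalize comul (R := ℂ) a = u
    induction comul (R := ℂ) b with
    | zero => simp
    | add w w' hu hv => simp only [map_add, mul_add, TensorProduct.add_tmul, hu, hv]
    | tmul b b' =>
      induction u with
      | zero => simp
      | add u v hu hv =>
        simp only [map_add, add_mul, TensorProduct.add_tmul, LinearMap.add_apply, hu, hv]
      | tmul a a' => simp

lemma lcoact_lTensor_comul (g : B →ₗ[ℂ] N) (b : B) : lcoact B N (g.lTensor B (comul b)) =
    (g.lTensor B ∘ₗ comul).lTensor B (comul b) := by
  have h : ∀ u : B ⊗[ℂ] B, lcoact B N (g.lTensor B u) =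
      (g.lTensor B).lTensor B (TensorProduct.assoc ℂ B B B (LinearMap.rTensor B comul u)) := by
    intro u
    induction u with
    | zero => simp
    | add u v hu hv => simp only [map_add, hu, hv]
    | tmul x y =>
      simp only [lcoact, LinearMap.comp_apply, LinearMap.lTensor_tmul, LinearMap.rTensor_tmul]
      induction comul (R := ℂ) x with
      | zero => simp
      | add u v hu hv => simp only [map_add, TensorProduct.add_tmul, hu, hv]
      | tmul p q => simp
  rw [h, Coalgebra.coassoc_apply, LinearMap.lTensor_comp]
  rfl

lemma lcoact_eq_iff (w : B ⊗[ℂ] N) :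
    lcoact B N w = 1 ⊗ₜ w ↔ ∃ m, (1 : B) ⊗ₜ[ℂ] m = w := by
  constructor
  · intro h
    let e : B ⊗[ℂ] N →ₗ[ℂ] N := (TensorProduct.lid ℂ N).toLinearMap ∘ₗ LinearMap.rTensor N counit
    have h1 : ∀ w : B ⊗[ℂ] N, e.lTensor B (lcoact B N w) = w := by
      intro w
      induction w with
      | zero => simp
      | add u v hu hv => simp only [map_add, hu, hv]
      | tmul b m =>
        have h2 : ∀ u : B ⊗[ℂ] B, e.lTensor B (TensorProduct.assoc ℂ B B N (u ⊗ₜ m)) =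
            TensorProduct.rid ℂ B (LinearMap.lTensor B counit u) ⊗ₜ m := by
          intro u
          induction u with
          | zero => simp
          | add u v hu hv => simp only [map_add, TensorProduct.add_tmul, hu, hv]
          | tmul x y => simp [e, TensorProduct.smul_tmul]
        refine (h2 (comul b)).trans ?_
        rw [Coalgebra.lTensor_counit_comul, TensorProduct.rid_tmul, one_smul]
    refine ⟨e w, ?_⟩
    rw [← LinearMap.lTensor_tmul, ← h, h1]
  · rintro ⟨m, rfl⟩
    simp [lcoact, Algebra.TensorProduct.one_def]

variable (B N) in
lemma mk_one_injective : Function.Injective (TensorProduct.mk ℂ B N 1) := by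
  intro m n h
  have := congrArg ((TensorProduct.lid ℂ N).toLinearMap ∘ₗ LinearMap.rTensor N counit) h
  simpa using this

variable [YDModule B N]

variable (B N) in
/-- The right multiplication of `B ⊗ N`: `(b ⊗ m) c = b c⁽¹⁾ ⊗ (m ∘ c⁽²⁾)`. -/
def rsmul : B ⊗[ℂ] N →ₗ[ℂ] B →ₗ[ℂ] B ⊗[ℂ] N :=
  LinearMap.lcomp ℂ _ comul ∘ₗ TensorProduct.lift
    ((TensorProduct.mapBilinear (RingHom.id ℂ) B B B N).compl₁₂ (LinearMap.mul ℂ B) YDModule.act)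

lemma rsmul_tmul (b : B) (m : N) (c : B) : rsmul B N (b ⊗ₜ m) c =
    TensorProduct.map (LinearMap.mulLeft ℂ b) (YDModule.act m) (comul c) := rfl

lemma rsmul_one_tmul (m : N) (c : B) : rsmul B N (1 ⊗ₜ m) c =
    (YDModule.act m).lTensor B (comul c) := by
  rw [rsmul_tmul, LinearMap.mulLeft_one]; rfl

lemma lsmul_rsmul (a : B) (w : B ⊗[ℂ] N) (c : B) :
    rsmul B N (lsmul B N a w) c = lsmul B N a (rsmul B N w c) := by
  induction w with
  | zero => simp
  | add u v hu hv => simp only [map_add, LinearMap.add_apply, hu, hv]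
  | tmul b m =>
    rw [lsmul_tmul, rsmul_tmul, rsmul_tmul]
    induction comul (R := ℂ) c with
    | zero => simp
    | add u v hu hv => simp only [map_add, hu, hv]
    | tmul x y => simp

lemma rsmul_one (w : B ⊗[ℂ] N) : rsmul B N w 1 = w := by
  induction w with
  | zero => simp
  | add u v hu hv => simp only [map_add, LinearMap.add_apply, hu, hv]
  | tmul b m => simp [rsmul_tmul, Algebra.TensorProduct.one_def, YDModule.act_one]

lemma rsmul_mul (w : B ⊗[ℂ] N) (c d : B) :
    rsmul B N w (c * d) = rsmul B N (rsmul B N w c) d := by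
  induction w with
  | zero => simp
  | add u v hu hv => simp only [map_add, LinearMap.add_apply, hu, hv]
  | tmul b m =>
    simp only [rsmul_tmul, Bialgebra.comul_mul]
    induction comul (R := ℂ) c with
    | zero => simp
    | add u v hu hv => simp only [map_add, add_mul, LinearMap.add_apply, hu, hv]
    | tmul x y =>
      rw [TensorProduct.map_tmul, rsmul_tmul]
      induction comul (R := ℂ) d with
      | zero => simp
      | add u v hu hv => simp only [map_add, mul_add, hu, hv]
      | tmul p q => simp [YDModule.act_mul]

variable (B N) in
/-- The right coaction of `B ⊗ N`. -/
def rcoact : B ⊗[ℂ] N →ₗ[ℂ] (B ⊗[ℂ] N) ⊗[ℂ] B :=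
  LinearMap.lTensor (B ⊗[ℂ] N) (LinearMap.mul' ℂ B) ∘ₗ
    (TensorProduct.tensorTensorTensorComm ℂ B B N B).toLinearMap ∘ₗ
      TensorProduct.map comul YDModule.coact

lemma rcoact_lsmul (a : B) (w : B ⊗[ℂ] N) : rcoact B N (lsmul B N a w) =
    TensorProduct.map₂ (lsmul B N) (LinearMap.mul ℂ B) (comul a) (rcoact B N w) := by
  induction w with
  | zero => simp
  | add u v hu hv => simp only [map_add, hu, hv]
  | tmul b m =>
    simp only [lsmul_tmul, rcoact, LinearMap.comp_apply, TensorProduct.map_tmul,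
      Bialgebra.comul_mul]
    generalize comul (R := ℂ) a = u
    induction comul (R := ℂ) b with
    | zero => simp
    | add w w' hu hv => simp only [map_add, mul_add, TensorProduct.add_tmul, hu, hv]
    | tmul b b' =>
      induction u with
      | zero => simp
      | add u v hu hv =>
        simp only [map_add, add_mul, TensorProduct.add_tmul, LinearMap.add_apply, hu, hv]
      | tmul a a' =>
        induction YDModule.coact (A := B) m with
        | zero => simp
        | add u v hu hv => simp only [map_add, TensorProduct.tmul_add, hu, hv]
        | tmul n c => simp [mul_assoc]

variable {ϖ : B →ₗ[ℂ] N}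

lemma rcoact_d (hϖ : ∀ b, YDModule.coact (ϖ b) = ϖ.rTensor B (adCoact B b)) (b : B) :
    rcoact B N (ϖ.lTensor B (comul b)) = (ϖ.lTensor B ∘ₗ comul).rTensor B (comul b) := by
  let T : B ⊗[ℂ] (B ⊗[ℂ] B) →ₗ[ℂ] (B ⊗[ℂ] N) ⊗[ℂ] B :=
    (ϖ.lTensor B).rTensor B ∘ₗ (TensorProduct.assoc ℂ B B B).symm.toLinearMap
  let G := prodMap (Algebra.TensorProduct.includeRight : B →ₐ[ℂ] B ⊗[ℂ] B).toLinearMap (adCoact B)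
  have h : ∀ u : B ⊗[ℂ] B, rcoact B N (ϖ.lTensor B u) =
      T (LinearMap.lTensor B G
        (TensorProduct.assoc ℂ B B B (LinearMap.rTensor B comul u))) := by
    intro u
    induction u with
    | zero => simp
    | add u v hu hv => simp only [map_add, hu, hv]
    | tmul x y =>
      simp only [rcoact, LinearMap.comp_apply, LinearMap.lTensor_tmul, LinearMap.rTensor_tmul,
        TensorProduct.map_tmul, hϖ]
      induction comul (R := ℂ) x with
      | zero => simp
      | add u v hu hv => simp only [map_add, TensorProduct.add_tmul, hu, hv]
      | tmul p q =>
        simp only [TensorProduct.assoc_tmul, LinearMap.lTensor_tmul, G, prodMap_tmul]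
        induction adCoact B y with
        | zero => simp
        | add u v hu hv => simp only [map_add, TensorProduct.tmul_add, mul_add, hu, hv]
        | tmul r s => simp [T]
  have h1 : G ∘ₗ comul = comul := conv_adCoact
  rw [h, Coalgebra.coassoc_apply, ← LinearMap.comp_apply (LinearMap.lTensor B G),
    ← LinearMap.lTensor_comp, h1, LinearMap.rTensor_comp]
  simp only [T, LinearMap.comp_apply, LinearEquiv.coe_coe, Coalgebra.coassoc_symm_apply]

lemma d_mul (hϖ : ∀ b c, ϖ (b * c) = YDModule.act (ϖ b) c + counit (R := ℂ) b • ϖ c) (b c : B) :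
    ϖ.lTensor B (comul (b * c)) = rsmul B N (ϖ.lTensor B (comul b)) c +
      lsmul B N b (ϖ.lTensor B (comul c)) := by
  have h : ∀ u : B ⊗[ℂ] B, ϖ.lTensor B (u * comul c) = rsmul B N (ϖ.lTensor B u) c +
      lsmul B N (TensorProduct.rid ℂ B (LinearMap.lTensor B counit u)) (ϖ.lTensor B (comul c)) := by
    intro u
    induction u with
    | zero => simp
    | add u v hu hv => simp only [map_add, add_mul, LinearMap.add_apply, hu, hv]; abel
    | tmul x y =>
      rw [LinearMap.lTensor_tmul, rsmul_tmul]
      induction comul (R := ℂ) c with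
      | zero => simp
      | add u v hu hv => simp only [map_add, mul_add, hu, hv]; abel
      | tmul p q => simp [hϖ, TensorProduct.tmul_add]
  rw [Bialgebra.comul_mul, h, Coalgebra.lTensor_counit_comul, TensorProduct.rid_tmul, one_smul]

section Star

variable [StarRing B] [HopfStarAlgebra B] [StarAddMonoid N] [StarModule ℂ N]

variable (B N) in
/-- The involution of `B ⊗ N`: `(b ⊗ m)* = (1 ⊗ m*) b*`. -/
def conj : B ⊗[ℂ] N →ₛₗ[starRingEnd ℂ] B ⊗[ℂ] N where
  toFun w := TensorProduct.lift (rsmul B N ∘ₗ TensorProduct.mk ℂ B N 1).flip (star w)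
  map_add' := by intros; simp
  map_smul' := by intros; simp

lemma conj_tmul (b : B) (m : N) : conj B N (b ⊗ₜ m) = rsmul B N (1 ⊗ₜ star m) (star b) := rfl

lemma conj_lsmul (a : B) (w : B ⊗[ℂ] N) :
    conj B N (lsmul B N a w) = rsmul B N (conj B N w) (star a) := by
  induction w with
  | zero => simp
  | add u v hu hv => simp only [map_add, LinearMap.add_apply, hu, hv]
  | tmul b m => rw [lsmul_tmul, conj_tmul, conj_tmul, star_mul, rsmul_mul]

/-- The map `a ↦ κ(a*)*`. -/
def starAntipodeStar : B →ₗ[ℂ] B where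
  toFun a := star (antipode ℂ (star a))
  map_add' := by simp
  map_smul' := by simp

lemma starAntipodeStar_apply (a : B) : starAntipodeStar a = star (antipode ℂ (star a)) := rfl

lemma conj_conj [YDStarModule B N] (w : B ⊗[ℂ] N) : conj B N (conj B N w) = w := by
  induction w with
  | zero => simp
  | add u v hu hv => simp only [map_add, hu, hv]
  | tmul b m =>
    let s : B →ₗ[ℂ] B := starAntipodeStar
    have h : ∀ u : B ⊗[ℂ] B, conj B N ((YDModule.act (star m)).lTensor B (star u)) =
        (YDModule.act m ∘ₗ prodMap s LinearMap.id ∘ₗ (TensorProduct.comm ℂ B B).toLinearMap).lTensor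
          B (TensorProduct.assoc ℂ B B B (LinearMap.rTensor B comul u)) := by
      intro u
      induction u with
      | zero => simp
      | add u v hu hv => simp only [map_add, star_add, hu, hv]
      | tmul x y =>
        rw [TensorProduct.star_tmul, LinearMap.lTensor_tmul, conj_tmul, YDStarModule.star_act,
          star_star, star_star, rsmul_one_tmul, LinearMap.rTensor_tmul]
        induction comul (R := ℂ) x with
        | zero => simp
        | add u v hu hv => simp only [map_add, TensorProduct.add_tmul, hu, hv]
        | tmul p q => simp [s, starAntipodeStar_apply, YDModule.act_mul]
    have h1 : (YDModule.act m ∘ₗ prodMap s LinearMap.id ∘ₗ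
        (TensorProduct.comm ℂ B B).toLinearMap) ∘ₗ comul =
        LinearMap.toSpanSingleton ℂ N m ∘ₗ counit := by
      ext c
      simp only [LinearMap.comp_apply, LinearEquiv.coe_coe]
      rw [prodMap_star_antipode_star s starAntipodeStar_apply, Algebra.algebraMap_eq_smul_one,
        map_smul, YDModule.act_one, LinearMap.toSpanSingleton_apply]
    rw [conj_tmul, rsmul_one_tmul, HopfStarAlgebra.comul_star, h, Coalgebra.coassoc_apply,
      ← LinearMap.comp_apply (LinearMap.lTensor B _), ← LinearMap.lTensor_comp, h1,
      LinearMap.lTensor_comp, LinearMap.comp_apply, Coalgebra.lTensor_counit_comul]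
    simp

lemma conj_d (hϖ : IsGermMap ϖ) (b : B) :
    conj B N (ϖ.lTensor B (comul b)) = ϖ.lTensor B (comul (star b)) := by
  let s : B →ₗ[ℂ] B := starAntipodeStar
  let G : B ⊗[ℂ] B →ₗ[ℂ] N := TensorProduct.lift (YDModule.act ∘ₗ ϖ ∘ₗ s) ∘ₗ
    (TensorProduct.comm ℂ B B).toLinearMap
  have h : ∀ u : B ⊗[ℂ] B, conj B N (ϖ.lTensor B u) =
      -G.lTensor B (TensorProduct.assoc ℂ B B B (LinearMap.rTensor B comul (star u))) := by
    intro u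
    induction u with
    | zero => simp
    | add u v hu hv => simp only [map_add, star_add, hu, hv, neg_add]
    | tmul x y =>
      rw [LinearMap.lTensor_tmul, conj_tmul, hϖ.star_apply, rsmul_one_tmul, TensorProduct.star_tmul,
        LinearMap.rTensor_tmul]
      induction comul (R := ℂ) (star x) with
      | zero => simp
      | add u v hu hv => simp only [map_add, TensorProduct.add_tmul, hu, hv, neg_add]
      | tmul p q => simp [s, G, starAntipodeStar_apply]
  have h1 : G ∘ₗ comul = -ϖ := by
    have hG : ∀ u : B ⊗[ℂ] B, G u = ϖ (prodMap s LinearMap.id (TensorProduct.comm ℂ B B u)) -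
        ϖ (TensorProduct.rid ℂ B (LinearMap.lTensor B counit u)) := by
      intro u
      induction u with
      | zero => simp
      | add u v hu hv => simp only [map_add, hu, hv]; abel
      | tmul x y =>
        have hs : counit (R := ℂ) (s y) = counit (R := ℂ) y := by
          rw [starAntipodeStar_apply, counit_star_antipode, counit_star, star_star]
        simp [G, hϖ.map_mul, hs]
    ext c
    rw [LinearMap.comp_apply, hG, prodMap_star_antipode_star s starAntipodeStar_apply,
      Coalgebra.lTensor_counit_comul, TensorProduct.rid_tmul, one_smul,
      Algebra.algebraMap_eq_smul_one, map_smul, germ_one hϖ.map_mul, smul_zero, zero_sub,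
      LinearMap.neg_apply]
  rw [h, ← HopfStarAlgebra.comul_star, Coalgebra.coassoc_apply,
    ← LinearMap.comp_apply (LinearMap.lTensor B G), ← LinearMap.lTensor_comp, h1,
    LinearMap.lTensor_neg, LinearMap.neg_apply, neg_neg]

variable [YDStarModule B N] (hϖ : IsGermMap ϖ) (hsurj : Function.Surjective ϖ)

/-- The bicovariant *-calculus `B ⊗ N` with `d b = b⁽¹⁾ ⊗ ϖ(b⁽²⁾)` defined by a surjective quantum
germs map `ϖ : B → N`. -/
def calculus : BicovariantStarCalculus B where
  carrier := B ⊗[ℂ] N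
  lsmul := lsmul B N
  rsmul := rsmul B N
  one_lsmul w := by
    induction w with
    | zero => simp
    | add u v hu hv => rw [map_add, hu, hv]
    | tmul b m => simp
  mul_lsmul a b w := by
    induction w with
    | zero => simp
    | add u v hu hv => simp only [map_add, hu, hv]
    | tmul c m => simp [mul_assoc]
  rsmul_one := rsmul_one
  rsmul_mul := rsmul_mul
  lsmul_rsmul := lsmul_rsmul
  d := ϖ.lTensor B ∘ₗ comul
  d_mul := d_mul hϖ.map_mul
  span_eq_top := by
    rw [eq_top_iff]
    rintro w -
    induction w with
    | zero => exact Submodule.zero_mem _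
    | add u v hu hv => exact Submodule.add_mem _ hu hv
    | tmul b m =>
      obtain ⟨c, rfl⟩ := hsurj m
      have h : ∀ u : B ⊗[ℂ] B, lsmul B N b (TensorProduct.lift ((lsmul B N).compl₁₂ (antipode ℂ)
          (ϖ.lTensor B ∘ₗ comul)) u) ∈ Submodule.span ℂ
            {w | ∃ a b, w = lsmul B N a ((ϖ.lTensor B ∘ₗ comul) b)} := by
        intro u
        induction u with
        | zero => simp
        | add u v hu hv => rw [map_add, map_add]; exact Submodule.add_mem _ hu hv
        | tmul x y =>
          refine Submodule.subset_span ⟨b * antipode ℂ x, y, ?_⟩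
          simp only [TensorProduct.lift.tmul, LinearMap.compl₁₂_apply]
          generalize (ϖ.lTensor B ∘ₗ comul) y = w
          induction w with
          | zero => simp
          | add u v hu hv => simp only [map_add, hu, hv]
          | tmul c m => simp [mul_assoc]
      have h1 := h (comul c)
      rwa [antipode_lTensor_comul, lsmul_tmul, mul_one] at h1
  lcoact := lcoact B N
  lcoact_apply a b := by
    rw [lcoact_lsmul]
    exact congrArg _ (lcoact_lTensor_comul ϖ b)
  rcoact := rcoact B N
  rcoact_apply a b := by
    rw [rcoact_lsmul]
    exact congrArg _ (rcoact_d hϖ.coact_apply b)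
  conj := conj B N
  conj_conj := conj_conj
  conj_apply a b := by
    rw [conj_lsmul]
    exact congrArg (fun w => rsmul B N w (star a)) (conj_d hϖ b)

lemma range_mk_one : LinearMap.range (TensorProduct.mk ℂ B N 1) = (calculus hϖ hsurj).inv := by
  ext w
  exact (lcoact_eq_iff w).symm.trans sub_eq_zero.symm

lemma germ_calculus : (calculus hϖ hsurj).germ = TensorProduct.mk ℂ B N 1 ∘ₗ ϖ := by
  ext b
  exact antipode_lTensor_comul ϖ b

lemma invAct_calculus (m : N) (b : B) : (calculus hϖ hsurj).invAct (1 ⊗ₜ[ℂ] m) b =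
    (1 : B) ⊗ₜ[ℂ] YDModule.act m b := by
  refine Eq.trans ?_ (antipode_lTensor_comul (YDModule.act m) b)
  have h : rsmul B N (1 ⊗ₜ m) = (YDModule.act m).lTensor B ∘ₗ comul := by
    ext c; exact rsmul_one_tmul m c
  rw [← h]
  rfl

end Star

end GermCalculus

/-! ### The calculus of a quantum germs map -/

namespace IsGermMap

variable {B X : Type*} [Ring B] [StarRing B] [HopfAlgebra ℂ B] [AddCommGroup X] [Module ℂ X]
  [StarAddMonoid X] [YDModule B X] {ϖ : B →ₗ[ℂ] X} (hϖ : IsGermMap ϖ)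

include hϖ in
lemma act_mem_range {x : X} (hx : x ∈ LinearMap.range ϖ) (b : B) :
    YDModule.act x b ∈ LinearMap.range ϖ := by
  obtain ⟨c, rfl⟩ := hx
  exact ⟨c * b - counit (R := ℂ) c • b, by
    rw [map_sub, map_smul, hϖ.map_mul, add_sub_cancel_right]⟩

include hϖ in
lemma star_mem_range {x : X} (hx : x ∈ LinearMap.range ϖ) : star x ∈ LinearMap.range ϖ := by
  obtain ⟨c, rfl⟩ := hx
  exact ⟨-star (antipode ℂ c), by rw [map_neg, hϖ.star_apply]⟩

/-- The inclusion of the range. -/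
abbrev incl (_ : IsGermMap ϖ) : LinearMap.range ϖ →ₗ[ℂ] X := (LinearMap.range ϖ).subtype

lemma rTensor_incl_injective (M : Type*) [AddCommGroup M] [Module ℂ M] :
    Function.Injective (hϖ.incl.rTensor M) :=
  Module.Flat.rTensor_preserves_injective_linearMap _ (Submodule.injective_subtype _)

/-- The action on the range. -/
def rangeAct : LinearMap.range ϖ →ₗ[ℂ] B →ₗ[ℂ] LinearMap.range ϖ :=
  LinearMap.mk₂ ℂ (fun m b => ⟨YDModule.act (m : X) b, hϖ.act_mem_range m.2 b⟩)
    (by intros; ext; simp) (by intros; ext; simp) (by intros; ext; simp) (by intros; ext; simp)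

lemma incl_rangeAct (m : LinearMap.range ϖ) (b : B) :
    hϖ.incl (hϖ.rangeAct m b) = YDModule.act (hϖ.incl m) b := rfl

/-- The coaction on the range. -/
def rangeCoact : LinearMap.range ϖ →ₗ[ℂ] LinearMap.range ϖ ⊗[ℂ] B :=
  LinearMap.codRestrictOfInjective (YDModule.coact ∘ₗ hϖ.incl) (hϖ.incl.rTensor B)
    (hϖ.rTensor_incl_injective B) (by
      rintro ⟨_, b, rfl⟩
      refine ⟨ϖ.rangeRestrict.rTensor B (adCoact B b), ?_⟩
      refine Eq.trans ?_ (hϖ.coact_apply b).symm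
      exact (LinearMap.congr_fun (LinearMap.rTensor_comp B hϖ.incl ϖ.rangeRestrict) _).symm)

lemma rTensor_rangeCoact (m : LinearMap.range ϖ) :
    hϖ.incl.rTensor B (hϖ.rangeCoact m) = YDModule.coact (hϖ.incl m) :=
  LinearMap.codRestrictOfInjective_comp_apply _ _ _ _ m

/-- The range of a quantum germs map is a submodule and a subcomodule. -/
abbrev rangeYDModule : YDModule B (LinearMap.range ϖ) where
  act := hϖ.rangeAct
  coact := hϖ.rangeCoact
  act_one m := Subtype.ext (YDModule.act_one (m : X))
  act_mul m a b := Subtype.ext (YDModule.act_mul (m : X) a b)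
  coact_coassoc m := by
    apply hϖ.rTensor_incl_injective (B ⊗[ℂ] B)
    have h1 : ∀ u : LinearMap.range ϖ ⊗[ℂ] B, hϖ.incl.rTensor (B ⊗[ℂ] B)
        (TensorProduct.assoc ℂ _ B B (hϖ.rangeCoact.rTensor B u)) =
        TensorProduct.assoc ℂ X B B (YDModule.coact.rTensor B (hϖ.incl.rTensor B u)) := by
      intro u
      induction u with
      | zero => simp
      | add u v hu hv => simp only [map_add, hu, hv]
      | tmul m b =>
        simp only [LinearMap.rTensor_tmul, ← rTensor_rangeCoact]
        induction hϖ.rangeCoact m with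
        | zero => simp
        | add u v hu hv => simp only [map_add, TensorProduct.add_tmul, hu, hv]
        | tmul n c => simp
    have h2 : ∀ u : LinearMap.range ϖ ⊗[ℂ] B, hϖ.incl.rTensor (B ⊗[ℂ] B)
        (LinearMap.lTensor _ comul u) = LinearMap.lTensor X comul (hϖ.incl.rTensor B u) := by
      intro u
      induction u with
      | zero => simp
      | add u v hu hv => simp only [map_add, hu, hv]
      | tmul m b => simp
    rw [h1, h2, rTensor_rangeCoact, YDModule.coact_coassoc]
  coact_counit m := by
    apply hϖ.rTensor_incl_injective ℂ
    have h2 : ∀ u : LinearMap.range ϖ ⊗[ℂ] B, hϖ.incl.rTensor ℂ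
        (LinearMap.lTensor _ counit u) = LinearMap.lTensor X counit (hϖ.incl.rTensor B u) := by
      intro u
      induction u with
      | zero => simp
      | add u v hu hv => simp only [map_add, hu, hv]
      | tmul m b => simp
    rw [h2, rTensor_rangeCoact, YDModule.coact_counit, LinearMap.rTensor_tmul]
  coact_act m a := by
    apply hϖ.rTensor_incl_injective B
    rw [rTensor_rangeCoact, incl_rangeAct, YDModule.coact_act, ← rTensor_rangeCoact]
    exact (rTensor_ydTwist hϖ.incl hϖ.rangeAct YDModule.act (fun _ _ => rfl) _ _).symm

/-- The involution on the range. -/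
abbrev rangeStar : StarAddMonoid (LinearMap.range ϖ) where
  star m := ⟨star (m : X), hϖ.star_mem_range m.2⟩
  star_involutive m := Subtype.ext (star_star (m : X))
  star_add m n := Subtype.ext (star_add (m : X) (n : X))

/-- The left-invariant part of the calculus is the range of the quantum germs map. -/
lemma exists_calculus {B : Type u} {X : Type v} [Ring B] [StarRing B] [HopfAlgebra ℂ B]
    [HopfStarAlgebra B] [AddCommGroup X] [Module ℂ X] [StarAddMonoid X] [StarModule ℂ X]
    [YDModule B X] [YDStarModule B X] {ϖ : B →ₗ[ℂ] X} (hϖ : IsGermMap ϖ) :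
    ∃ (Υ : BicovariantStarCalculus.{u, max u v} B) (j : LinearMap.range ϖ →ₗ[ℂ] Υ.carrier),
      Function.Injective j ∧ LinearMap.range j = Υ.inv ∧ j ∘ₗ ϖ.rangeRestrict = Υ.germ ∧
      ∀ (x y : LinearMap.range ϖ) (b : B), (y : X) = YDModule.act (x : X) b →
        j y = Υ.invAct (j x) b := by
  let _ := hϖ.rangeYDModule
  let _ := hϖ.rangeStar
  have : StarModule ℂ (LinearMap.range ϖ) :=
    ⟨fun c m => Subtype.ext (star_smul c (m : X))⟩
  have : YDStarModule B (LinearMap.range ϖ) :=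
    { coact_star := fun m => by
        apply hϖ.rTensor_incl_injective B
        have h : ∀ u : LinearMap.range ϖ ⊗[ℂ] B,
            hϖ.incl.rTensor B (star u) = star (hϖ.incl.rTensor B u) := by
          intro u
          induction u with
          | zero => simp
          | add u v hu hv => simp only [map_add, star_add, hu, hv]
          | tmul m b => simp; rfl
        refine (hϖ.rTensor_rangeCoact (star m)).trans ?_
        refine (YDStarModule.coact_star (m : X)).trans ?_
        rw [h]
        exact congrArg star (hϖ.rTensor_rangeCoact m).symm
      star_act := fun m a => Subtype.ext (YDStarModule.star_act (m : X) a) }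
  have hg : IsGermMap ϖ.rangeRestrict :=
    { coact_apply := fun b => by
        apply hϖ.rTensor_incl_injective B
        refine (hϖ.rTensor_rangeCoact _).trans ((hϖ.coact_apply b).trans ?_)
        exact LinearMap.congr_fun (LinearMap.rTensor_comp B hϖ.incl ϖ.rangeRestrict) _
      star_apply := fun b => Subtype.ext (hϖ.star_apply b)
      map_mul := fun b c => Subtype.ext (hϖ.map_mul b c) }
  refine ⟨GermCalculus.calculus hg ϖ.surjective_rangeRestrict,
    TensorProduct.mk ℂ B (LinearMap.range ϖ) 1, GermCalculus.mk_one_injective B _,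
    GermCalculus.range_mk_one hg _, (GermCalculus.germ_calculus hg _).symm, fun x y b hy => ?_⟩
  refine Eq.trans ?_ (GermCalculus.invAct_calculus hg ϖ.surjective_rangeRestrict x b).symm
  exact congrArg (TensorProduct.mk ℂ B (LinearMap.range ϖ) 1) (Subtype.ext hy)

end IsGermMap

end AffineQG

end

theorem mainTheorem2 {A : Type u} {V : Type v} {H : Type w}
    [Ring A] [StarRing A] [HopfAlgebra ℂ A] [HopfStarAlgebra A]
    [AddCommGroup V] [Module ℂ V] [StarAddMonoid V] [StarModule ℂ V]
    [YDModule A V] [YDStarModule A V]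
    [Ring H] [Algebra ℂ H] [StarRing H] [StarModule ℂ H]
    [YDModule A H] [YDStarAlgebra A H]
    (π : A →ₗ[ℂ] H) (hπ : IsGermMap π)
    (ζ : V →ₗ[ℂ] H) (hζ : IsCovariantMap A ζ) :
    Nonempty (AffineExtension.{u, v, max u v} A V) ∧
    ∀ E : AffineExtension.{u, v, max u v} A V,
      Nonempty (AffineAlgebra.{u, v, w, max v w, max u v} E H) ∧
      ∀ R : AffineAlgebra.{u, v, w, max v w, max u v} E H,
        ∃ ϖ : E.carrier →ₗ[ℂ] R.carrier,
          IsAffineGermMap R π ζ ϖ ∧ (∀ ϖ', IsAffineGermMap R π ζ ϖ' → ϖ' = ϖ) ∧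
          IsGermMap ϖ ∧
          (∃ (Υ : BicovariantStarCalculus.{max u v, max u v w} E.carrier)
              (j : LinearMap.range ϖ →ₗ[ℂ] Υ.carrier),
            Function.Injective j ∧ LinearMap.range j = Υ.inv ∧
            j ∘ₗ ϖ.rangeRestrict = Υ.germ ∧
            ∀ (x y : LinearMap.range ϖ) (ψ : E.carrier),
              (y : R.carrier) = YDModule.act (x : R.carrier) ψ → j y = Υ.invAct (j x) ψ) ∧
          (∀ x ∈ LinearMap.range ϖ, ∀ ψ : E.carrier, YDModule.act x ψ ∈ LinearMap.range ϖ) ∧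
          LinearMap.range ϖ = Submodule.span ℂ
            {z | ∃ x : R.carrier, ((∃ a, x = R.incl (π a)) ∨ ∃ θ, x = ϖ (E.trans θ)) ∧
              ∃ t : TensorAlgebra ℂ V, z = YDModule.act x (E.sym t)} := by
  refine ⟨nonempty_affineExtension A V, fun E => ⟨AffineExtension.nonempty_affineAlgebra E H,
    fun R => ?_⟩⟩
  obtain ⟨ϖ, hA, hV, hϖ⟩ :=
    R.exists_germMap hπ.map_mul hπ.coact_apply hζ.act_apply hζ.coact_apply
  have hg := R.isAffineGermMap hA hV hϖ
  have hgerm := R.isGermMap hπ hζ hA hV hϖ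
  exact ⟨ϖ, hg, fun ϖ' h' => R.isAffineGermMap_unique hg h', hgerm, hgerm.exists_calculus,
    fun x hx ψ => hgerm.act_mem_range hx ψ, R.range_germ_eq_span hA hϖ⟩
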